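/- **Setting.** Let $p$ be a prime, $J=\begin{bmatrix}0&\mathbf 1_2\\-\mathbf 1_2&0\end{bmatrix}$, and let $\mathrm{GSp}(4,\mathbb Q_p)$ be the group of all $g\in\mathrm{GL}(4,\mathbb Q_p)$ with ${}^tgJg=\lambda(g)J$ for some $\lambda(g)\in\mathbb Q_p^\times$. Let $\mathrm{GSp}(4,\mathbb Z_p)$ be the subgroup of $k$ with entries in $\mathbb Z_p$ and $\lambda(k)\in\mathbb Z_p^\times$, and let $K^{\rm para}(p^n)$ be the subgroup of $k$ with $\lambda(k)\in\mathbb Z_p^\times$ and $$k\in\begin{bmatrix}\mathbb Z_p&\mathbb Z_p&p^{-n}\mathbb Z_p&\mathbb Z_p\\p^n\mathbb Z_p&\mathbb Z_p&\mathbb Z_p&\mathbb Z_p\\p^n\mathbb Z_p&p^n\mathbb Z_p&\mathbb Z_p&p^n\mathbb Z_p\\p^n\mathbb Z_p&\mathbb Z_p&\mathbb Z_p&\mathbb Z_p\end{bmatrix}.$$ Let $(\pi,V)$ be a smooth complex representation of $\mathrm{GSp}(4,\mathbb Q_p)$ (every vector has an open stabilizer) for which the center acts trivially, and let $\chi$ be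 a quadratic character of $\mathbb Q_p^\times$ of conductor $p$, i.e. $\chi$ has values $\pm1$, is trivial on $1+p\mathbb Z_p$ and is not trivial on $\mathbb Z_p^\times$. Let $V(0)$ be the space of $v\in V$ with $\pi(k)v=v$ for all $k\in\mathrm{GSp}(4,\mathbb Z_p)=K^{\rm para}(p^0)$, and $V(4,\chi)$ the space of $v\in V$ with $\pi(k)v=\chi(\lambda(k))v$ for all $k\in K^{\rm para}(p^4)$. **The twisting map.** Let $J'$ be the antidiagonal matrix with entries $1,1,-1,-1$ in positions $(1,4),(2,3),(3,2),(4,1)$, and let $C$ be the permutation matrix exchanging the last two coordinates; $g\mapsto CgC$ is an isomorphism from the similitude group of $J'$ onto that of $J$. Put $\pi'(g)=\pi(CgC)$ for $g$ in the similitude group of $J'$, and $$L(x)=\begin{bmatrix}1&&&\\&1&&\\&x&1&\\&&&1\end{bmatrix},\ s=\begin{bmatrix}1&&&\\&&1&\\&-1&&\\&&&1\end{bmatrix},\ H_m(a,b,z)=\begin{bmatrix}1&-ap^{-1}&bp^{-2}&zp^{-m}\\&1&&bp^{-2}\\&&1&ap^{-1}\\&&&1\end{bmatrix},\ t_4=\begin{bmatrix}&&&-p^{-4}\\&1&&\\&&1&\\p^4&&&\end{bmatrix},$$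 $\tau=\mathrm{diag}(1,p^{-1},p,1)$. With the Haar measure on $\mathbb Q_p$ giving $\mathbb Z_p$ measure $1$ (the integrands are locally constant), the twisting map $T_\chi$ is defined for $v\in V(0)$ by $$\begin{aligned}T_\chi(v)={}&p^3\int_{\mathbb Z_p}\int_{\mathbb Z_p}\int_{\mathbb Z_p^\times}\int_{\mathbb Z_p^\times}\chi(ab)\,\pi'(L(x)H_4(a,b,z)\tau)v\,da\,db\,dx\,dz\\ &+p^3\int_{\mathbb Z_p}\int_{p\mathbb Z_p}\int_{\mathbb Z_p^\times}\int_{\mathbb Z_p^\times}\chi(ab)\,\pi'(sL(y)H_4(a,b,z)\tau)v\,da\,db\,dy\,dz\\ &+p^2\int_{\mathbb Z_p}\int_{\mathbb Z_p}\int_{\mathbb Z_p^\times}\int_{\mathbb Z_p^\times}\chi(ab)\,\pi'(t_4L(x)H_3(a,b,z)\tau)v\,da\,db\,dx\,dz\\ &+p^2\int_{\mathbb Z_p}\int_{p\mathbb Z_p}\int_{\mathbb Z_p^\times}\int_{\mathbb Z_p^\times}\chi(ab)\,\pi'(t_4sL(y)H_3(a,b,z)\tau)v\,da\,db\,dy\,dz.\end{aligned}$$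 **Notation for the formula.** Let $\eta'=\mathrm{diag}(p^{-1},1,p,1)$ and $\tau'=\mathrm{diag}(1,p^{-1},1,p)$; also write $\eta',\tau'$ for $\pi(\eta'),\pi(\tau')$. For $t,x,y,z\in\mathbb Q_p$ put $$A(t)=\begin{bmatrix}1&t&&\\&1&&\\&&1&\\&&-t&1\end{bmatrix},\qquad U(x,y,z)=\begin{bmatrix}1&&x&y\\&1&y&z\\&&1&\\&&&1\end{bmatrix}.$$ Write $R_n=\mathbb Z_p/p^n\mathbb Z_p$, and $R_n^{\ast}$ for the set of $u\in R_n^\times$ with $u\not\equiv1\pmod p$. In the sums below each residue class is replaced by a representative in $\mathbb Z_p$, from an arbitrary fixed choice, for each $n$, of representatives of the elements of $R_n$. **Statement.** For every $v\in V(0)$ one has $T_\chi(v)\in V(4,\chi)$ and, for every choice of representatives, $T_\chi(v)=\sum_{i=1}^{14}T_\chi^i(v)$, where $$\begin{aligned} T^1_\chi(v)&=p^{-11}\sum_{a,b,x\in R_3^\times,\;z\in R_4}\chi(ab)\,\pi\big(A(-(a+xb)p^{-1})\,U(zp^{-4},bp^{-2},x^{-1}p^{-1})\big)v,\\ T^2_\chi(v)&=p^{-11}\eta'\sum_{a,b\in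 R_3^\times,\;x,y\in R_3^{\ast}}\chi(abxy)\,\pi\big(A(bp^{-1})\,U(ab(1-(1-y)^{-1}x)p^{-3},-ap^{-2},ab^{-1}(1-x)^{-1}p^{-1})\big)v,\\ T^3_\chi(v)&=p^{-6}\eta'\sum_{a\in R_2^\times,\;b\in R_3^\times,\;z\in R_1^{\ast}}\chi(b(1-z))\,\pi\big(U(bp^{-3},ap^{-2},a^2b^{-1}zp^{-1})\big)v,\\ T^4_\chi(v)&=p^{-10}\eta'\sum_{a\in R_4,\;b\in R_3^\times,\;x\in R_4^\times}\chi(b)\,\pi\big(A(xp^{-2})\,U((bp-ax)p^{-4},ap^{-2},0)\big)v,\\ T^5_\chi(v)&=p^{-9}\eta'\sum_{a,b\in R_3^\times,\;x\in R_3}\chi(b)\,\pi\big(A(xp^{-1})\,U((b-ax)p^{-3},ap^{-2},0)\big)v,\\ T^6_\chi(v)&=p^{-6}\eta'^2\sum_{a,b\in R_2^\times,\;x\in R_1^\times}\chi(bx)\,\pi\big(U(b(1-xp)p^{-2},ap^{-2},a^2b^{-1}p^{-2})\big)v,\\ T^7_\chi(v)&=p^{-7}\tau'\sum_{a\in R_3^\times,\;b\in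 R_1^\times,\;z\in R_4}\chi(ab)\,\pi\big(A(-ap^{-2})\,U(zp^{-4},bp^{-1},0)\big)v,\\ T^8_\chi(v)&=p^{-9}\eta'\tau'\sum_{a,b\in R_3^\times,\;z\in R_3^{\ast}}\chi(abz(1-z))\,\pi\big(A(bp^{-2})\,U(-ab(1-z)p^{-3},ap^{-1},0)\big)v,\\ T^9_\chi(v)&=p^{-6}\eta'^2\tau'\sum_{a\in R_2^\times,\;b,x\in R_1^\times}\chi(b)\,\pi\big(A(ap^{-1})\,U(-bp^{-1},0,xp^{-1})\big)v,\\ T^{10}_\chi(v)&=p^{-6}\eta'^2\tau'^2\sum_{a\in R_2^\times,\;b\in R_1^\times}\chi(b)\,\pi\big(A(ap^{-2})\,U(-bp^{-1},0,0)\big)v,\\ T^{11}_\chi(v)&=p^{-10}\tau'^{-1}\sum_{a\in R_2^\times,\;b\in R_4^\times,\;x\in R_3,\;z\in R_4}\chi(ab)\,\pi\big(A(bp^{-1})\,U(zp^{-4},(xb+ap)p^{-3},-xp^{-2})\big)v,\\ T^{12}_\chi(v)&=p^{-12}\eta'\tau'^{-1}\sum_{y\in R_4,\;a\in R_4^\times,\;b\in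 R_3^\times,\;z\in R_3^{\ast}}\chi(abz(1-z))\,\pi\big(A(ap^{-1})\,U(a(b(1-z)p-y)p^{-4},yp^{-3},-a^{-1}(y+bp)p^{-2})\big)v,\\ T^{13}_\chi(v)&=p^{-6}\eta'^2\tau'^{-1}\sum_{a\in R_2^\times,\;b\in R_3^\times,\;x\in R_1^\times}\chi(bx)\,\pi\big(U(b(1-x)p^{-1},ap^{-2},a^2b^{-1}p^{-3})\big)v,\\ T^{14}_\chi(v)&=p^{-6}\eta'^2\tau'^{-2}\sum_{a\in R_2^\times,\;b\in R_1^\times,\;x\in R_4}\chi(b)\,\pi\big(U(-bp^{-1},ap^{-2},xp^{-4})\big)v. \end{aligned}$$ -/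

import Mathlib

open Matrix MeasureTheory

noncomputable section

namespace TwistGSp4

/-! ### The groups `GSp(4, ℚ_p)` for the two symplectic forms -/

section Groups

variable {p : ℕ} [Fact p.Prime]

/-- The similitude group of the form `S`: all `g ∈ GL(4, ℚ_p)` with `ᵗg S g = c S` for some
`c ∈ ℚ_pˣ`. It carries the topology induced from `GL(4, ℚ_p)`. -/
def similitudeGroup (S : Matrix (Fin 4) (Fin 4) ℚ_[p]) : Subgroup (GL (Fin 4) ℚ_[p]) where
  carrier := {g | ∃ c : ℚ_[p]ˣ, (g : Matrix (Fin 4) (Fin 4) ℚ_[p])ᵀ * S * g = (c : ℚ_[p]) • S}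
  one_mem' := ⟨1, by simp⟩
  mul_mem' := by
    rintro g h ⟨c, hc⟩ ⟨d, hd⟩
    refine ⟨c * d, ?_⟩
    calc ((g * h : GL (Fin 4) ℚ_[p]) : Matrix (Fin 4) (Fin 4) ℚ_[p])ᵀ * S * (g * h : GL (Fin 4) ℚ_[p])
        = (h : Matrix (Fin 4) (Fin 4) ℚ_[p])ᵀ *
            ((g : Matrix (Fin 4) (Fin 4) ℚ_[p])ᵀ * S * g) * h := by
          simp [Matrix.transpose_mul, Matrix.mul_assoc]
      _ = ((c * d : ℚ_[p]ˣ) : ℚ_[p]) • S := by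
          rw [hc, Matrix.mul_smul, Matrix.smul_mul, hd, smul_smul, Units.val_mul]
  inv_mem' := by
    rintro g ⟨c, hc⟩
    refine ⟨c⁻¹, ?_⟩
    have h1 : (g : Matrix (Fin 4) (Fin 4) ℚ_[p]) * (g⁻¹ : GL (Fin 4) ℚ_[p]) = 1 := by
      rw [← Units.val_mul, mul_inv_cancel, Units.val_one]
    have h2 : ((g⁻¹ : GL (Fin 4) ℚ_[p]) : Matrix (Fin 4) (Fin 4) ℚ_[p])ᵀ *
        (g : Matrix (Fin 4) (Fin 4) ℚ_[p])ᵀ = 1 := by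
      rw [← Matrix.transpose_mul, h1, Matrix.transpose_one]
    have h3 : S = (c⁻¹ : ℚ_[p]ˣ).val • ((g : Matrix (Fin 4) (Fin 4) ℚ_[p])ᵀ * S * g) := by
      rw [hc, smul_smul, Units.inv_mul, one_smul]
    set A : Matrix (Fin 4) (Fin 4) ℚ_[p] := (g : Matrix (Fin 4) (Fin 4) ℚ_[p])
    set B : Matrix (Fin 4) (Fin 4) ℚ_[p] :=
      ((g⁻¹ : GL (Fin 4) ℚ_[p]) : Matrix (Fin 4) (Fin 4) ℚ_[p])
    calc Bᵀ * S * B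
        = Bᵀ * ((c⁻¹ : ℚ_[p]ˣ).val • (Aᵀ * S * A)) * B := by rw [← h3]
      _ = (c⁻¹ : ℚ_[p]ˣ).val • ((Bᵀ * Aᵀ) * S * (A * B)) := by
          simp only [Matrix.mul_smul, Matrix.smul_mul, Matrix.mul_assoc]
      _ = (c⁻¹ : ℚ_[p]ˣ).val • S := by rw [h1, h2, Matrix.one_mul, Matrix.mul_one]

/-- A matrix `M` with `ᵗM S M = S` as an element of the similitude group of `S`, where
`S² = -1` (so that `M` is invertible). -/
def ofIsometry (S : Matrix (Fin 4) (Fin 4) ℚ_[p]) (hS : S * S = -1)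
    (M : Matrix (Fin 4) (Fin 4) ℚ_[p]) (hM : Mᵀ * S * M = S) : similitudeGroup S :=
  have h : (-(S * Mᵀ * S)) * M = 1 := by
    rw [Matrix.neg_mul, Matrix.mul_assoc, Matrix.mul_assoc, ← Matrix.mul_assoc Mᵀ S M, hM, hS,
      neg_neg]
  ⟨⟨M, -(S * Mᵀ * S), mul_eq_one_comm.mp h, h⟩, 1, by simpa using hM⟩

variable (p)

/-- The form `J`, with `2 × 2` blocks `0, 1, -1, 0`. -/
def J : Matrix (Fin 4) (Fin 4) ℚ_[p] :=
  !![0, 0, 1, 0;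
     0, 0, 0, 1;
     -1, 0, 0, 0;
     0, -1, 0, 0]

/-- The antidiagonal form `J'`. -/
def J' : Matrix (Fin 4) (Fin 4) ℚ_[p] :=
  !![0, 0, 0, 1;
     0, 0, 1, 0;
     0, -1, 0, 0;
     -1, 0, 0, 0]

lemma J_mul_J : J p * J p = -1 := by
  ext i j; fin_cases i <;> fin_cases j <;> simp [J, Matrix.mul_apply, Fin.sum_univ_four]

lemma J'_mul_J' : J' p * J' p = -1 := by
  ext i j; fin_cases i <;> fin_cases j <;> simp [J', Matrix.mul_apply, Fin.sum_univ_four]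

/-- `GSp(4, ℚ_p)` with respect to `J`. -/
abbrev GSp4 : Subgroup (GL (Fin 4) ℚ_[p]) := similitudeGroup (J p)

/-- `GSp(4, ℚ_p)` with respect to `J'`. -/
abbrev GSp4' : Subgroup (GL (Fin 4) ℚ_[p]) := similitudeGroup (J' p)

/-- The permutation matrix `C` exchanging the last two coordinates; `C² = 1`. -/
def C : GL (Fin 4) ℚ_[p] :=
  have h : (!![1, 0, 0, 0; 0, 1, 0, 0; 0, 0, 0, 1; 0, 0, 1, 0] : Matrix (Fin 4) (Fin 4) ℚ_[p]) *
      !![1, 0, 0, 0; 0, 1, 0, 0; 0, 0, 0, 1; 0, 0, 1, 0] = 1 := by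
    ext i j; fin_cases i <;> fin_cases j <;> simp [Matrix.mul_apply, Fin.sum_univ_four]
  ⟨!![1, 0, 0, 0; 0, 1, 0, 0; 0, 0, 0, 1; 0, 0, 1, 0],
   !![1, 0, 0, 0; 0, 1, 0, 0; 0, 0, 0, 1; 0, 0, 1, 0], h, h⟩

lemma C_inv : (C p)⁻¹ = C p := by
  ext i j; rfl

lemma C_form' : ((C p : GL (Fin 4) ℚ_[p]) : Matrix (Fin 4) (Fin 4) ℚ_[p])ᵀ * J' p * C p = J p := by
  ext i j; fin_cases i <;> fin_cases j <;>
    simp [C, J, J', Matrix.mul_apply, Fin.sum_univ_four]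

lemma C_form : ((C p : GL (Fin 4) ℚ_[p]) : Matrix (Fin 4) (Fin 4) ℚ_[p])ᵀ * J p * C p = J' p := by
  ext i j; fin_cases i <;> fin_cases j <;>
    simp [C, J, J', Matrix.mul_apply, Fin.sum_univ_four]

lemma C_conj_mem {S T : Matrix (Fin 4) (Fin 4) ℚ_[p]}
    (h1 : ((C p : GL (Fin 4) ℚ_[p]) : Matrix (Fin 4) (Fin 4) ℚ_[p])ᵀ * T * C p = S)
    (h2 : ((C p : GL (Fin 4) ℚ_[p]) : Matrix (Fin 4) (Fin 4) ℚ_[p])ᵀ * S * C p = T)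
    {g : GL (Fin 4) ℚ_[p]} (hg : g ∈ similitudeGroup S) :
    C p * g * C p ∈ similitudeGroup T := by
  obtain ⟨c, hc⟩ := hg
  refine ⟨c, ?_⟩
  have e : ∀ A B : Matrix (Fin 4) (Fin 4) ℚ_[p],
      (B * A * B)ᵀ * T * (B * A * B) = Bᵀ * (Aᵀ * (Bᵀ * T * B) * A) * B := by
    intro A B; simp only [Matrix.transpose_mul, Matrix.mul_assoc]
  rw [Units.val_mul, Units.val_mul, e, h1, hc, Matrix.mul_smul, Matrix.smul_mul, h2]

/-- The isomorphism between the two realizations, `g ↦ C g C` in both directions. -/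
def conjC : GSp4' p ≃* GSp4 p where
  toFun g := ⟨C p * g * C p, C_conj_mem p (C_form p) (C_form' p) g.2⟩
  invFun g := ⟨C p * g * C p, C_conj_mem p (C_form' p) (C_form p) g.2⟩
  left_inv g := by
    have h : C p * C p = 1 := by nth_rewrite 1 [← C_inv p]; exact inv_mul_cancel _
    ext1
    change C p * (C p * (g : GL (Fin 4) ℚ_[p]) * C p) * C p = g
    rw [mul_assoc (C p) (g : GL (Fin 4) ℚ_[p]), ← mul_assoc, ← mul_assoc, h, one_mul, mul_assoc, h,
      mul_one]
  right_inv g := by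
    have h : C p * C p = 1 := by nth_rewrite 1 [← C_inv p]; exact inv_mul_cancel _
    ext1
    change C p * (C p * (g : GL (Fin 4) ℚ_[p]) * C p) * C p = g
    rw [mul_assoc (C p) (g : GL (Fin 4) ℚ_[p]), ← mul_assoc, ← mul_assoc, h, one_mul, mul_assoc, h,
      mul_one]
  map_mul' g g' := by
    have h : C p * C p = 1 := by nth_rewrite 1 [← C_inv p]; exact inv_mul_cancel _
    ext1
    change C p * ((g : GL (Fin 4) ℚ_[p]) * g') * C p = C p * g * C p * (C p * g' * C p)
    have : C p * (g : GL (Fin 4) ℚ_[p]) * C p * (C p * g' * C p) =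
        C p * g * (C p * C p) * g' * C p := by simp only [mul_assoc]
    rw [this, h, mul_one]; simp only [mul_assoc]

variable {p}

/-- The underlying matrix of an element of `GSp(4, ℚ_p)`. -/
def mat (g : GSp4 p) : Matrix (Fin 4) (Fin 4) ℚ_[p] := (g : GL (Fin 4) ℚ_[p])

/-- The multiplier `λ(g)` of `g ∈ GSp(4, ℚ_p)`, read off from `ᵗg J g = λ(g) J`. -/
def multiplier (g : GSp4 p) : ℚ_[p] :=
  ((mat g)ᵀ * J p * mat g) 0 2

lemma multiplier_spec (g : GSp4 p) :
    (mat g)ᵀ * J p * mat g =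
      multiplier g • J p := by
  obtain ⟨c, hc⟩ := g.2
  rw [multiplier, mat, hc]
  simp [J]

variable (p)

/-- `GSp(4, ℤ_p)`: integral entries and multiplier a unit (so the inverse is integral too). -/
def GSp4Zp : Set (GSp4 p) :=
  {k | ‖multiplier k‖ = 1 ∧ ∀ i j, ‖mat k i j‖ ≤ 1}

/-- The paramodular group `K^para(p^n)`: the multiplier is a unit and the `(i, j)` entry lies in
`p^e ℤ_p`, with `e` the `(i, j)` entry of the matrix displayed. -/
def Kpara (n : ℕ) : Set (GSp4 p) :=
  {k | ‖multiplier k‖ = 1 ∧ ∀ i j,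
    ‖mat k i j‖ ≤
      (p : ℝ) ^ (-((!![0, 0, -n, 0;
                       n, 0, 0, 0;
                       n, n, 0, n;
                       n, 0, 0, 0] : Matrix (Fin 4) (Fin 4) ℤ) i j))}

/-- `K^para(p^0)` is `GSp(4, ℤ_p)`. -/
lemma Kpara_zero : Kpara p 0 = GSp4Zp p := by
  ext k
  have h : ∀ i j : Fin 4, (!![0, 0, -((0 : ℕ) : ℤ), 0; ((0 : ℕ) : ℤ), 0, 0, 0;
      ((0 : ℕ) : ℤ), ((0 : ℕ) : ℤ), 0, ((0 : ℕ) : ℤ); ((0 : ℕ) : ℤ), 0, 0, 0] :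
      Matrix (Fin 4) (Fin 4) ℤ) i j = 0 := by
    intro i j; fin_cases i <;> fin_cases j <;> rfl
  change (_ ∧ _) ↔ (_ ∧ _)
  simp only [h, neg_zero, zpow_zero]

end Groups

/-! ### Matrices in the `J'` realization, used to define the twisting map -/

section PrimedMatrices

/-- The lower unipotent matrix with entry `x` in position `(3, 2)`. -/
def lower' (p : ℕ) [Fact p.Prime] (x : ℚ_[p]) : GSp4' p :=
  ofIsometry (J' p) (J'_mul_J' p)
    !![1, 0, 0, 0;
       0, 1, 0, 0;
       0, x, 1, 0;
       0, 0, 0, 1]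
    (by ext i j; fin_cases i <;> fin_cases j <;> simp [J', Matrix.mul_apply, Fin.sum_univ_four])

/-- The Heisenberg matrix with parameters `a, b, z`. -/
def heis' (p : ℕ) [Fact p.Prime] (a b z : ℚ_[p]) : GSp4' p :=
  ofIsometry (J' p) (J'_mul_J' p)
    !![1, -a, b, z;
       0, 1, 0, b;
       0, 0, 1, a;
       0, 0, 0, 1]
    (by ext i j; fin_cases i <;> fin_cases j <;> simp [J', Matrix.mul_apply, Fin.sum_univ_four]; ring)

variable (p : ℕ) [Fact p.Prime]

/-- The Weyl element acting on the middle coordinates. -/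
def weyl' : GSp4' p :=
  ofIsometry (J' p) (J'_mul_J' p)
    !![1, 0, 0, 0;
       0, 0, 1, 0;
       0, -1, 0, 0;
       0, 0, 0, 1]
    (by ext i j; fin_cases i <;> fin_cases j <;> simp [J', Matrix.mul_apply, Fin.sum_univ_four])

/-- `p ≠ 0` in `ℚ_p`. -/
lemma p_ne_zero : (p : ℚ_[p]) ≠ 0 := Nat.cast_ne_zero.mpr (Fact.out : p.Prime).ne_zero

/-- `τ = diag(1, p⁻¹, p, 1)`, in the `J'` realization. -/
def tauJ' : GSp4' p :=
  ofIsometry (J' p) (J'_mul_J' p)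
    !![1, 0, 0, 0;
       0, (p : ℚ_[p])⁻¹, 0, 0;
       0, 0, (p : ℚ_[p]), 0;
       0, 0, 0, 1]
    (by
      have := p_ne_zero p
      ext i j; fin_cases i <;> fin_cases j <;>
        simp [J', Matrix.mul_apply, Fin.sum_univ_four, this])

/-- The element `t₄`, in the `J'` realization. -/
def t4' : GSp4' p :=
  ofIsometry (J' p) (J'_mul_J' p)
    !![0, 0, 0, -((p : ℚ_[p]) ^ 4)⁻¹;
       0, 1, 0, 0;
       0, 0, 1, 0;
       (p : ℚ_[p]) ^ 4, 0, 0, 0]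
    (by
      have := p_ne_zero p
      ext i j; fin_cases i <;> fin_cases j <;>
        simp [J', Matrix.mul_apply, Fin.sum_univ_four, this])

end PrimedMatrices

/-! ### Matrices in the `J` realization, used in the explicit formula -/

section Matrices

/-- The block diagonal matrix with blocks `A = [1, t; 0, 1]` and `ᵗA⁻¹`. -/
def levi (p : ℕ) [Fact p.Prime] (t : ℚ_[p]) : GSp4 p :=
  ofIsometry (J p) (J_mul_J p)
    !![1, t, 0, 0;
       0, 1, 0, 0;
       0, 0, 1, 0;
       0, 0, -t, 1]
    (by ext i j; fin_cases i <;> fin_cases j <;> simp [J, Matrix.mul_apply, Fin.sum_univ_four])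

/-- The block unipotent matrix with upper right block the symmetric matrix `[x, y; y, z]`. -/
def unip (p : ℕ) [Fact p.Prime] (x y z : ℚ_[p]) : GSp4 p :=
  ofIsometry (J p) (J_mul_J p)
    !![1, 0, x, y;
       0, 1, y, z;
       0, 0, 1, 0;
       0, 0, 0, 1]
    (by ext i j; fin_cases i <;> fin_cases j <;> simp [J, Matrix.mul_apply, Fin.sum_univ_four])

variable (p : ℕ) [Fact p.Prime]

/-- `η' = diag(p⁻¹, 1, p, 1)`. -/
def etaJ : GSp4 p :=
  ofIsometry (J p) (J_mul_J p)
    !![(p : ℚ_[p])⁻¹, 0, 0, 0;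
       0, 1, 0, 0;
       0, 0, (p : ℚ_[p]), 0;
       0, 0, 0, 1]
    (by
      have := p_ne_zero p
      ext i j; fin_cases i <;> fin_cases j <;>
        simp [J, Matrix.mul_apply, Fin.sum_univ_four, this])

/-- `τ' = diag(1, p⁻¹, 1, p)`. -/
def tauJ : GSp4 p :=
  ofIsometry (J p) (J_mul_J p)
    !![1, 0, 0, 0;
       0, (p : ℚ_[p])⁻¹, 0, 0;
       0, 0, 1, 0;
       0, 0, 0, (p : ℚ_[p])]
    (by
      have := p_ne_zero p
      ext i j; fin_cases i <;> fin_cases j <;>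
        simp [J, Matrix.mul_apply, Fin.sum_univ_four, this])

end Matrices

/-! ### Integration of locally constant vector valued functions on `ℤ_p` -/

section Integral

variable (p : ℕ) [Fact p.Prime]

/-- The Haar measure on the Borel sets of `ℤ_p` with total mass `1`, i.e. the restriction to `ℤ_p`
of the Haar measure on `ℚ_p` for which `ℤ_p` has measure `1`. -/
def haarZp : @Measure ℤ_[p] (borel ℤ_[p]) :=
  letI : MeasurableSpace ℤ_[p] := borel ℤ_[p]
  haveI : BorelSpace ℤ_[p] := ⟨rfl⟩
  Measure.addHaarMeasure ⊤

variable {V : Type*} [AddCommGroup V] [Module ℂ V]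

/-- The integral over `S ⊆ ℤ_p` of a function that takes finitely many values on `S`, in a complex
vector space without topology: the sum over all `w` of `μ({x ∈ S | f x = w}) w`. Locally constant
functions on compact sets are of this kind. -/
def integralZp (S : Set ℤ_[p]) (f : ℤ_[p] → V) : V :=
  ∑ᶠ w : V, (((haarZp p) (S ∩ f ⁻¹' {w})).toReal : ℂ) • w

/-- The unit group `ℤ_pˣ` as a subset of `ℤ_p`. -/
def unitsZp : Set ℤ_[p] := {x | ‖x‖ = 1}

/-- The maximal ideal `pℤ_p` as a subset of `ℤ_p`. -/
def maxIdealZp : Set ℤ_[p] := {x | ‖x‖ < 1}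

end Integral

/-! ### Representations and the twisting map -/

section Twist

variable {p : ℕ} [Fact p.Prime] {V : Type*} [AddCommGroup V] [Module ℂ V]

/-- A representation is smooth if every vector has an open stabilizer. -/
def IsSmooth {G : Type*} [Group G] [TopologicalSpace G] (π : Representation ℂ G V) : Prop :=
  ∀ v : V, IsOpen {g : G | π g v = v}

/-- `χ` has conductor `p`: it is trivial on `1 + pℤ_p` but not on `ℤ_pˣ`. Characters of `ℚ_pˣ` are
given here as multiplicative characters, extended to `ℚ_p` by `χ 0 = 0`. -/
def HasConductorP (χ : MulChar ℚ_[p] ℂ) : Prop :=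
  (∀ u : ℚ_[p], ‖u - 1‖ < 1 → χ u = 1) ∧ ∃ u : ℚ_[p], ‖u‖ = 1 ∧ χ u ≠ 1

/-- `V(n, χ)`: the vectors on which `k ∈ K^para(p^n)` acts by `χ(λ(k))`. -/
def paramodularVectors (π : Representation ℂ (GSp4 p) V) (n : ℕ) (χ : MulChar ℚ_[p] ℂ) :
    Submodule ℂ V where
  carrier := {v | ∀ k ∈ Kpara p n, π k v = χ (multiplier k) • v}
  add_mem' := by
    intro v w hv hw k hk
    rw [map_add, hv k hk, hw k hk, smul_add]
  zero_mem' := by intro k _; simp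
  smul_mem' := by
    intro c v hv k hk
    rw [map_smul, hv k hk, smul_comm]

/-- The twisting map for a representation of the `J'` realization of `GSp(4, ℚ_p)`, as a sum of
four iterated integrals (the innermost integral is the one over `a`). -/
def twist' (π : Representation ℂ (GSp4' p) V) (χ : MulChar ℚ_[p] ℂ) (v : V) : V :=
  ((p : ℂ) ^ 3) •
    (integralZp p Set.univ fun z => integralZp p Set.univ fun x =>
      integralZp p (unitsZp p) fun b => integralZp p (unitsZp p) fun a =>
        χ ((a : ℚ_[p]) * b) •
          π (lower' p (x : ℚ_[p]) * heis' p ((a : ℚ_[p]) / p) ((b : ℚ_[p]) / p ^ 2) ((z : ℚ_[p]) / p ^ 4))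
            (π (tauJ' p) v)) +
  ((p : ℂ) ^ 3) •
    (integralZp p Set.univ fun z => integralZp p (maxIdealZp p) fun y =>
      integralZp p (unitsZp p) fun b => integralZp p (unitsZp p) fun a =>
        χ ((a : ℚ_[p]) * b) •
          π (weyl' p * lower' p (y : ℚ_[p]) *
              heis' p ((a : ℚ_[p]) / p) ((b : ℚ_[p]) / p ^ 2) ((z : ℚ_[p]) / p ^ 4))
            (π (tauJ' p) v)) +
  ((p : ℂ) ^ 2) •
    (integralZp p Set.univ fun z => integralZp p Set.univ fun x =>
      integralZp p (unitsZp p) fun b => integralZp p (unitsZp p) fun a =>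
        χ ((a : ℚ_[p]) * b) •
          π (t4' p * lower' p (x : ℚ_[p]) *
              heis' p ((a : ℚ_[p]) / p) ((b : ℚ_[p]) / p ^ 2) ((z : ℚ_[p]) / p ^ 3))
            (π (tauJ' p) v)) +
  ((p : ℂ) ^ 2) •
    (integralZp p Set.univ fun z => integralZp p (maxIdealZp p) fun y =>
      integralZp p (unitsZp p) fun b => integralZp p (unitsZp p) fun a =>
        χ ((a : ℚ_[p]) * b) •
          π (t4' p * weyl' p * lower' p (y : ℚ_[p]) *
              heis' p ((a : ℚ_[p]) / p) ((b : ℚ_[p]) / p ^ 2) ((z : ℚ_[p]) / p ^ 3))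
            (π (tauJ' p) v))

/-- The twisting map `T_χ` for a representation of `GSp(4, ℚ_p)` with respect to `J`, obtained by
transport along conjugation by `C`. -/
def twist (π : Representation ℂ (GSp4 p) V) (χ : MulChar ℚ_[p] ℂ) (v : V) : V :=
  twist' (π.comp (conjC p).toMonoidHom) χ v

end Twist

/-! ### The fourteen finite sums

A residue class mod `p^n` is an element of `ZMod (p ^ n)`, identified with `ℤ_p / p^n ℤ_p` through
`PadicInt.toZModPow n`. The expressions to be summed involve representatives in `ℤ_p` of the
residue classes; these are provided by a choice `r` of representatives. -/

section Formula

variable {p : ℕ} [Fact p.Prime] {V : Type*} [AddCommGroup V] [Module ℂ V]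

/-- A choice, for every `n`, of representatives in `ℤ_p` of the residue classes mod `p^n`. -/
structure Representatives (p : ℕ) [Fact p.Prime] where
  /-- the representative of a residue class, as an element of `ℤ_p` -/
  rep : ∀ n : ℕ, ZMod (p ^ n) → ℤ_[p]
  toZModPow_rep : ∀ (n : ℕ) (a : ZMod (p ^ n)), PadicInt.toZModPow n (rep n a) = a

/-- The sum of `f` over (representatives of) `ℤ_p / p^n ℤ_p`. -/
def sumAll (r : Representatives p) (n : ℕ) (f : ℚ_[p] → V) : V :=
  ∑ a : ZMod (p ^ n), f (r.rep n a)

/-- The sum of `f` over (representatives of) `(ℤ_p / p^n ℤ_p)ˣ`. -/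
def sumUnits (r : Representatives p) (n : ℕ) (f : ℚ_[p] → V) : V :=
  ∑ a : (ZMod (p ^ n))ˣ, f (r.rep n (a : ZMod (p ^ n)))

open scoped Classical in
/-- The sum of `f` over (representatives of) the classes in `(ℤ_p / p^n ℤ_p)ˣ` that are not
congruent to `1` mod `p`. -/
def sumUnitsNeOne (r : Representatives p) (n : ℕ) (f : ℚ_[p] → V) : V :=
  ∑ a : (ZMod (p ^ n))ˣ with PadicInt.toZMod (r.rep n (a : ZMod (p ^ n))) ≠ 1,
    f (r.rep n (a : ZMod (p ^ n)))

variable (π : Representation ℂ (GSp4 p) V) (χ : MulChar ℚ_[p] ℂ) (r : Representatives p) (v : V)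

def T1 : V :=
  ((p : ℂ) ^ 11)⁻¹ •
    sumUnits r 3 fun a => sumUnits r 3 fun b => sumUnits r 3 fun x => sumAll r 4 fun z =>
      χ (a * b) • π (levi p (-(a + x * b) / p) * unip p (z / p ^ 4) (b / p ^ 2) (x⁻¹ / p)) v

def T2 : V :=
  ((p : ℂ) ^ 11)⁻¹ • π (etaJ p)
    (sumUnits r 3 fun a => sumUnits r 3 fun b =>
      sumUnitsNeOne r 3 fun x => sumUnitsNeOne r 3 fun y =>
        χ (a * b * x * y) •
          π (levi p (b / p) *
            unip p (a * b * (1 - (1 - y)⁻¹ * x) / p ^ 3) (-a / p ^ 2)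
              (a * b⁻¹ * (1 - x)⁻¹ / p)) v)

def T3 : V :=
  ((p : ℂ) ^ 6)⁻¹ • π (etaJ p)
    (sumUnits r 2 fun a => sumUnits r 3 fun b => sumUnitsNeOne r 1 fun z =>
      χ (b * (1 - z)) • π (unip p (b / p ^ 3) (a / p ^ 2) (a ^ 2 * b⁻¹ * z / p)) v)

def T4 : V :=
  ((p : ℂ) ^ 10)⁻¹ • π (etaJ p)
    (sumAll r 4 fun a => sumUnits r 3 fun b => sumUnits r 4 fun x =>
      χ b • π (levi p (x / p ^ 2) * unip p ((b * p - a * x) / p ^ 4) (a / p ^ 2) 0) v)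

def T5 : V :=
  ((p : ℂ) ^ 9)⁻¹ • π (etaJ p)
    (sumUnits r 3 fun a => sumUnits r 3 fun b => sumAll r 3 fun x =>
      χ b • π (levi p (x / p) * unip p ((b - a * x) / p ^ 3) (a / p ^ 2) 0) v)

def T6 : V :=
  ((p : ℂ) ^ 6)⁻¹ • π (etaJ p ^ 2)
    (sumUnits r 2 fun a => sumUnits r 2 fun b => sumUnits r 1 fun x =>
      χ (b * x) • π (unip p (b * (1 - x * p) / p ^ 2) (a / p ^ 2) (a ^ 2 * b⁻¹ / p ^ 2)) v)

def T7 : V :=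
  ((p : ℂ) ^ 7)⁻¹ • π (tauJ p)
    (sumUnits r 3 fun a => sumUnits r 1 fun b => sumAll r 4 fun z =>
      χ (a * b) • π (levi p (-a / p ^ 2) * unip p (z / p ^ 4) (b / p) 0) v)

def T8 : V :=
  ((p : ℂ) ^ 9)⁻¹ • π (etaJ p * tauJ p)
    (sumUnits r 3 fun a => sumUnits r 3 fun b => sumUnitsNeOne r 3 fun z =>
      χ (a * b * z * (1 - z)) •
        π (levi p (b / p ^ 2) * unip p (-(a * b * (1 - z)) / p ^ 3) (a / p) 0) v)

def T9 : V :=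
  ((p : ℂ) ^ 6)⁻¹ • π (etaJ p ^ 2 * tauJ p)
    (sumUnits r 2 fun a => sumUnits r 1 fun b => sumUnits r 1 fun x =>
      χ b • π (levi p (a / p) * unip p (-b / p) 0 (x / p)) v)

/-- Here `levi p (a / p ^ 2) * unip p (-b / p) 0 0` is the matrix with rows
`(1, a p⁻², -b p⁻¹, 0)`, `(0, 1, 0, 0)`, `(0, 0, 1, 0)`, `(0, 0, -a p⁻², 1)`. -/
def T10 : V :=
  ((p : ℂ) ^ 6)⁻¹ • π (etaJ p ^ 2 * tauJ p ^ 2)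
    (sumUnits r 2 fun a => sumUnits r 1 fun b =>
      χ b • π (levi p (a / p ^ 2) * unip p (-b / p) 0 0) v)

def T11 : V :=
  ((p : ℂ) ^ 10)⁻¹ • π (tauJ p)⁻¹
    (sumUnits r 2 fun a => sumUnits r 4 fun b => sumAll r 3 fun x => sumAll r 4 fun z =>
      χ (a * b) •
        π (levi p (b / p) * unip p (z / p ^ 4) ((x * b + a * p) / p ^ 3) (-x / p ^ 2)) v)

def T12 : V :=
  ((p : ℂ) ^ 12)⁻¹ • π (etaJ p * (tauJ p)⁻¹)
    (sumAll r 4 fun y => sumUnits r 4 fun a => sumUnits r 3 fun b => sumUnitsNeOne r 3 fun z =>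
      χ (a * b * z * (1 - z)) •
        π (levi p (a / p) *
          unip p (a * (b * (1 - z) * p - y) / p ^ 4) (y / p ^ 3)
            (-(a⁻¹ * (y + b * p)) / p ^ 2)) v)

def T13 : V :=
  ((p : ℂ) ^ 6)⁻¹ • π (etaJ p ^ 2 * (tauJ p)⁻¹)
    (sumUnits r 2 fun a => sumUnits r 3 fun b => sumUnits r 1 fun x =>
      χ (b * x) • π (unip p (b * (1 - x) / p) (a / p ^ 2) (a ^ 2 * b⁻¹ / p ^ 3)) v)

def T14 : V :=
  ((p : ℂ) ^ 6)⁻¹ • π (etaJ p ^ 2 * (tauJ p ^ 2)⁻¹)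
    (sumUnits r 2 fun a => sumUnits r 1 fun b => sumAll r 4 fun x =>
      χ b • π (unip p (-b / p) (a / p ^ 2) (x / p ^ 4)) v)

end Formula

end TwistGSp4

end

open Matrix MeasureTheory

noncomputable section

/-! Both assertions are equalities in `V`, so they may be tested with linear functionals `φ`. For
fixed `φ` the coefficient Φ(g) = φ(π(g)v) is continuous and right invariant under `GSp(4, ℤ_p)`, and
each assertion becomes an identity between iterated Haar integrals over `ℤ_p` of values of Φ. Three
tools then suffice: column operations over `ℤ_p` on the argument of Φ; measure-preserving
substitutions (translations, unit scalings, inversion of units); and the division of `ℤ_p` into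
units and maximal ideal, where each passage to `pℤ_p` costs a factor 1/p.

The formula. Splitting the variable x of L(x) by valuation 0, 1, or at least 2 brings L(x)Hτ into
upper triangular form with prefix τ'⁻¹, 1 or τ' (`avg_lowHeis_add_avg_weyl`). In the two integrals
without t₄ the resulting averages already are T¹¹, T¹ and T⁷. In the two integrals with t₄ the
product must be made triangular again. The new prefix η'^k τ'^l is forced: p^k generates the ideal
of the entries of the third row, and p^(k+l) that of the 2×2 minors of the last two rows, neither of
which changes under integral column operations. A shift of the central variable z to a variable u
makes these data visible: they are governed by u and u + ab when the first prefix is τ'⁻¹, and by u,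
s = a + xb and d = xu + as when it is trivial. Valuations of these quantities separate the cases,
with a finer division by u + ab and s among the cosets with prefix η'. The case prefix τ' is the
missing x ∈ pℤ_p part of the case of trivial prefix, and merges with it (`mean_t4_unit_unit`,
`mean_t4_p_unit`). In each case a triangular chain of substitutions carries the average to that of
one of the remaining eleven sums. The character survives because χ, being quadratic of conductor p,
ignores square unit factors and changes in `pℤ_p`.

A sum over residue classes mod p^n is p^n times an average when the summand is periodic
(`IsResidueSum`). Periodicity holds term by term, except that in T¹³ the variable a is periodic only
after summation over b (`mean4_T13_periodic`).

Membership in V(4, χ). The transform Φ ↦ `twistAvg` Φ must be multiplied by χ(λ(k)) when Φ is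
translated by k ∈ K^para(p⁴). It has the shape of an integral over a projective line in two ways:
over ℙ¹ of the SL(2) in coordinates 2, 4, with Weyl element s, and, since p² times an average over
p⁻³ℤ_p is p³ times one over p·p⁻⁴ℤ_p, over ℙ¹ of the SL(2) in coordinates 1, 3, with Weyl element
t₄. Changing charts of ℙ¹ gives invariance under s, L(y), t₄ and the center p⁻⁴ℤ_p; integral
Heisenberg elements are absorbed by translations, and diagonal matrices produce χ(λ). Elimination
writes every element of K^para(p⁴) in these generators (`twistInvariant_of_mem_Kpara`). -/

namespace TwistGSp4

/-! ### Haar measure on `ℤ_p` and its isometries -/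

section Haar

variable {p : ℕ} [Fact p.Prime]

/-- The Borel `σ`-algebra on `ℤ_p`. -/
instance measurableSpaceZp : MeasurableSpace ℤ_[p] := borel ℤ_[p]

instance borelSpaceZp : BorelSpace ℤ_[p] := ⟨rfl⟩

lemma haarZp_eq : haarZp p = Measure.addHaarMeasure (⊤ : TopologicalSpace.PositiveCompacts ℤ_[p]) :=
  rfl

instance : IsProbabilityMeasure (haarZp p) := by
  constructor
  rw [haarZp_eq]
  exact Measure.addHaarMeasure_self

instance : Measure.IsAddHaarMeasure (haarZp p) := by
  rw [haarZp_eq]; infer_instance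

/-- Isometries of `ℤ_p` preserve the Haar measure, since they permute the balls of given radius. -/
lemma measurePreserving_isometryEquiv (e : ℤ_[p] ≃ᵢ ℤ_[p]) :
    MeasurePreserving e (haarZp p) (haarZp p) := by
  refine ⟨e.continuous.measurable, ?_⟩
  have : IsProbabilityMeasure ((haarZp p).map e) :=
    Measure.isProbabilityMeasure_map e.continuous.measurable.aemeasurable
  set B : Set (Set ℤ_[p]) := {s | s = ∅ ∨ ∃ x : ℤ_[p], ∃ r : ℝ, 0 < r ∧ s = Metric.ball x r} with hB
  have hgen : borel ℤ_[p] = MeasurableSpace.generateFrom B := by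
    refine (TopologicalSpace.IsTopologicalBasis.borel_eq_generateFrom ?_)
    refine TopologicalSpace.isTopologicalBasis_of_isOpen_of_nhds ?_ ?_
    · rintro s (rfl | ⟨x, r, -, rfl⟩)
      · exact isOpen_empty
      · exact Metric.isOpen_ball
    · intro x u hx hu
      obtain ⟨r, hr, hru⟩ := Metric.isOpen_iff.mp hu x hx
      exact ⟨_, Or.inr ⟨x, r, hr, rfl⟩, Metric.mem_ball_self hr, hru⟩
  -- Ultrametric balls are nested or disjoint, so the balls form a π-system once the empty set is
  -- added.
  refine ext_of_generate_finite B hgen ?_ ?_ (by simp)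
  · rintro s (rfl | ⟨x, r, hr, rfl⟩) t (rfl | ⟨y, r', hr', rfl⟩) hne
    · simp at hne
    · simp at hne
    · simp at hne
    · rcases IsUltrametricDist.ball_subset_trichotomy (x := x) (r := r) (y := y) (s := r') with h | h | h
      · rw [Set.inter_eq_left.mpr h]; exact Or.inr ⟨x, r, hr, rfl⟩
      · rw [Set.inter_eq_right.mpr h]; exact Or.inr ⟨y, r', hr', rfl⟩
      · exact absurd (Set.disjoint_iff_inter_eq_empty.mp h) hne.ne_empty
  · rintro s (rfl | ⟨x, r, hr, rfl⟩)
    · simp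
    · rw [Measure.map_apply e.continuous.measurable Metric.isOpen_ball.measurableSet,
        e.preimage_ball]
      have key : ∀ y : ℤ_[p], haarZp p (Metric.ball y r) = haarZp p (Metric.ball 0 r) := by
        intro y
        have : (fun z => y + z) ⁻¹' Metric.ball y r = Metric.ball 0 r := by
          ext z; simp [dist_eq_norm]
        rw [← this, measure_preimage_add]
      rw [key, key x]

end Haar

/-! ### Averages over `ℤ_p`: substitutions, Fubini, residue classes -/

section Average

variable (p : ℕ) [Fact p.Prime]

/-- The mean over `ℤ_p` of a function on `ℚ_p`. -/
def mean (f : ℚ_[p] → ℂ) : ℂ := ∫ x : ℤ_[p], f (x : ℚ_[p]) ∂(haarZp p)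

/-- The indicator function of the units. -/
def oneU (x : ℚ_[p]) : ℂ := if ‖x‖ = 1 then 1 else 0

/-- The indicator function of the maximal ideal. -/
def oneP (x : ℚ_[p]) : ℂ := if ‖x‖ < 1 then 1 else 0

/-- The identity on units, extended by one. -/
def uval (x : ℚ_[p]) : ℚ_[p] := if ‖x‖ = 1 then x else 1

/-- The inverse on units, extended by one. -/
def uinv (x : ℚ_[p]) : ℚ_[p] := if ‖x‖ = 1 then x⁻¹ else 1

/-- The inverse on units, extended by the identity. -/
def uflip (x : ℚ_[p]) : ℚ_[p] := if ‖x‖ = 1 then x⁻¹ else x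

variable {p}

lemma isClopen_sphere_one : IsClopen {x : ℚ_[p] | ‖x‖ = 1} := by
  have := IsUltrametricDist.isClopen_sphere (0 : ℚ_[p]) (one_ne_zero (α := ℝ))
  convert this using 1
  ext x; simp

lemma isClopen_norm_lt_one : IsClopen {x : ℚ_[p] | ‖x‖ < 1} := by
  have := IsUltrametricDist.isClopen_ball (0 : ℚ_[p]) (1 : ℝ)
  convert this using 1
  ext x; simp

lemma continuous_ite_clopen {X Y : Type*} [TopologicalSpace X] [TopologicalSpace Y] {P : X → Prop}
    [DecidablePred P] (hP : IsClopen {x | P x}) {f g : X → Y} (hf : ContinuousOn f {x | P x})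
    (hg : Continuous g) : Continuous fun x => if P x then f x else g x := by
  refine continuous_if' ?_ ?_ ?_ ?_
  · intro a ha; rw [hP.frontier_eq] at ha; exact ha.elim
  · intro a ha; rw [hP.frontier_eq] at ha; exact ha.elim
  · exact hf
  · exact hg.continuousOn

@[fun_prop]
lemma continuous_oneU : Continuous (oneU p) :=
  continuous_ite_clopen isClopen_sphere_one continuousOn_const continuous_const

@[fun_prop]
lemma continuous_oneP : Continuous (oneP p) :=
  continuous_ite_clopen isClopen_norm_lt_one continuousOn_const continuous_const

lemma continuousOn_inv_sphere_one : ContinuousOn (fun x : ℚ_[p] => x⁻¹) {x : ℚ_[p] | ‖x‖ = 1} :=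
  continuousOn_inv₀.mono fun x hx h0 => by
    rw [Set.mem_ofPred_eq, show x = 0 from h0, norm_zero] at hx
    exact zero_ne_one hx

@[fun_prop]
lemma continuous_uval : Continuous (uval p) :=
  continuous_ite_clopen isClopen_sphere_one continuousOn_id continuous_const

@[fun_prop]
lemma continuous_uinv : Continuous (uinv p) :=
  continuous_ite_clopen isClopen_sphere_one continuousOn_inv_sphere_one continuous_const

@[fun_prop]
lemma continuous_uflip : Continuous (uflip p) :=
  continuous_ite_clopen isClopen_sphere_one continuousOn_inv_sphere_one continuous_id

-- The functions `uval`, `uinv`, `uflip` exist so that substitution coefficients are units, and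
-- integrands continuous, at every point, including those where a weight kills the integrand.
-- Substitution and Fubini then apply without restricting the domain.
@[simp] lemma norm_uval (x : ℚ_[p]) : ‖uval p x‖ = 1 := by
  by_cases h : ‖x‖ = 1 <;> simp [uval, h]

@[simp] lemma norm_uinv (x : ℚ_[p]) : ‖uinv p x‖ = 1 := by
  by_cases h : ‖x‖ = 1 <;> simp [uinv, h]

@[simp] lemma norm_uflip (x : ℚ_[p]) : ‖uflip p x‖ = ‖x‖ := by
  by_cases h : ‖x‖ = 1 <;> simp [uflip, h]

lemma oneU_of {x : ℚ_[p]} (h : ‖x‖ = 1) : oneU p x = 1 := if_pos h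
lemma oneU_of_ne {x : ℚ_[p]} (h : ‖x‖ ≠ 1) : oneU p x = 0 := if_neg h
lemma oneP_of {x : ℚ_[p]} (h : ‖x‖ < 1) : oneP p x = 1 := if_pos h
lemma oneP_of_not {x : ℚ_[p]} (h : ¬ ‖x‖ < 1) : oneP p x = 0 := if_neg h
lemma uval_of {x : ℚ_[p]} (h : ‖x‖ = 1) : uval p x = x := if_pos h
lemma uinv_of {x : ℚ_[p]} (h : ‖x‖ = 1) : uinv p x = x⁻¹ := if_pos h
lemma uflip_of {x : ℚ_[p]} (h : ‖x‖ = 1) : uflip p x = x⁻¹ := if_pos h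

lemma mean_congr {f g : ℚ_[p] → ℂ} (h : ∀ x, ‖x‖ ≤ 1 → f x = g x) : mean p f = mean p g := by
  unfold mean
  congr 1; ext x
  exact h _ x.2

lemma mean_const (c : ℂ) : mean p (fun _ => c) = c := by simp [mean]

lemma mean_const_mul (c : ℂ) (f : ℚ_[p] → ℂ) : mean p (fun x => c * f x) = c * mean p f :=
  integral_const_mul _ _

lemma mean_integrable {f : ℚ_[p] → ℂ} (hf : Continuous f) :
    Integrable (fun x : ℤ_[p] => f x) (haarZp p) := by
  have hc : Continuous fun x : ℤ_[p] => f x := hf.comp continuous_subtype_val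
  exact hc.integrable_of_hasCompactSupport (HasCompactSupport.of_compactSpace _)

lemma mean_add {f g : ℚ_[p] → ℂ} (hf : Continuous f) (hg : Continuous g) :
    mean p (fun x => f x + g x) = mean p f + mean p g :=
  integral_add (mean_integrable hf) (mean_integrable hg)

/-- Substitution along a bijective isometry of `ℤ_p`, given on the level of `ℚ_p`. -/
lemma mean_comp (σ ρ : ℚ_[p] → ℚ_[p]) (hσ : ∀ x, ‖x‖ ≤ 1 → ‖σ x‖ ≤ 1)
    (hρ : ∀ x, ‖x‖ ≤ 1 → ‖ρ x‖ ≤ 1) (hinv : ∀ x, ‖x‖ ≤ 1 → σ (ρ x) = x)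
    (hiso : ∀ x y, ‖x‖ ≤ 1 → ‖y‖ ≤ 1 → ‖σ x - σ y‖ = ‖x - y‖) (f : ℚ_[p] → ℂ) :
    mean p (fun x => f (σ x)) = mean p f := by
  let F : ℤ_[p] → ℤ_[p] := fun x => ⟨σ (x : ℚ_[p]), hσ _ x.2⟩
  let G : ℤ_[p] → ℤ_[p] := fun x => ⟨ρ (x : ℚ_[p]), hρ _ x.2⟩
  have hF : ∀ x : ℤ_[p], ((F x : ℤ_[p]) : ℚ_[p]) = σ x := fun x => rfl
  have hG : ∀ x : ℤ_[p], ((G x : ℤ_[p]) : ℚ_[p]) = ρ x := fun x => rfl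
  let e : ℤ_[p] ≃ᵢ ℤ_[p] := IsometryEquiv.mk' F G
    (fun x => Subtype.ext (by rw [hF, hG]; exact hinv _ x.2))
    (Isometry.of_dist_eq fun x y => hiso _ _ x.2 y.2)
  have he : ∀ x, e x = F x := fun x => rfl
  exact (measurePreserving_isometryEquiv e).integral_comp e.toHomeomorph.measurableEmbedding
    (fun x : ℤ_[p] => f x)

lemma mean_add_right (c : ℚ_[p]) (hc : ‖c‖ ≤ 1) (f : ℚ_[p] → ℂ) :
    mean p (fun x => f (x + c)) = mean p f := by
  refine mean_comp (fun x => x + c) (fun x => x - c) ?_ ?_ ?_ ?_ f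
  · intro x hx; exact (IsUltrametricDist.norm_add_le_max _ _).trans (max_le hx hc)
  · intro x hx
    rw [sub_eq_add_neg]
    exact (IsUltrametricDist.norm_add_le_max _ _).trans (max_le hx (by rwa [norm_neg]))
  · intro x _; ring
  · intro x y _ _; congr 1; ring

lemma ne_zero_of_norm_one {u : ℚ_[p]} (hu : ‖u‖ = 1) : u ≠ 0 := by
  intro h; simp [h] at hu

lemma mean_mul_left (u : ℚ_[p]) (hu : ‖u‖ = 1) (f : ℚ_[p] → ℂ) :
    mean p (fun x => f (u * x)) = mean p f := by
  have hu0 := ne_zero_of_norm_one hu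
  refine mean_comp (fun x => u * x) (fun x => u⁻¹ * x) ?_ ?_ ?_ ?_ f
  · intro x hx; simpa [hu] using hx
  · intro x hx; simpa [hu] using hx
  · intro x _; field_simp
  · intro x y _ _; rw [← mul_sub, norm_mul, hu, one_mul]

lemma norm_eq_of_norm_sub_lt {x y : ℚ_[p]} (h : ‖x - y‖ < ‖x‖) : ‖y‖ = ‖x‖ := by
  have h2 : y = (y - x) + x := by ring
  have h3 : ‖y - x‖ < ‖x‖ := by rwa [norm_sub_rev]
  rw [h2, IsUltrametricDist.norm_add_eq_max_of_norm_ne_norm h3.ne, max_eq_right h3.le]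

lemma uflip_uflip (x : ℚ_[p]) : uflip p (uflip p x) = x := by
  by_cases h : ‖x‖ = 1 <;> simp [uflip, h]

/-- Inversion on the units. -/
lemma mean_uflip (f : ℚ_[p] → ℂ) : mean p (fun x => f (uflip p x)) = mean p f := by
  refine mean_comp (uflip p) (uflip p) (fun x hx => by rwa [norm_uflip])
    (fun x hx => by rwa [norm_uflip]) (fun x _ => uflip_uflip x) ?_ f
  · intro x y hx hy
    by_cases hxu : ‖x‖ = 1 <;> by_cases hyu : ‖y‖ = 1
    · have hx0 := ne_zero_of_norm_one hxu
      have hy0 := ne_zero_of_norm_one hyu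
      rw [uflip_of hxu, uflip_of hyu]
      have : x⁻¹ - y⁻¹ = -(x⁻¹ * y⁻¹ * (x - y)) := by field_simp; ring
      rw [this, norm_neg, norm_mul, norm_mul, norm_inv, norm_inv, hxu, hyu]; simp
    · have e1 : ‖uflip p x‖ ≠ ‖-uflip p y‖ := by rw [norm_neg, norm_uflip, norm_uflip, hxu]; exact fun h => hyu h.symm
      have e2 : ‖x‖ ≠ ‖-y‖ := by rw [norm_neg, hxu]; exact fun h => hyu h.symm
      rw [sub_eq_add_neg, sub_eq_add_neg, IsUltrametricDist.norm_add_eq_max_of_norm_ne_norm e1,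
        IsUltrametricDist.norm_add_eq_max_of_norm_ne_norm e2, norm_neg, norm_neg, norm_uflip, norm_uflip]
    · have e1 : ‖uflip p x‖ ≠ ‖-uflip p y‖ := by rw [norm_neg, norm_uflip, norm_uflip, hyu]; exact hxu
      have e2 : ‖x‖ ≠ ‖-y‖ := by rw [norm_neg, hyu]; exact hxu
      rw [sub_eq_add_neg, sub_eq_add_neg, IsUltrametricDist.norm_add_eq_max_of_norm_ne_norm e1,
        IsUltrametricDist.norm_add_eq_max_of_norm_ne_norm e2, norm_neg, norm_neg, norm_uflip, norm_uflip]
    · simp only [uflip, hxu, hyu, if_false]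

lemma mean_inv (f : ℚ_[p] → ℂ) :
    mean p (fun x => oneU p x * f (x⁻¹)) = mean p (fun x => oneU p x * f x) := by
  rw [← mean_uflip (fun x => oneU p x * f x)]
  refine mean_congr fun x _ => ?_
  by_cases h : ‖x‖ = 1 <;> simp [uflip, h, oneU]

lemma mean_mul_uflip (u : ℚ_[p]) (hu : ‖u‖ = 1) (f : ℚ_[p] → ℂ) :
    mean p (fun x => f (u * uflip p x)) = mean p f :=
  (mean_uflip fun x => f (u * x)).trans (mean_mul_left u hu f)

lemma mean_affine (u c : ℚ_[p]) (hu : ‖u‖ = 1) (hc : ‖c‖ ≤ 1) (f : ℚ_[p] → ℂ) :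
    mean p (fun x => f (u * x + c)) = mean p f :=
  (mean_mul_left u hu fun x => f (x + c)).trans (mean_add_right c hc f)

lemma norm_p_lt_one : ‖(p : ℚ_[p])‖ < 1 := Padic.norm_p_lt_one

lemma norm_le_inv_p_of_lt_one {x : ℚ_[p]} (h : ‖x‖ < 1) : ‖x / p‖ ≤ 1 := by
  have hp : (0 : ℝ) < p := by exact_mod_cast (Fact.out : p.Prime).pos
  have h1 : ‖x‖ ≤ (p : ℝ) ^ (-1 : ℤ) := by
    rw [Padic.norm_le_pow_iff_norm_lt_pow_add_one]; simpa using h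
  rw [norm_div, Padic.norm_p, div_inv_eq_mul]
  calc ‖x‖ * p ≤ (p : ℝ) ^ (-1 : ℤ) * p := by gcongr
    _ = 1 := by simp [hp.ne']

lemma toZModPow_eq_iff (n : ℕ) (x y : ℤ_[p]) :
    PadicInt.toZModPow n x = PadicInt.toZModPow n y ↔ ‖x - y‖ ≤ (p : ℝ) ^ (-n : ℤ) := by
  rw [PadicInt.norm_le_pow_iff_mem_span_pow, ← PadicInt.ker_toZModPow, RingHom.mem_ker, map_sub,
    sub_eq_zero]

lemma measurableSet_residue (n : ℕ) (y : ℤ_[p]) :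
    MeasurableSet {x : ℤ_[p] | PadicInt.toZModPow n x = PadicInt.toZModPow n y} := by
  have : {x : ℤ_[p] | PadicInt.toZModPow n x = PadicInt.toZModPow n y} =
      Metric.closedBall y ((p : ℝ) ^ (-n : ℤ)) := by
    ext x
    rw [Set.mem_ofPred_eq, toZModPow_eq_iff, Metric.mem_closedBall, dist_eq_norm]
  rw [this]
  exact Metric.isClosed_closedBall.measurableSet

/-- The p^n residue classes are translates of one another and partition a space of mass 1. -/
lemma haar_residue (n : ℕ) (y : ℤ_[p]) :
    (haarZp p).real {x : ℤ_[p] | PadicInt.toZModPow n x = PadicInt.toZModPow n y} =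
      ((p : ℝ) ^ n)⁻¹ := by
  have hp := (Fact.out : p.Prime).pos
  have hsurj : ∀ a : ZMod (p ^ n), ∃ x : ℤ_[p], PadicInt.toZModPow n x = a :=
    ZMod.ringHom_surjective (PadicInt.toZModPow n)
  choose rep hrep using hsurj
  have htrans : ∀ z : ℤ_[p],
      (haarZp p).real {x : ℤ_[p] | PadicInt.toZModPow n x = PadicInt.toZModPow n z} =
      (haarZp p).real {x : ℤ_[p] | PadicInt.toZModPow n x = PadicInt.toZModPow n 0} := by
    intro z
    have : (fun x => z + x) ⁻¹' {x : ℤ_[p] | PadicInt.toZModPow n x = PadicInt.toZModPow n z} =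
        {x : ℤ_[p] | PadicInt.toZModPow n x = PadicInt.toZModPow n 0} := by
      ext x; simp [map_add]
    rw [← this, measureReal_def, measureReal_def, measure_preimage_add]
  have hun : (Set.univ : Set ℤ_[p]) =
      ⋃ a : ZMod (p ^ n), {x : ℤ_[p] | PadicInt.toZModPow n x = PadicInt.toZModPow n (rep a)} := by
    ext x; simp [hrep]
  have h1 : (haarZp p).real Set.univ = 1 := by simp
  rw [hun, measureReal_iUnion_fintype] at h1
  · rw [Finset.sum_congr rfl fun a _ => htrans (rep a), Finset.sum_const, Finset.card_univ,
      ZMod.card, nsmul_eq_mul] at h1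
    rw [htrans y]
    rw [Nat.cast_pow] at h1
    exact eq_inv_of_mul_eq_one_right h1
  · intro a b hab
    rw [Function.onFun, Set.disjoint_left]
    intro x hx hx'
    rw [Set.mem_ofPred_eq, hrep] at hx hx'
    exact hab (hx.symm.trans hx')
  · intro a; exact measurableSet_residue n _

/-- The mean of a function of the residue class mod `p^n` is a finite sum. -/
lemma sum_rep_eq_mean (r : Representatives p) (n : ℕ) (f : ℚ_[p] → ℂ)
    (hf : ∀ x c : ℚ_[p], ‖x‖ ≤ 1 → ‖c‖ ≤ 1 → f (x + p ^ n * c) = f x) :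
    ∑ a : ZMod (p ^ n), f (r.rep n a) = (p : ℂ) ^ n * mean p f := by
  have hp := (Fact.out : p.Prime).pos
  have hf' : ∀ x y : ℤ_[p], PadicInt.toZModPow n x = PadicInt.toZModPow n y → f x = f y := by
    intro x y h
    have : x - y ∈ Ideal.span {(p : ℤ_[p]) ^ n} := by
      rw [← PadicInt.ker_toZModPow, RingHom.mem_ker, map_sub, h, sub_self]
    obtain ⟨c, hc⟩ := Ideal.mem_span_singleton'.mp this
    have hx : (x : ℚ_[p]) = (y : ℚ_[p]) + p ^ n * (c : ℚ_[p]) := by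
      have := congrArg (fun t : ℤ_[p] => (t : ℚ_[p])) hc
      simp only [PadicInt.coe_mul, PadicInt.coe_pow, PadicInt.coe_natCast, PadicInt.coe_sub] at this
      linear_combination -this
    rw [hx]; exact hf _ _ y.2 c.2
  let A : ZMod (p ^ n) → Set ℤ_[p] := fun a =>
    {x | PadicInt.toZModPow n x = PadicInt.toZModPow n (r.rep n a)}
  have hfA : ∀ x : ℤ_[p], f x = ∑ a : ZMod (p ^ n), (A a).indicator (fun _ => f (r.rep n a)) x := by
    intro x
    rw [Finset.sum_eq_single (PadicInt.toZModPow n x)]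
    · have hx : x ∈ A (PadicInt.toZModPow n x) := by
        simp only [A, Set.mem_ofPred_eq, r.toZModPow_rep]
      rw [Set.indicator_of_mem hx]
      exact hf' _ _ hx
    · intro b _ hb
      apply Set.indicator_of_notMem
      simp only [A, Set.mem_ofPred_eq, r.toZModPow_rep]
      exact fun h => hb h.symm
    · intro h; exact absurd (Finset.mem_univ _) h
  have hm : mean p f = ∑ a : ZMod (p ^ n), ((p : ℂ) ^ n)⁻¹ * f (r.rep n a) := by
    unfold mean
    rw [integral_congr_ae (Filter.Eventually.of_forall hfA), integral_finsetSum]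
    · refine Finset.sum_congr rfl fun a _ => ?_
      rw [integral_indicator_const _ (measurableSet_residue n _), haar_residue]
      rw [Complex.real_smul]; push_cast; rfl
    · intro a _
      exact (integrable_const _).indicator (measurableSet_residue n _)
  rw [hm, ← Finset.mul_sum, mul_inv_cancel_left₀]
  exact pow_ne_zero _ (by exact_mod_cast hp.ne')

/-- Substitution of `p x` on the maximal ideal. -/
lemma mean_oneP (f : ℚ_[p] → ℂ) :
    mean p (fun x => oneP p x * f x) = (p : ℂ)⁻¹ * mean p (fun x => f (p * x)) := by
  have hp0 : (p : ℂ) ≠ 0 := by exact_mod_cast (Fact.out : p.Prime).ne_zero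
  have hpq := p_ne_zero p
  let m : ℤ_[p] → ℤ_[p] := fun x => p * x
  have hmc : Continuous m := by fun_prop
  have hinj : Function.Injective m := by
    intro x y h
    have : ((p : ℤ_[p]) : ℚ_[p]) * x = (p : ℤ_[p]) * y := by exact_mod_cast congrArg _ h
    exact Subtype.ext (mul_left_cancel₀ (by simpa using hpq) this)
  have hemb : MeasurableEmbedding m := (hmc.isClosedEmbedding hinj).measurableEmbedding
  have hrange : Set.range m = {x : ℤ_[p] | ‖(x : ℚ_[p])‖ < 1} := by
    ext x
    constructor
    · rintro ⟨y, rfl⟩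
      simp only [m, Set.mem_ofPred_eq, PadicInt.coe_mul, PadicInt.coe_natCast, norm_mul]
      exact mul_lt_one_of_nonneg_of_lt_one_left (norm_nonneg _) norm_p_lt_one y.2
    · intro hx
      refine ⟨⟨(x : ℚ_[p]) / p, norm_le_inv_p_of_lt_one hx⟩, ?_⟩
      apply Subtype.ext
      change ((p : ℤ_[p]) : ℚ_[p]) * ((x : ℚ_[p]) / p) = x
      rw [PadicInt.coe_natCast]; field_simp
  have hr1 : Set.range m = {x : ℤ_[p] | PadicInt.toZModPow 1 x = PadicInt.toZModPow 1 0} := by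
    rw [hrange]; ext x
    rw [Set.mem_ofPred_eq, Set.mem_ofPred_eq, toZModPow_eq_iff, sub_zero,
      PadicInt.norm_le_pow_iff_norm_lt_pow_add_one]
    simp
  have hadd : ∀ x y, m (x + y) = m x + m y := fun x y => mul_add _ _ _
  -- The pullback of Haar measure along x ↦ px is again invariant, hence a multiple of Haar measure;
  -- the factor is the mass of `pℤ_p`, that is 1/p.
  have : ((haarZp p).comap m).IsAddLeftInvariant := by
    refine ⟨fun g => ?_⟩
    ext s hs
    rw [Measure.map_apply (measurable_const_add g) hs, hemb.comap_apply, hemb.comap_apply]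
    have : m '' ((fun x => g + x) ⁻¹' s) = (fun x => m g + x) ⁻¹' (m '' s) := by
      ext x
      constructor
      · rintro ⟨y, hy, rfl⟩
        exact ⟨g + y, hy, hadd _ _⟩
      · rintro ⟨y, hy, hxy⟩
        refine ⟨y - g, by simpa using hy, ?_⟩
        have : m y = m g + m (y - g) := by rw [← hadd]; congr 1; ring
        exact add_left_cancel ((this.symm.trans hxy))
    rw [this, measure_preimage_add]
  have : IsFiniteMeasure ((haarZp p).comap m) := by
    refine ⟨?_⟩
    rw [hemb.comap_apply]; exact measure_lt_top _ _
  have hc := Measure.isAddInvariant_eq_smul_of_compactSpace ((haarZp p).comap m) (haarZp p)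
  set c := Measure.addHaarScalarFactor ((haarZp p).comap m) (haarZp p)
  have hcv : (c : ℝ) = (p : ℝ)⁻¹ := by
    have h2 : ((haarZp p).comap m).real Set.univ = (p : ℝ)⁻¹ := by
      rw [measureReal_def, hemb.comap_apply, Set.image_univ, hr1, ← measureReal_def, haar_residue]
      simp
    rw [hc] at h2
    simpa [measureReal_def] using h2
  have h3 : (haarZp p).restrict (Set.range m) = Measure.map m (c • haarZp p) := by
    rw [← hc, hemb.map_comap]
  have h4 : mean p (fun x => oneP p x * f x) =
      ∫ x in Set.range m, f (x : ℚ_[p]) ∂(haarZp p) := by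
    unfold mean
    rw [← integral_indicator hemb.measurableSet_range]
    congr 1; ext x
    change oneP p (x : ℚ_[p]) * f x = _
    by_cases hx : x ∈ Set.range m
    · rw [Set.indicator_of_mem hx]
      rw [hrange] at hx
      rw [oneP_of hx, one_mul]
    · rw [Set.indicator_of_notMem hx]
      rw [hrange] at hx
      rw [oneP_of_not hx, zero_mul]
  rw [h4, h3, hemb.integral_map, integral_smul_nnreal_measure]
  unfold mean
  have h5 : ∀ x : ℤ_[p], ((m x : ℤ_[p]) : ℚ_[p]) = p * x := fun x => by simp [m]
  simp_rw [h5]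
  rw [NNReal.smul_def, hcv, Complex.real_smul]
  push_cast; rfl

lemma mean_oneU_mul_left (u : ℚ_[p]) (hu : ‖u‖ = 1) (f : ℚ_[p] → ℂ) :
    mean p (fun x => oneU p x * f (u * x)) = mean p (fun x => oneU p x * f x) := by
  rw [← mean_mul_left u hu (fun x => oneU p x * f x)]
  refine mean_congr fun x _ => ?_
  simp [oneU, hu]

lemma oneU_add_oneP {x : ℚ_[p]} (hx : ‖x‖ ≤ 1) : oneU p x + oneP p x = 1 := by
  rcases hx.eq_or_lt with h | h
  · simp [oneU, oneP, h]
  · simp [oneU, oneP, h, h.ne]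

/-- Splitting `ℤ_p` into the units and the maximal ideal. -/
lemma mean_split {f : ℚ_[p] → ℂ} (hf : Continuous f) :
    mean p f = mean p (fun x => oneU p x * f x) + (p : ℂ)⁻¹ * mean p (fun x => f (p * x)) := by
  rw [← mean_oneP, ← mean_add (by fun_prop) (by fun_prop)]
  refine mean_congr fun x hx => ?_
  rw [← add_mul, oneU_add_oneP hx, one_mul]

lemma mean_comm {F : ℚ_[p] → ℚ_[p] → ℂ} (hF : Continuous fun q : ℚ_[p] × ℚ_[p] => F q.1 q.2) :
    mean p (fun x => mean p fun y => F x y) = mean p (fun y => mean p fun x => F x y) := by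
  unfold mean
  refine integral_integral_swap (f := fun x y : ℤ_[p] => F x y) ?_
  have hc : Continuous (fun q : ℤ_[p] × ℤ_[p] => F q.1 q.2) :=
    hF.comp ((continuous_subtype_val.comp continuous_fst).prodMk
      (continuous_subtype_val.comp continuous_snd))
  exact hc.integrable_of_hasCompactSupport (HasCompactSupport.of_compactSpace _)

@[fun_prop]
lemma continuous_mean {X : Type*} [TopologicalSpace X] [FirstCountableTopology X]
    [LocallyCompactSpace X] {F : X → ℚ_[p] → ℂ} (hF : Continuous fun q : X × ℚ_[p] => F q.1 q.2) :
    Continuous fun x => mean p (F x) := by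
  unfold mean
  have hc : Continuous (Function.uncurry fun (x : X) (y : ℤ_[p]) => F x y) :=
    hF.comp (continuous_fst.prodMk (continuous_subtype_val.comp continuous_snd))
  simpa using continuous_parametric_integral_of_continuous (μ := haarZp p) hc
    (isCompact_univ (X := ℤ_[p]))

/-! ### Finite sums over residue classes -/

/-- For n = 0 the residue ring is trivial and every class is a unit, hence the condition on n. -/
lemma norm_eq_one_iff_isUnit_toZModPow {n : ℕ} (hn : n ≠ 0) (x : ℤ_[p]) :
    ‖(x : ℚ_[p])‖ = 1 ↔ IsUnit (PadicInt.toZModPow n x) := by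
  have e : ‖(x : ℚ_[p])‖ = ‖x‖ := rfl
  rw [e, ← PadicInt.isUnit_iff]
  constructor
  · intro h; exact h.map _
  · intro h
    by_contra hx
    rw [PadicInt.not_isUnit_iff, PadicInt.norm_lt_one_iff_dvd] at hx
    obtain ⟨y, rfl⟩ := hx
    rw [map_mul, map_natCast] at h
    have h1 : IsUnit ((p : ℕ) : ZMod (p ^ n)) := isUnit_of_mul_isUnit_left h
    rw [ZMod.isUnit_iff_coprime] at h1
    have h2 := Nat.Coprime.coprime_dvd_right (dvd_pow_self p hn) h1
    exact (Fact.out : p.Prime).one_lt.ne' ((Nat.coprime_self p).mp h2)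

lemma sumAll_eq_mean (r : Representatives p) (n : ℕ) (f : ℚ_[p] → ℂ)
    (hf : ∀ x c : ℚ_[p], ‖x‖ ≤ 1 → ‖c‖ ≤ 1 → f (x + p ^ n * c) = f x) :
    sumAll r n f = (p : ℂ) ^ n * mean p f :=
  sum_rep_eq_mean r n f hf

lemma norm_add_p_pow {n : ℕ} (hn : n ≠ 0) {x c : ℚ_[p]} (hc : ‖c‖ ≤ 1) :
    ‖x + p ^ n * c‖ = 1 ↔ ‖x‖ = 1 := by
  have h : ‖(p : ℚ_[p]) ^ n * c‖ < 1 := by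
    rw [norm_mul, norm_pow]
    exact mul_lt_one_of_nonneg_of_lt_one_left (by positivity)
      (pow_lt_one₀ (norm_nonneg _) norm_p_lt_one hn) hc
  constructor
  · intro h1
    have h2 : ‖(x + p ^ n * c) - x‖ < ‖x + p ^ n * c‖ := by rw [h1]; simpa using h
    rw [norm_eq_of_norm_sub_lt h2, h1]
  · intro h1
    have h2 : ‖x - (x + p ^ n * c)‖ < ‖x‖ := by
      rw [h1, sub_add_cancel_left, norm_neg]; exact h
    rw [norm_eq_of_norm_sub_lt h2, h1]

lemma oneU_add_p_pow {n : ℕ} (hn : n ≠ 0) {x c : ℚ_[p]} (hc : ‖c‖ ≤ 1) :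
    oneU p (x + p ^ n * c) = oneU p x := by
  simp only [oneU, norm_add_p_pow hn hc]

lemma sumUnits_eq_mean (r : Representatives p) {n : ℕ} (hn : n ≠ 0) (f : ℚ_[p] → ℂ)
    (hf : ∀ x c : ℚ_[p], ‖x‖ = 1 → ‖c‖ ≤ 1 → f (x + p ^ n * c) = f x) :
    sumUnits r n f = (p : ℂ) ^ n * mean p (fun x => oneU p x * f x) := by
  rw [← sum_rep_eq_mean r n (fun x => oneU p x * f x)]
  · unfold sumUnits
    have h1 : ∀ a : ZMod (p ^ n), a ∉ Set.range (Units.val : (ZMod (p ^ n))ˣ → ZMod (p ^ n)) →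
        oneU p (r.rep n a) * f (r.rep n a) = 0 := by
      intro a ha
      rw [oneU_of_ne, zero_mul]
      rw [Ne, norm_eq_one_iff_isUnit_toZModPow hn, r.toZModPow_rep]
      rintro ⟨u, hu⟩
      exact ha ⟨u, hu⟩
    refine Finset.sum_of_injOn Units.val (fun _ _ _ _ h => Units.ext h)
      (fun _ _ => Finset.mem_coe.mpr (Finset.mem_univ _)) ?_ ?_
    · intro a _ ha
      refine h1 a fun ⟨u, hu⟩ => ha ⟨u, by simp, hu⟩
    · intro u _
      rw [oneU_of, one_mul]
      rw [norm_eq_one_iff_isUnit_toZModPow hn, r.toZModPow_rep]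
      exact u.isUnit
  · intro x c _ hc
    rw [oneU_add_p_pow hn hc]
    by_cases h : ‖x‖ = 1
    · rw [hf x c h hc]
    · rw [oneU_of_ne h, zero_mul, zero_mul]

lemma toZMod_ne_one_iff (x : ℤ_[p]) : PadicInt.toZMod x ≠ 1 ↔ ‖1 - (x : ℚ_[p])‖ = 1 := by
  have h1 : PadicInt.toZMod x = 1 ↔ ‖1 - x‖ < 1 := by
    rw [← PadicInt.mem_nonunits, ← IsLocalRing.mem_maximalIdeal, ← PadicInt.ker_toZMod,
      RingHom.mem_ker, map_sub, map_one, sub_eq_zero, eq_comm]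
  have e : ‖1 - (x : ℚ_[p])‖ = ‖1 - x‖ := rfl
  rw [Ne, h1, e, not_lt]
  exact ⟨fun h => le_antisymm (PadicInt.norm_le_one _) h, fun h => h.ge⟩

lemma sumUnitsNeOne_eq_mean (r : Representatives p) {n : ℕ} (hn : n ≠ 0) (f : ℚ_[p] → ℂ)
    (hf : ∀ x c : ℚ_[p], ‖x‖ = 1 → ‖1 - x‖ = 1 → ‖c‖ ≤ 1 → f (x + p ^ n * c) = f x) :
    sumUnitsNeOne r n f = (p : ℂ) ^ n * mean p (fun x => oneU p x * (oneU p (1 - x) * f x)) := by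
  have hmem : ∀ a : ZMod (p ^ n), oneU p (r.rep n a) = if IsUnit a then 1 else 0 := by
    intro a
    simp only [oneU, norm_eq_one_iff_isUnit_toZModPow hn, r.toZModPow_rep]
  rw [← sum_rep_eq_mean r n (fun x => oneU p x * (oneU p (1 - x) * f x))]
  · unfold sumUnitsNeOne
    rw [Finset.sum_filter, ← Finset.sum_subset (Finset.subset_univ _)]
    · refine Finset.sum_congr rfl fun a ha => ?_
      have ha' : IsUnit a := by
        -- The index set is the image of the unit group in `ZMod (p ^ n)`, expressed through the
        -- monad structure of `Finset`; membership in it means being a unit.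
        simp only [Finset.pure_def, Finset.bind_def, Finset.mem_sup, Finset.mem_singleton] at ha
        obtain ⟨u, -, rfl⟩ := ha
        exact u.isUnit
      rw [hmem, if_pos ha', one_mul]
      by_cases h : PadicInt.toZMod (r.rep n a) ≠ 1
      · rw [if_pos h, oneU_of ((toZMod_ne_one_iff _).mp h), one_mul]
      · rw [if_neg h, oneU_of_ne, zero_mul]
        rwa [toZMod_ne_one_iff] at h
    · intro a _ ha
      rw [hmem, if_neg, zero_mul]
      rintro ⟨u, rfl⟩
      apply ha
      simp only [Finset.pure_def, Finset.bind_def, Finset.mem_sup, Finset.mem_singleton]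
      exact ⟨u, Finset.mem_univ _, rfl⟩
  · intro x c _ hc
    have e : 1 - (x + p ^ n * c) = (1 - x) + p ^ n * (-c) := by ring
    have hc' : ‖-c‖ ≤ 1 := by rwa [norm_neg]
    rw [oneU_add_p_pow hn hc, e, oneU_add_p_pow hn hc']
    by_cases hx : ‖x‖ = 1
    · by_cases h : ‖1 - x‖ = 1
      · rw [hf x c hx h hc]
      · rw [oneU_of_ne h, zero_mul, zero_mul]
    · rw [oneU_of_ne hx, zero_mul, zero_mul]

section MapSum

variable {V : Type*} [AddCommGroup V] [Module ℂ V] (φ : V →ₗ[ℂ] ℂ) (r : Representatives p)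

lemma map_sumAll (n : ℕ) (f : ℚ_[p] → V) : φ (sumAll r n f) = sumAll r n fun x => φ (f x) :=
  map_sum _ _ _

lemma map_sumUnits (n : ℕ) (f : ℚ_[p] → V) : φ (sumUnits r n f) = sumUnits r n fun x => φ (f x) :=
  map_sum _ _ _

lemma map_sumUnitsNeOne (n : ℕ) (f : ℚ_[p] → V) :
    φ (sumUnitsNeOne r n f) = sumUnitsNeOne r n fun x => φ (f x) :=
  map_sum _ _ _

end MapSum

end Average

/-! ### Products of explicit 4×4 matrices -/

section ExplicitMatrices

lemma mul_fin_four {R : Type*} [Semiring R] (a00 a01 a02 a03 a10 a11 a12 a13 a20 a21 a22 a23 a30 a31 a32 a33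
    b00 b01 b02 b03 b10 b11 b12 b13 b20 b21 b22 b23 b30 b31 b32 b33 : R) :
    !![a00, a01, a02, a03; a10, a11, a12, a13; a20, a21, a22, a23; a30, a31, a32, a33] *
      !![b00, b01, b02, b03; b10, b11, b12, b13; b20, b21, b22, b23; b30, b31, b32, b33] =
      !![a00 * b00 + a01 * b10 + a02 * b20 + a03 * b30, a00 * b01 + a01 * b11 + a02 * b21 + a03 * b31,
          a00 * b02 + a01 * b12 + a02 * b22 + a03 * b32, a00 * b03 + a01 * b13 + a02 * b23 + a03 * b33;
        a10 * b00 + a11 * b10 + a12 * b20 + a13 * b30, a10 * b01 + a11 * b11 + a12 * b21 + a13 * b31,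
          a10 * b02 + a11 * b12 + a12 * b22 + a13 * b32, a10 * b03 + a11 * b13 + a12 * b23 + a13 * b33;
        a20 * b00 + a21 * b10 + a22 * b20 + a23 * b30, a20 * b01 + a21 * b11 + a22 * b21 + a23 * b31,
          a20 * b02 + a21 * b12 + a22 * b22 + a23 * b32, a20 * b03 + a21 * b13 + a22 * b23 + a23 * b33;
        a30 * b00 + a31 * b10 + a32 * b20 + a33 * b30, a30 * b01 + a31 * b11 + a32 * b21 + a33 * b31,
          a30 * b02 + a31 * b12 + a32 * b22 + a33 * b32, a30 * b03 + a31 * b13 + a32 * b23 + a33 * b33] := by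
  ext i j; fin_cases i <;> fin_cases j <;> simp [Matrix.mul_apply, Fin.sum_univ_four]

lemma fin_four_congr {R : Type*} {a00 a01 a02 a03 a10 a11 a12 a13 a20 a21 a22 a23 a30 a31 a32 a33
    b00 b01 b02 b03 b10 b11 b12 b13 b20 b21 b22 b23 b30 b31 b32 b33 : R}
    (h00 : a00 = b00) (h01 : a01 = b01) (h02 : a02 = b02) (h03 : a03 = b03)
    (h10 : a10 = b10) (h11 : a11 = b11) (h12 : a12 = b12) (h13 : a13 = b13)
    (h20 : a20 = b20) (h21 : a21 = b21) (h22 : a22 = b22) (h23 : a23 = b23)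
    (h30 : a30 = b30) (h31 : a31 = b31) (h32 : a32 = b32) (h33 : a33 = b33) :
    !![a00, a01, a02, a03; a10, a11, a12, a13; a20, a21, a22, a23; a30, a31, a32, a33] =
      !![b00, b01, b02, b03; b10, b11, b12, b13; b20, b21, b22, b23; b30, b31, b32, b33] := by
  subst h00 h01 h02 h03 h10 h11 h12 h13 h20 h21 h22 h23 h30 h31 h32 h33
  rfl

/-- Equality with a product of two explicit matrices, entry by entry. -/
lemma eq_mul_map_fin_four {R S : Type*} [NonUnitalNonAssocSemiring R] {f : S → R}
    {c00 c01 c02 c03 c10 c11 c12 c13 c20 c21 c22 c23 c30 c31 c32 c33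
    a00 a01 a02 a03 a10 a11 a12 a13 a20 a21 a22 a23 a30 a31 a32 a33 : R}
    {b00 b01 b02 b03 b10 b11 b12 b13 b20 b21 b22 b23 b30 b31 b32 b33 : S}
    (h00 : c00 = a00 * f b00 + a01 * f b10 + a02 * f b20 + a03 * f b30)
    (h01 : c01 = a00 * f b01 + a01 * f b11 + a02 * f b21 + a03 * f b31)
    (h02 : c02 = a00 * f b02 + a01 * f b12 + a02 * f b22 + a03 * f b32)
    (h03 : c03 = a00 * f b03 + a01 * f b13 + a02 * f b23 + a03 * f b33)
    (h10 : c10 = a10 * f b00 + a11 * f b10 + a12 * f b20 + a13 * f b30)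
    (h11 : c11 = a10 * f b01 + a11 * f b11 + a12 * f b21 + a13 * f b31)
    (h12 : c12 = a10 * f b02 + a11 * f b12 + a12 * f b22 + a13 * f b32)
    (h13 : c13 = a10 * f b03 + a11 * f b13 + a12 * f b23 + a13 * f b33)
    (h20 : c20 = a20 * f b00 + a21 * f b10 + a22 * f b20 + a23 * f b30)
    (h21 : c21 = a20 * f b01 + a21 * f b11 + a22 * f b21 + a23 * f b31)
    (h22 : c22 = a20 * f b02 + a21 * f b12 + a22 * f b22 + a23 * f b32)
    (h23 : c23 = a20 * f b03 + a21 * f b13 + a22 * f b23 + a23 * f b33)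
    (h30 : c30 = a30 * f b00 + a31 * f b10 + a32 * f b20 + a33 * f b30)
    (h31 : c31 = a30 * f b01 + a31 * f b11 + a32 * f b21 + a33 * f b31)
    (h32 : c32 = a30 * f b02 + a31 * f b12 + a32 * f b22 + a33 * f b32)
    (h33 : c33 = a30 * f b03 + a31 * f b13 + a32 * f b23 + a33 * f b33) :
    !![c00, c01, c02, c03; c10, c11, c12, c13; c20, c21, c22, c23; c30, c31, c32, c33] =
      !![a00, a01, a02, a03; a10, a11, a12, a13; a20, a21, a22, a23; a30, a31, a32, a33] *
      (!![b00, b01, b02, b03; b10, b11, b12, b13; b20, b21, b22, b23; b30, b31, b32, b33] :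
        Matrix (Fin 4) (Fin 4) S).map f := by
  subst h00 h01 h02 h03 h10 h11 h12 h13 h20 h21 h22 h23 h30 h31 h32 h33
  ext i j; fin_cases i <;> fin_cases j <;> simp [Matrix.mul_apply, Fin.sum_univ_four]

end ExplicitMatrices

/-! ### Elements of `GSp(4, ℚ_p)`, their multipliers and their continuous dependence on parameters
-/

section GroupElements

variable {p : ℕ} [Fact p.Prime]

lemma mat_mul (g h : GSp4 p) : mat (g * h) = mat g * mat h := rfl

lemma mat_one : mat (1 : GSp4 p) = 1 := rfl

lemma mat_injective : Function.Injective (mat : GSp4 p → _) := fun _ _ h =>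
  Subtype.ext (Units.ext h)

lemma multiplier_mul (g h : GSp4 p) : multiplier (g * h) = multiplier g * multiplier h := by
  have e : (mat (g * h))ᵀ * J p * mat (g * h) = (multiplier g * multiplier h) • J p := by
    calc (mat (g * h))ᵀ * J p * mat (g * h) = (mat h)ᵀ * ((mat g)ᵀ * J p * mat g) * mat h := by
          simp only [mat_mul, Matrix.transpose_mul, Matrix.mul_assoc]
      _ = _ := by
          rw [multiplier_spec, Matrix.mul_smul, Matrix.smul_mul, multiplier_spec, smul_smul]
  rw [multiplier, e]
  simp [J]

lemma multiplier_one : multiplier (1 : GSp4 p) = 1 := by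
  simp [multiplier, mat_one, J]

lemma multiplier_inv (g : GSp4 p) : multiplier g⁻¹ = (multiplier g)⁻¹ := by
  have : multiplier g * multiplier g⁻¹ = 1 := by
    rw [← multiplier_mul, mul_inv_cancel, multiplier_one]
  exact eq_inv_of_mul_eq_one_right this

lemma multiplier_ne_zero (g : GSp4 p) : multiplier g ≠ 0 := by
  have : multiplier g * multiplier g⁻¹ = 1 := by
    rw [← multiplier_mul, mul_inv_cancel, multiplier_one]
  exact left_ne_zero_of_mul_eq_one this

lemma multiplier_ofIsometry (M : Matrix (Fin 4) (Fin 4) ℚ_[p]) (hM : Mᵀ * J p * M = J p) :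
    multiplier (ofIsometry (J p) (J_mul_J p) M hM) = 1 := by
  change (Mᵀ * J p * M) 0 2 = 1
  rw [hM]; simp [J]

/-- The lower unipotent matrix `x ↦ 1 + x E₄₂`. -/
def low (p : ℕ) [Fact p.Prime] (x : ℚ_[p]) : GSp4 p :=
  ofIsometry (J p) (J_mul_J p)
    !![1, 0, 0, 0;
       0, 1, 0, 0;
       0, 0, 1, 0;
       0, x, 0, 1]
    (by ext i j; fin_cases i <;> fin_cases j <;> simp [J, Matrix.mul_apply, Fin.sum_univ_four])

variable (p) in
/-- The Weyl element in the second and fourth coordinates. -/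
def weyl : GSp4 p :=
  ofIsometry (J p) (J_mul_J p)
    !![1, 0, 0, 0;
       0, 0, 0, 1;
       0, 0, 1, 0;
       0, -1, 0, 0]
    (by ext i j; fin_cases i <;> fin_cases j <;> simp [J, Matrix.mul_apply, Fin.sum_univ_four])

/-- The Heisenberg matrix with parameters `a, b, z`. -/
def heis (p : ℕ) [Fact p.Prime] (a b z : ℚ_[p]) : GSp4 p :=
  ofIsometry (J p) (J_mul_J p)
    !![1, -a, z, b;
       0, 1, b, 0;
       0, 0, 1, 0;
       0, 0, a, 1]
    (by ext i j; fin_cases i <;> fin_cases j <;> simp [J, Matrix.mul_apply, Fin.sum_univ_four]; ring)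

variable (p) in
/-- The element `t₄`. -/
def t4 : GSp4 p :=
  ofIsometry (J p) (J_mul_J p)
    !![0, 0, -((p : ℚ_[p]) ^ 4)⁻¹, 0;
       0, 1, 0, 0;
       (p : ℚ_[p]) ^ 4, 0, 0, 0;
       0, 0, 0, 1]
    (by
      have := p_ne_zero p
      ext i j; fin_cases i <;> fin_cases j <;>
        simp [J, Matrix.mul_apply, Fin.sum_univ_four, this])

variable (p) in
/-- The diagonal matrix `diag(p^{-k}, p^{-l}, p^k, p^l)`. -/
def diagp (k l : ℤ) : GSp4 p :=
  ofIsometry (J p) (J_mul_J p)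
    !![(p : ℚ_[p]) ^ (-k), 0, 0, 0;
       0, (p : ℚ_[p]) ^ (-l), 0, 0;
       0, 0, (p : ℚ_[p]) ^ k, 0;
       0, 0, 0, (p : ℚ_[p]) ^ l]
    (by
      have h (k : ℤ) : (p : ℚ_[p]) ^ (-k) * (p : ℚ_[p]) ^ k = 1 := by
        rw [← zpow_add₀ (p_ne_zero p)]; simp
      have h' (k : ℤ) : (p : ℚ_[p]) ^ k * (p : ℚ_[p]) ^ (-k) = 1 := by
        rw [← zpow_add₀ (p_ne_zero p)]; simp
      ext i j; fin_cases i <;> fin_cases j <;>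
        first
        | (simp [J, Matrix.mul_apply, Fin.sum_univ_four]; done)
        | exact (by simpa [J, Matrix.mul_apply, Fin.sum_univ_four] using h k)
        | exact (by simpa [J, Matrix.mul_apply, Fin.sum_univ_four] using h l)
        | exact (by simpa [J, Matrix.mul_apply, Fin.sum_univ_four] using h' k)
        | exact (by simpa [J, Matrix.mul_apply, Fin.sum_univ_four] using h' l))

lemma mat_levi (t : ℚ_[p]) :
    mat (levi p t) = !![1, t, 0, 0; 0, 1, 0, 0; 0, 0, 1, 0; 0, 0, -t, 1] := rfl

lemma mat_unip (x y z : ℚ_[p]) :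
    mat (unip p x y z) = !![1, 0, x, y; 0, 1, y, z; 0, 0, 1, 0; 0, 0, 0, 1] := rfl

lemma mat_low (x : ℚ_[p]) :
    mat (low p x) = !![1, 0, 0, 0; 0, 1, 0, 0; 0, 0, 1, 0; 0, x, 0, 1] := rfl

lemma mat_weyl :
    mat (weyl p) = !![1, 0, 0, 0; 0, 0, 0, 1; 0, 0, 1, 0; 0, -1, 0, 0] := rfl

lemma mat_heis (a b z : ℚ_[p]) :
    mat (heis p a b z) = !![1, -a, z, b; 0, 1, b, 0; 0, 0, 1, 0; 0, 0, a, 1] := rfl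

lemma mat_t4 :
    mat (t4 p) = !![0, 0, -((p : ℚ_[p]) ^ 4)⁻¹, 0; 0, 1, 0, 0; (p : ℚ_[p]) ^ 4, 0, 0, 0; 0, 0, 0, 1] :=
  rfl

lemma mat_diagp (k l : ℤ) :
    mat (diagp p k l) = !![(p : ℚ_[p]) ^ (-k), 0, 0, 0; 0, (p : ℚ_[p]) ^ (-l), 0, 0;
      0, 0, (p : ℚ_[p]) ^ k, 0; 0, 0, 0, (p : ℚ_[p]) ^ l] := rfl

@[simp] lemma multiplier_levi (t : ℚ_[p]) : multiplier (levi p t) = 1 := multiplier_ofIsometry _ _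
@[simp] lemma multiplier_unip (x y z : ℚ_[p]) : multiplier (unip p x y z) = 1 :=
  multiplier_ofIsometry _ _
@[simp] lemma multiplier_low (x : ℚ_[p]) : multiplier (low p x) = 1 := multiplier_ofIsometry _ _
@[simp] lemma multiplier_weyl : multiplier (weyl p) = 1 := multiplier_ofIsometry _ _
@[simp] lemma multiplier_heis (a b z : ℚ_[p]) : multiplier (heis p a b z) = 1 :=
  multiplier_ofIsometry _ _
@[simp] lemma multiplier_t4 : multiplier (t4 p) = 1 := multiplier_ofIsometry _ _
@[simp] lemma multiplier_diagp (k l : ℤ) : multiplier (diagp p k l) = 1 :=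
  multiplier_ofIsometry _ _

lemma diagp_mul (k l k' l' : ℤ) : diagp p k l * diagp p k' l' = diagp p (k + k') (l + l') := by
  have := p_ne_zero p
  apply mat_injective
  rw [mat_mul, mat_diagp, mat_diagp, mat_diagp, mul_fin_four]
  apply fin_four_congr <;> simp [zpow_add₀ this, mul_comm]

lemma diagp_zero : diagp p 0 0 = 1 := by
  apply mat_injective
  rw [mat_diagp, mat_one]
  ext i j; fin_cases i <;> fin_cases j <;> simp

lemma diagp_inv (k l : ℤ) : (diagp p k l)⁻¹ = diagp p (-k) (-l) := by
  rw [inv_eq_iff_mul_eq_one, diagp_mul]; simp [diagp_zero]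

lemma etaJ_eq : etaJ p = diagp p 1 0 := by
  apply mat_injective
  change !![_, _, _, _; _, _, _, _; _, _, _, _; _, _, _, _] = _
  rw [mat_diagp]; simp

lemma tauJ_eq : tauJ p = diagp p 0 1 := by
  apply mat_injective
  change !![_, _, _, _; _, _, _, _; _, _, _, _; _, _, _, _] = _
  rw [mat_diagp]; simp

section Continuity

variable {X : Type*} [TopologicalSpace X]

/-- The topology induced from GL(4) also asks for continuity of the inverse; for an isometry the
inverse is `-(S * Mᵀ * S)`, linear in the entries of M. -/
lemma continuous_ofIsometry {S : Matrix (Fin 4) (Fin 4) ℚ_[p]} (hS : S * S = -1)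
    {M : X → Matrix (Fin 4) (Fin 4) ℚ_[p]} (hM : ∀ x, (M x)ᵀ * S * M x = S) (hc : Continuous M) :
    Continuous fun x => ofIsometry S hS (M x) (hM x) := by
  refine continuous_induced_rng.mpr (Units.continuous_iff.mpr ⟨hc, ?_⟩)
  change Continuous fun x => -(S * (M x)ᵀ * S)
  fun_prop

@[fun_prop]
lemma continuous_levi {f : X → ℚ_[p]} (hf : Continuous f) : Continuous fun x => levi p (f x) := by
  refine continuous_ofIsometry _ _ (continuous_matrix fun i j => ?_)
  fin_cases i <;> fin_cases j <;> simp <;> fun_prop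

@[fun_prop]
lemma continuous_unip {f g h : X → ℚ_[p]} (hf : Continuous f) (hg : Continuous g)
    (hh : Continuous h) : Continuous fun x => unip p (f x) (g x) (h x) := by
  refine continuous_ofIsometry _ _ (continuous_matrix fun i j => ?_)
  fin_cases i <;> fin_cases j <;> simp <;> fun_prop

@[fun_prop]
lemma continuous_low {f : X → ℚ_[p]} (hf : Continuous f) : Continuous fun x => low p (f x) := by
  refine continuous_ofIsometry _ _ (continuous_matrix fun i j => ?_)
  fin_cases i <;> fin_cases j <;> simp <;> fun_prop

@[fun_prop]
lemma continuous_heis {f g h : X → ℚ_[p]} (hf : Continuous f) (hg : Continuous g)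
    (hh : Continuous h) : Continuous fun x => heis p (f x) (g x) (h x) := by
  refine continuous_ofIsometry _ _ (continuous_matrix fun i j => ?_)
  fin_cases i <;> fin_cases j <;> simp <;> fun_prop

end Continuity

end GroupElements

/-! ### Spherical functions and the two families of arguments -/

section Cosets

variable {p : ℕ} [Fact p.Prime]

/-- Continuous functions on `GSp(4, ℚ_p)` that are right invariant under `GSp(4, ℤ_p)`. -/
structure IsSpherical (Φ : GSp4 p → ℂ) : Prop where
  continuous : Continuous Φ
  right_inv : ∀ g, ∀ k ∈ GSp4Zp p, Φ (g * k) = Φ g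

/-- Left translates stay in the class, so a prefix such as t₄ or s can be hidden in the function and
one lemma serves several integrals. -/
lemma IsSpherical.comp_mul_left {Φ : GSp4 p → ℂ} (hΦ : IsSpherical Φ) (h : GSp4 p) :
    IsSpherical fun g => Φ (h * g) :=
  ⟨hΦ.continuous.comp (continuous_const_mul h), fun g k hk => by
    rw [← mul_assoc, hΦ.right_inv _ k hk]⟩

lemma IsSpherical.continuous_comp {X : Type*} [TopologicalSpace X] {Φ : GSp4 p → ℂ}
    (hΦ : IsSpherical Φ) {f : X → GSp4 p} (hf : Continuous f) : Continuous fun x => Φ (f x) :=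
  hΦ.continuous.comp hf

/-- Two elements whose matrices differ by an integral matrix on the right lie in the same coset. -/
lemma IsSpherical.eq_of_mat {Φ : GSp4 p → ℂ} (hΦ : IsSpherical Φ) {g h : GSp4 p}
    (κ : Matrix (Fin 4) (Fin 4) ℤ_[p]) (hm : ‖multiplier g‖ = ‖multiplier h‖)
    (hκ : mat g = mat h * κ.map (fun x => (x : ℚ_[p]))) : Φ g = Φ h := by
  have hk : mat (h⁻¹ * g) = κ.map (fun x => (x : ℚ_[p])) := by
    have h1 : mat h⁻¹ * mat h = 1 := by rw [← mat_mul, inv_mul_cancel, mat_one]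
    rw [mat_mul, hκ, ← Matrix.mul_assoc, h1, Matrix.one_mul]
  have : Φ (h * (h⁻¹ * g)) = Φ h := by
    refine hΦ.right_inv _ _ ⟨?_, fun i j => ?_⟩
    · rw [multiplier_mul, multiplier_inv, norm_mul, norm_inv, hm, inv_mul_cancel₀]
      exact norm_ne_zero_iff.mpr (multiplier_ne_zero h)
    · rw [hk]; exact (κ i j).2
  rw [← this, mul_inv_cancel_left]

lemma exists_int {x : ℚ_[p]} (hx : ‖x‖ ≤ 1) : ∃ y : ℤ_[p], (y : ℚ_[p]) = x := ⟨⟨x, hx⟩, rfl⟩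

lemma exists_unit {x : ℚ_[p]} (hx : ‖x‖ = 1) :
    ∃ y yi : ℤ_[p], (y : ℚ_[p]) = x ∧ (yi : ℚ_[p]) = x⁻¹ :=
  ⟨⟨x, hx.le⟩, ⟨x⁻¹, by simp [hx]⟩, rfl, rfl⟩

/-- The matrices that occur in the explicit formula. -/
def upper (p : ℕ) [Fact p.Prime] (k l : ℤ) (t x y z : ℚ_[p]) : GSp4 p :=
  diagp p k l * (levi p t * unip p x y z)

lemma mat_upper (k l : ℤ) (t x y z : ℚ_[p]) :
    mat (upper p k l t x y z) =
      !![(p : ℚ_[p]) ^ (-k), p ^ (-k) * t, p ^ (-k) * (x + t * y), p ^ (-k) * (y + t * z);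
         0, p ^ (-l), p ^ (-l) * y, p ^ (-l) * z;
         0, 0, p ^ k, 0;
         0, 0, -(p ^ l * t), p ^ l] := by
  rw [upper, mat_mul, mat_mul, mat_diagp, mat_levi, mat_unip, mul_fin_four, mul_fin_four]
  apply fin_four_congr <;> simp [mul_add]

lemma mat_t4_upper (k l : ℤ) (t x y z : ℚ_[p]) :
    mat (t4 p * upper p k l t x y z) =
      !![0, 0, -((p : ℚ_[p]) ^ k / p ^ 4), 0;
         0, p ^ (-l), p ^ (-l) * y, p ^ (-l) * z;
         p ^ 4 * p ^ (-k), p ^ 4 * (p ^ (-k) * t), p ^ 4 * (p ^ (-k) * (x + t * y)),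
           p ^ 4 * (p ^ (-k) * (y + t * z));
         0, 0, -(p ^ l * t), p ^ l] := by
  rw [mat_mul, mat_upper, mat_t4, mul_fin_four]
  apply fin_four_congr <;> simp
  field_simp

@[simp] lemma multiplier_upper (k l : ℤ) (t x y z : ℚ_[p]) : multiplier (upper p k l t x y z) = 1 := by
  simp [upper, multiplier_mul]

attribute [irreducible] upper

@[fun_prop]
lemma continuous_upper {X : Type*} [TopologicalSpace X] {k l : ℤ} {f g h i : X → ℚ_[p]}
    (hf : Continuous f) (hg : Continuous g) (hh : Continuous h) (hi : Continuous i) :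
    Continuous fun x => upper p k l (f x) (g x) (h x) (i x) := by
  unfold upper
  refine continuous_const.mul ?_
  fun_prop

variable (p) in
/-- The matrices that occur in the twisting map. -/
def lowHeis (x a b z : ℚ_[p]) : GSp4 p := low p x * heis p a b z * diagp p 0 1

lemma mat_lowHeis (x a b z : ℚ_[p]) :
    mat (lowHeis p x a b z) =
      !![1, -(a / p), z, b * p;
         0, (p : ℚ_[p])⁻¹, b, 0;
         0, 0, 1, 0;
         0, x / p, a + x * b, p] := by
  rw [lowHeis, mat_mul, mat_mul, mat_diagp, mat_low, mat_heis, mul_fin_four, mul_fin_four]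
  apply fin_four_congr <;> simp [div_eq_mul_inv, add_comm]

@[simp] lemma multiplier_lowHeis (x a b z : ℚ_[p]) : multiplier (lowHeis p x a b z) = 1 := by
  simp [lowHeis, multiplier_mul]

attribute [irreducible] lowHeis

@[fun_prop]
lemma continuous_lowHeis {X : Type*} [TopologicalSpace X] {f g h i : X → ℚ_[p]}
    (hf : Continuous f) (hg : Continuous g) (hh : Continuous h) (hi : Continuous i) :
    Continuous fun x => lowHeis p (f x) (g x) (h x) (i x) := by
  unfold lowHeis
  refine Continuous.mul ?_ continuous_const
  fun_prop

attribute [irreducible] diagp weyl t4 low heis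

end Cosets

/-! ### The quadratic character on units -/

section Character

variable {p : ℕ} [Fact p.Prime]

/-- The restriction of `χ` to the units, extended by zero. -/
def chi (χ : MulChar ℚ_[p] ℂ) (x : ℚ_[p]) : ℂ := if ‖x‖ = 1 then χ x else 0

variable {χ : MulChar ℚ_[p] ℂ}

lemma chi_of {x : ℚ_[p]} (hx : ‖x‖ = 1) : chi χ x = χ x := if_pos hx

lemma chi_of_ne {x : ℚ_[p]} (hx : ‖x‖ ≠ 1) : chi χ x = 0 := if_neg hx

/-- On `ℤ_p` a product is a unit only if both factors are. Without integrality the cut-off destroys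
multiplicativity, as x = p, y = p⁻¹ shows. -/
lemma chi_mul {x y : ℚ_[p]} (hx : ‖x‖ ≤ 1) (hy : ‖y‖ ≤ 1) :
    chi χ (x * y) = chi χ x * chi χ y := by
  by_cases h : ‖x * y‖ = 1
  · have h1 : ‖x‖ = 1 := by
      rw [norm_mul] at h
      refine le_antisymm hx (h ▸ mul_le_of_le_one_right (norm_nonneg _) hy)
    have h2 : ‖y‖ = 1 := by simpa [h1] using h
    rw [chi_of h, chi_of h1, chi_of h2, map_mul]
  · rw [chi_of_ne h]
    by_cases h1 : ‖x‖ = 1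
    · rw [chi_of_ne (x := y), mul_zero]
      intro h2; exact h (by rw [norm_mul, h1, h2, one_mul])
    · rw [chi_of_ne h1, zero_mul]

lemma chi_unit_mul {x : ℚ_[p]} (hx : ‖x‖ = 1) (y : ℚ_[p]) :
    chi χ (x * y) = chi χ x * chi χ y := by
  rw [chi_of hx]
  by_cases h : ‖y‖ = 1
  · rw [chi_of h, chi_of (by rw [norm_mul, hx, h, one_mul]), map_mul]
  · rw [chi_of_ne h, chi_of_ne (by rwa [norm_mul, hx, one_mul]), mul_zero]

lemma chi_sq (hq : χ.IsQuadratic) (x : ℚ_[p]) : chi χ x * chi χ x = oneU p x := by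
  by_cases h : ‖x‖ = 1
  · rw [chi_of h, oneU_of h]
    rcases hq x with h0 | h1 | h1
    · exact absurd h0 ((ne_zero_of_norm_one h).isUnit.map χ).ne_zero
    · rw [h1, one_mul]
    · rw [h1]; norm_num
  · rw [chi_of_ne h, oneU_of_ne h, zero_mul]

lemma chi_congr (hc : HasConductorP χ) {x y : ℚ_[p]} (h : ‖x - y‖ < 1) :
    chi χ x = chi χ y := by
  by_cases hx1 : ‖x‖ = 1
  · have hy1 : ‖y‖ = 1 := by rw [← hx1]; exact norm_eq_of_norm_sub_lt (by rwa [hx1])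
    have hy0 := ne_zero_of_norm_one hy1
    rw [chi_of hx1, chi_of hy1]
    have e : x = y * (x / y) := by field_simp
    rw [e, map_mul, hc.1 (x / y), mul_one]
    have e2 : x / y - 1 = (x - y) / y := by field_simp
    rwa [e2, norm_div, hy1, div_one]
  · have hy1 : ‖y‖ ≠ 1 := by
      intro hy1
      apply hx1
      rw [← hy1]
      exact norm_eq_of_norm_sub_lt (by rwa [norm_sub_rev, hy1])
    rw [chi_of_ne hx1, chi_of_ne hy1]

lemma continuous_chi (hc : HasConductorP χ) : Continuous (chi χ) := by
  refine IsLocallyConstant.continuous (IsLocallyConstant.iff_exists_open _ |>.mpr fun x => ?_)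
  refine ⟨Metric.ball x 1, Metric.isOpen_ball, Metric.mem_ball_self one_pos, fun y hy => ?_⟩
  exact chi_congr hc (by rwa [Metric.mem_ball, dist_eq_norm] at hy)

end Character

/-! ### Upper triangular form of the integrands, and the three averages -/

section UpperTriangular

variable {p : ℕ} [Fact p.Prime] {Φ : GSp4 p → ℂ}

/-- The last row of the matrix has x/p in column 2 and p in column 4. The one of smaller valuation
becomes the last diagonal entry after integral column operations, so valuation 0, 1 or at least 2 of
the argument of L yields p⁻¹, 1 or p there, that is the prefix τ'⁻¹, 1 or τ'. This identity and the
next two are the three cases. With s in front the rows are exchanged beforehand, and the prefix is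
τ'⁻¹ whatever x is. -/
lemma IsSpherical.lowHeis_unit (hΦ : IsSpherical Φ) {x a b c : ℚ_[p]} (hx : ‖x‖ = 1) :
    Φ (lowHeis p x (a / p) (b / p ^ 2) c) =
      Φ (upper p 0 (-1) (-(x * b + p * a) / p)
        (c - a * (x * b + p * a) / x / p ^ 3 + (x * b + p * a) ^ 2 / x / p ^ 4)
        (b / p ^ 3) (x⁻¹ / p ^ 2)) := by
  have hp := p_ne_zero p
  have hx0 := ne_zero_of_norm_one hx
  obtain ⟨x', xi, hx1, hx2⟩ := exists_unit hx
  refine hΦ.eq_of_mat !![1, 0, 0, 0; 0, 0, 0, -xi; 0, 0, 1, 0; 0, x', 0, p ^ 2] (by simp) ?_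
  rw [mat_upper, mat_lowHeis]
  apply eq_mul_map_fin_four <;>
    simp [hx1, hx2] <;> field_simp <;> ring

lemma IsSpherical.lowHeis_p_mul_unit (hΦ : IsSpherical Φ) {x a b c : ℚ_[p]} (hx : ‖x‖ = 1) :
    Φ (lowHeis p (p * x) (a / p) (b / p ^ 2) c) =
      Φ (upper p 0 0 (-(a + x * b) / p) (c + (a + x * b) * b / p ^ 3) (b / p ^ 2) (x⁻¹ / p)) := by
  have hp := p_ne_zero p
  have hx0 := ne_zero_of_norm_one hx
  obtain ⟨x', xi, hx1, hx2⟩ := exists_unit hx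
  refine hΦ.eq_of_mat !![1, 0, 0, 0; 0, 0, 0, -xi; 0, 0, 1, 0; 0, x', 0, p] (by simp) ?_
  rw [mat_upper, mat_lowHeis]
  apply eq_mul_map_fin_four <;>
    simp [hx1, hx2] <;> field_simp <;> ring

lemma IsSpherical.lowHeis_p_sq_mul (hΦ : IsSpherical Φ) {x a b c : ℚ_[p]} (hx : ‖x‖ ≤ 1) :
    Φ (lowHeis p (p ^ 2 * x) (a / p) (b / p ^ 2) c) =
      Φ (upper p 0 1 (-(a + p * x * b) / p ^ 2) (c + (a + p * x * b) * b / p ^ 3) (b / p) 0) := by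
  have hp := p_ne_zero p
  obtain ⟨x', hx1⟩ := exists_int hx
  refine hΦ.eq_of_mat !![1, 0, 0, 0; 0, 1, 0, 0; 0, 0, 1, 0; 0, x', 0, 1] (by simp) ?_
  rw [mat_upper, mat_lowHeis]
  apply eq_mul_map_fin_four <;>
    simp [hx1] <;> field_simp <;> ring

lemma IsSpherical.weyl_lowHeis (hΦ : IsSpherical Φ) {x a b c : ℚ_[p]} :
    Φ (weyl p * lowHeis p x (a / p) (b / p ^ 2) c) =
      Φ (upper p 0 (-1) (b / p) (c - a * b / p ^ 3 - x * b ^ 2 / p ^ 4) ((x * b + a * p) / p ^ 3)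
        (-x / p ^ 2)) := by
  have hp := p_ne_zero p
  refine hΦ.eq_of_mat !![1, 0, 0, 0; 0, 0, 0, 1; 0, 0, 1, 0; 0, -1, 0, 0]
    (by simp [multiplier_mul]) ?_
  rw [mat_upper, mat_mul, mat_lowHeis, mat_weyl, mul_fin_four]
  apply eq_mul_map_fin_four <;>
    simp <;> field_simp <;> ring

variable (χ : MulChar ℚ_[p] ℂ) (m : ℕ) (Φ)

/-- The inner average in the part of the twist with prefix `τ'⁻¹`. -/
def avgTauInvAt (x : ℚ_[p]) : ℂ :=
  mean p fun a => mean p fun b => mean p fun z => chi χ a * chi χ b *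
    Φ (upper p 0 (-1) (b / p) (z / p ^ m - x * b ^ 2 / p ^ 4) ((x * b + a * p) / p ^ 3) (-x / p ^ 2))

/-- The average for the part of the twist with trivial prefix. -/
def avgOne : ℂ :=
  mean p fun x => mean p fun a => mean p fun b => mean p fun z => oneU p x * (chi χ a * chi χ b *
    Φ (upper p 0 0 (-(a + x * b) / p) (z / p ^ m) (b / p ^ 2) (uinv p x / p)))

/-- The average for the part of the twist with prefix `τ'`. -/
def avgTau : ℂ :=
  mean p fun a => mean p fun b => mean p fun z => chi χ a * chi χ b *
    Φ (upper p 0 1 (-a / p ^ 2) (z / p ^ m) (b / p) 0)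

variable {m Φ}

/-- The shift is a translation of z by p^(m-3)c, which is integral; both values m = 3 and m = 4 of
the twisting map qualify. -/
lemma mean_shift (hm : 3 ≤ m) {c : ℚ_[p]} (hc : ‖c‖ ≤ 1) (f : ℚ_[p] → ℂ) :
    mean p (fun z => f (z / p ^ m + c / p ^ 3)) = mean p (fun z => f (z / p ^ m)) := by
  have hp := p_ne_zero p
  have h : ‖(p : ℚ_[p]) ^ (m - 3) * c‖ ≤ 1 := by
    rw [norm_mul, norm_pow]
    exact mul_le_one₀ (pow_le_one₀ (norm_nonneg _) norm_p_lt_one.le) (norm_nonneg _) hc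
  rw [← mean_add_right _ h (fun z => f (z / p ^ m))]
  refine mean_congr fun z _ => ?_
  congr 1
  obtain ⟨k, rfl⟩ := Nat.exists_eq_add_of_le hm
  rw [Nat.add_sub_cancel_left, pow_add]
  field_simp

lemma norm_add_le_one {x y : ℚ_[p]} (hx : ‖x‖ ≤ 1) (hy : ‖y‖ ≤ 1) : ‖x + y‖ ≤ 1 :=
  (IsUltrametricDist.norm_add_le_max _ _).trans (max_le hx hy)

lemma norm_sub_le_one {x y : ℚ_[p]} (hx : ‖x‖ ≤ 1) (hy : ‖y‖ ≤ 1) : ‖x - y‖ ≤ 1 := by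
  rw [sub_eq_add_neg]; exact norm_add_le_one hx (by rwa [norm_neg])

lemma norm_mul_le_one {x y : ℚ_[p]} (hx : ‖x‖ ≤ 1) (hy : ‖y‖ ≤ 1) : ‖x * y‖ ≤ 1 := by
  rw [norm_mul]; exact mul_le_one₀ hx (norm_nonneg _) hy

lemma norm_p_mul_lt {x : ℚ_[p]} (hx : ‖x‖ ≤ 1) : ‖p * x‖ < 1 := by
  rw [norm_mul]; exact mul_lt_one_of_nonneg_of_lt_one_left (norm_nonneg _) norm_p_lt_one hx

lemma chi_add_p_mul (hc : HasConductorP χ) {x y : ℚ_[p]} (hy : ‖y‖ ≤ 1) :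
    chi χ (x + p * y) = chi χ x :=
  chi_congr hc (by simpa using norm_p_mul_lt hy)

/-- Replacing a by -x⁻¹a and b by -(xb + pa) turns the entries of `lowHeis_unit` into those of the
τ'⁻¹ average at -x⁻¹, up to a central shift. The character is unchanged because χ(-x⁻¹)χ(-x) = 1 and
pa does not matter modulo p. -/
lemma avg_lowHeis_unit (hΦ : IsSpherical Φ) (hc : HasConductorP χ)
    (hm : 3 ≤ m) {x : ℚ_[p]} (hx : ‖x‖ = 1) :
    (mean p fun a => mean p fun b => mean p fun z => chi χ a * chi χ b *
      Φ (lowHeis p x (a / p) (b / p ^ 2) (z / p ^ m))) = avgTauInvAt Φ χ m (-x⁻¹) := by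
  have hp := p_ne_zero p
  have hx0 := ne_zero_of_norm_one hx
  have hxi : ‖-x⁻¹‖ = 1 := by rw [norm_neg, norm_inv, hx, inv_one]
  unfold avgTauInvAt
  refine Eq.trans (mean_congr fun a ha => ?_) (mean_mul_left _ hxi _)
  have hs : ‖p * (a / x)‖ ≤ 1 := (norm_p_mul_lt (by rwa [norm_div, hx, div_one])).le
  have hnx : ‖-x‖ = 1 := by rwa [norm_neg]
  refine Eq.trans (Eq.trans (mean_congr fun b hb => ?_) (mean_add_right _ hs _))
    (mean_mul_left _ hnx _)
  have hc1 : ‖-(a * (x * b + p * a) / x)‖ ≤ 1 := by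
    rw [norm_neg, norm_div, hx, div_one]
    exact norm_mul_le_one ha (norm_add_le_one (norm_mul_le_one hx.le hb)
      (norm_p_mul_lt ha).le)
  have hchi : chi χ (-x⁻¹ * a) * chi χ (-x * (b + p * (a / x))) = chi χ a * chi χ b := by
    have h1 : ‖a / x‖ ≤ 1 := by rwa [norm_div, hx, div_one]
    rw [chi_unit_mul hxi, chi_unit_mul hnx, chi_add_p_mul χ hc h1]
    have h2 : chi χ (-x⁻¹) * chi χ (-x) = 1 := by
      rw [← chi_unit_mul hxi]
      have : -x⁻¹ * -x = 1 := by field_simp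
      rw [this, chi_of (by simp), map_one]
    linear_combination chi χ a * chi χ b * h2
  simp only [hchi, mean_const_mul]
  congr 1
  refine Eq.trans (mean_congr fun z _ => ?_) ((mean_shift hm hc1 fun w => Φ (upper p 0 (-1)
    (-(x * b + p * a) / p) (w + (x * b + p * a) ^ 2 / x / p ^ 4) (b / p ^ 3) (x⁻¹ / p ^ 2))).trans
    (mean_congr fun z _ => ?_))
  · rw [hΦ.lowHeis_unit hx]
    congr 2; field_simp; ring
  · congr 2 <;> field_simp <;> ring

lemma avgTauInv_weyl (hΦ : IsSpherical Φ) (hm : 3 ≤ m) {x : ℚ_[p]} :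
    (mean p fun a => mean p fun b => mean p fun z => chi χ a * chi χ b *
      Φ (weyl p * lowHeis p x (a / p) (b / p ^ 2) (z / p ^ m))) = avgTauInvAt Φ χ m x := by
  refine mean_congr fun a ha => mean_congr fun b hb => ?_
  have hc1 : ‖-(a * b)‖ ≤ 1 := by
    rw [norm_neg]; exact norm_mul_le_one ha hb
  rw [mean_const_mul, mean_const_mul]
  congr 1
  refine Eq.trans (mean_congr fun z _ => ?_) (mean_shift hm hc1 fun w => Φ (upper p 0 (-1)
    (b / p) (w - x * b ^ 2 / p ^ 4) ((x * b + a * p) / p ^ 3) (-x / p ^ 2)))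
  rw [hΦ.weyl_lowHeis]
  congr 2; ring

/-- The averages over the two parts of `GL(2, ℤ_p)`, with upper triangular arguments. -/
lemma avg_lowHeis_add_avg_weyl (hΦ : IsSpherical Φ) (hc : HasConductorP χ)
    (hm : 3 ≤ m) :
    (mean p fun x => mean p fun a => mean p fun b => mean p fun z => chi χ a * chi χ b *
      Φ (lowHeis p x (a / p) (b / p ^ 2) (z / p ^ m))) +
    (mean p fun x => oneP p x * mean p fun a => mean p fun b => mean p fun z => chi χ a * chi χ b *
      Φ (weyl p * lowHeis p x (a / p) (b / p ^ 2) (z / p ^ m))) =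
    mean p (avgTauInvAt Φ χ m) + (p : ℂ)⁻¹ * avgOne Φ χ m + (p : ℂ)⁻¹ ^ 2 * avgTau Φ χ m := by
  have hΦc := hΦ.continuous
  have hχc := continuous_chi hc
  have hcont : Continuous (avgTauInvAt Φ χ m) := by unfold avgTauInvAt; fun_prop
  have h1 : (mean p fun x => oneP p x * mean p fun a => mean p fun b => mean p fun z =>
      chi χ a * chi χ b * Φ (weyl p * lowHeis p x (a / p) (b / p ^ 2) (z / p ^ m))) =
      mean p fun x => oneP p x * avgTauInvAt Φ χ m x :=
    mean_congr fun x _ => by rw [avgTauInv_weyl χ hΦ hm]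
  -- Under x ↦ -x⁻¹ the unit part of the L(x) integral becomes the unit part of the τ'⁻¹ average;
  -- the integral with s supplies the part on the maximal ideal.
  have h2 : (mean p fun x => oneU p x * mean p fun a => mean p fun b => mean p fun z =>
      chi χ a * chi χ b * Φ (lowHeis p x (a / p) (b / p ^ 2) (z / p ^ m))) =
      mean p fun x => oneU p x * avgTauInvAt Φ χ m x := by
    rw [← mean_inv (fun x => avgTauInvAt Φ χ m x),
      ← mean_oneU_mul_left (-1) (by simp) (fun x => avgTauInvAt Φ χ m x⁻¹)]
    refine mean_congr fun x _ => ?_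
    by_cases hx : ‖x‖ = 1
    · rw [avg_lowHeis_unit χ hΦ hc hm hx]
      congr 2; rw [mul_inv, inv_neg, inv_one]; ring
    · rw [oneU_of_ne hx, zero_mul, zero_mul]
  have h3 : (mean p fun x => oneU p x * mean p fun a => mean p fun b => mean p fun z =>
      chi χ a * chi χ b * Φ (lowHeis p (p * x) (a / p) (b / p ^ 2) (z / p ^ m))) =
      avgOne Φ χ m := by
    refine mean_congr fun x _ => ?_
    by_cases hx : ‖x‖ = 1
    · rw [← mean_const_mul]
      refine mean_congr fun a ha => ?_
      rw [← mean_const_mul]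
      refine mean_congr fun b hb => ?_
      have hc1 : ‖(a + x * b) * b‖ ≤ 1 :=
        norm_mul_le_one (norm_add_le_one ha (norm_mul_le_one hx.le hb)) hb
      simp only [mean_const_mul]
      congr 2
      refine Eq.trans (mean_congr fun z _ => ?_) (mean_shift hm hc1 fun w => Φ (upper p 0 0
        (-(a + x * b) / p) w (b / p ^ 2) (uinv p x / p)))
      rw [hΦ.lowHeis_p_mul_unit hx, uinv_of hx]
    · simp [oneU_of_ne hx, mean_const]
  -- On p²ℤ_p the variable x enters only through a + pxb, which a translation of a removes, so the
  -- integral over x becomes trivial.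
  have h4 : ∀ x : ℚ_[p], ‖x‖ ≤ 1 → (mean p fun a => mean p fun b => mean p fun z =>
      chi χ a * chi χ b * Φ (lowHeis p (p * (p * x)) (a / p) (b / p ^ 2) (z / p ^ m))) =
      avgTau Φ χ m := by
    intro x hx
    unfold avgTau
    rw [mean_comm (by fun_prop), mean_comm (F := fun a b => mean p fun z => chi χ a * chi χ b *
      Φ (upper p 0 1 (-a / p ^ 2) (z / p ^ m) (b / p) 0)) (by fun_prop)]
    refine mean_congr fun b hb => ?_
    have hs : ‖p * (x * b)‖ ≤ 1 := (norm_p_mul_lt (norm_mul_le_one hx hb)).le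
    refine Eq.trans (mean_congr fun a ha => ?_) (mean_add_right _ hs _)
    have hc1 : ‖(a + p * x * b) * b‖ ≤ 1 := by
      rw [mul_assoc (p : ℚ_[p])]
      exact norm_mul_le_one (norm_add_le_one ha hs) hb
    rw [chi_add_p_mul χ hc (norm_mul_le_one hx hb), mean_const_mul, mean_const_mul]
    congr 1
    refine Eq.trans (mean_congr fun z _ => ?_) (mean_shift hm hc1 fun w => Φ (upper p 0 1
      (-(a + p * (x * b)) / p ^ 2) w (b / p) 0))
    rw [← mul_assoc (p : ℚ_[p]), ← pow_two, hΦ.lowHeis_p_sq_mul hx, mul_assoc (p : ℚ_[p])]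
  -- Splitting twice gives `ℤ_p` as units, p times units and p²ℤ_p, the source of the weights 1, 1/p
  -- and 1/p².
  rw [mean_split (f := fun x => mean p fun a => mean p fun b => mean p fun z => chi χ a * chi χ b *
      Φ (lowHeis p x (a / p) (b / p ^ 2) (z / p ^ m))) (by fun_prop),
    mean_split (f := fun x => mean p fun a => mean p fun b => mean p fun z => chi χ a * chi χ b *
      Φ (lowHeis p ((p : ℚ_[p]) * x) (a / p) (b / p ^ 2) (z / p ^ m))) (by fun_prop),
    h1, h2, h3, mean_congr h4, mean_const, mean_split hcont, mean_oneP]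
  ring

end UpperTriangular

/-! ### Coset identities: triangular form after multiplication by t₄ -/

section CosetIdentities

variable {p : ℕ} [Fact p.Prime] {Φ : GSp4 p → ℂ}

/-- Moving the integral factor A(δ) to the right through the unipotent factor conjugates the
symmetric block S to A S ᵗA; at the far right it is absorbed. -/
lemma IsSpherical.upper_levi (hΦ : IsSpherical Φ) (k l : ℤ) {t δ x y z : ℚ_[p]} (hδ : ‖δ‖ ≤ 1) :
    Φ (upper p k l (t + δ) x y z) =
      Φ (upper p k l t (x + 2 * δ * y + δ ^ 2 * z) (y + δ * z) z) := by
  obtain ⟨d, hd⟩ := exists_int hδ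
  refine hΦ.eq_of_mat !![1, d, 0, 0; 0, 1, 0, 0; 0, 0, 1, 0; 0, 0, -d, 1] (by simp) ?_
  rw [mat_upper, mat_upper]
  apply eq_mul_map_fin_four <;>
    simp [hd] <;> first | ring1 | (left; ring1)

lemma IsSpherical.upper_congr (hΦ : IsSpherical Φ) (k l : ℤ) {t x y z x' y' z' : ℚ_[p]}
    (hx : ‖x - x'‖ ≤ 1) (hy : ‖y - y'‖ ≤ 1) (hz : ‖z - z'‖ ≤ 1) :
    Φ (upper p k l t x y z) = Φ (upper p k l t x' y' z') := by
  obtain ⟨d, hd⟩ := exists_int hx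
  obtain ⟨e, he⟩ := exists_int hy
  obtain ⟨f, hf⟩ := exists_int hz
  refine hΦ.eq_of_mat !![1, 0, d, e; 0, 1, e, f; 0, 0, 1, 0; 0, 0, 0, 1] (by simp) ?_
  rw [mat_upper, mat_upper]
  apply eq_mul_map_fin_four <;>
    simp [hd, he, hf] <;> ring

/-- The third row of the left matrix is (p⁴, bp³, pu, ap²), and the minor of the last two rows in
columns 3, 4 is u + ab. Here the row has content p and the minors have content 1, which forces k =
1, l = -1. If u is a unit but u + ab is not, the minors have content p and l = 0; if u is divisible
by p and ab is a unit, the row has content p² and (k, l) = (2, -2). The witness is the quotient of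
the two matrices, and its third row is the row above divided by p^k. -/
lemma IsSpherical.t4_upper_tauInv_unit_unit (hΦ : IsSpherical Φ) {a b x u w : ℚ_[p]} (ha : ‖a‖ = 1)
    (hb : ‖b‖ = 1) (hu : ‖u‖ = 1) (hw : ‖w‖ = 1) (hwd : w = u + a * b) :
    Φ (t4 p * upper p 0 (-1) (b / p)
      (u / p ^ 3 - b * (x * b + a * p) / p ^ 4) ((x * b + a * p) / p ^ 3) (-x / p ^ 2)) =
    Φ (upper p 1 (-1) (b / u / p)
      (-((p + b * (x * b + a * p) / u) / u / p ^ 4)) ((x * b + a * p) / u / p ^ 3)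
        (-((x + a ^ 2 * p / w) / p ^ 2))) := by
  have hp := p_ne_zero p
  have hu0 := ne_zero_of_norm_one hu
  have hw0 := ne_zero_of_norm_one hw
  obtain ⟨a', ha'⟩ := exists_int ha.le
  obtain ⟨b', hb'⟩ := exists_int hb.le
  obtain ⟨u', ui, hu1, hu2⟩ := exists_unit hu
  obtain ⟨-, wi, -, hw2⟩ := exists_unit hw
  refine hΦ.eq_of_mat !![ui, 0, 0, 0; -a' * p * wi, u' * wi, 0, 0;
    p ^ 3, b' * p ^ 2, u', a' * p; b' * p ^ 2 * ui, b' ^ 2 * p * ui, 0, 1 + a' * b' * ui]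
    (by simp [multiplier_mul]) ?_
  rw [mat_upper, mat_t4_upper]
  apply eq_mul_map_fin_four <;>
    simp [ha', hb', hu1, hu2, hw2] <;> field_simp <;>
    (try simp only [hwd]) <;> ring

lemma IsSpherical.t4_upper_tauInv_unit (hΦ : IsSpherical Φ) {a b x u m : ℚ_[p]} (ha : ‖a‖ ≤ 1)
    (hb : ‖b‖ ≤ 1) (hx : ‖x‖ ≤ 1) (hu : ‖u‖ = 1) (hm : ‖m‖ ≤ 1) (hum : u = p * m - a * b) :
    Φ (t4 p * upper p 0 (-1) (b / p)
      (u / p ^ 3 - b * (x * b + a * p) / p ^ 4) ((x * b + a * p) / p ^ 3) (-x / p ^ 2)) =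
    Φ (upper p 1 0 (b / u / p ^ 2)
      ((-u⁻¹ * p - (x * b + a * p) / u * (b / u)) / p ^ 4) ((x * b + a * p) / u / p ^ 2) 0) := by
  have hp := p_ne_zero p
  have hu0 := ne_zero_of_norm_one hu
  obtain ⟨a', ha'⟩ := exists_int ha
  obtain ⟨b', hb'⟩ := exists_int hb
  obtain ⟨x', hx'⟩ := exists_int hx
  obtain ⟨m', hm'⟩ := exists_int hm
  obtain ⟨u', ui, hu1, hu2⟩ := exists_unit hu
  refine hΦ.eq_of_mat !![ui, 0, 0, 0;
    -(x' * b' + a' * p) * p * ui, p - (x' * b' + a' * p) * b' * ui, 0, -(x' * m' + a' ^ 2) * ui;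
    p ^ 3, b' * p ^ 2, u', a' * p; b' * p * ui, b' ^ 2 * ui, 0, m' * ui]
    (by simp [multiplier_mul]) ?_
  rw [mat_upper, mat_t4_upper]
  apply eq_mul_map_fin_four <;>
    simp [ha', hb', hx', hm', hu1, hu2] <;> field_simp <;>
    (try simp only [hum]) <;> ring

lemma IsSpherical.t4_upper_tauInv_p (hΦ : IsSpherical Φ) {a b x u d : ℚ_[p]} (ha : ‖a‖ ≤ 1)
    (hb : ‖b‖ ≤ 1) (hu : ‖u‖ ≤ 1) (hd : ‖d‖ = 1) (hdd : d = a * b + p * u) :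
    Φ (t4 p * upper p 0 (-1) (b / p)
      (p * u / p ^ 3 - b * (x * b + a * p) / p ^ 4) ((x * b + a * p) / p ^ 3) (-x / p ^ 2)) =
    Φ (upper p 2 (-2) 0 (-d⁻¹ / p) (a / d / p ^ 2) (-(x + a ^ 2 / d * p) / p ^ 4)) := by
  have hp := p_ne_zero p
  have hd0 := ne_zero_of_norm_one hd
  obtain ⟨a', ha'⟩ := exists_int ha
  obtain ⟨b', hb'⟩ := exists_int hb
  obtain ⟨u', hu'⟩ := exists_int hu
  obtain ⟨-, di, -, hd2⟩ := exists_unit hd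
  refine hΦ.eq_of_mat !![p * di, b' * di, 0, 0; -a' * di, u' * di, 0, 0;
    p ^ 2, b' * p, u', a'; 0, 0, -b', p]
    (by simp [multiplier_mul]) ?_
  rw [mat_upper, mat_t4_upper]
  apply eq_mul_map_fin_four <;>
    simp [ha', hb', hu', hd2] <;> field_simp <;>
    (try simp only [hdd]) <;> ring

/-- For trivial first prefix the third row is (p⁴, -sp³, pu, -ap²/x) and the decisive minor is pd/x.
A unit u gives k = 1, and then d decides between l = 0 and l = 1; when a is a unit and p divides u,
k = 2, and l is determined by s and the further valuation of d. -/
lemma IsSpherical.t4_upper_one_unit_unit (hΦ : IsSpherical Φ) {a b x u s d : ℚ_[p]}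
    (ha : ‖a‖ ≤ 1) (hb : ‖b‖ ≤ 1) (hx : ‖x‖ = 1) (hu : ‖u‖ = 1) (hd : ‖d‖ = 1)
    (hs : s = a + x * b) (hdd : d = x * u + a * s) :
    Φ (t4 p * upper p 0 0 (-s / p) ((u + s * b) / p ^ 3) (b / p ^ 2) (x⁻¹ / p)) =
    Φ (upper p 1 0 (-s / u / p) ((s * b / u - 1) / u / p ^ 3) (b / u / p ^ 2)
      ((u + a * b) / d / p)) := by
  have hp := p_ne_zero p
  have hu0 := ne_zero_of_norm_one hu
  have hd0 := ne_zero_of_norm_one hd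
  have hx0 := ne_zero_of_norm_one hx
  obtain ⟨a', ha'⟩ := exists_int ha
  obtain ⟨b', hb'⟩ := exists_int hb
  obtain ⟨s', hs'⟩ := exists_int
    (hs ▸ norm_add_le_one ha (norm_mul_le_one hx.le hb) : ‖s‖ ≤ 1)
  obtain ⟨u', ui, hu1, hu2⟩ := exists_unit hu
  obtain ⟨-, xi, -, hx2⟩ := exists_unit hx
  obtain ⟨d', di, hd1, hd2⟩ := exists_unit hd
  refine hΦ.eq_of_mat !![ui, 0, 0, 0;
    -b' * p * ui + (u' + a' * b') * s' * p * di * ui,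
      1 + s' * b' * ui - (u' + a' * b') * s' ^ 2 * di * ui, 0, 0;
    p ^ 3, -s' * p ^ 2, u', -a' * p * xi; -s' * p ^ 2 * ui, s' ^ 2 * p * ui, 0, d' * xi * ui]
    (by simp [multiplier_mul]) ?_
  rw [mat_upper, mat_t4_upper]
  apply eq_mul_map_fin_four <;>
    simp [ha', hb', hs', hx2, hu1, hu2, hd1, hd2] <;>
    field_simp <;> (try simp only [hdd, hs]) <;> ring

lemma IsSpherical.t4_upper_tau_unit (hΦ : IsSpherical Φ) {a b u : ℚ_[p]}
    (ha : ‖a‖ = 1) (hb : ‖b‖ ≤ 1) (hu : ‖u‖ = 1) :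
    Φ (t4 p * upper p 0 1 (-a / p ^ 2) ((u + a * b) / p ^ 3) (b / p) 0) =
    Φ (upper p 1 0 (-a / u / p) ((a * b / u - 1) / u / p ^ 3) (b / u / p ^ 2)
      ((u + a * b) / a ^ 2 / p)) := by
  have hp := p_ne_zero p
  have hu0 := ne_zero_of_norm_one hu
  have ha0 := ne_zero_of_norm_one ha
  obtain ⟨b', hb'⟩ := exists_int hb
  obtain ⟨u', ui, hu1, hu2⟩ := exists_unit hu
  obtain ⟨a', ai, ha1, ha2⟩ := exists_unit ha
  refine hΦ.eq_of_mat !![ui, 0, 0, 0; p * ai, 0, 0, -u' * ai ^ 2;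
    p ^ 3, -a' * p, u', b' * p ^ 2; -a' * p ^ 2 * ui, a' ^ 2 * ui, 0, p * (1 - a' * b' * ui)]
    (by simp [multiplier_mul]) ?_
  rw [mat_upper, mat_t4_upper]
  apply eq_mul_map_fin_four <;>
    simp [hb', ha1, ha2, hu1, hu2] <;>
    field_simp <;> ring

lemma IsSpherical.t4_upper_one_unit_p (hΦ : IsSpherical Φ) {a b x u s d : ℚ_[p]}
    (ha : ‖a‖ ≤ 1) (hb : ‖b‖ ≤ 1) (hx : ‖x‖ = 1) (hu : ‖u‖ = 1) (hd : ‖d‖ ≤ 1)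
    (hs : s = a + x * b) (hdd : p * d = x * u + a * s) :
    Φ (t4 p * upper p 0 0 (-s / p) ((u + s * b) / p ^ 3) (b / p ^ 2) (x⁻¹ / p)) =
    Φ (upper p 1 1 (-s / u / p ^ 2) ((s * b / u - 1) / u / p ^ 3) (b / u / p) 0) := by
  have hp := p_ne_zero p
  have hu0 := ne_zero_of_norm_one hu
  have hx0 := ne_zero_of_norm_one hx
  have hdd : d = (x * u + a * s) / p := by field_simp; linear_combination hdd
  obtain ⟨a', ha'⟩ := exists_int ha
  obtain ⟨b', hb'⟩ := exists_int hb
  obtain ⟨s', hs'⟩ := exists_int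
    (hs ▸ norm_add_le_one ha (norm_mul_le_one hx.le hb) : ‖s‖ ≤ 1)
  obtain ⟨u', ui, hu1, hu2⟩ := exists_unit hu
  obtain ⟨-, xi, -, hx2⟩ := exists_unit hx
  obtain ⟨d', hd1⟩ := exists_int hd
  refine hΦ.eq_of_mat !![ui, 0, 0, 0;
    -b' * p ^ 2 * ui, p + s' * b' * p * ui, 0, (u' + a' * b') * xi * ui;
    p ^ 3, -s' * p ^ 2, u', -a' * p * xi; -s' * p * ui, s' ^ 2 * ui, 0, d' * xi * ui]
    (by simp [multiplier_mul]) ?_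
  rw [mat_upper, mat_t4_upper]
  apply eq_mul_map_fin_four <;>
    simp [ha', hb', hs', hx2, hu1, hu2, hd1] <;>
    (try simp only [hdd]) <;> field_simp <;> (try simp only [hs]) <;> ring

lemma IsSpherical.t4_upper_one_p_unit (hΦ : IsSpherical Φ) {a b x u s d : ℚ_[p]}
    (ha : ‖a‖ ≤ 1) (hb : ‖b‖ ≤ 1) (hx : ‖x‖ = 1) (hu : ‖u‖ ≤ 1) (hd : ‖d‖ = 1)
    (hs : s = a + x * b) (hdd : d = x * (p * u) + a * s) :
    Φ (t4 p * upper p 0 0 (-s / p) ((p * u + s * b) / p ^ 3) (b / p ^ 2) (x⁻¹ / p)) =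
    Φ (upper p 2 (-1) 0 (-x / d / p) (-a / d / p ^ 2) ((p * u + a * b) / d / p ^ 3)) := by
  have hp := p_ne_zero p
  have hd0 := ne_zero_of_norm_one hd
  have hx0 := ne_zero_of_norm_one hx
  obtain ⟨a', ha'⟩ := exists_int ha
  obtain ⟨s', hs'⟩ := exists_int
    (hs ▸ norm_add_le_one ha (norm_mul_le_one hx.le hb) : ‖s‖ ≤ 1)
  obtain ⟨u', hu'⟩ := exists_int hu
  obtain ⟨x', xi, hx1, hx2⟩ := exists_unit hx
  obtain ⟨-, di, -, hd2⟩ := exists_unit hd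
  refine hΦ.eq_of_mat !![x' * p * di, -x' * s' * di, 0, 0; a' * di, x' * u' * di, 0, 0;
    p ^ 2, -s' * p, u', -a' * xi; 0, 0, s', p]
    (by simp [multiplier_mul]) ?_
  rw [mat_upper, mat_t4_upper]
  apply eq_mul_map_fin_four <;>
    simp [ha', hs', hu', hx1, hx2, hd2] <;>
    field_simp <;> (try simp only [hdd, hs]) <;> ring

lemma IsSpherical.t4_upper_tau_p (hΦ : IsSpherical Φ) {a b u : ℚ_[p]}
    (ha : ‖a‖ = 1) (hb : ‖b‖ ≤ 1) (hu : ‖u‖ ≤ 1) :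
    Φ (t4 p * upper p 0 1 (-a / p ^ 2) ((p * u + a * b) / p ^ 3) (b / p) 0) =
    Φ (upper p 2 (-1) 0 0 (-a⁻¹ / p ^ 2) ((p * u + a * b) / a ^ 2 / p ^ 3)) := by
  have hp := p_ne_zero p
  have ha0 := ne_zero_of_norm_one ha
  obtain ⟨b', hb'⟩ := exists_int hb
  obtain ⟨u', hu'⟩ := exists_int hu
  obtain ⟨a', ai, ha1, ha2⟩ := exists_unit ha
  refine hΦ.eq_of_mat !![0, 0, 0, ai; ai, 0, 0, -u' * ai ^ 2;
    p ^ 2, -a', u', b' * p; 0, 0, a', p ^ 2]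
    (by simp [multiplier_mul]) ?_
  rw [mat_upper, mat_t4_upper]
  apply eq_mul_map_fin_four <;>
    simp [hb', hu', ha1, ha2] <;>
    field_simp <;> ring

/-- The left side of the following three identities, where `a + x b = p s` and `x u + a s = x d`. -/
lemma IsSpherical.t4_upper_one_p_p_unit (hΦ : IsSpherical Φ) {a b x u s d : ℚ_[p]}
    (ha : ‖a‖ = 1) (hx : ‖x‖ = 1) (hs : ‖s‖ ≤ 1) (hd : ‖d‖ = 1)
    (hb : b = (p * s - a) / x) (hu : u = d - a * s / x) :
    Φ (t4 p * upper p 0 0 (-(p * s) / p) ((p * u + p * s * b) / p ^ 3) (b / p ^ 2) (x⁻¹ / p)) =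
    Φ (upper p 2 0 0 (-d⁻¹ / p ^ 2) (-(a / x / d) / p ^ 2)
      ((p * d * x - a ^ 2) / x ^ 2 / d / p ^ 2)) := by
  have hp := p_ne_zero p
  have hd0 := ne_zero_of_norm_one hd
  have hx0 := ne_zero_of_norm_one hx
  obtain ⟨a', ha'⟩ := exists_int ha.le
  obtain ⟨s', hs'⟩ := exists_int hs
  obtain ⟨-, xi, -, hx2⟩ := exists_unit hx
  obtain ⟨d', di, hd1, hd2⟩ := exists_unit hd
  refine hΦ.eq_of_mat !![di, -s' * di, 0, 0; a' * xi * di, 1 - a' * s' * xi * di, 0, 0;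
    p ^ 2, -s' * p ^ 2, d' - a' * s' * xi, -a' * xi; 0, 0, s', 1]
    (by simp [multiplier_mul]) ?_
  rw [mat_upper, mat_t4_upper, hb, hu]
  apply eq_mul_map_fin_four <;>
    simp [ha', hs', hx2, hd1, hd2] <;> field_simp <;> ring

lemma IsSpherical.t4_upper_one_p_p_p (hΦ : IsSpherical Φ) {a b x u s d : ℚ_[p]}
    (ha : ‖a‖ = 1) (hx : ‖x‖ = 1) (hs : ‖s‖ ≤ 1) (hd : ‖d‖ = 1)
    (hb : b = (p * s - a) / x) (hu : u = p * d - a * s / x) :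
    Φ (t4 p * upper p 0 0 (-(p * s) / p) ((p * u + p * s * b) / p ^ 3) (b / p ^ 2) (x⁻¹ / p)) =
    Φ (upper p 2 1 (x / a / p) (x / a ^ 2 / p) 0 (-(a ^ 2 / x ^ 2 / d) / p)) := by
  have hp := p_ne_zero p
  have ha0 := ne_zero_of_norm_one ha
  have hd0 := ne_zero_of_norm_one hd
  have hx0 := ne_zero_of_norm_one hx
  obtain ⟨a', ai, ha1, ha2⟩ := exists_unit ha
  obtain ⟨s', hs'⟩ := exists_int hs
  obtain ⟨x', xi, hx1, hx2⟩ := exists_unit hx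
  obtain ⟨d', di, hd1, hd2⟩ := exists_unit hd
  refine hΦ.eq_of_mat !![-x' * p * ai ^ 2, -x' * ai + x' * s' * p * ai ^ 2, -x' * d' * ai ^ 2, 0;
    a' * xi * di, p - a' * s' * xi * di, s' * xi, xi;
    p ^ 2, -s' * p ^ 2, p * d' - a' * s' * xi, -a' * xi;
    x' * p * ai, -x' * p * s' * ai, x' * d' * ai, 0]
    (by simp [multiplier_mul]) ?_
  rw [mat_upper, mat_t4_upper, hb, hu]
  apply eq_mul_map_fin_four <;>
    simp [ha1, ha2, hs', hx1, hx2, hd1, hd2] <;>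
    field_simp <;> ring

lemma IsSpherical.t4_upper_one_p_p_p_sq (hΦ : IsSpherical Φ) {a b x u s d : ℚ_[p]}
    (ha : ‖a‖ = 1) (hx : ‖x‖ = 1) (hs : ‖s‖ ≤ 1) (hd : ‖d‖ ≤ 1)
    (hb : b = (p * s - a) / x) (hu : u = p * (p * d) - a * s / x) :
    Φ (t4 p * upper p 0 0 (-(p * s) / p) ((p * u + p * s * b) / p ^ 3) (b / p ^ 2) (x⁻¹ / p)) =
    Φ (upper p 2 2 (x / a / p ^ 2) (x / a ^ 2 / p) 0 0) := by
  have hp := p_ne_zero p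
  have ha0 := ne_zero_of_norm_one ha
  have hx0 := ne_zero_of_norm_one hx
  obtain ⟨a', ai, ha1, ha2⟩ := exists_unit ha
  obtain ⟨s', hs'⟩ := exists_int hs
  obtain ⟨x', xi, hx1, hx2⟩ := exists_unit hx
  obtain ⟨d', hd1⟩ := exists_int hd
  refine hΦ.eq_of_mat !![-x' * p * ai ^ 2, -x' * ai + x' * s' * p * ai ^ 2,
      -x' * p * d' * ai ^ 2, 0;
    0, p ^ 2, (p * s' - a') * xi, p * xi;
    p ^ 2, -s' * p ^ 2, p ^ 2 * d' - a' * s' * xi, -a' * xi;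
    x' * ai, -x' * s' * ai, x' * d' * ai, 0]
    (by simp [multiplier_mul]) ?_
  rw [mat_upper, mat_t4_upper, hb, hu]
  apply eq_mul_map_fin_four <;>
    simp [ha1, ha2, hs', hx1, hx2, hd1] <;>
    field_simp <;> ring

end CosetIdentities

/-! ### Fourfold averages and their substitutions -/

section IteratedMean

variable {p : ℕ} [Fact p.Prime]

variable (p) in
/-- The iterated mean in four variables. -/
def mean4 (F : ℚ_[p] → ℚ_[p] → ℚ_[p] → ℚ_[p] → ℂ) : ℂ :=
  mean p fun a => mean p fun b => mean p fun c => mean p fun d => F a b c d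

lemma mean4_congr {F G : ℚ_[p] → ℚ_[p] → ℚ_[p] → ℚ_[p] → ℂ}
    (h : ∀ a b c d, ‖a‖ ≤ 1 → ‖b‖ ≤ 1 → ‖c‖ ≤ 1 → ‖d‖ ≤ 1 → F a b c d = G a b c d) :
    mean4 p F = mean4 p G :=
  mean_congr fun a ha => mean_congr fun b hb => mean_congr fun c hc => mean_congr fun d hd =>
    h a b c d ha hb hc hd

/-- Joint continuity in four variables. -/
def Continuous4 (F : ℚ_[p] → ℚ_[p] → ℚ_[p] → ℚ_[p] → ℂ) : Prop :=
  Continuous fun q : ℚ_[p] × ℚ_[p] × ℚ_[p] × ℚ_[p] => F q.1 q.2.1 q.2.2.1 q.2.2.2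

lemma Continuous4.comp {F : ℚ_[p] → ℚ_[p] → ℚ_[p] → ℚ_[p] → ℂ} (hF : Continuous4 F)
    {X : Type*} [TopologicalSpace X] {f g h i : X → ℚ_[p]} (hf : Continuous f) (hg : Continuous g)
    (hh : Continuous h) (hi : Continuous i) : Continuous fun x => F (f x) (g x) (h x) (i x) :=
  Continuous.comp (g := fun q : ℚ_[p] × ℚ_[p] × ℚ_[p] × ℚ_[p] => F q.1 q.2.1 q.2.2.1 q.2.2.2) hF
    (hf.prodMk (hg.prodMk (hh.prodMk hi)))

variable {F G : ℚ_[p] → ℚ_[p] → ℚ_[p] → ℚ_[p] → ℂ}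

lemma mean4_add (hF : Continuous4 F) (hG : Continuous4 G) :
    mean4 p (fun a b c d => F a b c d + G a b c d) = mean4 p F + mean4 p G := by
  have h1 : ∀ (H : ℚ_[p] → ℚ_[p] → ℚ_[p] → ℚ_[p] → ℂ), Continuous4 H →
      ∀ a b c, Continuous fun d => H a b c d := fun H hH a b c => hH.comp (by fun_prop)
        (by fun_prop) (by fun_prop) (by fun_prop)
  have h2 : ∀ (H : ℚ_[p] → ℚ_[p] → ℚ_[p] → ℚ_[p] → ℂ), Continuous4 H →
      ∀ a b, Continuous fun c => mean p fun d => H a b c d := fun H hH a b =>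
        continuous_mean (hH.comp (by fun_prop) (by fun_prop) (by fun_prop) (by fun_prop))
  have h3 : ∀ (H : ℚ_[p] → ℚ_[p] → ℚ_[p] → ℚ_[p] → ℂ), Continuous4 H →
      ∀ a, Continuous fun b => mean p fun c => mean p fun d => H a b c d := fun H hH a =>
        continuous_mean (continuous_mean
          (hH.comp (by fun_prop) (by fun_prop) (by fun_prop) (by fun_prop)))
  have h4 : ∀ (H : ℚ_[p] → ℚ_[p] → ℚ_[p] → ℚ_[p] → ℂ), Continuous4 H →
      Continuous fun a => mean p fun b => mean p fun c => mean p fun d => H a b c d := fun H hH =>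
        continuous_mean (continuous_mean (continuous_mean
          (hH.comp (by fun_prop) (by fun_prop) (by fun_prop) (by fun_prop))))
  simp only [mean4]
  rw [← mean_add (h4 F hF) (h4 G hG)]
  refine mean_congr fun a _ => ?_
  rw [← mean_add (h3 F hF a) (h3 G hG a)]
  refine mean_congr fun b _ => ?_
  rw [← mean_add (h2 F hF a b) (h2 G hG a b)]
  exact mean_congr fun c _ => mean_add (h1 F hF a b c) (h1 G hG a b c)

/-- Interchange of the last two variables. -/
lemma mean4_comm34 (hF : Continuous4 F) : mean4 p F = mean4 p fun a b d c => F a b c d :=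
  mean_congr fun a _ => mean_congr fun b _ => mean_comm
    (hF.comp (by fun_prop) (by fun_prop) (by fun_prop) (by fun_prop))

/-- The second variable becomes the last. -/
lemma mean4_comm24 (hF : Continuous4 F) : mean4 p F = mean4 p fun a c d b => F a b c d :=
  (mean_congr fun a _ => mean_comm (F := fun b c => mean p fun d => F a b c d) (continuous_mean
    (hF.comp (by fun_prop) (by fun_prop) (by fun_prop) (by fun_prop)))).trans
  (mean4_comm34 (F := fun a c b d => F a b c d)
    (hF.comp (by fun_prop) (by fun_prop) (by fun_prop) (by fun_prop)))

/-- The first variable becomes the last. -/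
lemma mean4_comm14 (hF : Continuous4 F) : mean4 p F = mean4 p fun b c d a => F a b c d :=
  (mean_comm (F := fun a b => mean p fun c => mean p fun d => F a b c d) (continuous_mean
    (continuous_mean (hF.comp (by fun_prop) (by fun_prop) (by fun_prop) (by fun_prop))))).trans
  (mean4_comm24 (F := fun b a c d => F a b c d)
    (hF.comp (by fun_prop) (by fun_prop) (by fun_prop) (by fun_prop)))

/-- A unit affine substitution in the last variable. -/
lemma mean4_affine (u v : ℚ_[p] → ℚ_[p] → ℚ_[p] → ℚ_[p])
    (h : ∀ a b c, ‖a‖ ≤ 1 → ‖b‖ ≤ 1 → ‖c‖ ≤ 1 → ‖u a b c‖ = 1 ∧ ‖v a b c‖ ≤ 1) :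
    mean4 p F = mean4 p fun a b c d => F a b c (u a b c * d + v a b c) :=
  mean_congr fun a ha => mean_congr fun b hb => mean_congr fun c hc =>
    (mean_affine _ _ (h a b c ha hb hc).1 (h a b c ha hb hc).2 _).symm

lemma mean4_mul (u : ℚ_[p] → ℚ_[p] → ℚ_[p] → ℚ_[p])
    (h : ∀ a b c, ‖a‖ ≤ 1 → ‖b‖ ≤ 1 → ‖c‖ ≤ 1 → ‖u a b c‖ = 1) :
    mean4 p F = mean4 p fun a b c d => F a b c (u a b c * d) :=
  mean_congr fun a ha => mean_congr fun b hb => mean_congr fun c hc =>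
    (mean_mul_left _ (h a b c ha hb hc) _).symm

/-- Inversion of the last variable, up to a unit. -/
lemma mean4_flip (u : ℚ_[p] → ℚ_[p] → ℚ_[p] → ℚ_[p])
    (h : ∀ a b c, ‖a‖ ≤ 1 → ‖b‖ ≤ 1 → ‖c‖ ≤ 1 → ‖u a b c‖ = 1) :
    mean4 p F = mean4 p fun a b c d => F a b c (u a b c * uflip p d) :=
  mean_congr fun a ha => mean_congr fun b hb => mean_congr fun c hc =>
    (mean_mul_uflip _ (h a b c ha hb hc) _).symm

lemma mean4_oneP : mean4 p (fun a b c d => oneP p d * F a b c d) =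
    (p : ℂ)⁻¹ * mean4 p fun a b c d => F a b c (p * d) := by
  simp only [mean4, mean_oneP, mean_const_mul]

end IteratedMean

/-! ### The averages behind the sums, and the evaluation giving T¹² -/

section Reduction

variable {p : ℕ} [Fact p.Prime]

lemma norm_add_p_mul {x c : ℚ_[p]} (hc : ‖c‖ ≤ 1) : ‖x + p * c‖ = 1 ↔ ‖x‖ = 1 := by
  simpa using norm_add_p_pow (n := 1) one_ne_zero (x := x) hc

lemma norm_sub_p_mul {x c : ℚ_[p]} (hc : ‖c‖ ≤ 1) : ‖x - p * c‖ = 1 ↔ ‖x‖ = 1 := by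
  rw [sub_eq_add_neg, ← mul_neg]
  exact norm_add_p_mul (by rwa [norm_neg])

lemma norm_div_le_one {x u : ℚ_[p]} (hx : ‖x‖ ≤ 1) (hu : ‖u‖ = 1) : ‖x / u‖ ≤ 1 := by
  rwa [norm_div, hu, div_one]

section

variable {χ : MulChar ℚ_[p] ℂ}

/-- The substitutions below replace units by inverses and by multiples of squares; this is why the
character comes out in the stated form. -/
lemma chi_eq_of_sq (hq : χ.IsQuadratic) {x y c : ℚ_[p]} (hc : ‖c‖ = 1) (h : x = y * c ^ 2) :
    chi χ x = chi χ y := by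
  have := chi_sq hq c
  rw [oneU_of hc] at this
  rw [h, mul_comm, pow_two, mul_assoc, chi_unit_mul hc, chi_unit_mul hc, ← mul_assoc, this, one_mul]

lemma chi_one : chi χ 1 = 1 := by rw [chi_of (by simp), map_one]

end

variable (Φ : GSp4 p → ℂ) (χ : MulChar ℚ_[p] ℂ)

/-! The explicit averages that correspond to the summands `T2`, …, `T14`. -/

/-- The power of p in front is the total exponent of the residue rings minus the normalizing
exponent of the sum, here 4·3 - 11 = 1. Where a sum has fewer than four variables, the remaining
ones are dummies that keep the number of variables fixed. -/
def meanT2 : ℂ := (p : ℂ) * mean4 p fun a b x y =>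
  chi χ a * chi χ b * (chi χ x * oneU p (1 - x)) * (chi χ y * oneU p (1 - y)) *
    Φ (upper p 1 0 (b / p) (a * b * (1 - uinv p (1 - y) * x) / p ^ 3) (-a / p ^ 2)
      (a * uinv p b * uinv p (1 - x) / p))

def meanT3 : ℂ := mean4 p fun _ a b z =>
  oneU p a * chi χ b * (oneU p z * chi χ (1 - z)) *
    Φ (upper p 1 0 0 (b / p ^ 3) (a / p ^ 2) (a ^ 2 * uinv p b * z / p))

def meanT4 : ℂ := (p : ℂ) * mean4 p fun _ a b x => chi χ b * oneU p x *
  Φ (upper p 1 0 (x / p ^ 2) ((b * p - a * x) / p ^ 4) (a / p ^ 2) 0)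

def meanT5 : ℂ := mean4 p fun _ a b x => oneU p a * chi χ b *
  Φ (upper p 1 0 (x / p) ((b - a * x) / p ^ 3) (a / p ^ 2) 0)

def meanT6 : ℂ := (p : ℂ)⁻¹ * mean4 p fun _ a b x => oneU p a * chi χ b * chi χ x *
  Φ (upper p 2 0 0 (b * (1 - x * p) / p ^ 2) (a / p ^ 2) (a ^ 2 * uinv p b / p ^ 2))

def meanT8 : ℂ := mean4 p fun _ a b z => chi χ a * chi χ b * (chi χ z * chi χ (1 - z)) *
  Φ (upper p 1 1 (b / p ^ 2) (-(a * b * (1 - z)) / p ^ 3) (a / p) 0)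

def meanT9 : ℂ := (p : ℂ)⁻¹ ^ 2 * mean4 p fun _ a b x => oneU p a * chi χ b * oneU p x *
  Φ (upper p 2 1 (a / p) (-b / p) 0 (x / p))

def meanT10 : ℂ := (p : ℂ)⁻¹ ^ 3 * mean4 p fun _ _ a b => oneU p a * chi χ b *
  Φ (upper p 2 2 (a / p ^ 2) (-b / p) 0 0)

def meanT12 : ℂ := (p : ℂ) ^ 2 * mean4 p fun y a b z =>
  chi χ a * chi χ b * (chi χ z * chi χ (1 - z)) * Φ (upper p 1 (-1) (a / p)
    (a * (b * (1 - z) * p - y) / p ^ 4) (y / p ^ 3) (-(uinv p a * (y + b * p)) / p ^ 2))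

def meanT13 : ℂ := mean4 p fun _ a b x => oneU p a * chi χ b * chi χ x *
  Φ (upper p 2 (-1) 0 (b * (1 - x) / p) (a / p ^ 2) (a ^ 2 * uinv p b / p ^ 3))

def meanT14 : ℂ := (p : ℂ) * mean4 p fun _ a b x => oneU p a * chi χ b *
  Φ (upper p 2 (-2) 0 (-b / p) (a / p ^ 2) (x / p ^ 4))

variable {Φ χ}

/-- Put u = -abz, so that u + ab = ab(1 - z) and the two unit conditions concern z and 1 - z alone.
An affine change of x then straightens the off-diagonal entry to y, and inverting a and b
straightens b/u. The later evaluations follow the same pattern: cyclic permutation brings a variable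
to the last place, a substitution acts on it, points outside the support of the weights are
discarded, and a coset identity finishes. -/
lemma mean_t4_tauInv_unit_unit (hΦ : IsSpherical Φ) (hq : χ.IsQuadratic) (hc : HasConductorP χ) :
    (p : ℂ) ^ 2 * mean4 p (fun x a b u => chi χ a * chi χ b * (oneU p u * (oneU p (u + a * b) *
      Φ (t4 p * upper p 0 (-1) (b / p) (u / p ^ 3 - b * (x * b + a * p) / p ^ 4)
        ((x * b + a * p) / p ^ 3) (-x / p ^ 2))))) = meanT12 Φ χ := by
  have hΦc := hΦ.continuous
  have hχc := continuous_chi hc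
  unfold meanT12
  congr 1
  refine (mean4_mul (fun x a b => -(uval p a * uval p b)) (by simp)).trans ?_
  refine (mean4_comm14 (by unfold Continuous4; fun_prop)).trans ?_
  refine (mean4_affine (fun a b z => -(uval p a * uval p z)) (fun a b z => -(uinv p b * a * p)) ?_).trans ?_
  · intro a b z ha _ _
    exact ⟨by simp, by simpa using norm_mul_le_one ha norm_p_lt_one.le⟩
  refine (mean4_comm14 (by unfold Continuous4; fun_prop)).trans ?_
  refine (mean4_flip (fun b z y => -uinv p z) (by simp)).trans ?_
  refine (mean4_comm14 (by unfold Continuous4; fun_prop)).trans ?_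
  refine (mean4_flip (fun z y a => -uinv p (1 - z)) (by simp)).trans ?_
  refine (mean4_comm14 (by unfold Continuous4; fun_prop)).trans ?_
  refine mean4_congr fun y a b z hy ha hb hz => ?_
  by_cases ha1 : ‖a‖ = 1; swap
  · rw [chi_of_ne ha1, chi_of_ne (by simpa using ha1)]; ring
  by_cases hb1 : ‖b‖ = 1; swap
  · rw [chi_of_ne hb1, chi_of_ne (x := _ * uflip p b) (by simpa using hb1)]; ring
  by_cases hz1 : ‖z‖ = 1; swap
  · rw [chi_of_ne hz1, oneU_of_ne (x := _ * z) (by simpa using hz1)]; ring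
  have ha0 := ne_zero_of_norm_one ha1
  have hb0 := ne_zero_of_norm_one hb1
  have hz0 := ne_zero_of_norm_one hz1
  have hp := p_ne_zero p
  by_cases hz2 : ‖1 - z‖ = 1; swap
  · rw [chi_of_ne hz2, oneU_of_ne (x := _ + _)]; · ring
    rw [uval_of (by simp [ha1]), uval_of (by simp [hb1]), neg_mul, mul_comm _ z, neg_add_eq_sub,
      ← one_sub_mul]
    simpa [ha1, hb1, hz1] using hz2
  have hz3 := ne_zero_of_norm_one hz2
  rw [uflip_of ha1, uflip_of hb1, uinv_of ha1, uinv_of hz1, uval_of hz1, uinv_of hz2,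
    uval_of (by simp [ha1, hz1]), uval_of (by simp [hb1, hz2]), uinv_of (by simp [hb1, hz2])]
  set a' := -z⁻¹ * a⁻¹ with ha'
  set b' := -(1 - z)⁻¹ * b⁻¹ with hb'
  have hw : -(a' * b') * z + a' * b' = (z * a * b)⁻¹ := by
    rw [ha', hb']; field_simp; ring
  have hu : -(a' * b') * z = -((1 - z) * a * b)⁻¹ := by
    rw [ha', hb']; field_simp
  have hx : ‖-(a' * z) * y + -(b'⁻¹ * a' * p)‖ ≤ 1 := by
    refine norm_add_le_one (norm_mul_le_one ?_ hy) ?_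
    · simp [ha', ha1, hz1]
    · rw [norm_neg]; refine norm_mul_le_one ?_ norm_p_lt_one.le
      simp [ha', hb', ha1, hb1, hz1, hz2]
  rw [hΦ.t4_upper_tauInv_unit_unit (w := (z * a * b)⁻¹) (by simp [ha', ha1, hz1])
    (by simp [hb', hb1, hz2]) (by rw [hu]; simp [hz2, ha1, hb1]) (by simp [hz1, ha1, hb1]) hw.symm, hw,
    hu, oneU_of (by simp [hz2, ha1, hb1]), oneU_of (by simp [hz1, ha1, hb1])]
  -- Here a'b' is the inverse of abz(1 - z), hence that product times a square.
  have hχ : chi χ a' * chi χ b' = chi χ a * chi χ b * (chi χ z * chi χ (1 - z)) := by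
    rw [← chi_mul, ← chi_mul, ← chi_mul, ← chi_mul]
    refine chi_eq_of_sq hq (c := (z * a * b * (1 - z))⁻¹) (by simp [hz1, ha1, hb1, hz2]) ?_
    rw [ha', hb']; field_simp
    all_goals simp [ha', hb', hz1, ha1, hb1, hz2]
  rw [hχ, one_mul, one_mul]
  congr 3
  all_goals (simp only [ha', hb']; field_simp; try ring)

end Reduction

/-! ### The remaining cases of prefix τ'⁻¹: T⁴ and T¹⁴ -/

section TauInvPart
variable {p : ℕ} [Fact p.Prime] {Φ : GSp4 p → ℂ} {χ : MulChar ℚ_[p] ℂ}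

/-- The condition on u + ab is parametrized by u + ab = pm, at the cost of 1/p. The changes of a, b
and x are chosen to make u = -b⁻¹, b/u = x and (xb + ap)/u = a in the new variables; the coset no
longer involves m, which remains as a dummy. -/
lemma mean_t4_tauInv_unit_p (hΦ : IsSpherical Φ) (hq : χ.IsQuadratic) (hc : HasConductorP χ) :
    (p : ℂ) ^ 2 * mean4 p (fun x a b u => chi χ a * chi χ b * (oneU p u * (oneP p (u + a * b) *
      Φ (t4 p * upper p 0 (-1) (b / p) (u / p ^ 3 - b * (x * b + a * p) / p ^ 4)
        ((x * b + a * p) / p ^ 3) (-x / p ^ 2))))) = meanT4 Φ χ := by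
  have hΦc := hΦ.continuous
  have hχc := continuous_chi hc
  have hp := p_ne_zero p
  have hp' : (p : ℂ) ≠ 0 := by exact_mod_cast (Fact.out : p.Prime).ne_zero
  have h1 : mean4 p (fun x a b u => chi χ a * chi χ b * (oneU p u * (oneP p (u + a * b) *
      Φ (t4 p * upper p 0 (-1) (b / p) (u / p ^ 3 - b * (x * b + a * p) / p ^ 4)
        ((x * b + a * p) / p ^ 3) (-x / p ^ 2))))) = (p : ℂ)⁻¹ * mean4 p fun x a b m =>
      chi χ a * chi χ b * (oneU p (p * m - a * b) *
      Φ (t4 p * upper p 0 (-1) (b / p) ((p * m - a * b) / p ^ 3 - b * (x * b + a * p) / p ^ 4)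
        ((x * b + a * p) / p ^ 3) (-x / p ^ 2))) := by
    rw [← mean4_oneP (F := fun x a b m => chi χ a * chi χ b * (oneU p (m - a * b) *
      Φ (t4 p * upper p 0 (-1) (b / p) ((m - a * b) / p ^ 3 - b * (x * b + a * p) / p ^ 4)
        ((x * b + a * p) / p ^ 3) (-x / p ^ 2))))]
    refine (mean4_affine (fun _ _ _ => 1) (fun x a b => -(a * b)) ?_).trans ?_
    · intro x a b _ ha hb
      exact ⟨by simp, by simpa using norm_mul_le_one ha hb⟩
    refine mean4_congr fun x a b m _ _ _ _ => ?_
    rw [one_mul, neg_add_cancel_right, ← sub_eq_add_neg]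
    ring
  rw [h1, meanT4, ← mul_assoc]
  congr 1
  · field_simp
  refine (mean4_comm24 (by unfold Continuous4; fun_prop)).trans ?_
  refine (mean4_affine (fun x b m => -uinv p b) (fun x b m => uinv p b * (p * m)) ?_).trans ?_
  · intro x b m _ _ hm
    exact ⟨by simp, norm_mul_le_one (by simp) (norm_p_mul_lt hm).le⟩
  refine (mean4_flip (fun x b m => -1) (by simp)).trans ?_
  refine (mean4_comm24 (by unfold Continuous4; fun_prop)).trans ?_
  refine (mean4_mul (fun x m b => -uinv p b) (by simp)).trans ?_
  refine (mean4_comm14 (by unfold Continuous4; fun_prop)).trans ?_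
  refine (mean4_affine (fun m b x => uinv p x)
    (fun m b x => -((p * m + uinv p b) * p * (uval p b * uinv p x) ^ 2)) ?_).trans ?_
  · intro m b x hm _ _
    refine ⟨by simp, ?_⟩
    rw [norm_neg]
    exact norm_mul_le_one (norm_mul_le_one (norm_add_le_one (norm_p_mul_lt hm).le (by simp))
      norm_p_lt_one.le) (by simp)
  refine (mean4_comm24 (by unfold Continuous4; fun_prop)).trans ?_
  refine (mean4_comm24 (by unfold Continuous4; fun_prop)).trans ?_
  refine mean4_congr fun m a b x hm ha hb hx => ?_
  by_cases hx1 : ‖x‖ = 1; swap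
  · rw [oneU_of_ne hx1, chi_of_ne (x := -uinv p b * x) (by simpa using hx1)]; ring
  have hx0 := ne_zero_of_norm_one hx1
  rw [uinv_of (x := -uinv p b * x) (by simpa using hx1)]
  by_cases hb1 : ‖b‖ = 1; swap
  · rw [chi_of_ne hb1, oneU_of_ne (x := _ - _)]; · ring
    have h0 : uinv p b ≠ 0 := ne_zero_of_norm_one (by simp)
    have : (p : ℚ_[p]) * m - (-(-uinv p b * x)⁻¹ * (-1 * uflip p b) + (-uinv p b * x)⁻¹ * (p * m)) *
      (-uinv p b * x) = -uflip p b := by field_simp; ring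
    rw [this]; simpa using hb1
  have hb0 := ne_zero_of_norm_one hb1
  rw [uflip_of hb1, uinv_of hb1, uinv_of hx1, uval_of hb1]
  set b' := -b⁻¹ * x with hb'
  set a' := -b'⁻¹ * (-1 * b⁻¹) + b'⁻¹ * (p * m) with ha'
  set x' := x⁻¹ * a + -((p * m + b⁻¹) * p * (b * x⁻¹) ^ 2) with hx'
  have hab : a' * b' = p * m + b⁻¹ := by
    rw [ha', hb']; field_simp; ring
  have hu : p * m - a' * b' = -b⁻¹ := by rw [hab]; ring
  have hnb : ‖b'‖ = 1 := by simp [hb', hb1, hx1]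
  have hna : ‖a'‖ ≤ 1 := by
    refine norm_add_le_one ?_ (norm_mul_le_one (by simp [hnb]) (norm_p_mul_lt hm).le)
    simp [hnb, hb1]
  have hnx : ‖x'‖ ≤ 1 := by
    refine norm_add_le_one (norm_mul_le_one (by simp [hx1]) ha) ?_
    rw [norm_neg]
    exact norm_mul_le_one (norm_mul_le_one (norm_add_le_one (norm_p_mul_lt hm).le (by simp [hb1]))
      norm_p_lt_one.le) (by simp [hb1, hx1])
  have hχ : chi χ a' * chi χ b' = chi χ b := by
    rw [← chi_mul hna hnb.le, hab, add_comm, chi_add_p_mul χ hc hm]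
    exact chi_eq_of_sq hq (c := b⁻¹) (by simp [hb1]) (by field_simp)
  rw [hχ, hΦ.t4_upper_tauInv_unit hna hnb.le hnx (by simp [hu, hb1]) hm rfl, hu,
    oneU_of (by simp [hb1]), oneU_of hx1, mul_one, one_mul]
  have hxu : (x' * b' + a' * p) / -b⁻¹ = a := by
    have : a' = (p * m + b⁻¹) / b' := by
      rw [← hab]; field_simp [ne_zero_of_norm_one hnb]
    rw [this, hx', hb']; field_simp; ring
  have hbu : b' / -b⁻¹ = x := by rw [hb']; field_simp
  rw [hxu, hbu]
  congr 3
  field_simp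

/-- Writing u = pu, the invariant is d = ab + pu. Using d⁻¹ as the new b, a/d as the new a and the
whole last entry as the new x leaves u as a dummy variable; χ(ab) = χ(d) because they agree modulo
p. -/
lemma mean_t4_tauInv_p (hΦ : IsSpherical Φ) (hq : χ.IsQuadratic) (hc : HasConductorP χ) :
    (p : ℂ) ^ 2 * mean4 p (fun x a b u => chi χ a * chi χ b * (oneP p u *
      Φ (t4 p * upper p 0 (-1) (b / p) (u / p ^ 3 - b * (x * b + a * p) / p ^ 4)
        ((x * b + a * p) / p ^ 3) (-x / p ^ 2)))) = meanT14 Φ χ := by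
  have hΦc := hΦ.continuous
  have hχc := continuous_chi hc
  have hp := p_ne_zero p
  have hp' : (p : ℂ) ≠ 0 := by exact_mod_cast (Fact.out : p.Prime).ne_zero
  have h1 : mean4 p (fun x a b u => chi χ a * chi χ b * (oneP p u *
      Φ (t4 p * upper p 0 (-1) (b / p) (u / p ^ 3 - b * (x * b + a * p) / p ^ 4)
        ((x * b + a * p) / p ^ 3) (-x / p ^ 2)))) = (p : ℂ)⁻¹ * mean4 p fun x a b u =>
      chi χ a * chi χ b *
      Φ (t4 p * upper p 0 (-1) (b / p) (p * u / p ^ 3 - b * (x * b + a * p) / p ^ 4)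
        ((x * b + a * p) / p ^ 3) (-x / p ^ 2)) := by
    rw [← mean4_oneP (F := fun x a b u => chi χ a * chi χ b *
      Φ (t4 p * upper p 0 (-1) (b / p) (u / p ^ 3 - b * (x * b + a * p) / p ^ 4)
        ((x * b + a * p) / p ^ 3) (-x / p ^ 2)))]
    exact mean4_congr fun x a b m _ _ _ _ => by ring
  rw [h1, meanT14, ← mul_assoc]
  congr 1
  · field_simp
  refine (mean4_comm34 (by unfold Continuous4; fun_prop)).trans ?_
  refine (mean4_affine (fun x a u => uinv p a) (fun x a u => -(uinv p a * (p * u))) ?_).trans ?_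
  · intro x a u _ _ hu
    refine ⟨by simp, ?_⟩
    rw [norm_neg]
    exact norm_mul_le_one (by simp) (norm_p_mul_lt hu).le
  refine (mean4_flip (fun x a u => 1) (by simp)).trans ?_
  refine (mean4_comm24 (by unfold Continuous4; fun_prop)).trans ?_
  refine (mean4_mul (fun x u b => uinv p b) (by simp)).trans ?_
  refine (mean4_comm14 (by unfold Continuous4; fun_prop)).trans ?_
  refine (mean4_affine (fun u b a => -1) (fun u b a => -(a ^ 2 * uinv p b * p)) ?_).trans ?_
  · intro u b a _ _ ha
    refine ⟨by simp, ?_⟩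
    rw [norm_neg]
    exact norm_mul_le_one (norm_mul_le_one (by rw [norm_pow]; exact pow_le_one₀ (norm_nonneg _) ha)
      (by simp)) norm_p_lt_one.le
  refine (mean4_comm24 (by unfold Continuous4; fun_prop)).trans ?_
  refine (mean4_comm34 (by unfold Continuous4; fun_prop)).trans ?_
  refine mean4_congr fun u a b x hu ha hb hx => ?_
  by_cases ha1 : ‖a‖ = 1; swap
  · rw [oneU_of_ne ha1, chi_of_ne (x := uinv p b * a) (by simpa using ha1)]; ring
  have ha0 := ne_zero_of_norm_one ha1
  have hna : ‖uinv p b * a‖ = 1 := by simpa using ha1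
  rw [uinv_of hna, one_mul]
  set a' := uinv p b * a with ha'
  have e : a'⁻¹ * uflip p b + -(a'⁻¹ * (p * u)) = a'⁻¹ * uflip p b + p * (-(a'⁻¹ * u)) := by ring
  have hnu : ‖-(a'⁻¹ * u)‖ ≤ 1 := by rw [norm_neg]; exact norm_mul_le_one (by simp [hna]) hu
  by_cases hb1 : ‖b‖ = 1; swap
  · rw [chi_of_ne hb1, e, chi_add_p_mul χ hc hnu, chi_of_ne (x := a'⁻¹ * _)]
    · ring
    simpa [hna] using hb1
  have hb0 := ne_zero_of_norm_one hb1
  have ha'0 := ne_zero_of_norm_one hna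
  rw [uflip_of hb1] at e ⊢
  have hχ : chi χ a' * chi χ (a'⁻¹ * b⁻¹ + -(a'⁻¹ * (p * u))) = chi χ b := by
    rw [e, chi_add_p_mul χ hc hnu, ← chi_unit_mul hna]
    exact chi_eq_of_sq hq (c := b⁻¹) (by simp [hb1]) (by field_simp)
  have hnb : ‖a'⁻¹ * b⁻¹ + -(a'⁻¹ * (p * u))‖ ≤ 1 := by
    rw [e, ((norm_add_p_mul hnu).mpr (by simp [hna, hb1]))]
  rw [hχ, hΦ.t4_upper_tauInv_p (d := b⁻¹) hna.le hnb hu (by simp [hb1]) (by field_simp; ring),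
    oneU_of ha1, one_mul]
  rw [uinv_of hb1] at ha' ⊢
  congr 3
  · field_simp
  · rw [ha']; field_simp
  · rw [ha']; field_simp; ring
end TauInvPart

/-! ### Cosets with prefix η': merging with the τ' terms, and T⁵ -/

section UnitPart
variable {p : ℕ} [Fact p.Prime] {Φ : GSp4 p → ℂ} {χ : MulChar ℚ_[p] ℂ}

lemma mean4_oneP_fst {F : ℚ_[p] → ℚ_[p] → ℚ_[p] → ℚ_[p] → ℂ} :
    mean4 p (fun a b c d => oneP p a * F a b c d) =
    (p : ℂ)⁻¹ * mean4 p fun a b c d => F (p * a) b c d := by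
  simp only [mean4, mean_const_mul]
  exact mean_oneP _

variable (Φ) in
/-- The common value of `Φ` on the parts of the twist with prefix `η'`, with `u` a unit. -/
def unitVal (x a b u : ℚ_[p]) : ℂ :=
  Φ (upper p 1 0 (-(a + x * b) * uinv p u / p) (((a + x * b) * b * uinv p u - 1) * uinv p u / p ^ 3)
    (b * uinv p u / p ^ 2) ((u + a * b) * uinv p (x * u + a * (a + x * b)) / p))

@[fun_prop]
lemma continuous_unitVal (hΦ : Continuous Φ) {X : Type*} [TopologicalSpace X]
    {f g h i : X → ℚ_[p]} (hf : Continuous f) (hg : Continuous g) (hh : Continuous h)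
    (hi : Continuous i) : Continuous fun x => unitVal Φ (f x) (g x) (h x) (i x) := by
  unfold unitVal; fun_prop

/-- The terms with prefix `τ'` supply the missing part of the average over `x`. -/
lemma mean_t4_unit_unit (hΦ : IsSpherical Φ) (hc : HasConductorP χ) :
    (p : ℂ) * mean4 p (fun x a b u => oneU p x * (chi χ a * chi χ b * (oneU p u *
      (oneU p (x * u + a * (a + x * b)) * Φ (t4 p * upper p 0 0 (-(a + x * b) / p)
        ((u + (a + x * b) * b) / p ^ 3) (b / p ^ 2) (uinv p x / p)))))) +
    mean4 p (fun _ a b u => chi χ a * chi χ b * (oneU p u *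
      Φ (t4 p * upper p 0 1 (-a / p ^ 2) ((u + a * b) / p ^ 3) (b / p) 0))) =
    (p : ℂ) * mean4 p (fun x a b u => chi χ a * chi χ b * (oneU p u *
      (oneU p (x * u + a * (a + x * b)) * unitVal Φ x a b u))) := by
  have hΦc := hΦ.continuous
  have hχc := continuous_chi hc
  have hp := p_ne_zero p
  have hp' : (p : ℂ) ≠ 0 := by exact_mod_cast (Fact.out : p.Prime).ne_zero
  have h1 : mean4 p (fun x a b u => oneU p x * (chi χ a * chi χ b * (oneU p u *
      (oneU p (x * u + a * (a + x * b)) * Φ (t4 p * upper p 0 0 (-(a + x * b) / p)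
        ((u + (a + x * b) * b) / p ^ 3) (b / p ^ 2) (uinv p x / p)))))) =
      mean4 p (fun x a b u => oneU p x * (chi χ a * chi χ b * (oneU p u *
        (oneU p (x * u + a * (a + x * b)) * unitVal Φ x a b u)))) := by
    refine mean4_congr fun x a b u hx ha hb hu => ?_
    by_cases hx1 : ‖x‖ = 1; swap
    · rw [oneU_of_ne hx1]; ring
    by_cases hu1 : ‖u‖ = 1; swap
    · rw [oneU_of_ne hu1]; ring
    by_cases hd1 : ‖x * u + a * (a + x * b)‖ = 1; swap
    · rw [oneU_of_ne hd1]; ring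
    rw [uinv_of hx1, unitVal, hΦ.t4_upper_one_unit_unit ha hb hx1 hu1 hd1 rfl rfl, uinv_of hu1,
      uinv_of hd1]
    simp only [div_eq_mul_inv]
  -- Translating a by -pxb makes a + (px)b equal to a again, so the τ' coset can be compared with
  -- the common value at px. A dummy x is available for this.
  have h2 : mean4 p (fun _ a b u => chi χ a * chi χ b * (oneU p u *
      Φ (t4 p * upper p 0 1 (-a / p ^ 2) ((u + a * b) / p ^ 3) (b / p) 0))) =
      mean4 p fun x a b u => chi χ a * chi χ b * (oneU p u *
      (oneU p (p * x * u + a * (a + p * x * b)) * unitVal Φ (p * x) a b u)) := by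
    refine (mean4_comm24 (by unfold Continuous4; fun_prop)).trans (Eq.trans ?_
      (mean4_comm24 (by unfold Continuous4; fun_prop)).symm)
    refine Eq.trans ?_ (mean4_affine (fun _ _ _ => 1) (fun x b u => -(p * x * b)) ?_).symm
    · refine mean4_congr fun x b u a hx hb hu ha => ?_
      have e : chi χ (1 * a + -(p * x * b)) = chi χ a := by
        rw [one_mul, mul_assoc, ← mul_neg, chi_add_p_mul χ hc]
        rw [norm_neg]; exact norm_mul_le_one hx hb
      rw [e]
      by_cases ha1 : ‖a‖ = 1; swap
      · rw [chi_of_ne ha1]; ring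
      by_cases hu1 : ‖u‖ = 1; swap
      · rw [oneU_of_ne hu1]; ring
      have ha0 := ne_zero_of_norm_one ha1
      have hu0 := ne_zero_of_norm_one hu1
      have es : 1 * a + -(p * x * b) + p * x * b = a := by ring
      have hd : ‖p * x * u + (1 * a + -(p * x * b)) * a‖ = 1 := by
        have : p * x * u + (1 * a + -(p * x * b)) * a = a ^ 2 + p * (x * (u - a * b)) := by ring
        rw [this]
        refine (norm_add_p_mul (norm_mul_le_one hx (norm_sub_le_one hu (norm_mul_le_one ha hb)))).mpr ?_
        simp [ha1]
      have hd0 := ne_zero_of_norm_one hd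
      rw [unitVal, es, oneU_of hd, uinv_of hd, uinv_of hu1, hΦ.t4_upper_tau_unit ha1 hb hu1, one_mul]
      congr 2
      -- Only the last entry of the symmetric block differs, and it differs by an integer.
      refine (hΦ.upper_congr _ _ (x' := (a * b / u - 1) / u / p ^ 3)
        (y' := b / u / p ^ 2) (z' := (u + (1 * a + -(p * x * b)) * b) *
          (p * x * u + (1 * a + -(p * x * b)) * a)⁻¹ / p) ?_ ?_ ?_).trans ?_
      · simp
      · simp
      · have : (u + a * b) / a ^ 2 / p - (u + (1 * a + -(p * x * b)) * b) *
          (p * x * u + (1 * a + -(p * x * b)) * a)⁻¹ / p =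
            x * u ^ 2 / a ^ 2 / (p * x * u + (1 * a + -(p * x * b)) * a) := by
          generalize hD : p * x * u + (1 * a + -(p * x * b)) * a = D at hd0 ⊢
          field_simp
          rw [← hD]; ring
        rw [this]
        refine norm_div_le_one (norm_div_le_one (norm_mul_le_one hx (by simp [hu1])) (by simp [ha1])) hd
      · simp only [div_eq_mul_inv]
    · intro x b u hx hb _
      refine ⟨by simp, ?_⟩
      rw [norm_neg, mul_assoc]
      exact (norm_p_mul_lt (norm_mul_le_one hx hb)).le
  have h3 : mean4 p (fun x a b u => chi χ a * chi χ b * (oneU p u *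
      (oneU p (x * u + a * (a + x * b)) * unitVal Φ x a b u))) =
      mean4 p (fun x a b u => oneU p x * (chi χ a * chi χ b * (oneU p u *
      (oneU p (x * u + a * (a + x * b)) * unitVal Φ x a b u)))) +
      mean4 p (fun x a b u => oneP p x * (chi χ a * chi χ b * (oneU p u *
      (oneU p (x * u + a * (a + x * b)) * unitVal Φ x a b u)))) := by
    rw [← mean4_add (by unfold Continuous4; fun_prop) (by unfold Continuous4; fun_prop)]
    refine mean4_congr fun x a b u hx _ _ _ => ?_
    rw [← add_mul, oneU_add_oneP hx, one_mul]
  rw [h1, h2, h3, mean4_oneP_fst, mul_add, ← mul_assoc (p : ℂ) (p : ℂ)⁻¹, mul_inv_cancel₀ hp', one_mul]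

/-- With u + ab = pm one has d = a² + pxm, automatically a unit, and the last entry of the symmetric
block is m/d, an integer that may be dropped. The substitutions make u = -b⁻¹ and s = xb⁻¹, and m
becomes a dummy. -/
lemma mean_unitVal_p (hΦ : IsSpherical Φ) (hq : χ.IsQuadratic) (hc : HasConductorP χ) :
    (p : ℂ) * mean4 p (fun x a b u => chi χ a * chi χ b * (oneU p u *
      (oneU p (x * u + a * (a + x * b)) * (oneP p (u + a * b) * unitVal Φ x a b u)))) =
      meanT5 Φ χ := by
  have hΦc := hΦ.continuous
  have hχc := continuous_chi hc
  have hp := p_ne_zero p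
  have hp' : (p : ℂ) ≠ 0 := by exact_mod_cast (Fact.out : p.Prime).ne_zero
  have h1 : mean4 p (fun x a b u => chi χ a * chi χ b * (oneU p u *
      (oneU p (x * u + a * (a + x * b)) * (oneP p (u + a * b) * unitVal Φ x a b u)))) =
      (p : ℂ)⁻¹ * mean4 p fun x a b m => chi χ a * chi χ b * (oneU p (p * m - a * b) *
      (oneU p (x * (p * m - a * b) + a * (a + x * b)) * unitVal Φ x a b (p * m - a * b))) := by
    rw [← mean4_oneP (F := fun x a b m => chi χ a * chi χ b * (oneU p (m - a * b) *
      (oneU p (x * (m - a * b) + a * (a + x * b)) * unitVal Φ x a b (m - a * b))))]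
    refine (mean4_affine (fun _ _ _ => 1) (fun x a b => -(a * b)) ?_).trans ?_
    · intro x a b _ ha hb
      exact ⟨by simp, by simpa using norm_mul_le_one ha hb⟩
    refine mean4_congr fun x a b m _ _ _ _ => ?_
    rw [one_mul, neg_add_cancel_right, ← sub_eq_add_neg]
    ring
  rw [h1, meanT5, ← mul_assoc, mul_inv_cancel₀ hp', one_mul]
  refine (mean4_comm24 (by unfold Continuous4; fun_prop)).trans ?_
  refine (mean4_affine (fun x b m => -uinv p b) (fun x b m => uinv p b * (p * m)) ?_).trans ?_
  · intro x b m _ _ hm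
    exact ⟨by simp, norm_mul_le_one (by simp) (norm_p_mul_lt hm).le⟩
  refine (mean4_flip (fun x b m => -1) (by simp)).trans ?_
  refine (mean4_comm24 (by unfold Continuous4; fun_prop)).trans ?_
  refine (mean4_mul (fun x m b => -uinv p b) (by simp)).trans ?_
  refine (mean4_comm14 (by unfold Continuous4; fun_prop)).trans ?_
  refine (mean4_affine (fun m b a => -uinv p a)
    (fun m b a => -((p * m + uinv p b) * (uval p b * uinv p a) ^ 2)) ?_).trans ?_
  · intro m b a hm _ _
    refine ⟨by simp, ?_⟩
    rw [norm_neg]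
    exact norm_mul_le_one (norm_add_le_one (norm_p_mul_lt hm).le (by simp)) (by simp)
  refine (mean4_comm24 (by unfold Continuous4; fun_prop)).trans ?_
  refine (mean4_comm34 (by unfold Continuous4; fun_prop)).trans ?_
  refine mean4_congr fun m a b x hm ha hb hx => ?_
  by_cases ha1 : ‖a‖ = 1; swap
  · rw [oneU_of_ne ha1, chi_of_ne (x := -uinv p b * a) (by simpa using ha1)]; ring
  have ha0 := ne_zero_of_norm_one ha1
  rw [uinv_of (x := -uinv p b * a) (by simpa using ha1)]
  by_cases hb1 : ‖b‖ = 1; swap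
  · rw [chi_of_ne hb1, oneU_of_ne (x := _ - _)]; · ring
    have h0 : uinv p b ≠ 0 := ne_zero_of_norm_one (by simp)
    have : (p : ℚ_[p]) * m - (-(-uinv p b * a)⁻¹ * (-1 * uflip p b) + (-uinv p b * a)⁻¹ * (p * m)) *
      (-uinv p b * a) = -uflip p b := by field_simp; ring
    rw [this]; simpa using hb1
  have hb0 := ne_zero_of_norm_one hb1
  rw [uflip_of hb1, uinv_of hb1, uinv_of ha1, uval_of hb1]
  set b' := -b⁻¹ * a with hb'
  set a' := -b'⁻¹ * (-1 * b⁻¹) + b'⁻¹ * (p * m) with ha'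
  set x' := -a⁻¹ * x + -((p * m + b⁻¹) * (b * a⁻¹) ^ 2) with hx'
  have hab : a' * b' = p * m + b⁻¹ := by
    rw [ha', hb']; field_simp; ring
  have hu : p * m - a' * b' = -b⁻¹ := by rw [hab]; ring
  have hnb : ‖b'‖ = 1 := by simp [hb', hb1, ha1]
  have hna : ‖a'‖ = 1 := by
    have : ‖a' * b'‖ = 1 := by
      rw [hab, add_comm]; exact (norm_add_p_mul hm).mpr (by simp [hb1])
    simpa [hnb] using this
  have hnx : ‖x'‖ ≤ 1 := by
    refine norm_add_le_one (norm_mul_le_one (by simp [ha1]) hx) ?_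
    rw [norm_neg]
    exact norm_mul_le_one (norm_add_le_one (norm_p_mul_lt hm).le (by simp [hb1]))
      (by simp [hb1, ha1])
  have hχ : chi χ a' * chi χ b' = chi χ b := by
    rw [← chi_unit_mul hna, hab, add_comm, chi_add_p_mul χ hc hm]
    exact chi_eq_of_sq hq (c := b⁻¹) (by simp [hb1]) (by field_simp)
  have hs : a' + x' * b' = x * b⁻¹ := by
    have : a' = (p * m + b⁻¹) / b' := by
      rw [← hab]; field_simp [ne_zero_of_norm_one hnb]
    rw [this, hx', hb']; field_simp; ring
  have hd : ‖x' * (p * m - a' * b') + a' * (a' + x' * b')‖ = 1 := by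
    have : x' * (p * m - a' * b') + a' * (a' + x' * b') = a' ^ 2 + p * (x' * m) := by ring
    rw [this]
    exact (norm_add_p_mul (norm_mul_le_one hnx hm)).mpr (by simp [hna])
  rw [hχ, oneU_of hd, unitVal, uinv_of hd, hu, hs, oneU_of (by simp [hb1]), oneU_of ha1, one_mul,
    one_mul, uinv_of (by simp [hb1])]
  congr 1
  · ring
  rw [hu, hs] at hd
  refine (hΦ.upper_congr _ _ (x' := (b - a * x) / p ^ 3) (y' := a / p ^ 2) (z' := 0) ?_ ?_ ?_).trans ?_
  · rw [hb']
    have : (x * b⁻¹ * (-b⁻¹ * a) * (-b⁻¹)⁻¹ - 1) * (-b⁻¹)⁻¹ / p ^ 3 - (b - a * x) / p ^ 3 = 0 := by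
      field_simp; ring
    rw [this]; simp
  · rw [hb']
    have : -b⁻¹ * a * (-b⁻¹)⁻¹ / p ^ 2 - a / p ^ 2 = 0 := by field_simp; ring
    rw [this]; simp
  · have : (-b⁻¹ + a' * b') * (x' * -b⁻¹ + a' * (x * b⁻¹))⁻¹ / p - 0 =
      m / (x' * -b⁻¹ + a' * (x * b⁻¹)) := by
      rw [hab]; field_simp; ring
    rw [this]
    exact norm_div_le_one hm hd
  · congr 2
    field_simp
end UnitPart

/-! ### Cosets with prefix η': T² and T³ -/

section UnitUnitPart
variable {p : ℕ} [Fact p.Prime] {Φ : GSp4 p → ℂ} {χ : MulChar ℚ_[p] ℂ}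

/-- First s replaces x. Then u + ab = ab/(1 - y) and s = ay/x, which gives u = aby/(1 - y) and d =
a²y(1 - x)/((1 - y)x). The four unit conditions thus become the conditions that x, y, 1 - x, 1 - y
be units, and inverting a and b brings the entries to the form in T². -/
lemma mean_unitVal_unit_unit (hΦ : IsSpherical Φ) (hq : χ.IsQuadratic) (hc : HasConductorP χ) :
    (p : ℂ) * mean4 p (fun x a b u => chi χ a * chi χ b * (oneU p u *
      (oneU p (x * u + a * (a + x * b)) * (oneU p (u + a * b) * (oneU p (a + x * b) *
        unitVal Φ x a b u))))) = meanT2 Φ χ := by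
  have hΦc := hΦ.continuous
  have hχc := continuous_chi hc
  have hp := p_ne_zero p
  unfold meanT2
  congr 1
  refine (mean4_comm14 (by unfold Continuous4; fun_prop)).trans ?_
  refine (mean4_affine (fun a b u => uinv p b) (fun a b u => -(uinv p b * a)) ?_).trans ?_
  · intro a b u ha _ _
    exact ⟨by simp, by rw [norm_neg]; exact norm_mul_le_one (by simp) ha⟩
  refine (mean4_comm34 (by unfold Continuous4; fun_prop)).trans ?_
  refine (mean4_affine (fun a b s => uval p a * uval p b) (fun a b s => -(uval p a * uval p b))
    (by simp)).trans ?_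
  refine (mean4_flip (fun a b s => 1) (by simp)).trans ?_
  refine (mean4_affine (fun a b s => -1) (fun a b s => 1) (by simp)).trans ?_
  refine (mean4_comm34 (by unfold Continuous4; fun_prop)).trans ?_
  refine (mean4_flip (fun a b y => uval p a * uval p y) (by simp)).trans ?_
  refine (mean4_comm14 (by unfold Continuous4; fun_prop)).trans ?_
  refine (mean4_flip (fun b y x => -(uinv p y * uval p (1 - y))) (by simp)).trans ?_
  refine (mean4_comm14 (by unfold Continuous4; fun_prop)).trans ?_
  refine (mean4_flip (fun y x a => -(uval p (1 - y) * uinv p x)) (by simp)).trans ?_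
  refine (mean4_comm24 (by unfold Continuous4; fun_prop)).trans ?_
  refine (mean4_comm14 (by unfold Continuous4; fun_prop)).trans ?_
  refine mean4_congr fun a b x y ha hb hx hy => ?_
  by_cases ha1 : ‖a‖ = 1; swap
  · rw [chi_of_ne ha1, chi_of_ne (x := _ * uflip p a) (by simpa using ha1)]; ring
  by_cases hb1 : ‖b‖ = 1; swap
  · rw [chi_of_ne hb1, chi_of_ne (x := _ * uflip p b) (by simpa using hb1)]; ring
  have ha0 := ne_zero_of_norm_one ha1
  have hb0 := ne_zero_of_norm_one hb1
  have hna : ‖-(uinv p y * uval p (1 - y)) * uflip p a‖ = 1 := by simpa using ha1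
  have hnb : ‖-(uval p (1 - y) * uinv p x) * uflip p b‖ = 1 := by simpa using hb1
  rw [uval_of hna, uval_of hnb, uinv_of hnb]
  set a' := -(uinv p y * uval p (1 - y)) * uflip p a with ha'
  set b' := -(uval p (1 - y) * uinv p x) * uflip p b with hb'
  have ha'0 := ne_zero_of_norm_one hna
  have hb'0 := ne_zero_of_norm_one hnb
  have hs : a' + (b'⁻¹ * (a' * uval p y * uflip p x) + -(b'⁻¹ * a')) * b' = a' * uval p y * uflip p x := by
    field_simp; ring
  rw [unitVal, hs]
  by_cases hx1 : ‖x‖ = 1; swap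
  · rw [chi_of_ne hx1, oneU_of_ne (x := a' * uval p y * uflip p x) (by simpa [hna] using hx1)]; ring
  have hx0 := ne_zero_of_norm_one hx1
  have e1 : -1 * y + 1 = 1 - y := by ring
  by_cases hy2 : ‖1 - y‖ = 1; swap
  · rw [oneU_of_ne hy2, oneU_of_ne (x := _ + a' * b')]; · ring
    rw [e1, one_mul, neg_add_cancel_right, norm_mul, norm_mul, hna, hnb]
    simpa using hy2
  have hy3 := ne_zero_of_norm_one hy2
  rw [e1, one_mul, uflip_of hy2, uflip_of hx1]
  have hu : a' * b' * (1 - y)⁻¹ + -(a' * b') = a' * b' * y * (1 - y)⁻¹ := by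
    field_simp; ring
  rw [hu]
  by_cases hy1 : ‖y‖ = 1; swap
  · rw [chi_of_ne hy1, oneU_of_ne (x := a' * b' * y * _) (by simpa [hna, hnb, hy2] using hy1)]; ring
  have hy0 := ne_zero_of_norm_one hy1
  rw [uval_of hy1]
  rw [uinv_of hy1, uval_of hy2, uflip_of ha1] at ha'
  rw [uinv_of hx1, uval_of hy2, uflip_of hb1] at hb'
  have hw : a' * b' * y * (1 - y)⁻¹ + a' * b' = a' * b' * (1 - y)⁻¹ := by
    field_simp; ring
  have hd : (b'⁻¹ * (a' * y * x⁻¹) + -(b'⁻¹ * a')) * (a' * b' * y * (1 - y)⁻¹) +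
      a' * (a' * y * x⁻¹) = a' ^ 2 * y * (1 - x) * (1 - y)⁻¹ * x⁻¹ := by
    field_simp; ring
  have hnu : ‖a' * b' * y * (1 - y)⁻¹‖ = 1 := by simp [hna, hnb, hy1, hy2]
  rw [hw, hd, oneU_of hnu, uinv_of hnu, oneU_of (x := a' * y * x⁻¹) (by simp [hna, hy1, hx1]),
    oneU_of (x := a' * b' * (1 - y)⁻¹) (by simp [hna, hnb, hy2])]
  by_cases hx2 : ‖1 - x‖ = 1; swap
  · rw [oneU_of_ne hx2, oneU_of_ne (x := a' ^ 2 * _ * _ * _ * _)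
      (by simpa [hna, hy1, hy2, hx1] using hx2)]; ring
  have hx3 := ne_zero_of_norm_one hx2
  have hnd : ‖a' ^ 2 * y * (1 - x) * (1 - y)⁻¹ * x⁻¹‖ = 1 := by simp [hna, hy1, hy2, hx1, hx2]
  rw [oneU_of hnd, uinv_of hnd, oneU_of hx2, oneU_of hy2, uinv_of hx2, uinv_of hy2, uinv_of hb1]
  have hχ : chi χ a' * chi χ b' = chi χ a * chi χ b * chi χ x * chi χ y := by
    rw [← chi_unit_mul hna, ← chi_unit_mul ha1, ← chi_unit_mul (by simp [ha1, hb1]),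
      ← chi_unit_mul (by simp [ha1, hb1, hx1])]
    refine chi_eq_of_sq hq (c := (1 - y) * (x * a * b * y)⁻¹)
      (by simp [hx1, ha1, hb1, hy2, hy1]) ?_
    rw [ha', hb']; field_simp
  rw [hχ]
  simp only [mul_one, one_mul, mul_assoc]
  congr 6
  all_goals (simp only [ha', hb']; field_simp; try ring)

/-- For s divisible by p, d is congruent to -ua/b and so is a unit, and the Levi parameter -s/(up)
is integral. Removing that parameter conjugates the symmetric block and disturbs its entries by
non-integral amounts; rescaling a and b by units congruent to 1 modulo p compensates this. The
parametrization u + ab = abz accounts for the conditions on z and 1 - z. -/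
lemma mean_unitVal_unit_p (hΦ : IsSpherical Φ) (hq : χ.IsQuadratic) (hc : HasConductorP χ) :
    (p : ℂ) * mean4 p (fun x a b u => chi χ a * chi χ b * (oneU p u *
      (oneU p (x * u + a * (a + x * b)) * (oneU p (u + a * b) * (oneP p (a + x * b) *
        unitVal Φ x a b u))))) = meanT3 Φ χ := by
  have hΦc := hΦ.continuous
  have hχc := continuous_chi hc
  have hp := p_ne_zero p
  have hp' : (p : ℂ) ≠ 0 := by exact_mod_cast (Fact.out : p.Prime).ne_zero
  have h1 : mean4 p (fun x a b u => chi χ a * chi χ b * (oneU p u *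
      (oneU p (x * u + a * (a + x * b)) * (oneU p (u + a * b) * (oneP p (a + x * b) *
        unitVal Φ x a b u))))) = (p : ℂ)⁻¹ * mean4 p fun a b u s => chi χ a * chi χ b * (oneU p u *
      (oneU p (u + a * b) * unitVal Φ (uinv p b * (p * s - a)) a b u)) := by
    rw [← mean4_oneP (F := fun a b u s => chi χ a * chi χ b * (oneU p u *
      (oneU p (u + a * b) * unitVal Φ (uinv p b * (s - a)) a b u)))]
    refine (mean4_comm14 (by unfold Continuous4; fun_prop)).trans ?_
    refine (mean4_affine (fun a b u => uinv p b) (fun a b u => -(uinv p b * a)) ?_).trans ?_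
    · intro a b u ha _ _
      exact ⟨by simp, by rw [norm_neg]; exact norm_mul_le_one (by simp) ha⟩
    refine mean4_congr fun a b u s ha hb hu hs => ?_
    by_cases ha1 : ‖a‖ = 1; swap
    · rw [chi_of_ne ha1]; ring
    by_cases hb1 : ‖b‖ = 1; swap
    · rw [chi_of_ne hb1]; ring
    by_cases hu1 : ‖u‖ = 1; swap
    · rw [oneU_of_ne hu1]; ring
    have ha0 := ne_zero_of_norm_one ha1
    have hb0 := ne_zero_of_norm_one hb1
    have hu0 := ne_zero_of_norm_one hu1
    rw [uinv_of hb1]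
    have es : a + (b⁻¹ * s + -(b⁻¹ * a)) * b = s := by field_simp; ring
    rw [es, ← mul_neg, ← mul_add, ← sub_eq_add_neg]
    by_cases hs1 : ‖s‖ < 1; swap
    · rw [oneP_of_not hs1]; ring
    have hd : ‖b⁻¹ * (s - a) * u + a * s‖ = 1 := by
      have e : b⁻¹ * (s - a) * u + a * s = -(b⁻¹ * a * u) + p * ((b⁻¹ * u + a) * (s / p)) := by
        field_simp; ring
      rw [e]
      refine (norm_add_p_mul (norm_mul_le_one (norm_add_le_one (by simp [hb1, hu1]) ha)
        (norm_le_inv_p_of_lt_one hs1))).mpr ?_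
      simp [hb1, ha1, hu1]
    rw [oneU_of hd]; ring
  rw [h1, meanT3, ← mul_assoc, mul_inv_cancel₀ hp', one_mul]
  refine (mean4_comm34 (by unfold Continuous4; fun_prop)).trans ?_
  refine (mean4_affine (fun a b s => uval p a * uval p b) (fun a b s => -(uval p a * uval p b))
    (by simp)).trans ?_
  refine (mean4_comm14 (by unfold Continuous4; fun_prop)).trans ?_
  refine (mean4_flip (fun b s z => -(uinv p b * uinv p (z - 1))) (by simp)).trans ?_
  refine (mean4_comm24 (by unfold Continuous4; fun_prop)).trans ?_
  refine (mean4_mul (fun b z c => -(uinv p b * uinv p c)) (by simp)).trans ?_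
  refine (mean4_comm34 (by unfold Continuous4; fun_prop)).trans ?_
  -- This factor, called D below, is what conjugation by the integral Levi element does to the first
  -- entry of the symmetric block; E = 1 + pθz, combined with D in the next scaling, plays the same
  -- role for the off-diagonal entry.
  refine (mean4_mul (fun b z t => uinv p (1 + p * (t + p * (t ^ 2 * z)))) (by simp)).trans ?_
  refine (mean4_comm14 (by unfold Continuous4; fun_prop)).trans ?_
  refine (mean4_mul (fun z t b => -(uinv p b * uval p (1 + p * (t + p * (t ^ 2 * z))) *
    uinv p (1 + p * (t * z)))) (by simp)).trans ?_
  refine (mean4_comm14 (by unfold Continuous4; fun_prop)).trans ?_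
  refine (mean4_comm24 (by unfold Continuous4; fun_prop)).trans ?_
  refine (mean4_comm34 (by unfold Continuous4; fun_prop)).trans ?_
  refine mean4_congr fun θ a b z hθ ha hb hz => ?_
  have hD : ‖1 + p * (θ + p * (θ ^ 2 * z))‖ = 1 := by
    refine (norm_add_p_mul (norm_add_le_one hθ (norm_p_mul_lt (norm_mul_le_one ?_ hz)).le)).mpr
      norm_one
    rw [norm_pow]; exact pow_le_one₀ (norm_nonneg _) hθ
  have hE : ‖1 + p * (θ * z)‖ = 1 :=
    (norm_add_p_mul (norm_mul_le_one hθ hz)).mpr norm_one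
  have hD0 := ne_zero_of_norm_one hD
  have hE0 := ne_zero_of_norm_one hE
  rw [uval_of hD, uinv_of hD, uinv_of hE]
  by_cases hb1 : ‖b‖ = 1; swap
  · rw [chi_of_ne hb1, chi_of_ne (x := _ * uflip p _) (by simpa [hD] using hb1)]; ring
  by_cases ha1 : ‖a‖ = 1; swap
  · rw [oneU_of_ne ha1, chi_of_ne (x := _ * a) (by simpa [hD, hE] using ha1)]; ring
  have ha0 := ne_zero_of_norm_one ha1
  have hb0 := ne_zero_of_norm_one hb1
  generalize hDd : 1 + p * (θ + p * (θ ^ 2 * z)) = D at *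
  generalize hEd : 1 + p * (θ * z) = E at *
  rw [uinv_of hb1, uflip_of (x := D⁻¹ * b) (by simp [hD, hb1]), uinv_of (x := D⁻¹ * b) (by simp [hD, hb1])]
  set b' := -(b⁻¹ * D * E⁻¹) * a with hb'
  have hnb : ‖b'‖ = 1 := by simp [hb', hb1, ha1, hD, hE]
  have hb'0 := ne_zero_of_norm_one hnb
  rw [uinv_of hnb]
  set a' := -(b'⁻¹ * uinv p (z - 1)) * (D⁻¹ * b)⁻¹ with ha'
  have hna : ‖a'‖ = 1 := by simp [ha', hb1, hD, hnb]
  have ha'0 := ne_zero_of_norm_one hna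
  rw [uval_of hna, uval_of hnb]
  have hw : a' * b' * z + -(a' * b') + a' * b' = a' * b' * z := by ring
  have hu : a' * b' * z + -(a' * b') = a' * b' * (z - 1) := by ring
  rw [hw, hu]
  by_cases hz1 : ‖z‖ = 1; swap
  · rw [oneU_of_ne hz1, oneU_of_ne (x := a' * b' * z) (by simpa [hna, hnb] using hz1)]; ring
  by_cases hz2 : ‖1 - z‖ = 1; swap
  · rw [chi_of_ne hz2, oneU_of_ne (x := a' * b' * (z - 1))]; · ring
    rw [norm_mul, norm_mul, hna, hnb, norm_sub_rev]; simpa using hz2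
  have hz3 : ‖z - 1‖ = 1 := by rw [norm_sub_rev]; exact hz2
  have hz0 := ne_zero_of_norm_one hz1
  have hz4 := ne_zero_of_norm_one hz3
  rw [uinv_of hz3] at ha'
  have hu2 : a' * b' * (z - 1) = -(D / b) := by
    rw [ha']; field_simp
  have hnu : ‖-(D / b)‖ = 1 := by simp [hD, hb1]
  have hχ : chi χ a' * chi χ b' = chi χ b * chi χ (1 - z) := by
    rw [← chi_unit_mul hna, ← chi_unit_mul hb1]
    have e1 : a' * b' = b⁻¹ * (1 - z)⁻¹ * D := by
      have := ne_zero_of_norm_one hz2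
      rw [ha']; field_simp; ring
    rw [e1, ← hDd, mul_add, mul_one, mul_left_comm, chi_add_p_mul χ hc]
    · exact chi_eq_of_sq hq (c := b⁻¹ * (1 - z)⁻¹) (by simp [hb1, hz2])
        (by have := ne_zero_of_norm_one hz2; field_simp)
    · refine norm_mul_le_one (by simp [hb1, hz2]) (norm_add_le_one hθ (norm_p_mul_lt
        (norm_mul_le_one ?_ hz)).le)
      rw [norm_pow]; exact pow_le_one₀ (norm_nonneg _) hθ
  rw [hχ, hu2, oneU_of hnu, oneU_of hz1, oneU_of (x := a' * b' * z) (by simp [hna, hnb, hz1]),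
    oneU_of ha1]
  set s := -(b'⁻¹ * (D⁻¹ * b)⁻¹) * θ with hs
  have hns : ‖s‖ ≤ 1 := by
    rw [hs]; exact norm_mul_le_one (by simp [hnb, hD, hb1]) hθ
  have es : a' + b'⁻¹ * (p * s - a') * b' = p * s := by field_simp; ring
  have hd : ‖b'⁻¹ * (p * s - a') * -(D / b) + a' * (p * s)‖ = 1 := by
    have e : b'⁻¹ * (p * s - a') * -(D / b) + a' * (p * s) =
      b'⁻¹ * a' * (D / b) + p * (s * (a' - b'⁻¹ * (D / b))) := by ring
    rw [e]
    refine (norm_add_p_mul (norm_mul_le_one hns (norm_sub_le_one hna.le ?_))).mpr ?_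
    · simp [hnb, hD, hb1]
    · simp [hna, hnb, hD, hb1]
  have hd0 := ne_zero_of_norm_one hd
  rw [unitVal, es, uinv_of hnu, uinv_of hd]
  generalize hΔ : b'⁻¹ * (p * s - a') * -(D / b) + a' * (p * s) = Δ at *
  -- Leading term plus p times an integer: divided by p, the second summand is integral, and it
  -- stays so after the conjugation.
  have hζ : (-(D / b) + a' * b') * Δ⁻¹ = b' ^ 2 * b * z / D +
      p * (s * b' ^ 2 * z * (b'⁻¹ * -(D / b) + a') / -(D / b) / Δ) := by
    have e : -(D / b) + a' * b' = a' * b' * z := by rw [← hu2]; ring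
    rw [e]
    field_simp
    rw [← hΔ]; field_simp; ring
  have hnq : ‖s * b' ^ 2 * z * (b'⁻¹ * -(D / b) + a') / -(D / b) / Δ‖ ≤ 1 := by
    refine norm_div_le_one (norm_div_le_one (norm_mul_le_one (norm_mul_le_one
      (norm_mul_le_one hns (by simp [hnb])) hz) (norm_add_le_one ?_ hna.le)) hnu) hd
    simp [hnb, hD, hb1]
  rw [hζ]
  generalize s * b' ^ 2 * z * (b'⁻¹ * -(D / b) + a') / -(D / b) / Δ = q at *
  have ht : -(p * s) * (-(D / b))⁻¹ / p = 0 + -(θ / b') := by rw [hs]; field_simp; ring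
  have hnt : ‖-(θ / b')‖ ≤ 1 := by rw [norm_neg]; exact norm_div_le_one hθ hnb
  rw [ht, hΦ.upper_levi 1 0 hnt]
  simp only [one_mul]
  congr 1
  refine hΦ.upper_congr _ _ ?_ ?_ ?_
  · have e : (p * s * b' * (-(D / b))⁻¹ - 1) * (-(D / b))⁻¹ / p ^ 3 +
        2 * -(θ / b') * (b' * (-(D / b))⁻¹ / p ^ 2) +
        (-(θ / b')) ^ 2 * ((b' ^ 2 * b * z / D + p * q) / p) - b / p ^ 3 = (θ / b') ^ 2 * q := by
      rw [hs]; field_simp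
      rw [← hDd]; ring
    rw [e]
    exact norm_mul_le_one (by rw [norm_pow]; exact pow_le_one₀ (norm_nonneg _) (by simpa using hnt)) hnq
  · have e : b' * (-(D / b))⁻¹ / p ^ 2 + -(θ / b') * ((b' ^ 2 * b * z / D + p * q) / p) - a / p ^ 2 =
        -(θ / b') * q := by
      rw [hb']; field_simp
      rw [← hEd]; ring
    rw [e]
    exact norm_mul_le_one hnt hnq
  · have e : (b' ^ 2 * b * z / D + p * q) / p - a ^ 2 * b⁻¹ * z / p =
        q - a ^ 2 * b⁻¹ * z * (2 * θ * z + p * (θ ^ 2 * z ^ 2) - θ - p * (θ ^ 2 * z)) / E ^ 2 := by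
      rw [hb']; field_simp
      rw [← hDd, ← hEd]; ring
    rw [e]
    have hθ2 : ‖θ ^ 2‖ ≤ 1 := by rw [norm_pow]; exact pow_le_one₀ (norm_nonneg _) hθ
    refine norm_sub_le_one hnq (norm_div_le_one (norm_mul_le_one (norm_mul_le_one
      (by simp [ha1, hb1]) hz) ?_) (by simp [hE]))
    refine norm_sub_le_one (norm_sub_le_one (norm_add_le_one (norm_mul_le_one (norm_mul_le_one ?_ hθ)
      hz) (norm_p_mul_lt (norm_mul_le_one hθ2 (by simp [hz1]))).le) hθ)
      (norm_p_mul_lt (norm_mul_le_one hθ2 hz)).le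
    exact_mod_cast Padic.norm_int_le_one 2

end UnitUnitPart

/-! ### Cosets with prefix η'τ': T⁸ -/

section SingularPart
variable {p : ℕ} [Fact p.Prime] {Φ : GSp4 p → ℂ} {χ : MulChar ℚ_[p] ℂ}

lemma norm_lt_one_of_ne {x : ℚ_[p]} (h : ‖x‖ ≤ 1) (h1 : ‖x‖ ≠ 1) : ‖x‖ < 1 := lt_of_le_of_ne h h1

lemma norm_sub_ne_one {x y : ℚ_[p]} (hx : ‖x‖ < 1) (hy : ‖y‖ < 1) : ‖x - y‖ ≠ 1 := by
  rw [sub_eq_add_neg]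
  exact ((IsUltrametricDist.norm_add_le_max _ _).trans_lt (max_lt hx (by rwa [norm_neg]))).ne

lemma norm_mul_lt_one {x y : ℚ_[p]} (hx : ‖x‖ < 1) (hy : ‖y‖ ≤ 1) : ‖x * y‖ < 1 := by
  rw [norm_mul]; exact mul_lt_one_of_nonneg_of_lt_one_left (norm_nonneg _) hx hy

/-- The condition d ∈ pℤ_p is solved for u, at the cost of 1/p. Then s replaces x, and with s - a =
(s² - pd)/(s(1 - z)) one finds u = zsb exactly, so the coset depends on s, b and z but not on d.
Inverting s and b, with factors of z, gives the entries of T⁸. -/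
lemma mean_t4_unit_p (hΦ : IsSpherical Φ) (hq : χ.IsQuadratic) (hc : HasConductorP χ) :
    (p : ℂ) * mean4 p (fun x a b u => oneU p x * (chi χ a * chi χ b * (oneU p u *
      (oneP p (x * u + a * (a + x * b)) * Φ (t4 p * upper p 0 0 (-(a + x * b) / p)
        ((u + (a + x * b) * b) / p ^ 3) (b / p ^ 2) (uinv p x / p)))))) = meanT8 Φ χ := by
  have hΦc := hΦ.continuous
  have hχc := continuous_chi hc
  have hp := p_ne_zero p
  have hp' : (p : ℂ) ≠ 0 := by exact_mod_cast (Fact.out : p.Prime).ne_zero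
  have h1 : mean4 p (fun x a b u => oneU p x * (chi χ a * chi χ b * (oneU p u *
      (oneP p (x * u + a * (a + x * b)) * Φ (t4 p * upper p 0 0 (-(a + x * b) / p)
        ((u + (a + x * b) * b) / p ^ 3) (b / p ^ 2) (uinv p x / p)))))) =
      (p : ℂ)⁻¹ * mean4 p fun x a b d => oneU p x * (chi χ a * chi χ b *
        (oneU p (uinv p x * (p * d - a * (a + x * b))) * Φ (t4 p * upper p 0 0 (-(a + x * b) / p)
        ((uinv p x * (p * d - a * (a + x * b)) + (a + x * b) * b) / p ^ 3) (b / p ^ 2)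
          (uinv p x / p)))) := by
    rw [← mean4_oneP (F := fun x a b d => oneU p x * (chi χ a * chi χ b *
        (oneU p (uinv p x * (d - a * (a + x * b))) * Φ (t4 p * upper p 0 0 (-(a + x * b) / p)
        ((uinv p x * (d - a * (a + x * b)) + (a + x * b) * b) / p ^ 3) (b / p ^ 2)
          (uinv p x / p)))))]
    refine (mean4_affine (fun x _ _ => uinv p x)
      (fun x a b => -(uinv p x * (a * (a + x * b)))) ?_).trans ?_
    · intro x a b hx ha hb
      refine ⟨by simp, ?_⟩
      rw [norm_neg]
      exact norm_mul_le_one (by simp) (norm_mul_le_one ha (norm_add_le_one ha (norm_mul_le_one hx hb)))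
    refine mean4_congr fun x a b d _ _ _ _ => ?_
    by_cases hx1 : ‖x‖ = 1; swap
    · rw [oneU_of_ne hx1]; ring
    have hx0 := ne_zero_of_norm_one hx1
    have e : uinv p x * d + -(uinv p x * (a * (a + x * b))) = uinv p x * (d - a * (a + x * b)) := by
      ring
    have e2 : x * (uinv p x * (d - a * (a + x * b))) + a * (a + x * b) = d := by
      rw [uinv_of hx1]; field_simp; ring
    rw [e, e2]; ring
  rw [h1, meanT8, ← mul_assoc, mul_inv_cancel₀ hp', one_mul]
  refine (mean4_comm14 (by unfold Continuous4; fun_prop)).trans ?_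
  refine (mean4_affine (fun a b d => uinv p b) (fun a b d => -(uinv p b * a)) ?_).trans ?_
  · intro a b u ha _ _
    exact ⟨by simp, by rw [norm_neg]; exact norm_mul_le_one (by simp) ha⟩
  refine (mean4_comm14 (by unfold Continuous4; fun_prop)).trans ?_
  refine (mean4_affine (fun b d s => -1) (fun b d s => s) (fun _ _ _ _ _ h => ⟨by simp, h⟩)).trans ?_
  refine (mean4_flip (fun b d s => uinv p s * uval p (s ^ 2 - p * d)) (by simp)).trans ?_
  refine (mean4_affine (fun b d s => -1) (fun b d s => 1) (by simp)).trans ?_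
  refine (mean4_comm14 (by unfold Continuous4; fun_prop)).trans ?_
  refine (mean4_flip (fun d s z => -uinv p z) (by simp)).trans ?_
  refine (mean4_comm24 (by unfold Continuous4; fun_prop)).trans ?_
  refine (mean4_flip (fun d z b => uinv p z) (by simp)).trans ?_
  refine (mean4_comm24 (by unfold Continuous4; fun_prop)).trans ?_
  refine (mean4_comm24 (by unfold Continuous4; fun_prop)).trans ?_
  refine (mean4_comm34 (by unfold Continuous4; fun_prop)).trans ?_
  refine mean4_congr fun d a b z hd ha hb hz => ?_
  by_cases hb1 : ‖b‖ = 1; swap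
  · rw [chi_of_ne hb1, chi_of_ne (x := _ * uflip p b) (by simpa using hb1)]; ring
  have hb0 := ne_zero_of_norm_one hb1
  have hnb : ‖-uinv p z * uflip p b‖ = 1 := by simpa using hb1
  rw [uinv_of hnb]
  set b' := -uinv p z * uflip p b with hb'
  have hb'0 := ne_zero_of_norm_one hnb
  set s := uinv p z * uflip p a with hs
  have e1 : -1 * z + 1 = 1 - z := by ring
  rw [e1]
  set a' := -1 * (uinv p s * uval p (s ^ 2 - p * d) * uflip p (1 - z)) + s with ha'
  set x' := b'⁻¹ * s + -(b'⁻¹ * a') with hx'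
  have es : a' + x' * b' = s := by rw [hx']; field_simp; ring
  rw [es]
  have hns : ‖s‖ ≤ 1 := by rw [hs, norm_mul, norm_uinv, norm_uflip, one_mul]; exact ha
  have hna' : ‖a'‖ ≤ 1 := by
    refine norm_add_le_one ?_ hns
    simpa using norm_sub_le_one (by simp) hz
  by_cases ha1 : ‖a‖ = 1; swap
  · have hs1 : ‖s‖ < 1 := by
      rw [hs, norm_mul, norm_uinv, norm_uflip, one_mul]; exact norm_lt_one_of_ne ha ha1
    -- If s is not a unit, then neither is pd - as, so the unit condition on u fails.
    rw [chi_of_ne ha1, oneU_of_ne (x := uinv p x' * _)]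
    · ring
    rw [norm_mul, norm_uinv, one_mul, mul_comm a']
    exact norm_sub_ne_one (norm_p_mul_lt hd) (norm_mul_lt_one hs1 hna')
  have hs1 : ‖s‖ = 1 := by simpa [hs] using ha1
  have hs0 := ne_zero_of_norm_one hs1
  have hsd : ‖s ^ 2 - p * d‖ = 1 := (norm_sub_p_mul hd).mpr (by simp [hs1])
  have hsd0 := ne_zero_of_norm_one hsd
  have hxe : x' = b'⁻¹ * (s⁻¹ * (s ^ 2 - p * d) * uflip p (1 - z)) := by
    rw [hx', ha', uinv_of hs1, uval_of hsd]; ring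
  by_cases hz2 : ‖1 - z‖ = 1; swap
  · rw [chi_of_ne hz2, oneU_of_ne (x := x')]; · ring
    rw [hxe]; simpa [hnb, hs1, hsd] using hz2
  have hz3 := ne_zero_of_norm_one hz2
  have hxn : ‖x'‖ = 1 := by rw [hxe]; simpa [hnb, hs1, hsd] using hz2
  have hx0 := ne_zero_of_norm_one hxn
  rw [uflip_of hz2] at hxe
  rw [uflip_of hz2, uinv_of hs1, uval_of hsd] at ha'
  have hae : a' = (z * s ^ 2 - p * d) / (s * (z - 1)) := by
    have : z - 1 ≠ 0 := fun h => hz3 (by linear_combination -h)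
    rw [ha']; field_simp; ring
  by_cases hz1 : ‖z‖ = 1; swap
  · rw [chi_of_ne hz1, chi_of_ne (x := a')]; · ring
    rw [hae, norm_div, norm_mul, hs1, norm_sub_rev z, hz2, mul_one, div_one]
    exact norm_sub_ne_one (norm_mul_lt_one (norm_lt_one_of_ne hz hz1) (by simp [hs1])) (norm_p_mul_lt hd)
  have hz0 := ne_zero_of_norm_one hz1
  have ha0 := ne_zero_of_norm_one ha1
  rw [uinv_of hz1, uflip_of ha1] at hs
  rw [uinv_of hz1, uflip_of hb1] at hb'
  have hna : ‖a'‖ = 1 := by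
    rw [hae, norm_div, norm_mul, hs1, norm_sub_rev z, hz2, mul_one, div_one]
    exact (norm_sub_p_mul hd).mpr (by simp [hz1, hs1])
  have hu : uinv p x' * (p * d - a' * s) = z * s * b' := by
    have hz4 : z - 1 ≠ 0 := fun h => hz3 (by linear_combination -h)
    rw [uinv_of hxn, hxe, hae]; field_simp; ring
  have hnu : ‖z * s * b'‖ = 1 := by simp [hz1, hs1, hnb]
  have hu0 := ne_zero_of_norm_one hnu
  rw [hu, oneU_of hxn, oneU_of hnu, uinv_of hxn,
    hΦ.t4_upper_one_unit_p (d := d) hna.le hnb.le hxn hnu hd es.symm (by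
      rw [← hu, uinv_of hxn]; field_simp; ring)]
  have hχ : chi χ a' * chi χ b' = chi χ a * chi χ b * (chi χ z * chi χ (1 - z)) := by
    rw [← chi_unit_mul hna, ← chi_unit_mul ha1, ← chi_unit_mul hz1,
      ← chi_unit_mul (by simp [ha1, hb1])]
    have e2 : a' * b' = s * b' * z / (z - 1) + p * (-(d * b' / (s * (z - 1)))) := by
      have hz4 : z - 1 ≠ 0 := fun h => hz3 (by linear_combination -h)
      rw [hae]; field_simp; ring
    rw [e2, chi_add_p_mul χ hc]
    · refine chi_eq_of_sq hq (c := (z * a * b * (1 - z))⁻¹) (by simp [hz1, ha1, hb1, hz2]) ?_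
      have hz4 : z - 1 ≠ 0 := fun h => hz3 (by linear_combination -h)
      rw [hs, hb']; field_simp; ring
    · rw [norm_neg]
      exact norm_div_le_one (norm_mul_le_one hd hnb.le) (by rw [norm_mul, hs1, norm_sub_rev, hz2, one_mul])
  rw [hχ]
  simp only [one_mul]
  congr 3
  · rw [hs, hb']; field_simp
  · rw [hs, hb']; field_simp
  · rw [hs, hb']; field_simp

end SingularPart

/-! ### Cosets with prefix η'²τ'⁻¹: T¹³ -/

section SingularUnitPart
variable {p : ℕ} [Fact p.Prime] {Φ : GSp4 p → ℂ} {χ : MulChar ℚ_[p] ℂ}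

/-- The variable w = pu + ab replaces b, and x is written as (x - 1)a²/w. Then s is congruent to ax
and d = a²x exactly, so the unit condition on the old x concerns 1 - x, and the one on s concerns
the new x. The part of T¹³ with 1 - x divisible by p is still missing; the τ' terms provide it. -/
lemma mean_t4_p_unit_aux (hΦ : IsSpherical Φ) (hq : χ.IsQuadratic) (hc : HasConductorP χ) :
    (p : ℂ) * mean4 p (fun x a b u => oneU p x * (chi χ a * chi χ b * (oneP p u *
      (oneU p (a + x * b) * Φ (t4 p * upper p 0 0 (-(a + x * b) / p)
        ((u + (a + x * b) * b) / p ^ 3) (b / p ^ 2) (uinv p x / p)))))) =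
    mean4 p fun _ a b x => oneU p (1 - x) * (oneU p a * chi χ b * chi χ x *
      Φ (upper p 2 (-1) 0 (b * (1 - x) / p) (a / p ^ 2) (a ^ 2 * uinv p b / p ^ 3))) := by
  have hΦc := hΦ.continuous
  have hχc := continuous_chi hc
  have hp := p_ne_zero p
  have hp' : (p : ℂ) ≠ 0 := by exact_mod_cast (Fact.out : p.Prime).ne_zero
  have h1 : mean4 p (fun x a b u => oneU p x * (chi χ a * chi χ b * (oneP p u *
      (oneU p (a + x * b) * Φ (t4 p * upper p 0 0 (-(a + x * b) / p)
        ((u + (a + x * b) * b) / p ^ 3) (b / p ^ 2) (uinv p x / p)))))) =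
      (p : ℂ)⁻¹ * mean4 p fun x a b u => oneU p x * (chi χ a * chi χ b *
      (oneU p (a + x * b) * Φ (t4 p * upper p 0 0 (-(a + x * b) / p)
        ((p * u + (a + x * b) * b) / p ^ 3) (b / p ^ 2) (uinv p x / p)))) := by
    rw [← mean4_oneP (F := fun x a b u => oneU p x * (chi χ a * chi χ b *
      (oneU p (a + x * b) * Φ (t4 p * upper p 0 0 (-(a + x * b) / p)
        ((u + (a + x * b) * b) / p ^ 3) (b / p ^ 2) (uinv p x / p)))))]
    exact mean4_congr fun x a b u _ _ _ _ => by ring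
  rw [h1, ← mul_assoc, mul_inv_cancel₀ hp', one_mul]
  refine (mean4_comm34 (by unfold Continuous4; fun_prop)).trans ?_
  refine (mean4_affine (fun x a u => uinv p a) (fun x a u => -(uinv p a * (p * u))) ?_).trans ?_
  · intro x a u _ _ hu
    refine ⟨by simp, ?_⟩
    rw [norm_neg]
    exact norm_mul_le_one (by simp) (norm_p_mul_lt hu).le
  refine (mean4_comm14 (by unfold Continuous4; fun_prop)).trans ?_
  refine (mean4_affine (fun a u w => uval p a ^ 2 * uinv p w) (fun a u w => -(uval p a ^ 2 * uinv p w))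
    (by simp)).trans ?_
  refine (mean4_comm14 (by unfold Continuous4; fun_prop)).trans ?_
  refine (mean4_flip (fun u w x => -uinv p x) (by simp)).trans ?_
  refine (mean4_comm24 (by unfold Continuous4; fun_prop)).trans ?_
  refine (mean4_flip (fun u x a => uinv p x) (by simp)).trans ?_
  refine (mean4_comm24 (by unfold Continuous4; fun_prop)).trans ?_
  refine mean4_congr fun u a b x hu ha hb hx => ?_
  by_cases ha1 : ‖a‖ = 1; swap
  · rw [oneU_of_ne ha1, chi_of_ne (x := _ * uflip p a) (by simpa using ha1)]; ring
  have ha0 := ne_zero_of_norm_one ha1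
  have hna : ‖-uinv p x * uflip p a‖ = 1 := by simpa using ha1
  rw [uflip_of ha1] at hna ⊢
  rw [uinv_of hna, uval_of hna]
  set a' := -uinv p x * a⁻¹ with ha'
  have ha'0 := ne_zero_of_norm_one hna
  set w := uinv p x * uflip p b with hw
  set b' := a'⁻¹ * w + -(a'⁻¹ * (p * u)) with hb'
  have hnu : ‖-(a'⁻¹ * u)‖ ≤ 1 := by rw [norm_neg]; exact norm_mul_le_one (by simp [hna]) hu
  have hbe : b' = a'⁻¹ * w + p * (-(a'⁻¹ * u)) := by rw [hb']; ring
  by_cases hb1 : ‖b‖ = 1; swap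
  · rw [chi_of_ne hb1, hbe, chi_add_p_mul χ hc hnu, chi_of_ne (x := a'⁻¹ * w)]
    · ring
    simpa [hna, hw] using hb1
  have hb0 := ne_zero_of_norm_one hb1
  have hnw : ‖w‖ = 1 := by simpa [hw] using hb1
  have hw0 := ne_zero_of_norm_one hnw
  have hnb : ‖b'‖ = 1 := by
    rw [hbe]; exact (norm_add_p_mul hnu).mpr (by simp [hna, hnw])
  rw [uflip_of hb1] at hw
  rw [uinv_of hnw]
  have hx' : a' ^ 2 * w⁻¹ * x + -(a' ^ 2 * w⁻¹) = (x - 1) * a' ^ 2 * w⁻¹ := by ring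
  rw [hx']
  by_cases hx2 : ‖1 - x‖ = 1; swap
  · rw [oneU_of_ne hx2, oneU_of_ne (x := (x - 1) * _ * _)]; · ring
    rw [norm_mul, norm_mul, norm_sub_rev]; simpa [hna, hnw] using hx2
  have hnx : ‖(x - 1) * a' ^ 2 * w⁻¹‖ = 1 := by
    rw [norm_mul, norm_mul, norm_sub_rev, hx2]; simp [hna, hnw]
  set x' := (x - 1) * a' ^ 2 * w⁻¹ with hx''
  have hx'0 := ne_zero_of_norm_one hnx
  have hs : a' + x' * b' = x * a' - p * (x' * a'⁻¹ * u) := by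
    rw [hb', hx'']; field_simp; ring
  have hns : ‖x' * a'⁻¹ * u‖ ≤ 1 := norm_mul_le_one (by simp [hna, hnx]) hu
  by_cases hx1 : ‖x‖ = 1; swap
  · rw [chi_of_ne hx1, oneU_of_ne (x := a' + x' * b')]; · ring
    rw [hs, Ne, norm_sub_p_mul hns]
    simpa [hna] using hx1
  have hx0 := ne_zero_of_norm_one hx1
  rw [uinv_of hx1] at ha' hw
  have hd : x' * (p * u) + a' * (a' + x' * b') = x * a' ^ 2 := by
    rw [hs]; field_simp; ring
  have hwe : p * u + a' * b' = w := by rw [hb']; field_simp; ring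
  rw [oneU_of hnx, uinv_of hnx, hΦ.t4_upper_one_p_unit (d := x * a' ^ 2) hna.le hnb.le hnx hu
    (by simp [hx1, hna]) rfl hd.symm, hwe, oneU_of hx2, oneU_of ha1, hs,
    oneU_of ((norm_sub_p_mul hns).mpr (by simp [hx1, hna])), uinv_of hb1]
  have hχ : chi χ a' * chi χ b' = chi χ b * chi χ x := by
    rw [← chi_unit_mul hna, ← chi_unit_mul hb1]
    have e2 : a' * b' = w + p * (-u) := by rw [← hwe]; ring
    rw [e2, chi_add_p_mul χ hc (by rwa [norm_neg])]
    exact chi_eq_of_sq hq (c := (x * b)⁻¹) (by simp [hx1, hb1]) (by rw [hw]; field_simp)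
  rw [hχ]
  simp only [one_mul]
  congr 3
  · rw [hx'', hw]; field_simp; ring
  · rw [ha']; field_simp
  · rw [ha', hw]; field_simp

/-- For 1 - x divisible by p the entry b(1 - x)/p is integral and χ(x) = 1. This is exactly the
freedom needed to match the τ' coset, whose first entry is 0 and which has no x. -/
lemma mean_t4_tau_p_aux (hΦ : IsSpherical Φ) (hq : χ.IsQuadratic) (hc : HasConductorP χ) :
    mean4 p (fun _ a b u => chi χ a * chi χ b * (oneP p u *
      Φ (t4 p * upper p 0 1 (-a / p ^ 2) ((u + a * b) / p ^ 3) (b / p) 0))) =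
    mean4 p fun _ a b x => oneP p (1 - x) * (oneU p a * chi χ b * chi χ x *
      Φ (upper p 2 (-1) 0 (b * (1 - x) / p) (a / p ^ 2) (a ^ 2 * uinv p b / p ^ 3))) := by
  have hΦc := hΦ.continuous
  have hχc := continuous_chi hc
  have hp := p_ne_zero p
  have h1 : mean4 p (fun _ a b u => chi χ a * chi χ b * (oneP p u *
      Φ (t4 p * upper p 0 1 (-a / p ^ 2) ((u + a * b) / p ^ 3) (b / p) 0))) =
      (p : ℂ)⁻¹ * mean4 p (fun _ a b u => chi χ a * chi χ b *
      Φ (t4 p * upper p 0 1 (-a / p ^ 2) ((p * u + a * b) / p ^ 3) (b / p) 0)) := by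
    rw [← mean4_oneP (F := fun _ a b u => chi χ a * chi χ b *
      Φ (t4 p * upper p 0 1 (-a / p ^ 2) ((u + a * b) / p ^ 3) (b / p) 0))]
    exact mean4_congr fun x a b u _ _ _ _ => by ring
  have h2 : mean4 p (fun _ a b x => oneP p (1 - x) * (oneU p a * chi χ b * chi χ x *
      Φ (upper p 2 (-1) 0 (b * (1 - x) / p) (a / p ^ 2) (a ^ 2 * uinv p b / p ^ 3)))) =
      (p : ℂ)⁻¹ * mean4 p (fun _ a b x => oneU p a * chi χ b * chi χ (1 - p * x) *
      Φ (upper p 2 (-1) 0 (b * (p * x) / p) (a / p ^ 2) (a ^ 2 * uinv p b / p ^ 3))) := by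
    rw [← mean4_oneP (F := fun _ a b x => oneU p a * chi χ b * chi χ (1 - x) *
      Φ (upper p 2 (-1) 0 (b * x / p) (a / p ^ 2) (a ^ 2 * uinv p b / p ^ 3)))]
    refine (mean4_affine (fun _ _ _ => -1) (fun _ _ _ => 1) (by simp)).trans ?_
    refine mean4_congr fun _ a b x _ _ _ _ => ?_
    rw [show -1 * x + 1 = 1 - x by ring, sub_sub_cancel]
  rw [h1, h2]
  congr 1
  refine (mean4_comm34 (by unfold Continuous4; fun_prop)).trans ?_
  refine (mean4_affine (fun x a u => uinv p a) (fun x a u => -(uinv p a * (p * u))) ?_).trans ?_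
  · intro x a u _ _ hu
    refine ⟨by simp, ?_⟩
    rw [norm_neg]
    exact norm_mul_le_one (by simp) (norm_p_mul_lt hu).le
  refine (mean4_flip (fun x a u => 1) (by simp)).trans ?_
  refine (mean4_comm24 (by unfold Continuous4; fun_prop)).trans ?_
  refine (mean4_flip (fun x u b => -1) (by simp)).trans ?_
  refine (mean4_comm24 (by unfold Continuous4; fun_prop)).trans ?_
  refine (mean4_comm24 (by unfold Continuous4; fun_prop)).trans ?_
  refine (mean4_comm34 (by unfold Continuous4; fun_prop)).trans ?_
  refine mean4_congr fun _ a b u _ ha hb hu => ?_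
  by_cases ha1 : ‖a‖ = 1; swap
  · rw [oneU_of_ne ha1, chi_of_ne (x := _ * uflip p a) (by simpa using ha1)]; ring
  have ha0 := ne_zero_of_norm_one ha1
  have hna : ‖-1 * uflip p a‖ = 1 := by simpa using ha1
  rw [uflip_of ha1] at hna ⊢
  rw [uinv_of hna, one_mul]
  set a' := -1 * a⁻¹ with ha'
  have ha'0 := ne_zero_of_norm_one hna
  set b' := a'⁻¹ * uflip p b + -(a'⁻¹ * (p * u)) with hb'
  have hnu : ‖-(a'⁻¹ * u)‖ ≤ 1 := by rw [norm_neg]; exact norm_mul_le_one (by simp [hna]) hu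
  have hbe : b' = a'⁻¹ * uflip p b + p * (-(a'⁻¹ * u)) := by rw [hb']; ring
  by_cases hb1 : ‖b‖ = 1; swap
  · rw [chi_of_ne hb1, hbe, chi_add_p_mul χ hc hnu, chi_of_ne (x := a'⁻¹ * _)]
    · ring
    simpa [hna] using hb1
  have hb0 := ne_zero_of_norm_one hb1
  rw [uflip_of hb1] at hb' hbe
  have hnb : ‖b'‖ = 1 := by
    rw [hbe]; exact (norm_add_p_mul hnu).mpr (by simp [hna, hb1])
  have hwe : p * u + a' * b' = b⁻¹ := by rw [hb']; field_simp; ring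
  have hχ : chi χ a' * chi χ b' = chi χ b := by
    rw [← chi_unit_mul hna]
    have e2 : a' * b' = b⁻¹ + p * (-u) := by rw [← hwe]; ring
    rw [e2, chi_add_p_mul χ hc (by rwa [norm_neg])]
    exact chi_eq_of_sq hq (c := b⁻¹) (by simp [hb1]) (by field_simp)
  have hχ1 : chi χ (1 - p * u) = 1 := by
    rw [sub_eq_add_neg, ← mul_neg, chi_add_p_mul χ hc (by rwa [norm_neg]), chi_one]
  rw [hχ, hχ1, hΦ.t4_upper_tau_p hna hnb.le hu, hwe, oneU_of ha1, one_mul, mul_one]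
  congr 1
  refine hΦ.upper_congr _ _ ?_ ?_ ?_
  · have e : (0 : ℚ_[p]) - b * (p * u) / p = -(b * u) := by field_simp; ring
    rw [e, norm_neg]; exact norm_mul_le_one hb hu
  · have e : -a'⁻¹ / p ^ 2 - a / p ^ 2 = 0 := by rw [ha']; field_simp; ring
    rw [e]; simp
  · have e : b⁻¹ / a' ^ 2 / p ^ 3 - a ^ 2 * uinv p b / p ^ 3 = 0 := by
      rw [ha', uinv_of hb1]; field_simp; ring
    rw [e]; simp

lemma mean_t4_p_unit (hΦ : IsSpherical Φ) (hq : χ.IsQuadratic) (hc : HasConductorP χ) :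
    (p : ℂ) * mean4 p (fun x a b u => oneU p x * (chi χ a * chi χ b * (oneP p u *
      (oneU p (a + x * b) * Φ (t4 p * upper p 0 0 (-(a + x * b) / p)
        ((u + (a + x * b) * b) / p ^ 3) (b / p ^ 2) (uinv p x / p)))))) +
    mean4 p (fun _ a b u => chi χ a * chi χ b * (oneP p u *
      Φ (t4 p * upper p 0 1 (-a / p ^ 2) ((u + a * b) / p ^ 3) (b / p) 0))) = meanT13 Φ χ := by
  have hΦc := hΦ.continuous
  have hχc := continuous_chi hc
  rw [mean_t4_p_unit_aux hΦ hq hc, mean_t4_tau_p_aux hΦ hq hc, meanT13,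
    ← mean4_add (by unfold Continuous4; fun_prop) (by unfold Continuous4; fun_prop)]
  refine mean4_congr fun _ a b x _ _ _ hx => ?_
  rw [← add_mul, oneU_add_oneP (norm_sub_le_one (by simp) hx), one_mul]

end SingularUnitPart

/-! ### Cosets with prefix η'², η'²τ' and η'²τ'²: T⁶, T⁹ and T¹⁰ -/

section MostSingularPart
variable {p : ℕ} [Fact p.Prime] {Φ : GSp4 p → ℂ} {χ : MulChar ℚ_[p] ℂ}

variable (Φ) in
/-- The value of `Φ` on the most singular part of the twist, with `a + x b = p s` and
`x u + a s = x d`. -/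
def singularVal (x a s d : ℚ_[p]) : ℂ :=
  Φ (t4 p * upper p 0 0 (-(p * s) / p)
    ((p * (d - a * s * uinv p x) + p * s * (uinv p x * (p * s - a))) / p ^ 3)
    (uinv p x * (p * s - a) / p ^ 2) (uinv p x / p))

@[fun_prop]
lemma continuous_singularVal (hΦ : Continuous Φ) {X : Type*} [TopologicalSpace X]
    {f g h i : X → ℚ_[p]} (hf : Continuous f) (hg : Continuous g) (hh : Continuous h)
    (hi : Continuous i) : Continuous fun x => singularVal Φ (f x) (g x) (h x) (i x) := by
  unfold singularVal; fun_prop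

/-- Both u and s are divisible by p, which costs 1/p². Solving for b gives b congruent to -a/x
modulo p, so χ(ab) = χ(-x⁻¹); d then replaces u by a translation and alone decides the power of τ'.
-/
lemma mean_t4_p_p_eq (hΦ : IsSpherical Φ) (hq : χ.IsQuadratic) (hc : HasConductorP χ) :
    (p : ℂ) * mean4 p (fun x a b u => oneU p x * (chi χ a * chi χ b * (oneP p u *
      (oneP p (a + x * b) * Φ (t4 p * upper p 0 0 (-(a + x * b) / p)
        ((u + (a + x * b) * b) / p ^ 3) (b / p ^ 2) (uinv p x / p)))))) =
    (p : ℂ)⁻¹ * mean4 p fun x a s d => chi χ (-uinv p x) * oneU p x * oneU p a *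
      singularVal Φ x a s d := by
  have hΦc := hΦ.continuous
  have hχc := continuous_chi hc
  have hp := p_ne_zero p
  have hp' : (p : ℂ) ≠ 0 := by exact_mod_cast (Fact.out : p.Prime).ne_zero
  have h1 : mean4 p (fun x a b u => oneU p x * (chi χ a * chi χ b * (oneP p u *
      (oneP p (a + x * b) * Φ (t4 p * upper p 0 0 (-(a + x * b) / p)
        ((u + (a + x * b) * b) / p ^ 3) (b / p ^ 2) (uinv p x / p)))))) =
      (p : ℂ)⁻¹ * mean4 p fun x a b u => oneU p x * (chi χ a * chi χ b *
      (oneP p (a + x * b) * Φ (t4 p * upper p 0 0 (-(a + x * b) / p)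
        ((p * u + (a + x * b) * b) / p ^ 3) (b / p ^ 2) (uinv p x / p)))) := by
    rw [← mean4_oneP (F := fun x a b u => oneU p x * (chi χ a * chi χ b *
      (oneP p (a + x * b) * Φ (t4 p * upper p 0 0 (-(a + x * b) / p)
        ((u + (a + x * b) * b) / p ^ 3) (b / p ^ 2) (uinv p x / p)))))]
    exact mean4_congr fun x a b u _ _ _ _ => by ring
  have h2 : mean4 p (fun x a b u => oneU p x * (chi χ a * chi χ b *
      (oneP p (a + x * b) * Φ (t4 p * upper p 0 0 (-(a + x * b) / p)
        ((p * u + (a + x * b) * b) / p ^ 3) (b / p ^ 2) (uinv p x / p))))) =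
      (p : ℂ)⁻¹ * mean4 p fun x a u s => chi χ (-uinv p x) * oneU p x * oneU p a *
      Φ (t4 p * upper p 0 0 (-(p * s) / p) ((p * u + p * s * (uinv p x * (p * s - a))) / p ^ 3)
        (uinv p x * (p * s - a) / p ^ 2) (uinv p x / p)) := by
    rw [← mean4_oneP (F := fun x a u s => chi χ (-uinv p x) * oneU p x * oneU p a *
      Φ (t4 p * upper p 0 0 (-s / p) ((p * u + s * (uinv p x * (s - a))) / p ^ 3)
        (uinv p x * (s - a) / p ^ 2) (uinv p x / p)))]
    refine (mean4_comm34 (by unfold Continuous4; fun_prop)).trans ?_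
    refine (mean4_affine (fun x a u => uinv p x) (fun x a u => -(uinv p x * a)) ?_).trans ?_
    · intro x a u _ ha _
      exact ⟨by simp, by rw [norm_neg]; exact norm_mul_le_one (by simp) ha⟩
    refine mean4_congr fun x a u s hx ha _ hs => ?_
    by_cases hx1 : ‖x‖ = 1; swap
    · rw [oneU_of_ne hx1]; ring
    by_cases ha1 : ‖a‖ = 1; swap
    · rw [oneU_of_ne ha1, chi_of_ne ha1]; ring
    have hx0 := ne_zero_of_norm_one hx1
    have e1 : uinv p x * s + -(uinv p x * a) = uinv p x * (s - a) := by ring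
    have e2 : a + x * (uinv p x * (s - a)) = s := by rw [uinv_of hx1]; field_simp; ring
    rw [e1, e2]
    by_cases hs1 : ‖s‖ < 1; swap
    · rw [oneP_of_not hs1]; ring
    have hχ : chi χ a * chi χ (uinv p x * (s - a)) = chi χ (-uinv p x) := by
      rw [← chi_unit_mul ha1]
      have e3 : a * (uinv p x * (s - a)) = -uinv p x * a ^ 2 + p * (uinv p x * a * (s / p)) := by
        field_simp; ring
      rw [e3, chi_add_p_mul χ hc (norm_mul_le_one (by simp [ha1]) (norm_le_inv_p_of_lt_one hs1))]
      exact chi_eq_of_sq hq ha1 rfl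
    rw [hχ, oneU_of ha1]; ring
  rw [h1, h2, ← mul_assoc, ← mul_assoc, mul_inv_cancel₀ hp', one_mul]
  congr 1
  refine (mean4_comm34 (by unfold Continuous4; fun_prop)).trans ?_
  refine (mean4_affine (fun _ _ _ => 1) (fun x a s => -(a * s * uinv p x)) ?_).trans ?_
  · intro x a s _ ha hs
    refine ⟨by simp, ?_⟩
    rw [norm_neg]
    exact norm_mul_le_one (norm_mul_le_one ha hs) (by simp)
  refine mean4_congr fun x a s d _ _ _ _ => ?_
  rw [singularVal, one_mul, ← sub_eq_add_neg]

/-- Scaling x by a²/d turns the numerator pdx - a² of the last entry into a²(px - 1); the factors 1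
- px in the substitutions for d and in the sum T⁶ come from there. The variable s drops out of the
coset. -/
lemma mean_singularVal_unit (hΦ : IsSpherical Φ) (hq : χ.IsQuadratic) (hc : HasConductorP χ) :
    (p : ℂ)⁻¹ * mean4 p (fun x a s d => oneU p d * (chi χ (-uinv p x) * oneU p x * oneU p a *
      singularVal Φ x a s d)) = meanT6 Φ χ := by
  have hΦc := hΦ.continuous
  have hχc := continuous_chi hc
  have hp := p_ne_zero p
  unfold meanT6
  congr 1
  refine (mean4_comm14 (by unfold Continuous4; fun_prop)).trans ?_
  refine (mean4_mul (fun a s d => uval p a ^ 2 * uinv p d) (by simp)).trans ?_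
  refine (mean4_comm14 (by unfold Continuous4; fun_prop)).trans ?_
  refine (mean4_flip (fun s d x => -uinv p x) (by simp)).trans ?_
  refine (mean4_comm24 (by unfold Continuous4; fun_prop)).trans ?_
  refine (mean4_flip (fun s x a => -uinv p (1 - (p : ℚ_[p]) * x)) (by simp)).trans ?_
  refine (mean4_comm24 (by unfold Continuous4; fun_prop)).trans ?_
  refine mean4_congr fun s a b x hs ha hb hx => ?_
  by_cases ha1 : ‖a‖ = 1; swap
  · rw [oneU_of_ne ha1, oneU_of_ne (x := -uinv p x * uflip p a) (by simpa using ha1)]; ring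
  by_cases hb1 : ‖b‖ = 1; swap
  · rw [chi_of_ne hb1, oneU_of_ne (x := _ * uflip p b) (by simpa using hb1)]; ring
  by_cases hx1 : ‖x‖ = 1; swap
  · rw [chi_of_ne hx1, oneU_of_ne (x := _ * x) (by simpa using hx1)]; ring
  have ha0 := ne_zero_of_norm_one ha1
  have hb0 := ne_zero_of_norm_one hb1
  have hx0 := ne_zero_of_norm_one hx1
  have hpx : ‖1 - p * x‖ = 1 := (norm_sub_p_mul hx).mpr norm_one
  have hpx0 := ne_zero_of_norm_one hpx
  have hxp0 : 1 - x * p ≠ 0 := by rwa [mul_comm x]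
  rw [uflip_of ha1, uflip_of hb1, uinv_of hx1, uinv_of hpx, uinv_of hb1]
  set a' := -x⁻¹ * a⁻¹ with ha'
  set d := -(1 - p * x)⁻¹ * b⁻¹ with hd'
  have hna : ‖a'‖ = 1 := by simp [ha', ha1, hx1]
  have hnd : ‖d‖ = 1 := by simp [hd', hb1, hpx]
  have hd0 := ne_zero_of_norm_one hnd
  have ha'0 := ne_zero_of_norm_one hna
  rw [uval_of hna, uinv_of hnd]
  set x' := a' ^ 2 * d⁻¹ * x with hx'
  have hnx : ‖x'‖ = 1 := by simp [hx', hna, hnd, hx1]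
  have hx'0 := ne_zero_of_norm_one hnx
  rw [oneU_of hna, oneU_of hnd, oneU_of hnx, oneU_of ha1, singularVal, uinv_of hnx,
    hΦ.t4_upper_one_p_p_unit (d := d) hna hnx hs hnd (by field_simp) (by field_simp)]
  have hχ : chi χ (-x'⁻¹) = chi χ b * chi χ x := by
    rw [← chi_unit_mul hb1]
    have e : -x'⁻¹ = (b * x)⁻¹ * a'⁻¹ ^ 2 + p * (-(-(1 - p * x)⁻¹ * b⁻¹ * a'⁻¹ ^ 2)) := by
      rw [hx', hd']; field_simp; ring
    rw [e, chi_add_p_mul χ hc]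
    · exact chi_eq_of_sq hq (c := a'⁻¹ * (b * x)⁻¹) (by simp [hna, hb1, hx1]) (by field_simp)
    · simp [hpx, hb1, hna]
  rw [hχ]
  simp only [one_mul, mul_one]
  congr 3
  all_goals (simp only [hx', ha', hd']; field_simp; try ring)

/-- Scaling x by a lets the Levi parameter x/a be the new a. The remaining two entries are then
inverted, up to unit factors, into b and x, and s becomes a dummy. -/
lemma mean_singularVal_p_unit (hΦ : IsSpherical Φ) (hq : χ.IsQuadratic) (hc : HasConductorP χ) :
    (p : ℂ)⁻¹ ^ 2 * mean4 p (fun x a s d => oneU p d * (chi χ (-uinv p x) * oneU p x * oneU p a *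
      singularVal Φ x a s (p * d))) = meanT9 Φ χ := by
  have hΦc := hΦ.continuous
  have hχc := continuous_chi hc
  have hp := p_ne_zero p
  unfold meanT9
  congr 1
  refine (mean4_comm14 (by unfold Continuous4; fun_prop)).trans ?_
  refine (mean4_mul (fun a s d => uval p a) (by simp)).trans ?_
  refine (mean4_comm14 (by unfold Continuous4; fun_prop)).trans ?_
  refine (mean4_flip (fun s d a => -uval p a) (by simp)).trans ?_
  refine (mean4_comm24 (by unfold Continuous4; fun_prop)).trans ?_
  refine (mean4_flip (fun s a b => -(uinv p a) ^ 2) (by simp)).trans ?_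
  refine mean4_congr fun s a b d hs ha hb hd => ?_
  by_cases ha1 : ‖a‖ = 1; swap
  · rw [oneU_of_ne ha1, oneU_of_ne (x := _ * a) (by simpa using ha1)]; ring
  by_cases hb1 : ‖b‖ = 1; swap
  · rw [chi_of_ne hb1, oneU_of_ne (x := _ * uflip p b) (by simpa using hb1)]; ring
  by_cases hd1 : ‖d‖ = 1; swap
  · rw [oneU_of_ne hd1, oneU_of_ne (x := _ * uflip p d) (by simpa using hd1)]; ring
  have ha0 := ne_zero_of_norm_one ha1
  have hb0 := ne_zero_of_norm_one hb1
  have hd0 := ne_zero_of_norm_one hd1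
  rw [uflip_of hb1, uflip_of hd1, uval_of ha1, uinv_of ha1]
  set a' := -a * b⁻¹ with ha'
  set d' := -a⁻¹ ^ 2 * d⁻¹ with hd'
  have hna : ‖a'‖ = 1 := by simp [ha', ha1, hb1]
  have hnd : ‖d'‖ = 1 := by simp [hd', ha1, hd1]
  have hd'0 := ne_zero_of_norm_one hnd
  have ha'0 := ne_zero_of_norm_one hna
  rw [uval_of hna]
  have hnx : ‖a' * a‖ = 1 := by simp [hna, ha1]
  rw [oneU_of hna, oneU_of hnd, oneU_of hnx, oneU_of ha1, oneU_of hd1, singularVal, uinv_of hnx,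
    hΦ.t4_upper_one_p_p_p (d := d') hna hnx hs hnd (by field_simp) (by field_simp)]
  have hχ : chi χ (-(a' * a)⁻¹) = chi χ b :=
    chi_eq_of_sq hq (c := a⁻¹) (by simp [ha1]) (by rw [ha']; field_simp)
  rw [hχ]
  simp only [one_mul, mul_one]
  congr 2
  all_goals (simp only [ha', hd']; field_simp; try ring)

lemma mean_singularVal_p_p (hΦ : IsSpherical Φ) (hq : χ.IsQuadratic) (hc : HasConductorP χ) :
    (p : ℂ)⁻¹ ^ 3 * mean4 p (fun x a s d => chi χ (-uinv p x) * oneU p x * oneU p a *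
      singularVal Φ x a s (p * (p * d))) = meanT10 Φ χ := by
  have hΦc := hΦ.continuous
  have hχc := continuous_chi hc
  have hp := p_ne_zero p
  unfold meanT10
  congr 1
  refine (mean4_comm14 (by unfold Continuous4; fun_prop)).trans ?_
  refine (mean4_mul (fun a s d => uval p a) (by simp)).trans ?_
  refine (mean4_comm14 (by unfold Continuous4; fun_prop)).trans ?_
  refine (mean4_flip (fun s d a => -uval p a) (by simp)).trans ?_
  refine mean4_congr fun s d a b hs hd ha hb => ?_
  by_cases ha1 : ‖a‖ = 1; swap
  · rw [oneU_of_ne ha1, oneU_of_ne (x := _ * a) (by simpa using ha1)]; ring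
  by_cases hb1 : ‖b‖ = 1; swap
  · rw [chi_of_ne hb1, oneU_of_ne (x := _ * uflip p b) (by simpa using hb1)]; ring
  have ha0 := ne_zero_of_norm_one ha1
  have hb0 := ne_zero_of_norm_one hb1
  rw [uflip_of hb1, uval_of ha1]
  set a' := -a * b⁻¹ with ha'
  have hna : ‖a'‖ = 1 := by simp [ha', ha1, hb1]
  have ha'0 := ne_zero_of_norm_one hna
  rw [uval_of hna]
  have hnx : ‖a' * a‖ = 1 := by simp [hna, ha1]
  rw [oneU_of hna, oneU_of hnx, oneU_of ha1, singularVal, uinv_of hnx,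
    hΦ.t4_upper_one_p_p_p_sq (d := d) hna hnx hs hd (by field_simp) (by field_simp)]
  have hχ : chi χ (-(a' * a)⁻¹) = chi χ b :=
    chi_eq_of_sq hq (c := a⁻¹) (by simp [ha1]) (by rw [ha']; field_simp)
  rw [hχ]
  simp only [one_mul, mul_one]
  congr 2
  all_goals (simp only [ha']; field_simp; try ring)

lemma mean4_split {F : ℚ_[p] → ℚ_[p] → ℚ_[p] → ℚ_[p] → ℂ} (hF : Continuous4 F) :
    mean4 p F = mean4 p (fun a b c d => oneU p d * F a b c d) +
      (p : ℂ)⁻¹ * mean4 p fun a b c d => F a b c (p * d) := by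
  have hF' : Continuous fun q : ℚ_[p] × ℚ_[p] × ℚ_[p] × ℚ_[p] => F q.1 q.2.1 q.2.2.1 q.2.2.2 := hF
  rw [← mean4_oneP, ← mean4_add (by unfold Continuous4; fun_prop) (by unfold Continuous4; fun_prop)]
  refine mean4_congr fun a b c d _ _ _ hd => ?_
  rw [← add_mul, oneU_add_oneP hd, one_mul]

lemma mean_t4_p_p (hΦ : IsSpherical Φ) (hq : χ.IsQuadratic) (hc : HasConductorP χ) :
    (p : ℂ) * mean4 p (fun x a b u => oneU p x * (chi χ a * chi χ b * (oneP p u *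
      (oneP p (a + x * b) * Φ (t4 p * upper p 0 0 (-(a + x * b) / p)
        ((u + (a + x * b) * b) / p ^ 3) (b / p ^ 2) (uinv p x / p)))))) =
    meanT6 Φ χ + meanT9 Φ χ + meanT10 Φ χ := by
  have hΦc := hΦ.continuous
  have hχc := continuous_chi hc
  rw [mean_t4_p_p_eq hΦ hq hc, mean4_split (by unfold Continuous4; fun_prop),
    mean4_split (F := fun x a s d => chi χ (-uinv p x) * oneU p x * oneU p a *
      singularVal Φ x a s (p * d)) (by unfold Continuous4; fun_prop),
    ← mean_singularVal_unit hΦ hq hc, ← mean_singularVal_p_unit hΦ hq hc,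
    ← mean_singularVal_p_p hΦ hq hc]
  ring

end MostSingularPart

/-! ### Assembly of the t₄ half of the twisting map -/

section Assembly
variable {p : ℕ} [Fact p.Prime] {Φ : GSp4 p → ℂ} {χ : MulChar ℚ_[p] ℂ}

lemma mean_t4_avgTauInvAt (hΦ : IsSpherical Φ) (hq : χ.IsQuadratic) (hc : HasConductorP χ) :
    (p : ℂ) ^ 2 * mean p (avgTauInvAt (fun g => Φ (t4 p * g)) χ 3) =
      meanT4 Φ χ + meanT12 Φ χ + meanT14 Φ χ := by
  have hΦc := hΦ.continuous
  have hχc := continuous_chi hc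
  -- The shift z = u - ab is the one for which the third row, after multiplication by t₄, has the
  -- entry pu on the diagonal.
  have h1 : mean p (avgTauInvAt (fun g => Φ (t4 p * g)) χ 3) = mean4 p fun x a b u =>
      chi χ a * chi χ b *
      Φ (t4 p * upper p 0 (-1) (b / p) (u / p ^ 3 - b * (x * b + a * p) / p ^ 4)
        ((x * b + a * p) / p ^ 3) (-x / p ^ 2)) := by
    refine (mean4_affine (F := fun x a b z => chi χ a * chi χ b * Φ (t4 p * upper p 0 (-1) (b / p)
      (z / p ^ 3 - x * b ^ 2 / p ^ 4) ((x * b + a * p) / p ^ 3) (-x / p ^ 2))) (fun _ _ _ => 1)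
      (fun x a b => -(a * b)) ?_).trans ?_
    · intro x a b _ ha hb
      exact ⟨by simp, by rw [norm_neg]; exact norm_mul_le_one ha hb⟩
    refine mean4_congr fun x a b u _ _ _ _ => ?_
    have hp := p_ne_zero p
    congr 4
    field_simp; ring
  rw [h1, ← mean_t4_tauInv_unit_p hΦ hq hc, ← mean_t4_tauInv_unit_unit hΦ hq hc,
    ← mean_t4_tauInv_p hΦ hq hc, ← mul_add, ← mul_add,
    ← mean4_add (by unfold Continuous4; fun_prop) (by unfold Continuous4; fun_prop),
    ← mean4_add (by unfold Continuous4; fun_prop) (by unfold Continuous4; fun_prop)]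
  congr 1
  -- Three disjoint cases: u and u + ab both units, u a unit but not u + ab, and u in the maximal
  -- ideal.
  refine mean4_congr fun x a b u _ ha hb hu => ?_
  linear_combination (-(chi χ a * chi χ b *
      Φ (t4 p * upper p 0 (-1) (b / p) (u / p ^ 3 - b * (x * b + a * p) / p ^ 4)
        ((x * b + a * p) / p ^ 3) (-x / p ^ 2)))) * (oneU_add_oneP hu + oneU p u *
          oneU_add_oneP (norm_add_le_one hu (norm_mul_le_one ha hb)))

lemma mean_unitVal (hΦ : IsSpherical Φ) (hq : χ.IsQuadratic) (hc : HasConductorP χ) :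
    (p : ℂ) * mean4 p (fun x a b u => chi χ a * chi χ b * (oneU p u *
      (oneU p (x * u + a * (a + x * b)) * unitVal Φ x a b u))) =
      meanT2 Φ χ + meanT3 Φ χ + meanT5 Φ χ := by
  have hΦc := hΦ.continuous
  have hχc := continuous_chi hc
  rw [← mean_unitVal_unit_unit hΦ hq hc, ← mean_unitVal_unit_p hΦ hq hc,
    ← mean_unitVal_p hΦ hq hc, ← mul_add, ← mul_add,
    ← mean4_add (by unfold Continuous4; fun_prop) (by unfold Continuous4; fun_prop),
    ← mean4_add (by unfold Continuous4; fun_prop) (by unfold Continuous4; fun_prop)]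
  congr 1
  refine mean4_congr fun x a b u hx ha hb hu => ?_
  linear_combination (-(chi χ a * chi χ b * (oneU p u *
      (oneU p (x * u + a * (a + x * b)) * unitVal Φ x a b u)))) *
    (oneU_add_oneP (norm_add_le_one hu (norm_mul_le_one ha hb)) + oneU p (u + a * b) *
      oneU_add_oneP (norm_add_le_one ha (norm_mul_le_one hx hb)))

lemma mean_t4_avgOne_add_avgTau (hΦ : IsSpherical Φ) (hq : χ.IsQuadratic) (hc : HasConductorP χ) :
    (p : ℂ) * avgOne (fun g => Φ (t4 p * g)) χ 3 + avgTau (fun g => Φ (t4 p * g)) χ 3 =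
      meanT2 Φ χ + meanT3 Φ χ + meanT5 Φ χ + meanT6 Φ χ + meanT8 Φ χ + meanT9 Φ χ + meanT10 Φ χ +
        meanT13 Φ χ := by
  have hΦc := hΦ.continuous
  have hχc := continuous_chi hc
  have hp := p_ne_zero p
  -- Again the central shift, now by (a + xb)b, makes the diagonal entry of the third row equal to
  -- pu.
  have h1 : avgOne (fun g => Φ (t4 p * g)) χ 3 = mean4 p fun x a b u => oneU p x *
      (chi χ a * chi χ b * Φ (t4 p * upper p 0 0 (-(a + x * b) / p)
        ((u + (a + x * b) * b) / p ^ 3) (b / p ^ 2) (uinv p x / p))) := by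
    refine (mean4_affine (F := fun x a b z => oneU p x * (chi χ a * chi χ b *
      Φ (t4 p * upper p 0 0 (-(a + x * b) / p) (z / p ^ 3) (b / p ^ 2) (uinv p x / p))))
      (fun _ _ _ => 1) (fun x a b => (a + x * b) * b) ?_).trans ?_
    · intro x a b hx ha hb
      exact ⟨by simp, norm_mul_le_one (norm_add_le_one ha (norm_mul_le_one hx hb)) hb⟩
    exact mean4_congr fun x a b u _ _ _ _ => by rw [one_mul]
  have h2 : avgTau (fun g => Φ (t4 p * g)) χ 3 = mean4 p fun _ a b u =>
      chi χ a * chi χ b * Φ (t4 p * upper p 0 1 (-a / p ^ 2) ((u + a * b) / p ^ 3) (b / p) 0) := by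
    refine (mean_const _).symm.trans ((mean4_affine (F := fun _ a b z => chi χ a * chi χ b *
      Φ (t4 p * upper p 0 1 (-a / p ^ 2) (z / p ^ 3) (b / p) 0))
      (fun _ _ _ => 1) (fun _ a b => a * b) ?_).trans ?_)
    · intro x a b _ ha hb
      exact ⟨by simp, norm_mul_le_one ha hb⟩
    exact mean4_congr fun x a b u _ _ _ _ => by rw [one_mul]
  -- For a unit u the case division is by d = xu + as; otherwise it is by s = a + xb.
  have h3 : avgOne (fun g => Φ (t4 p * g)) χ 3 =
      mean4 p (fun x a b u => oneU p x * (chi χ a * chi χ b * (oneU p u *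
      (oneU p (x * u + a * (a + x * b)) * Φ (t4 p * upper p 0 0 (-(a + x * b) / p)
        ((u + (a + x * b) * b) / p ^ 3) (b / p ^ 2) (uinv p x / p)))))) +
      mean4 p (fun x a b u => oneU p x * (chi χ a * chi χ b * (oneU p u *
      (oneP p (x * u + a * (a + x * b)) * Φ (t4 p * upper p 0 0 (-(a + x * b) / p)
        ((u + (a + x * b) * b) / p ^ 3) (b / p ^ 2) (uinv p x / p)))))) +
      mean4 p (fun x a b u => oneU p x * (chi χ a * chi χ b * (oneP p u *
      (oneU p (a + x * b) * Φ (t4 p * upper p 0 0 (-(a + x * b) / p)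
        ((u + (a + x * b) * b) / p ^ 3) (b / p ^ 2) (uinv p x / p)))))) +
      mean4 p (fun x a b u => oneU p x * (chi χ a * chi χ b * (oneP p u *
      (oneP p (a + x * b) * Φ (t4 p * upper p 0 0 (-(a + x * b) / p)
        ((u + (a + x * b) * b) / p ^ 3) (b / p ^ 2) (uinv p x / p)))))) := by
    rw [h1, ← mean4_add (by unfold Continuous4; fun_prop) (by unfold Continuous4; fun_prop),
      ← mean4_add (by unfold Continuous4; fun_prop) (by unfold Continuous4; fun_prop),
      ← mean4_add (by unfold Continuous4; fun_prop) (by unfold Continuous4; fun_prop)]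
    refine mean4_congr fun x a b u hx ha hb hu => ?_
    have hs := norm_add_le_one ha (norm_mul_le_one hx hb)
    linear_combination (-(oneU p x * (chi χ a * chi χ b * Φ (t4 p * upper p 0 0 (-(a + x * b) / p)
        ((u + (a + x * b) * b) / p ^ 3) (b / p ^ 2) (uinv p x / p))))) *
      (oneU_add_oneP hu +
        oneU p u * oneU_add_oneP (norm_add_le_one (norm_mul_le_one hx hu) (norm_mul_le_one ha hs)) +
        oneP p u * oneU_add_oneP hs)
  have h4 : avgTau (fun g => Φ (t4 p * g)) χ 3 =
      mean4 p (fun _ a b u => chi χ a * chi χ b * (oneU p u *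
        Φ (t4 p * upper p 0 1 (-a / p ^ 2) ((u + a * b) / p ^ 3) (b / p) 0))) +
      mean4 p (fun _ a b u => chi χ a * chi χ b * (oneP p u *
        Φ (t4 p * upper p 0 1 (-a / p ^ 2) ((u + a * b) / p ^ 3) (b / p) 0))) := by
    rw [h2, ← mean4_add (by unfold Continuous4; fun_prop) (by unfold Continuous4; fun_prop)]
    refine mean4_congr fun _ a b u _ ha hb hu => ?_
    linear_combination (-(chi χ a * chi χ b *
      Φ (t4 p * upper p 0 1 (-a / p ^ 2) ((u + a * b) / p ^ 3) (b / p) 0))) * oneU_add_oneP hu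
  rw [h3, h4]
  linear_combination mean_t4_unit_unit hΦ hc (χ := χ) + mean_unitVal hΦ hq hc +
    mean_t4_unit_p hΦ hq hc + mean_t4_p_unit hΦ hq hc + mean_t4_p_p hΦ hq hc

end Assembly

/-! ### Sums over residue classes as averages -/

section FiniteSums

variable {p : ℕ} [Fact p.Prime]

/-- `S` sums over the residue classes mod `p^n` of the elements satisfying `P`, and `w` is the
indicator function of `P`. -/
structure IsResidueSum (S : (ℚ_[p] → ℂ) → ℂ) (n : ℕ) (P : ℚ_[p] → Prop) (w : ℚ_[p] → ℂ) :
    Prop where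
  eq_mean : ∀ f : ℚ_[p] → ℂ, (∀ x c : ℚ_[p], P x → ‖c‖ ≤ 1 → f (x + p ^ n * c) = f x) →
    S f = (p : ℂ) ^ n * mean p fun x => w x * f x
  congr : ∀ f g : ℚ_[p] → ℂ, (∀ x, P x → f x = g x) → S f = S g
  weight : ∀ x, ‖x‖ ≤ 1 → ¬ P x → w x = 0
  norm_le : ∀ x, P x → ‖x‖ ≤ 1

lemma isResidueSum_sumAll (r : Representatives p) (n : ℕ) :
    IsResidueSum (sumAll r n) n (fun x => ‖x‖ ≤ 1) (fun _ => 1) where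
  eq_mean f hf := by simpa using sumAll_eq_mean r n f hf
  congr _ _ h := Finset.sum_congr rfl fun a _ => h _ (r.rep n a).2
  weight _ hx h := (h hx).elim
  norm_le _ h := h

lemma norm_rep_unit (r : Representatives p) {n : ℕ} (hn : n ≠ 0) (a : (ZMod (p ^ n))ˣ) :
    ‖((r.rep n (a : ZMod (p ^ n)) : ℤ_[p]) : ℚ_[p])‖ = 1 := by
  have := (norm_eq_one_iff_isUnit_toZModPow hn (r.rep n (a : ZMod (p ^ n)))).mpr
    (by rw [r.toZModPow_rep]; exact a.isUnit)
  exact this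

lemma isResidueSum_sumUnits (r : Representatives p) {n : ℕ} (hn : n ≠ 0) :
    IsResidueSum (sumUnits r n) n (fun x => ‖x‖ = 1) (oneU p) where
  eq_mean f hf := sumUnits_eq_mean r hn f hf
  congr _ _ h := Finset.sum_congr rfl fun a _ => h _ (norm_rep_unit r hn a)
  weight _ _ h := oneU_of_ne h
  norm_le _ h := h.le

lemma isResidueSum_sumUnitsNeOne (r : Representatives p) {n : ℕ} (hn : n ≠ 0) :
    IsResidueSum (sumUnitsNeOne r n) n (fun x => ‖x‖ = 1 ∧ ‖1 - x‖ = 1)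
      (fun x => oneU p x * oneU p (1 - x)) where
  eq_mean f hf := by
    rw [sumUnitsNeOne_eq_mean r hn f fun x c h1 h2 hc => hf x c ⟨h1, h2⟩ hc]
    simp only [mul_assoc]
  congr _ _ h := by
    unfold sumUnitsNeOne
    refine Finset.sum_congr rfl fun a ha => ?_
    obtain ⟨ha, ha'⟩ := Finset.mem_filter.mp ha
    simp only [Finset.pure_def, Finset.bind_def, Finset.mem_sup, Finset.mem_singleton] at ha
    obtain ⟨u, -, rfl⟩ := ha
    exact h _ ⟨norm_rep_unit r hn u, (toZMod_ne_one_iff _).mp ha'⟩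
  weight x _ h := by
    by_cases h1 : ‖x‖ = 1
    · rw [oneU_of_ne (x := 1 - x) fun h2 => h ⟨h1, h2⟩, mul_zero]
    · rw [oneU_of_ne h1, zero_mul]
  norm_le _ h := h.1.le

variable {S₁ S₂ S₃ S₄ : (ℚ_[p] → ℂ) → ℂ} {n₁ n₂ n₃ n₄ : ℕ} {P₁ P₂ P₃ P₄ : ℚ_[p] → Prop}
  {w₁ w₂ w₃ w₄ : ℚ_[p] → ℂ}

lemma IsResidueSum.mean_weight_congr (h : IsResidueSum S₁ n₁ P₁ w₁) {f g : ℚ_[p] → ℂ}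
    (hfg : ∀ x, P₁ x → f x = g x) :
    mean p (fun x => w₁ x * f x) = mean p fun x => w₁ x * g x := by
  refine mean_congr fun x hx => ?_
  by_cases hP : P₁ x
  · rw [hfg x hP]
  · rw [h.weight x hx hP, zero_mul, zero_mul]

lemma IsResidueSum.eq_mean_of_eq (h : IsResidueSum S₁ n₁ P₁ w₁) {f g : ℚ_[p] → ℂ} {k : ℂ}
    (hfg : ∀ x, P₁ x → f x = k * g x)
    (hg : ∀ x c : ℚ_[p], P₁ x → ‖c‖ ≤ 1 → g (x + p ^ n₁ * c) = g x) :
    S₁ f = (p : ℂ) ^ n₁ * k * mean p fun x => w₁ x * g x := by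
  rw [h.congr f (fun x => k * g x) hfg, h.eq_mean _ fun x c hx hc => by rw [hg x c hx hc],
    mul_assoc, ← mean_const_mul k]
  congr 1
  exact mean_congr fun x _ => by ring

/-- The summand as written is `f`, with χ itself; `F` is its version with the character cut off to
units. They agree on the index set, and periodicity is needed only for `F`, separately in each
variable. It is stated for elements of `ℤ_[p]`, so that the integral increments can be exhibited
there. -/
lemma IsResidueSum.iterate₂ (h₁ : IsResidueSum S₁ n₁ P₁ w₁) (h₂ : IsResidueSum S₂ n₂ P₂ w₂)
    {f F : ℚ_[p] → ℚ_[p] → ℂ} (hf : ∀ a b, P₁ a → P₂ b → f a b = F a b)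
    (hp₁ : ∀ a b e : ℤ_[p], P₁ a → P₂ b → F (a + p ^ n₁ * e) b = F a b)
    (hp₂ : ∀ a b e : ℤ_[p], P₁ a → P₂ b → F a (b + p ^ n₂ * e) = F a b) :
    (S₁ fun a => S₂ fun b => f a b) = (p : ℂ) ^ n₁ * (p : ℂ) ^ n₂ *
      mean p fun a => w₁ a * mean p fun b => w₂ b * F a b := by
  refine h₁.eq_mean_of_eq (fun a ha => (h₂.congr _ _ fun b hb => hf a b ha hb).trans
    (h₂.eq_mean _ fun b e hb he => hp₂ ⟨a, h₁.norm_le a ha⟩ ⟨b, h₂.norm_le b hb⟩ ⟨e, he⟩ ha hb)) ?_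
  exact fun a e ha he => h₂.mean_weight_congr fun b hb =>
    hp₁ ⟨a, h₁.norm_le a ha⟩ ⟨b, h₂.norm_le b hb⟩ ⟨e, he⟩ ha hb

lemma IsResidueSum.iterate₃ (h₁ : IsResidueSum S₁ n₁ P₁ w₁) (h₂ : IsResidueSum S₂ n₂ P₂ w₂)
    (h₃ : IsResidueSum S₃ n₃ P₃ w₃) {f F : ℚ_[p] → ℚ_[p] → ℚ_[p] → ℂ}
    (hf : ∀ a b c, P₁ a → P₂ b → P₃ c → f a b c = F a b c)
    (hp₁ : ∀ a b c e : ℤ_[p], P₁ a → P₂ b → P₃ c → F (a + p ^ n₁ * e) b c = F a b c)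
    (hp₂ : ∀ a b c e : ℤ_[p], P₁ a → P₂ b → P₃ c → F a (b + p ^ n₂ * e) c = F a b c)
    (hp₃ : ∀ a b c e : ℤ_[p], P₁ a → P₂ b → P₃ c → F a b (c + p ^ n₃ * e) = F a b c) :
    (S₁ fun a => S₂ fun b => S₃ fun c => f a b c) =
      (p : ℂ) ^ n₁ * ((p : ℂ) ^ n₂ * (p : ℂ) ^ n₃) * mean4 p fun _ a b c =>
        w₁ a * (w₂ b * (w₃ c * F a b c)) := by
  refine (h₁.eq_mean_of_eq (fun a ha => h₂.iterate₂ h₃ (fun b c => hf a b c ha) (fun b c e => hp₂ ⟨a, h₁.norm_le a ha⟩ b c e ha)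
    (fun b c e => hp₃ ⟨a, h₁.norm_le a ha⟩ b c e ha)) ?_).trans ?_
  · exact fun a e ha he => h₂.mean_weight_congr fun b hb => h₃.mean_weight_congr fun c hc =>
      hp₁ ⟨a, h₁.norm_le a ha⟩ ⟨b, h₂.norm_le b hb⟩ ⟨c, h₃.norm_le c hc⟩ ⟨e, he⟩ ha hb hc
  · rw [mean4, mean_const]
    simp only [mean_const_mul]

lemma IsResidueSum.iterate₄ (h₁ : IsResidueSum S₁ n₁ P₁ w₁) (h₂ : IsResidueSum S₂ n₂ P₂ w₂)
    (h₃ : IsResidueSum S₃ n₃ P₃ w₃) (h₄ : IsResidueSum S₄ n₄ P₄ w₄)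
    {f F : ℚ_[p] → ℚ_[p] → ℚ_[p] → ℚ_[p] → ℂ}
    (hf : ∀ a b c d, P₁ a → P₂ b → P₃ c → P₄ d → f a b c d = F a b c d)
    (hp₁ : ∀ a b c d e : ℤ_[p], P₁ a → P₂ b → P₃ c → P₄ d →
      F (a + p ^ n₁ * e) b c d = F a b c d)
    (hp₂ : ∀ a b c d e : ℤ_[p], P₁ a → P₂ b → P₃ c → P₄ d →
      F a (b + p ^ n₂ * e) c d = F a b c d)
    (hp₃ : ∀ a b c d e : ℤ_[p], P₁ a → P₂ b → P₃ c → P₄ d →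
      F a b (c + p ^ n₃ * e) d = F a b c d)
    (hp₄ : ∀ a b c d e : ℤ_[p], P₁ a → P₂ b → P₃ c → P₄ d →
      F a b c (d + p ^ n₄ * e) = F a b c d) :
    (S₁ fun a => S₂ fun b => S₃ fun c => S₄ fun d => f a b c d) =
      (p : ℂ) ^ n₁ * ((p : ℂ) ^ n₂ * ((p : ℂ) ^ n₃ * (p : ℂ) ^ n₄)) * mean4 p fun a b c d =>
        w₁ a * (w₂ b * (w₃ c * (w₄ d * F a b c d))) := by
  refine (h₁.eq_mean_of_eq (fun a ha => h₂.iterate₃ h₃ h₄ (fun b c d => hf a b c d ha)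
    (fun b c d e => hp₂ ⟨a, h₁.norm_le a ha⟩ b c d e ha)
    (fun b c d e => hp₃ ⟨a, h₁.norm_le a ha⟩ b c d e ha) (fun b c d e => hp₄ ⟨a, h₁.norm_le a ha⟩ b c d e ha)) ?_).trans ?_
  · intro a e ha he
    simp only [mean4, mean_const, mean_const_mul]
    exact h₂.mean_weight_congr fun b hb => h₃.mean_weight_congr fun c hc =>
      h₄.mean_weight_congr fun d hd => hp₁ ⟨a, h₁.norm_le a ha⟩ ⟨b, h₂.norm_le b hb⟩
        ⟨c, h₃.norm_le c hc⟩ ⟨d, h₄.norm_le d hd⟩ ⟨e, he⟩ ha hb hc hd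
  · simp only [mean4, mean_const, mean_const_mul]

end FiniteSums

/-! ### Integral changes of the parameters of a summand -/

section Periodicity

variable {p : ℕ} [Fact p.Prime] {Φ : GSp4 p → ℂ} {χ : MulChar ℚ_[p] ℂ}

/-- A summand of the explicit formula does not change if its parameters are changed by suitable
integral quantities. -/
lemma IsSpherical.summand_congr (hΦ : IsSpherical Φ) (hc : HasConductorP χ) {k l : ℤ}
    {c t x y z c' t' x' y' z' : ℚ_[p]} (q₀ qt q₁ q₂ q₃ : ℤ_[p]) (h₀ : c' = c + p * q₀)
    (ht : t' = t + qt) (h₁ : x' + 2 * qt * y' + (qt : ℚ_[p]) ^ 2 * z' = x + q₁)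
    (h₂ : y' + qt * z' = y + q₂) (h₃ : z' = z + q₃) :
    chi χ c' * Φ (upper p k l t' x' y' z') = chi χ c * Φ (upper p k l t x y z) := by
  rw [h₀, chi_add_p_mul χ hc q₀.2, ht, hΦ.upper_levi k l qt.2, h₁, h₂, h₃]
  congr 1
  exact hΦ.upper_congr k l (by simpa using q₁.2) (by simpa using q₂.2) (by simpa using q₃.2)

end Periodicity

/-! ### Matrix coefficients -/

section MatrixCoefficients

variable {p : ℕ} [Fact p.Prime] {V : Type*} [AddCommGroup V] [Module ℂ V]
  (π : Representation ℂ (GSp4 p) V) (φ : V →ₗ[ℂ] ℂ) (v : V)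

/-- The matrix coefficient `g ↦ φ(π(g)v)`. -/
def coeff (g : GSp4 p) : ℂ := φ (π g v)

lemma coeff_upper {g : GSp4 p} {k l : ℤ} (hg : g = diagp p k l) (t x y z : ℚ_[p]) (c : ℂ) :
    (φ ∘ₗ π g) (c • π (levi p t * unip p x y z) v) = c * coeff π φ v (upper p k l t x y z) := by
  rw [coeff, upper, map_mul π (diagp p k l), LinearMap.comp_apply, map_smul, map_smul,
    smul_eq_mul, hg]
  rfl

lemma coeff_upper_zero (t x y z : ℚ_[p]) (c : ℂ) :
    φ (c • π (levi p t * unip p x y z) v) = c * coeff π φ v (upper p 0 0 t x y z) := by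
  rw [coeff, upper, map_smul, smul_eq_mul, diagp_zero, one_mul]

lemma unip_eq (x y z : ℚ_[p]) : unip p x y z = levi p 0 * unip p x y z := by
  apply mat_injective
  rw [mat_mul, mat_levi, mat_unip]
  ext i j; fin_cases i <;> fin_cases j <;> simp [Matrix.mul_apply, Fin.sum_univ_four]

lemma map_prefix_smul (g : GSp4 p) (k : ℂ) (w : V) : φ (k • π g w) = k * (φ ∘ₗ π g) w := by
  rw [map_smul, smul_eq_mul]; rfl

end MatrixCoefficients

/-! ### Each of the fourteen sums as an average -/

section ExplicitSums

variable {p : ℕ} [Fact p.Prime] {V : Type*} [AddCommGroup V] [Module ℂ V]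
  {π : Representation ℂ (GSp4 p) V} {φ : V →ₗ[ℂ] ℂ} {v : V} {χ : MulChar ℚ_[p] ℂ}

lemma coeff_upper_unip {g : GSp4 p} {k l : ℤ} (hg : g = diagp p k l) (x y z : ℚ_[p]) (c : ℂ) :
    (φ ∘ₗ π g) (c • π (unip p x y z) v) = c * coeff π φ v (upper p k l 0 x y z) := by
  rw [unip_eq, coeff_upper π φ v hg]

lemma mean4_scale {k k' K : ℂ} {F G : ℚ_[p] → ℚ_[p] → ℚ_[p] → ℚ_[p] → ℂ} (hk : k * k' = K)
    (h : ∀ a b c d, ‖a‖ ≤ 1 → ‖b‖ ≤ 1 → ‖c‖ ≤ 1 → ‖d‖ ≤ 1 → F a b c d = G a b c d) :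
    k * (k' * mean4 p F) = K * mean4 p G := by
  rw [← mul_assoc, hk, mean4_congr h]

lemma exists_int_inv {a : ℤ_[p]} (ha : ‖(a : ℚ_[p])‖ = 1) : ∃ i : ℤ_[p], (i : ℚ_[p]) = (a : ℚ_[p])⁻¹ :=
  exists_int (by simp [ha])

lemma exists_int_inv_add {a : ℤ_[p]} (ha : ‖(a : ℚ_[p])‖ = 1) {n : ℕ} (hn : n ≠ 0) (e : ℤ_[p]) :
    ∃ i : ℤ_[p], (i : ℚ_[p]) = ((a : ℚ_[p]) + p ^ n * e)⁻¹ ∧ (a : ℚ_[p]) + p ^ n * e ≠ 0 := by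
  have h := (norm_add_p_pow hn (x := (a : ℚ_[p])) e.2).mpr ha
  obtain ⟨i, hi⟩ := exists_int (p := p) (x := ((a : ℚ_[p]) + p ^ n * e)⁻¹) (by simp [h])
  exact ⟨i, hi, ne_zero_of_norm_one h⟩

lemma natCast_p_ne_zero : (p : ℂ) ≠ 0 := Nat.cast_ne_zero.mpr (Fact.out : p.Prime).ne_zero

@[simp, norm_cast]
lemma coe_two_padicInt : ((2 : ℤ_[p]) : ℚ_[p]) = 2 := rfl

lemma oneU_mul_chi (x : ℚ_[p]) : oneU p x * chi χ x = chi χ x := by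
  by_cases h : ‖x‖ = 1
  · rw [oneU_of h, one_mul]
  · rw [chi_of_ne h, mul_zero]

lemma exists_int_one_sub_inv {a : ℤ_[p]} (ha : ‖1 - (a : ℚ_[p])‖ = 1) :
    ∃ i : ℤ_[p], (i : ℚ_[p]) = (1 - (a : ℚ_[p]))⁻¹ :=
  exists_int (by simp [ha])

lemma exists_int_one_sub_inv_add {a : ℤ_[p]} (ha : ‖1 - (a : ℚ_[p])‖ = 1) {n : ℕ} (hn : n ≠ 0)
    (e : ℤ_[p]) : ∃ i : ℤ_[p], (i : ℚ_[p]) = (1 - ((a : ℚ_[p]) + p ^ n * e))⁻¹ ∧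
      1 - ((a : ℚ_[p]) + p ^ n * e) ≠ 0 := by
  have h := (norm_add_p_pow hn (x := 1 - (a : ℚ_[p])) (c := -(e : ℚ_[p])) (by simpa using e.2)).mpr ha
  rw [show 1 - (a : ℚ_[p]) + p ^ n * -(e : ℚ_[p]) = 1 - ((a : ℚ_[p]) + p ^ n * e) by ring] at h
  obtain ⟨i, hi⟩ := exists_int (p := p) (x := (1 - ((a : ℚ_[p]) + p ^ n * e))⁻¹) (by simp [h])
  exact ⟨i, hi, ne_zero_of_norm_one h⟩

/-- The exponent 2 is 3 + 3 + 3 + 4 - 11. Each variable is shifted by a multiple of the modulus of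
its residue ring, and the five quantities given to `summand_congr` certify that the summand is
unchanged: the change of the argument of χ divided by p, the change of the Levi parameter, and the
changes of the three entries of the symmetric block after conjugation by that Levi change. The other
sums are treated in the same way. -/
lemma coeff_T1 (hΦ : IsSpherical (coeff π φ v)) (hc : HasConductorP χ) (r : Representatives p) :
    φ (T1 π χ r v) = (p : ℂ) ^ 2 * avgOne (coeff π φ v) χ 4 := by
  have hp := p_ne_zero p
  rw [T1, map_smul, smul_eq_mul]
  simp only [map_sumUnits, map_sumAll, coeff_upper_zero π φ v]
  refine (congrArg _ ((isResidueSum_sumUnits r three_ne_zero).iterate₄ (isResidueSum_sumUnits r three_ne_zero) (isResidueSum_sumUnits r three_ne_zero) (isResidueSum_sumAll r 4)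
    (F := fun a b x z => chi χ (a * b) * coeff π φ v (upper p 0 0 (-(a + x * b) / p) (z / p ^ 4) (b / p ^ 2) (x⁻¹ / p))) ?_ ?_ ?_ ?_ ?_)).trans ?_
  · intro a b x z ha hb hx hz
    rw [chi_of (by simp [ha, hb])]
  · intro a b x z e ha hb hx hz
    obtain ⟨xi, hxi⟩ := exists_int_inv hx
    have hx0 := ne_zero_of_norm_one hx
    refine hΦ.summand_congr hc (p ^ 2 * e * b) (-p ^ 2 * e) (-2 * e * b + p ^ 3 * e ^ 2 * xi) (-p * e * xi) 0 ?_ ?_ ?_ ?_ ?_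
    all_goals (push_cast; (try simp only [hxi]); (try field_simp) <;> try ring)
  · intro a b x z e ha hb hx hz
    obtain ⟨xi, hxi⟩ := exists_int_inv hx
    have hx0 := ne_zero_of_norm_one hx
    refine hΦ.summand_congr hc (p ^ 2 * e * a) (-p ^ 2 * x * e) (-2 * x * e * (b + p ^ 3 * e) + p ^ 3 * x ^ 2 * e ^ 2 * xi) 0 0 ?_ ?_ ?_ ?_ ?_
    all_goals (push_cast; (try simp only [hxi]); (try field_simp) <;> try ring)
  · intro a b x z e ha hb hx hz
    obtain ⟨xi, hxi⟩ := exists_int_inv hx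
    have hx0 := ne_zero_of_norm_one hx
    -- Inverses of x and of x + p³e differ by -p³e times the product of the two inverses, which are
    -- both integral.
    obtain ⟨xj, hxj, hxe⟩ := exists_int_inv_add hx three_ne_zero e
    refine hΦ.summand_congr hc 0 (-p ^ 2 * e * b) (-2 * e * b ^ 2 + p ^ 3 * e ^ 2 * b ^ 2 * xj) (-p * e * b * xj) (-p ^ 2 * e * xi * xj) ?_ ?_ ?_ ?_ ?_
    all_goals (push_cast; (try simp only [hxi, hxj]); (try field_simp) <;> try ring)
  · intro a b x z e ha hb hx hz
    refine hΦ.summand_congr hc 0 0 e 0 0 ?_ ?_ ?_ ?_ ?_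
    all_goals (push_cast; (try field_simp) <;> try ring)
  · have hΦc := hΦ.continuous
    have hχc := continuous_chi hc
    have h : avgOne (coeff π φ v) χ 4 = mean4 p fun a b x z => oneU p x * (chi χ a * chi χ b *
        coeff π φ v (upper p 0 0 (-(a + x * b) / p) (z / p ^ 4) (b / p ^ 2) (uinv p x / p))) :=
      (mean4_comm14 (by unfold Continuous4; fun_prop)).trans
        (mean4_comm34 (by unfold Continuous4; fun_prop))
    rw [h]
    refine mean4_scale ?_ fun a b x z _ _ _ _ => ?_
    · field_simp [natCast_p_ne_zero (p := p)]
    by_cases ha : ‖a‖ = 1; swap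
    · simp [oneU_of_ne ha, chi_of_ne ha]
    by_cases hb : ‖b‖ = 1; swap
    · simp [oneU_of_ne hb, chi_of_ne hb]
    by_cases hx : ‖x‖ = 1; swap
    · simp [oneU_of_ne hx]
    simp only [oneU_of ha, oneU_of hb, oneU_of hx, uinv_of hx, chi_unit_mul ha, one_mul]

lemma coeff_T2 (hΦ : IsSpherical (coeff π φ v)) (hc : HasConductorP χ) (r : Representatives p) :
    φ (T2 π χ r v) = meanT2 (coeff π φ v) χ := by
  have hp := p_ne_zero p
  rw [T2, map_prefix_smul]
  simp only [map_sumUnits, map_sumUnitsNeOne, coeff_upper π φ v etaJ_eq]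
  refine (congrArg _ ((isResidueSum_sumUnits r three_ne_zero).iterate₄ (isResidueSum_sumUnits r three_ne_zero) (isResidueSum_sumUnitsNeOne r three_ne_zero) (isResidueSum_sumUnitsNeOne r three_ne_zero)
    (F := fun a b x y => chi χ (a * b * x * y) * coeff π φ v (upper p 1 0 (b / p) (a * b * (1 - (1 - y)⁻¹ * x) / p ^ 3) (-a / p ^ 2) (a * b⁻¹ * (1 - x)⁻¹ / p))) ?_ ?_ ?_ ?_ ?_)).trans ?_
  · intro a b x y ha hb hx hy
    rw [chi_of (by simp [ha, hb, hx.1, hy.1])]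
  · intro a b x y e ha hb hx hy
    obtain ⟨bi, hbi⟩ := exists_int_inv hb
    have hb0 := ne_zero_of_norm_one hb
    obtain ⟨xi, hxi⟩ := exists_int_one_sub_inv hx.2
    have hx0 := ne_zero_of_norm_one hx.2
    obtain ⟨yi, hyi⟩ := exists_int_one_sub_inv hy.2
    have hy0 := ne_zero_of_norm_one hy.2
    refine hΦ.summand_congr hc (p ^ 2 * e * b * x * y) 0 (e * b * (1 - x * yi)) (-p * e) (p ^ 2 * e * bi * xi) ?_ ?_ ?_ ?_ ?_
    all_goals (push_cast; (try simp only [hbi, hxi, hyi]); (try field_simp) <;> try ring)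
  · intro a b x y e ha hb hx hy
    obtain ⟨bi, hbi⟩ := exists_int_inv hb
    have hb0 := ne_zero_of_norm_one hb
    obtain ⟨bj, hbj, hbe⟩ := exists_int_inv_add hb three_ne_zero e
    obtain ⟨xi, hxi⟩ := exists_int_one_sub_inv hx.2
    have hx0 := ne_zero_of_norm_one hx.2
    obtain ⟨yi, hyi⟩ := exists_int_one_sub_inv hy.2
    have hy0 := ne_zero_of_norm_one hy.2
    refine hΦ.summand_congr hc (p ^ 2 * e * a * x * y) (p ^ 2 * e) (a * e * (1 - x * yi) - 2 * e * a + p ^ 3 * e ^ 2 * a * bj * xi) (p * e * a * bj * xi) (-p ^ 2 * e * a * bi * bj * xi) ?_ ?_ ?_ ?_ ?_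
    all_goals (push_cast; (try simp only [hbi, hbj, hxi, hyi]); (try field_simp) <;> try ring)
  · intro a b x y e ha hb hx hy
    obtain ⟨bi, hbi⟩ := exists_int_inv hb
    have hb0 := ne_zero_of_norm_one hb
    obtain ⟨xi, hxi⟩ := exists_int_one_sub_inv hx.2
    have hx0 := ne_zero_of_norm_one hx.2
    obtain ⟨xj, hxj, hxe⟩ := exists_int_one_sub_inv_add hx.2 three_ne_zero e
    obtain ⟨yi, hyi⟩ := exists_int_one_sub_inv hy.2
    have hy0 := ne_zero_of_norm_one hy.2
    refine hΦ.summand_congr hc (p ^ 2 * e * a * b * y) 0 (-a * b * e * yi) 0 (a * bi * p ^ 2 * e * xi * xj) ?_ ?_ ?_ ?_ ?_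
    all_goals (push_cast; (try simp only [hbi, hxi, hxj, hyi]); (try field_simp) <;> try ring)
  · intro a b x y e ha hb hx hy
    obtain ⟨yi, hyi⟩ := exists_int_one_sub_inv hy.2
    have hy0 := ne_zero_of_norm_one hy.2
    obtain ⟨yj, hyj, hye⟩ := exists_int_one_sub_inv_add hy.2 three_ne_zero e
    refine hΦ.summand_congr hc (p ^ 2 * e * a * b * x) 0 (-a * b * x * e * yi * yj) 0 0 ?_ ?_ ?_ ?_ ?_
    all_goals (push_cast; (try simp only [hyi, hyj]); (try field_simp) <;> try ring)
  · rw [meanT2]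
    refine mean4_scale ?_ fun a b x y _ _ _ _ => ?_
    · field_simp [natCast_p_ne_zero (p := p)]
    by_cases ha : ‖a‖ = 1; swap
    · simp [oneU_of_ne ha, chi_of_ne ha]
    by_cases hb : ‖b‖ = 1; swap
    · simp [oneU_of_ne hb, chi_of_ne hb]
    by_cases hx : ‖x‖ = 1; swap
    · simp [oneU_of_ne hx, chi_of_ne hx]
    by_cases hy : ‖y‖ = 1; swap
    · simp [oneU_of_ne hy, chi_of_ne hy]
    by_cases hx' : ‖1 - x‖ = 1; swap
    · simp [oneU_of_ne hx']
    by_cases hy' : ‖1 - y‖ = 1; swap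
    · simp [oneU_of_ne hy']
    rw [mul_assoc (a * b), mul_comm (a * b)]
    simp only [oneU_of ha, oneU_of hb, oneU_of hx, oneU_of hy, oneU_of hx', oneU_of hy', uinv_of hb,
      uinv_of hx', uinv_of hy', chi_unit_mul ha, chi_unit_mul hx, mul_assoc x, chi_unit_mul hy]
    ring

lemma coeff_T3 (hΦ : IsSpherical (coeff π φ v)) (hc : HasConductorP χ) (r : Representatives p) :
    φ (T3 π χ r v) = meanT3 (coeff π φ v) χ := by
  have hp := p_ne_zero p
  rw [T3, map_prefix_smul]
  simp only [map_sumUnits, map_sumUnitsNeOne, coeff_upper_unip etaJ_eq]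
  refine (congrArg _ ((isResidueSum_sumUnits r two_ne_zero).iterate₃ (isResidueSum_sumUnits r three_ne_zero) (isResidueSum_sumUnitsNeOne r one_ne_zero)
    (F := fun a b z => chi χ (b * (1 - z)) * coeff π φ v (upper p 1 0 0 (b / p ^ 3) (a / p ^ 2) (a ^ 2 * b⁻¹ * z / p))) ?_ ?_ ?_ ?_)).trans ?_
  · intro a b z ha hb hz
    rw [chi_of (by simp [hb, hz.2])]
  · intro a b z e ha hb hz
    obtain ⟨bi, hbi⟩ := exists_int_inv hb
    have hb0 := ne_zero_of_norm_one hb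
    refine hΦ.summand_congr hc 0 0 0 e ((2 * a * p * e + p ^ 3 * e ^ 2) * bi * z) ?_ ?_ ?_ ?_ ?_
    all_goals (push_cast; (try simp only [hbi]); (try field_simp) <;> try ring)
  · intro a b z e ha hb hz
    obtain ⟨bi, hbi⟩ := exists_int_inv hb
    have hb0 := ne_zero_of_norm_one hb
    obtain ⟨bj, hbj, hbe⟩ := exists_int_inv_add hb three_ne_zero e
    refine hΦ.summand_congr hc (p ^ 2 * e * (1 - z)) 0 e 0 (-a ^ 2 * z * p ^ 2 * e * bi * bj) ?_ ?_ ?_ ?_ ?_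
    all_goals (push_cast; (try simp only [hbi, hbj]); (try field_simp) <;> try ring)
  · intro a b z e ha hb hz
    obtain ⟨bi, hbi⟩ := exists_int_inv hb
    have hb0 := ne_zero_of_norm_one hb
    refine hΦ.summand_congr hc (-b * e) 0 0 0 (a ^ 2 * bi * e) ?_ ?_ ?_ ?_ ?_
    all_goals (push_cast; (try simp only [hbi]); (try field_simp) <;> try ring)
  · rw [meanT3]
    refine Eq.trans ?_ (one_mul _)
    refine mean4_scale ?_ fun _ a b z _ _ _ _ => ?_
    · field_simp [natCast_p_ne_zero (p := p)]
    by_cases hb : ‖b‖ = 1; swap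
    · simp [oneU_of_ne hb, chi_of_ne hb]
    by_cases hz : ‖z‖ = 1; swap
    · simp [oneU_of_ne hz]
    by_cases hz' : ‖1 - z‖ = 1; swap
    · simp [oneU_of_ne hz', chi_of_ne hz']
    simp only [oneU_of hb, oneU_of hz, oneU_of hz', uinv_of hb, chi_unit_mul hb]
    ring

lemma coeff_T4 (hΦ : IsSpherical (coeff π φ v)) (hc : HasConductorP χ) (r : Representatives p) :
    φ (T4 π χ r v) = meanT4 (coeff π φ v) χ := by
  have hp := p_ne_zero p
  rw [T4, map_prefix_smul]
  simp only [map_sumUnits, map_sumAll, coeff_upper π φ v etaJ_eq]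
  refine (congrArg _ ((isResidueSum_sumAll r 4).iterate₃ (isResidueSum_sumUnits r three_ne_zero) (isResidueSum_sumUnits r four_ne_zero)
    (F := fun a b x => chi χ (b) * coeff π φ v (upper p 1 0 (x / p ^ 2) ((b * p - a * x) / p ^ 4) (a / p ^ 2) 0)) ?_ ?_ ?_ ?_)).trans ?_
  · intro a b x ha hb hx
    rw [chi_of hb]
  · intro a b x e ha hb hx
    refine hΦ.summand_congr hc 0 0 (-e * x) (p ^ 2 * e) 0 ?_ ?_ ?_ ?_ ?_
    all_goals (push_cast; (try field_simp) <;> try ring)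
  · intro a b x e ha hb hx
    refine hΦ.summand_congr hc (p ^ 2 * e) 0 e 0 0 ?_ ?_ ?_ ?_ ?_
    all_goals (push_cast; (try field_simp) <;> try ring)
  · intro a b x e ha hb hx
    refine hΦ.summand_congr hc 0 (p ^ 2 * e) (a * e) 0 0 ?_ ?_ ?_ ?_ ?_
    all_goals (push_cast; (try field_simp) <;> try ring)
  · rw [meanT4]
    refine mean4_scale ?_ fun _ a b x _ _ _ _ => ?_
    · field_simp [natCast_p_ne_zero (p := p)]
    by_cases hb : ‖b‖ = 1; swap
    · simp [oneU_of_ne hb, chi_of_ne hb]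
    rw [oneU_of hb]; ring

lemma coeff_T5 (hΦ : IsSpherical (coeff π φ v)) (hc : HasConductorP χ) (r : Representatives p) :
    φ (T5 π χ r v) = meanT5 (coeff π φ v) χ := by
  have hp := p_ne_zero p
  rw [T5, map_prefix_smul]
  simp only [map_sumUnits, map_sumAll, coeff_upper π φ v etaJ_eq]
  refine (congrArg _ ((isResidueSum_sumUnits r three_ne_zero).iterate₃ (isResidueSum_sumUnits r three_ne_zero) (isResidueSum_sumAll r 3)
    (F := fun a b x => chi χ (b) * coeff π φ v (upper p 1 0 (x / p) ((b - a * x) / p ^ 3) (a / p ^ 2) 0)) ?_ ?_ ?_ ?_)).trans ?_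
  · intro a b x ha hb hx
    rw [chi_of hb]
  · intro a b x e ha hb hx
    refine hΦ.summand_congr hc 0 0 (-e * x) (p * e) 0 ?_ ?_ ?_ ?_ ?_
    all_goals (push_cast; (try field_simp) <;> try ring)
  · intro a b x e ha hb hx
    refine hΦ.summand_congr hc (p ^ 2 * e) 0 e 0 0 ?_ ?_ ?_ ?_ ?_
    all_goals (push_cast; (try field_simp) <;> try ring)
  · intro a b x e ha hb hx
    refine hΦ.summand_congr hc 0 (p ^ 2 * e) (a * e) 0 0 ?_ ?_ ?_ ?_ ?_
    all_goals (push_cast; (try field_simp) <;> try ring)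
  · rw [meanT5]
    refine Eq.trans ?_ (one_mul _)
    refine mean4_scale ?_ fun _ a b x _ _ _ _ => ?_
    · field_simp [natCast_p_ne_zero (p := p)]
    by_cases hb : ‖b‖ = 1; swap
    · simp [oneU_of_ne hb, chi_of_ne hb]
    rw [oneU_of hb]; ring

lemma coeff_T6 (hΦ : IsSpherical (coeff π φ v)) (hc : HasConductorP χ) (r : Representatives p) :
    φ (T6 π χ r v) = meanT6 (coeff π φ v) χ := by
  have hp := p_ne_zero p
  have hg : etaJ p ^ 2 = diagp p 2 0 := by rw [etaJ_eq, pow_two, diagp_mul]; rfl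
  rw [T6, map_prefix_smul]
  simp only [map_sumUnits, coeff_upper_unip hg]
  refine (congrArg _ ((isResidueSum_sumUnits r two_ne_zero).iterate₃ (isResidueSum_sumUnits r two_ne_zero) (isResidueSum_sumUnits r one_ne_zero)
    (F := fun a b x => chi χ (b * x) * coeff π φ v (upper p 2 0 0 (b * (1 - x * p) / p ^ 2) (a / p ^ 2) (a ^ 2 * b⁻¹ / p ^ 2))) ?_ ?_ ?_ ?_)).trans ?_
  · intro a b x ha hb hx
    rw [chi_of (by simp [hb, hx])]
  · intro a b x e ha hb hx
    obtain ⟨bi, hbi⟩ := exists_int_inv hb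
    have hb0 := ne_zero_of_norm_one hb
    refine hΦ.summand_congr hc 0 0 0 e ((2 * a * e + p ^ 2 * e ^ 2) * bi) ?_ ?_ ?_ ?_ ?_
    all_goals (push_cast; (try simp only [hbi]); (try field_simp) <;> try ring)
  · intro a b x e ha hb hx
    obtain ⟨bi, hbi⟩ := exists_int_inv hb
    have hb0 := ne_zero_of_norm_one hb
    obtain ⟨bj, hbj, hbe⟩ := exists_int_inv_add hb two_ne_zero e
    refine hΦ.summand_congr hc (p * e * x) 0 (e * (1 - x * p)) 0 (-a ^ 2 * e * bi * bj) ?_ ?_ ?_ ?_ ?_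
    all_goals (push_cast; (try simp only [hbi, hbj]); (try field_simp) <;> try ring)
  · intro a b x e ha hb hx
    refine hΦ.summand_congr hc (b * e) 0 (-b * e) 0 0 ?_ ?_ ?_ ?_ ?_
    all_goals (push_cast; (try field_simp) <;> try ring)
  · rw [meanT6]
    refine mean4_scale ?_ fun _ a b x _ _ _ _ => ?_
    · field_simp [natCast_p_ne_zero (p := p)]
    by_cases hb : ‖b‖ = 1; swap
    · simp [oneU_of_ne hb, chi_of_ne hb]
    by_cases hx : ‖x‖ = 1; swap
    · simp [oneU_of_ne hx, chi_of_ne hx]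
    simp only [oneU_of hb, oneU_of hx, uinv_of hb, chi_unit_mul hb]
    ring

lemma coeff_T7 (hΦ : IsSpherical (coeff π φ v)) (hc : HasConductorP χ) (r : Representatives p) :
    φ (T7 π χ r v) = (p : ℂ) * avgTau (coeff π φ v) χ 4 := by
  have hp := p_ne_zero p
  rw [T7, map_prefix_smul]
  simp only [map_sumUnits, map_sumAll, coeff_upper π φ v tauJ_eq]
  refine (congrArg _ ((isResidueSum_sumUnits r three_ne_zero).iterate₃ (isResidueSum_sumUnits r one_ne_zero) (isResidueSum_sumAll r 4)
    (F := fun a b z => chi χ (a * b) * coeff π φ v (upper p 0 1 (-a / p ^ 2) (z / p ^ 4) (b / p) 0)) ?_ ?_ ?_ ?_)).trans ?_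
  · intro a b z ha hb hz
    rw [chi_of (by simp [ha, hb])]
  · intro a b z e ha hb hz
    refine hΦ.summand_congr hc (p ^ 2 * e * b) (-p * e) (-2 * e * b) 0 0 ?_ ?_ ?_ ?_ ?_
    all_goals (push_cast; (try field_simp) <;> try ring)
  · intro a b z e ha hb hz
    refine hΦ.summand_congr hc (a * e) 0 0 e 0 ?_ ?_ ?_ ?_ ?_
    all_goals (push_cast; (try field_simp) <;> try ring)
  · intro a b z e ha hb hz
    refine hΦ.summand_congr hc 0 0 e 0 0 ?_ ?_ ?_ ?_ ?_
    all_goals (push_cast; (try field_simp) <;> try ring)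
  · rw [avgTau, ← mean_const (p := p) (mean p fun a => mean p fun b => mean p fun z => _)]
    refine mean4_scale ?_ fun _ a b z _ _ _ _ => ?_
    · field_simp [natCast_p_ne_zero (p := p)]
    by_cases ha : ‖a‖ = 1; swap
    · simp [oneU_of_ne ha, chi_of_ne ha]
    by_cases hb : ‖b‖ = 1; swap
    · simp [oneU_of_ne hb, chi_of_ne hb]
    simp only [oneU_of ha, oneU_of hb, chi_unit_mul ha, one_mul]

lemma coeff_T8 (hΦ : IsSpherical (coeff π φ v)) (hc : HasConductorP χ) (r : Representatives p) :
    φ (T8 π χ r v) = meanT8 (coeff π φ v) χ := by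
  have hp := p_ne_zero p
  have hg : etaJ p * tauJ p = diagp p 1 1 := by rw [etaJ_eq, tauJ_eq, diagp_mul]; rfl
  rw [T8, map_prefix_smul]
  simp only [map_sumUnits, map_sumUnitsNeOne, coeff_upper π φ v hg]
  refine (congrArg _ ((isResidueSum_sumUnits r three_ne_zero).iterate₃ (isResidueSum_sumUnits r three_ne_zero) (isResidueSum_sumUnitsNeOne r three_ne_zero)
    (F := fun a b z => chi χ (a * b * z * (1 - z)) * coeff π φ v (upper p 1 1 (b / p ^ 2) (-(a * b * (1 - z)) / p ^ 3) (a / p) 0)) ?_ ?_ ?_ ?_)).trans ?_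
  · intro a b z ha hb hz
    rw [chi_of (by simp [ha, hb, hz.1, hz.2])]
  · intro a b z e ha hb hz
    refine hΦ.summand_congr hc (p ^ 2 * e * b * z * (1 - z)) 0 (-e * b * (1 - z)) (p ^ 2 * e) 0 ?_ ?_ ?_ ?_ ?_
    all_goals (push_cast; (try field_simp) <;> try ring)
  · intro a b z e ha hb hz
    refine hΦ.summand_congr hc (p ^ 2 * e * a * z * (1 - z)) (p * e) (-a * e * (1 - z) + 2 * e * a) 0 0 ?_ ?_ ?_ ?_ ?_
    all_goals (push_cast; (try field_simp) <;> try ring)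
  · intro a b z e ha hb hz
    refine hΦ.summand_congr hc (a * b * (p ^ 2 * e - 2 * p ^ 2 * e * z - p ^ 5 * e ^ 2)) 0 (a * b * e) 0 0 ?_ ?_ ?_ ?_ ?_
    all_goals (push_cast; (try field_simp) <;> try ring)
  · rw [meanT8]
    refine Eq.trans ?_ (one_mul _)
    refine mean4_scale ?_ fun _ a b z _ _ _ _ => ?_
    · field_simp [natCast_p_ne_zero (p := p)]
    by_cases ha : ‖a‖ = 1; swap
    · simp [oneU_of_ne ha, chi_of_ne ha]
    by_cases hb : ‖b‖ = 1; swap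
    · simp [oneU_of_ne hb, chi_of_ne hb]
    by_cases hz : ‖z‖ = 1; swap
    · simp [oneU_of_ne hz, chi_of_ne hz]
    by_cases hz' : ‖1 - z‖ = 1; swap
    · simp [oneU_of_ne hz', chi_of_ne hz']
    rw [mul_assoc (a * b), mul_comm (a * b)]
    simp only [oneU_of ha, oneU_of hb, oneU_of hz, oneU_of hz', chi_unit_mul ha, chi_unit_mul hz,
      mul_assoc z, chi_unit_mul hz']
    ring

lemma coeff_T9 (hΦ : IsSpherical (coeff π φ v)) (hc : HasConductorP χ) (r : Representatives p) :
    φ (T9 π χ r v) = meanT9 (coeff π φ v) χ := by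
  have hp := p_ne_zero p
  have hg : etaJ p ^ 2 * tauJ p = diagp p 2 1 := by rw [etaJ_eq, tauJ_eq, pow_two, diagp_mul, diagp_mul]; rfl
  rw [T9, map_prefix_smul]
  simp only [map_sumUnits, coeff_upper π φ v hg]
  refine (congrArg _ ((isResidueSum_sumUnits r two_ne_zero).iterate₃ (isResidueSum_sumUnits r one_ne_zero) (isResidueSum_sumUnits r one_ne_zero)
    (F := fun a b x => chi χ (b) * coeff π φ v (upper p 2 1 (a / p) (-b / p) 0 (x / p))) ?_ ?_ ?_ ?_)).trans ?_
  · intro a b x ha hb hx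
    rw [chi_of hb]
  · intro a b x e ha hb hx
    refine hΦ.summand_congr hc 0 (p * e) (p * e ^ 2 * x) (e * x) 0 ?_ ?_ ?_ ?_ ?_
    all_goals (push_cast; (try field_simp) <;> try ring)
  · intro a b x e ha hb hx
    refine hΦ.summand_congr hc e 0 (-e) 0 0 ?_ ?_ ?_ ?_ ?_
    all_goals (push_cast; (try field_simp) <;> try ring)
  · intro a b x e ha hb hx
    refine hΦ.summand_congr hc 0 0 0 0 e ?_ ?_ ?_ ?_ ?_
    all_goals (push_cast; (try field_simp) <;> try ring)
  · rw [meanT9]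
    refine mean4_scale ?_ fun _ a b x _ _ _ _ => ?_
    · field_simp [natCast_p_ne_zero (p := p)]
    by_cases hb : ‖b‖ = 1; swap
    · simp [oneU_of_ne hb, chi_of_ne hb]
    rw [oneU_of hb]; ring

lemma coeff_T10 (hΦ : IsSpherical (coeff π φ v)) (hc : HasConductorP χ) (r : Representatives p) :
    φ (T10 π χ r v) = meanT10 (coeff π φ v) χ := by
  have hp := p_ne_zero p
  have hg : etaJ p ^ 2 * tauJ p ^ 2 = diagp p 2 2 := by rw [etaJ_eq, tauJ_eq, pow_two, pow_two, diagp_mul, diagp_mul, diagp_mul]; rfl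
  rw [T10, map_prefix_smul]
  simp only [map_sumUnits, coeff_upper π φ v hg]
  refine (congrArg _ ((isResidueSum_sumUnits r two_ne_zero).iterate₂ (isResidueSum_sumUnits r one_ne_zero)
    (F := fun a b => chi χ (b) * coeff π φ v (upper p 2 2 (a / p ^ 2) (-b / p) 0 0)) ?_ ?_ ?_)).trans ?_
  · intro a b ha hb
    rw [chi_of hb]
  · intro a b e ha hb
    refine hΦ.summand_congr hc 0 e 0 0 0 ?_ ?_ ?_ ?_ ?_
    all_goals (push_cast; (try field_simp) <;> try ring)
  · intro a b e ha hb
    refine hΦ.summand_congr hc e 0 (-e) 0 0 ?_ ?_ ?_ ?_ ?_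
    all_goals (push_cast; (try field_simp) <;> try ring)
  · rw [meanT10, mean4, mean_const, mean_const]
    simp only [← mean_const_mul (oneU p _)]
    rw [← mul_assoc]
    congr 1
    · field_simp [natCast_p_ne_zero (p := p)]
    · refine mean_congr fun a _ => mean_congr fun b _ => ?_
      by_cases hb : ‖b‖ = 1; swap
      · simp [oneU_of_ne hb, chi_of_ne hb]
      rw [oneU_of hb]; ring

lemma coeff_T11 (hΦ : IsSpherical (coeff π φ v)) (hc : HasConductorP χ) (r : Representatives p) :
    φ (T11 π χ r v) = (p : ℂ) ^ 3 * mean p (avgTauInvAt (coeff π φ v) χ 4) := by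
  have hp := p_ne_zero p
  have hg : (tauJ p)⁻¹ = diagp p 0 (-1) := by rw [tauJ_eq, diagp_inv]; rfl
  rw [T11, map_prefix_smul]
  simp only [map_sumUnits, map_sumAll, coeff_upper π φ v hg]
  refine (congrArg _ ((isResidueSum_sumUnits r two_ne_zero).iterate₄ (isResidueSum_sumUnits r four_ne_zero) (isResidueSum_sumAll r 3) (isResidueSum_sumAll r 4)
    (F := fun a b x z => chi χ (a * b) * coeff π φ v (upper p 0 (-1) (b / p) (z / p ^ 4) ((x * b + a * p) / p ^ 3) (-x / p ^ 2))) ?_ ?_ ?_ ?_ ?_)).trans ?_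
  · intro a b x z ha hb hx hz
    rw [chi_of (by simp [ha, hb])]
  · intro a b x z e ha hb hx hz
    refine hΦ.summand_congr hc (p * e * b) 0 0 e 0 ?_ ?_ ?_ ?_ ?_
    all_goals (push_cast; (try field_simp) <;> try ring)
  · intro a b x z e ha hb hx hz
    refine hΦ.summand_congr hc (p ^ 3 * e * a) (p ^ 3 * e) (2 * e * (x * b + a * p) + p ^ 4 * e ^ 2 * x) 0 0 ?_ ?_ ?_ ?_ ?_
    all_goals (push_cast; (try field_simp) <;> try ring)
  · intro a b x z e ha hb hx hz
    refine hΦ.summand_congr hc 0 0 0 (e * b) (-p * e) ?_ ?_ ?_ ?_ ?_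
    all_goals (push_cast; (try field_simp) <;> try ring)
  · intro a b x z e ha hb hx hz
    refine hΦ.summand_congr hc 0 0 e 0 0 ?_ ?_ ?_ ?_ ?_
    all_goals (push_cast; (try field_simp) <;> try ring)
  · have hΦc := hΦ.continuous
    have hχc := continuous_chi hc
    have h : mean p (avgTauInvAt (coeff π φ v) χ 4) = mean4 p fun a b x z => chi χ a * chi χ b *
        coeff π φ v (upper p 0 (-1) (b / p) (z / p ^ 4) ((x * b + a * p) / p ^ 3) (-x / p ^ 2)) := by
      -- The translation z ↦ z + xb² removes the quadratic term; it is integral because the central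
      -- denominator here is p⁴, as in that term.
      refine (mean4_affine (F := fun x a b z => chi χ a * chi χ b * coeff π φ v
        (upper p 0 (-1) (b / p) (z / p ^ 4 - x * b ^ 2 / p ^ 4) ((x * b + a * p) / p ^ 3) (-x / p ^ 2)))
        (fun _ _ _ => 1) (fun x a b => x * b ^ 2) ?_).trans ?_
      · intro x a b hx _ hb
        exact ⟨by simp, by
          rw [pow_two]; exact norm_mul_le_one hx (norm_mul_le_one hb hb)⟩
      refine (mean4_comm14 (by unfold Continuous4; fun_prop)).trans
        ((mean4_comm34 (by unfold Continuous4; fun_prop)).trans ?_)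
      refine mean4_congr fun a b x z _ _ _ _ => ?_
      congr 3
      ring
    rw [h]
    refine mean4_scale ?_ fun a b x z _ _ _ _ => ?_
    · field_simp [natCast_p_ne_zero (p := p)]
    by_cases ha : ‖a‖ = 1; swap
    · simp [oneU_of_ne ha, chi_of_ne ha]
    by_cases hb : ‖b‖ = 1; swap
    · simp [oneU_of_ne hb, chi_of_ne hb]
    simp only [oneU_of ha, oneU_of hb, chi_unit_mul ha, one_mul]

lemma coeff_T12 (hΦ : IsSpherical (coeff π φ v)) (hc : HasConductorP χ) (r : Representatives p) :
    φ (T12 π χ r v) = meanT12 (coeff π φ v) χ := by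
  have hp := p_ne_zero p
  have hg : etaJ p * (tauJ p)⁻¹ = diagp p 1 (-1) := by rw [etaJ_eq, tauJ_eq, diagp_inv, diagp_mul]; rfl
  rw [T12, map_prefix_smul]
  simp only [map_sumUnits, map_sumAll, map_sumUnitsNeOne, coeff_upper π φ v hg]
  refine (congrArg _ ((isResidueSum_sumAll r 4).iterate₄ (isResidueSum_sumUnits r four_ne_zero) (isResidueSum_sumUnits r three_ne_zero) (isResidueSum_sumUnitsNeOne r three_ne_zero)
    (F := fun y a b z => chi χ (a * b * z * (1 - z)) * coeff π φ v (upper p 1 (-1) (a / p) (a * (b * (1 - z) * p - y) / p ^ 4) (y / p ^ 3) (-(a⁻¹ * (y + b * p)) / p ^ 2))) ?_ ?_ ?_ ?_ ?_)).trans ?_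
  · intro y a b z hy ha hb hz
    rw [chi_of (by simp [ha, hb, hz.1, hz.2])]
  · intro y a b z e hy ha hb hz
    obtain ⟨ai, hai⟩ := exists_int_inv ha
    have ha0 := ne_zero_of_norm_one ha
    refine hΦ.summand_congr hc 0 0 (-a * e) (p * e) (-ai * p ^ 2 * e) ?_ ?_ ?_ ?_ ?_
    all_goals (push_cast; (try simp only [hai]); (try field_simp) <;> try ring)
  · intro y a b z e hy ha hb hz
    obtain ⟨ai, hai⟩ := exists_int_inv ha
    have ha0 := ne_zero_of_norm_one ha
    obtain ⟨aj, haj, hae⟩ := exists_int_inv_add ha four_ne_zero e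
    refine hΦ.summand_congr hc (p ^ 3 * e * b * z * (1 - z)) (p ^ 3 * e) (e * (b * (1 - z) * p - y) + 2 * e * y - p ^ 4 * e ^ 2 * aj * (y + b * p)) (-p * e * aj * (y + b * p)) (p ^ 2 * e * ai * aj * (y + b * p)) ?_ ?_ ?_ ?_ ?_
    all_goals (push_cast; (try simp only [hai, haj]); (try field_simp) <;> try ring)
  · intro y a b z e hy ha hb hz
    obtain ⟨ai, hai⟩ := exists_int_inv ha
    have ha0 := ne_zero_of_norm_one ha
    refine hΦ.summand_congr hc (p ^ 2 * e * a * z * (1 - z)) 0 (a * e * (1 - z)) 0 (-ai * p ^ 2 * e) ?_ ?_ ?_ ?_ ?_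
    all_goals (push_cast; (try simp only [hai]); (try field_simp) <;> try ring)
  · intro y a b z e hy ha hb hz
    obtain ⟨ai, hai⟩ := exists_int_inv ha
    have ha0 := ne_zero_of_norm_one ha
    refine hΦ.summand_congr hc (a * b * (p ^ 2 * e - 2 * p ^ 2 * e * z - p ^ 5 * e ^ 2)) 0 (-a * b * e) 0 0 ?_ ?_ ?_ ?_ ?_
    all_goals (push_cast; (try simp only [hai]); (try field_simp) <;> try ring)
  · rw [meanT12]
    refine mean4_scale ?_ fun y a b z _ _ _ _ => ?_
    · field_simp [natCast_p_ne_zero (p := p)]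
    by_cases ha : ‖a‖ = 1; swap
    · simp [oneU_of_ne ha, chi_of_ne ha]
    by_cases hb : ‖b‖ = 1; swap
    · simp [oneU_of_ne hb, chi_of_ne hb]
    by_cases hz : ‖z‖ = 1; swap
    · simp [oneU_of_ne hz, chi_of_ne hz]
    by_cases hz' : ‖1 - z‖ = 1; swap
    · simp [oneU_of_ne hz', chi_of_ne hz']
    rw [mul_assoc (a * b), mul_comm (a * b)]
    simp only [oneU_of ha, oneU_of hb, oneU_of hz, oneU_of hz', uinv_of ha, chi_unit_mul ha,
      chi_unit_mul hz, mul_assoc z, chi_unit_mul hz']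
    ring

lemma coeff_T14 (hΦ : IsSpherical (coeff π φ v)) (hc : HasConductorP χ) (r : Representatives p) :
    φ (T14 π χ r v) = meanT14 (coeff π φ v) χ := by
  have hp := p_ne_zero p
  have hg : etaJ p ^ 2 * (tauJ p ^ 2)⁻¹ = diagp p 2 (-2) := by
    rw [etaJ_eq, tauJ_eq, pow_two, pow_two, diagp_mul, diagp_mul, diagp_inv, diagp_mul]; rfl
  rw [T14, map_prefix_smul]
  simp only [map_sumUnits, map_sumAll, coeff_upper_unip hg]
  refine (congrArg _ ((isResidueSum_sumUnits r two_ne_zero).iterate₃ (isResidueSum_sumUnits r one_ne_zero) (isResidueSum_sumAll r 4)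
    (F := fun a b x => chi χ (b) * coeff π φ v (upper p 2 (-2) 0 (-b / p) (a / p ^ 2) (x / p ^ 4))) ?_ ?_ ?_ ?_)).trans ?_
  · intro a b x ha hb hx
    rw [chi_of hb]
  · intro a b x e ha hb hx
    refine hΦ.summand_congr hc 0 0 0 e 0 ?_ ?_ ?_ ?_ ?_
    all_goals (push_cast; (try field_simp) <;> try ring)
  · intro a b x e ha hb hx
    refine hΦ.summand_congr hc e 0 (-e) 0 0 ?_ ?_ ?_ ?_ ?_
    all_goals (push_cast; (try field_simp) <;> try ring)
  · intro a b x e ha hb hx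
    refine hΦ.summand_congr hc 0 0 0 0 e ?_ ?_ ?_ ?_ ?_
    all_goals (push_cast; (try field_simp) <;> try ring)
  · rw [meanT14]
    refine mean4_scale ?_ fun _ a b x _ _ _ _ => ?_
    · field_simp [natCast_p_ne_zero (p := p)]
    by_cases hb : ‖b‖ = 1; swap
    · simp [oneU_of_ne hb, chi_of_ne hb]
    rw [oneU_of hb]; ring

/-- A change of a by p²e alters a²b⁻¹/p³ by about 2aeb⁻¹/p, which is not integral in general, so
single summands need not be periodic in a. Scaling b by ((a + p²e)/a)² restores a²b⁻¹. That factor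
is congruent to 1 modulo p², so the character is unaffected and the entry b(1 - x)/p changes by an
integer. -/
lemma mean4_T13_periodic (hΦ : IsSpherical (coeff π φ v)) (hc : HasConductorP χ) {a e : ℚ_[p]}
    (ha : ‖a‖ = 1) (he : ‖e‖ ≤ 1) :
    (mean p fun b => oneU p b * mean p fun x => oneU p x * (chi χ (b * x) * coeff π φ v
      (upper p 2 (-1) 0 (b * (1 - x) / p) ((a + p ^ 2 * e) / p ^ 2) ((a + p ^ 2 * e) ^ 2 * b⁻¹ / p ^ 3)))) =
    mean p fun b => oneU p b * mean p fun x => oneU p x * (chi χ (b * x) * coeff π φ v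
      (upper p 2 (-1) 0 (b * (1 - x) / p) (a / p ^ 2) (a ^ 2 * b⁻¹ / p ^ 3))) := by
  have hp := p_ne_zero p
  obtain ⟨e, rfl⟩ := exists_int he
  obtain ⟨a, rfl⟩ := exists_int ha.le
  obtain ⟨ai, hai⟩ := exists_int_inv ha
  have ha0 := ne_zero_of_norm_one ha
  have ha1 := (norm_add_p_pow two_ne_zero (x := (a : ℚ_[p])) e.2).mpr ha
  have ha2 := ne_zero_of_norm_one ha1
  have hu : ‖(((a : ℚ_[p]) + p ^ 2 * e) / a) ^ 2‖ = 1 := by rw [norm_pow, norm_div, ha1, ha]; simp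
  rw [← mean_mul_left _ hu]
  refine mean_congr fun b hb => ?_
  by_cases hb1 : ‖b‖ = 1; swap
  · rw [oneU_of_ne hb1, oneU_of_ne (by rwa [norm_mul, hu, one_mul])]; ring
  rw [oneU_of hb1, oneU_of (by rw [norm_mul, hu, hb1, one_mul])]
  congr 1
  refine mean_congr fun x hx => ?_
  obtain ⟨b, rfl⟩ := exists_int hb
  obtain ⟨x, rfl⟩ := exists_int hx
  have hb0 := ne_zero_of_norm_one hb1
  congr 1
  refine hΦ.summand_congr hc (b * x * p * (2 * e * ai + p ^ 2 * e ^ 2 * ai ^ 2)) 0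
    (p * b * (1 - x) * (2 * e * ai + p ^ 2 * e ^ 2 * ai ^ 2)) e 0 ?_ ?_ ?_ ?_ ?_
  all_goals (push_cast; (try simp only [hai]); (try field_simp) <;> try ring)

lemma coeff_T13 (hΦ : IsSpherical (coeff π φ v)) (hc : HasConductorP χ) (r : Representatives p) :
    φ (T13 π χ r v) = meanT13 (coeff π φ v) χ := by
  have hp := p_ne_zero p
  have hg : etaJ p ^ 2 * (tauJ p)⁻¹ = diagp p 2 (-1) := by
    rw [etaJ_eq, tauJ_eq, pow_two, diagp_mul, diagp_inv, diagp_mul]; rfl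
  rw [T13, map_prefix_smul]
  simp only [map_sumUnits, coeff_upper_unip hg]
  -- The inner double sum is converted first, since only the resulting average over b and x is
  -- periodic in a.
  refine (congrArg _ ((isResidueSum_sumUnits r two_ne_zero).eq_mean_of_eq (fun a ha =>
    (isResidueSum_sumUnits r three_ne_zero).iterate₂ (isResidueSum_sumUnits r one_ne_zero)
    (F := fun b x => chi χ (b * x) * coeff π φ v
      (upper p 2 (-1) 0 (b * (1 - x) / p) (a / p ^ 2) (a ^ 2 * b⁻¹ / p ^ 3))) ?_ ?_ ?_)
    fun a e ha he => mean4_T13_periodic hΦ hc ha he)).trans ?_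
  · intro b x hb hx
    rw [chi_of (by simp [hb, hx])]
  · intro b x e hb hx
    obtain ⟨a, rfl⟩ := exists_int ha.le
    obtain ⟨bi, hbi⟩ := exists_int_inv hb
    have hb0 := ne_zero_of_norm_one hb
    obtain ⟨bj, hbj, hbe⟩ := exists_int_inv_add hb three_ne_zero e
    refine hΦ.summand_congr hc (p ^ 2 * e * x) 0 (p ^ 2 * e * (1 - x)) 0 (-a ^ 2 * e * bi * bj)
      ?_ ?_ ?_ ?_ ?_
    all_goals (push_cast; (try simp only [hbi, hbj]); (try field_simp) <;> try ring)
  · intro b x e hb hx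
    refine hΦ.summand_congr hc (b * e) 0 (-b * e) 0 0 ?_ ?_ ?_ ?_ ?_
    all_goals (push_cast; (try field_simp) <;> try ring)
  · have hmean : meanT13 (coeff π φ v) χ = mean p fun a => oneU p a * mean p fun b => oneU p b *
        mean p fun x => oneU p x * (chi χ (b * x) * coeff π φ v
          (upper p 2 (-1) 0 (b * (1 - x) / p) (a / p ^ 2) (a ^ 2 * b⁻¹ / p ^ 3))) := by
      rw [meanT13, mean4, mean_const]
      simp only [← mean_const_mul (oneU p _)]
      refine mean_congr fun a _ => mean_congr fun b _ => mean_congr fun x _ => ?_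
      by_cases hb : ‖b‖ = 1; swap
      · simp [oneU_of_ne hb, chi_of_ne hb]
      by_cases hx : ‖x‖ = 1; swap
      · simp [oneU_of_ne hx, chi_of_ne hx]
      simp only [oneU_of hb, oneU_of hx, uinv_of hb, chi_unit_mul hb]
      ring
    rw [hmean, ← mul_assoc]
    refine Eq.trans (congrArg (· * _) ?_) (one_mul _)
    field_simp [natCast_p_ne_zero (p := p)]

end ExplicitSums

/-! ### Transport from the form J' to the form J -/

section Conjugation

variable {p : ℕ} [Fact p.Prime]

lemma mat_conjC (g : GSp4' p) : mat (conjC p g) =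
    (C p : Matrix (Fin 4) (Fin 4) ℚ_[p]) * ((g : GL (Fin 4) ℚ_[p]) : Matrix (Fin 4) (Fin 4) ℚ_[p]) *
      (C p : Matrix (Fin 4) (Fin 4) ℚ_[p]) := rfl

lemma coe_C : (C p : Matrix (Fin 4) (Fin 4) ℚ_[p]) =
    !![1, 0, 0, 0; 0, 1, 0, 0; 0, 0, 0, 1; 0, 0, 1, 0] := rfl

lemma conjC_lower' (x : ℚ_[p]) : conjC p (lower' p x) = low p x := by
  apply mat_injective
  have h : ((lower' p x : GL (Fin 4) ℚ_[p]) : Matrix (Fin 4) (Fin 4) ℚ_[p]) =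
    !![1, 0, 0, 0; 0, 1, 0, 0; 0, x, 1, 0; 0, 0, 0, 1] := rfl
  rw [mat_conjC, h, coe_C, mat_low]
  ext i j; fin_cases i <;> fin_cases j <;> simp [Matrix.mul_apply, Fin.sum_univ_four]

lemma conjC_heis' (a b z : ℚ_[p]) : conjC p (heis' p a b z) = heis p a b z := by
  apply mat_injective
  have h : ((heis' p a b z : GL (Fin 4) ℚ_[p]) : Matrix (Fin 4) (Fin 4) ℚ_[p]) =
    !![1, -a, b, z; 0, 1, 0, b; 0, 0, 1, a; 0, 0, 0, 1] := rfl
  rw [mat_conjC, h, coe_C, mat_heis]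
  ext i j; fin_cases i <;> fin_cases j <;> simp [Matrix.mul_apply, Fin.sum_univ_four]

lemma conjC_weyl' : conjC p (weyl' p) = weyl p := by
  apply mat_injective
  have h : ((weyl' p : GL (Fin 4) ℚ_[p]) : Matrix (Fin 4) (Fin 4) ℚ_[p]) =
    !![1, 0, 0, 0; 0, 0, 1, 0; 0, -1, 0, 0; 0, 0, 0, 1] := rfl
  rw [mat_conjC, h, coe_C, mat_weyl]
  ext i j; fin_cases i <;> fin_cases j <;> simp [Matrix.mul_apply, Fin.sum_univ_four]

lemma conjC_tauJ' : conjC p (tauJ' p) = diagp p 0 1 := by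
  apply mat_injective
  have h : ((tauJ' p : GL (Fin 4) ℚ_[p]) : Matrix (Fin 4) (Fin 4) ℚ_[p]) =
    !![1, 0, 0, 0; 0, (p : ℚ_[p])⁻¹, 0, 0; 0, 0, (p : ℚ_[p]), 0; 0, 0, 0, 1] := rfl
  rw [mat_conjC, h, coe_C, mat_diagp]
  ext i j; fin_cases i <;> fin_cases j <;> simp [Matrix.mul_apply, Fin.sum_univ_four]

lemma conjC_t4' : conjC p (t4' p) = t4 p := by
  apply mat_injective
  have h : ((t4' p : GL (Fin 4) ℚ_[p]) : Matrix (Fin 4) (Fin 4) ℚ_[p]) =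
    !![0, 0, 0, -((p : ℚ_[p]) ^ 4)⁻¹; 0, 1, 0, 0; 0, 0, 1, 0; (p : ℚ_[p]) ^ 4, 0, 0, 0] := rfl
  rw [mat_conjC, h, coe_C, mat_t4]
  ext i j; fin_cases i <;> fin_cases j <;> simp [Matrix.mul_apply, Fin.sum_univ_four]

end Conjugation

/-! ### Vector valued integrals of locally constant functions -/

section LocallyConstantIntegral

variable {p : ℕ} [Fact p.Prime] {V : Type*} [AddCommGroup V] [Module ℂ V]

lemma integralZp_congr {S : Set ℤ_[p]} {f g : ℤ_[p] → V} (h : ∀ x ∈ S, f x = g x) :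
    integralZp p S f = integralZp p S g := by
  unfold integralZp
  refine finsum_congr fun w => ?_
  congr 4
  ext x
  simp only [Set.mem_inter_iff, Set.mem_preimage, Set.mem_singleton_iff]
  exact and_congr_right fun hx => by rw [h x hx]

/-- By compactness a locally constant function on `ℤ_p` has finitely many values. The formal sum
over values is therefore finite, commutes with φ, and is the integral of the corresponding step
function. -/
lemma map_integralZp (φ : V →ₗ[ℂ] ℂ) {S : Set ℤ_[p]} (hS : IsClopen S) {f : ℤ_[p] → V}
    (hf : IsLocallyConstant f) {w g : ℚ_[p] → ℂ} (hw : ∀ x : ℤ_[p], w x = S.indicator 1 x)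
    (hg : ∀ x : ℤ_[p], φ (f x) = g x) :
    φ (integralZp p S f) = mean p fun x => w x * g x := by
  classical
  have hfin : (Set.range f).Finite := hf.range_finite
  have hmeas : ∀ u, MeasurableSet (S ∩ f ⁻¹' {u}) := fun u =>
    hS.isOpen.measurableSet.inter (hf.isOpen_fiber u).measurableSet
  have h1 : integralZp p S f = ∑ u ∈ hfin.toFinset,
      (((haarZp p) (S ∩ f ⁻¹' {u})).toReal : ℂ) • u := by
    refine finsum_eq_sum_of_support_subset _ fun u hu => ?_
    rw [Function.mem_support] at hu
    rw [Set.Finite.coe_toFinset]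
    by_contra h
    apply hu
    have : f ⁻¹' {u} = ∅ := Set.preimage_singleton_eq_empty.mpr h
    rw [this, Set.inter_empty, measure_empty]
    simp
  have h2 : ∀ x : ℤ_[p], w x * g x = ∑ u ∈ hfin.toFinset,
      (S ∩ f ⁻¹' {u}).indicator (fun _ => φ u) x := by
    intro x
    rw [Finset.sum_eq_single (f x), hw, ← hg]
    · by_cases hx : x ∈ S
      · rw [Set.indicator_of_mem hx, Set.indicator_of_mem (show x ∈ S ∩ f ⁻¹' {f x} from ⟨hx, rfl⟩)]
        simp
      · rw [Set.indicator_of_notMem hx, Set.indicator_of_notMem fun h => hx h.1]; simp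
    · intro u _ hu
      exact Set.indicator_of_notMem (fun h => hu h.2.symm) _
    · intro h
      exact absurd (hfin.mem_toFinset.mpr ⟨x, rfl⟩) h
  rw [h1, map_sum, mean]
  simp only [h2]
  rw [integral_finsetSum]
  · refine Finset.sum_congr rfl fun u _ => ?_
    rw [integral_indicator_const _ (hmeas u), map_smul]
    simp [Measure.real]
  · intro u _
    exact (integrable_const _).indicator (hmeas u)

/-- The tube lemma for the compact `ℤ_p` shows that the whole function F(x), not only its single
values, is constant near a given x. This is what makes the iterated integrals meaningful. -/
lemma isLocallyConstant_integralZp {X : Type*} [TopologicalSpace X] (S : Set ℤ_[p])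
    {F : X → ℤ_[p] → V} (hF : IsLocallyConstant fun q : X × ℤ_[p] => F q.1 q.2) :
    IsLocallyConstant fun x => integralZp p S (F x) := by
  refine (IsLocallyConstant.iff_exists_open _).mpr fun x₀ => ?_
  have hopen : IsOpen {q : X × ℤ_[p] | F q.1 q.2 = F x₀ q.2} := by
    have h : IsLocallyConstant fun q : X × ℤ_[p] => (F q.1 q.2, F x₀ q.2) :=
      hF.prodMk (hF.comp_continuous (f := fun q : X × ℤ_[p] => (x₀, q.2)) (by fun_prop))
    exact h {u | u.1 = u.2}
  obtain ⟨U, W, hU, -, hxU, hW, hUW⟩ := generalized_tube_lemma isCompact_singleton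
    (isCompact_univ (X := ℤ_[p])) (s := {x₀}) hopen (by
      rintro ⟨x, a⟩ ⟨rfl, -⟩
      rfl)
  refine ⟨U, hU, hxU rfl, fun x hx => ?_⟩
  congr 1
  ext a
  exact hUW (Set.mk_mem_prod hx (hW (Set.mem_univ a)))

lemma isClopen_unitsZp : IsClopen (unitsZp p) :=
  isClopen_sphere_one.preimage (f := fun x : ℤ_[p] => (x : ℚ_[p])) continuous_subtype_val

lemma isClopen_maxIdealZp : IsClopen (maxIdealZp p) :=
  isClopen_norm_lt_one.preimage (f := fun x : ℤ_[p] => (x : ℚ_[p])) continuous_subtype_val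

lemma oneU_eq_indicator (x : ℤ_[p]) : oneU p x = (unitsZp p).indicator 1 x := by
  by_cases h : ‖x‖ = 1
  · rw [Set.indicator_of_mem (show x ∈ unitsZp p from h)]; exact oneU_of h
  · rw [Set.indicator_of_notMem (show x ∉ unitsZp p from h)]; exact oneU_of_ne h

lemma oneP_eq_indicator (x : ℤ_[p]) : oneP p x = (maxIdealZp p).indicator 1 x := by
  by_cases h : ‖x‖ < 1
  · rw [Set.indicator_of_mem (show x ∈ maxIdealZp p from h)]; exact oneP_of h
  · rw [Set.indicator_of_notMem (show x ∉ maxIdealZp p from h)]; exact oneP_of_not h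

/-- The iterated integrals that occur in the definition of the twisting map. -/
lemma map_integralZp_four (φ : V →ₗ[ℂ] ℂ) {S : Set ℤ_[p]} (hS : IsClopen S) {w : ℚ_[p] → ℂ}
    (hw : ∀ x : ℤ_[p], w x = S.indicator 1 x) (hwc : Continuous w)
    {f F : ℤ_[p] → ℤ_[p] → ℤ_[p] → ℤ_[p] → V}
    (hf : ∀ z x b a, ‖b‖ = 1 → ‖a‖ = 1 → f z x b a = F z x b a)
    (hF : IsLocallyConstant fun q : ((ℤ_[p] × ℤ_[p]) × ℤ_[p]) × ℤ_[p] =>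
      F q.1.1.1 q.1.1.2 q.1.2 q.2)
    {G : ℚ_[p] → ℚ_[p] → ℚ_[p] → ℚ_[p] → ℂ} (hG : Continuous4 G)
    (hFG : ∀ z x b a : ℤ_[p], φ (F z x b a) = G z x b a)
    (hGU : ∀ z x b a : ℚ_[p], oneU p b * (oneU p a * G z x b a) = G z x b a) :
    φ (integralZp p Set.univ fun z => integralZp p S fun x => integralZp p (unitsZp p) fun b =>
      integralZp p (unitsZp p) fun a => f z x b a) =
    mean p fun x => w x * mean p fun a => mean p fun b => mean p fun z => G z x b a := by
  have e : (integralZp p Set.univ fun z => integralZp p S fun x => integralZp p (unitsZp p) fun b =>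
      integralZp p (unitsZp p) fun a => f z x b a) =
      integralZp p Set.univ fun z => integralZp p S fun x => integralZp p (unitsZp p) fun b =>
      integralZp p (unitsZp p) fun a => F z x b a :=
    integralZp_congr fun z _ => integralZp_congr fun x _ => integralZp_congr fun b hb =>
      integralZp_congr fun a ha => hf z x b a hb ha
  have l1 := isLocallyConstant_integralZp (unitsZp p)
    (F := fun (q : (ℤ_[p] × ℤ_[p]) × ℤ_[p]) a => F q.1.1 q.1.2 q.2 a) hF
  have l2 := isLocallyConstant_integralZp (unitsZp p)
    (F := fun (q : ℤ_[p] × ℤ_[p]) b => integralZp p (unitsZp p) fun a => F q.1 q.2 b a) l1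
  have l3 := isLocallyConstant_integralZp S
    (F := fun (z : ℤ_[p]) x => integralZp p (unitsZp p) fun b =>
      integralZp p (unitsZp p) fun a => F z x b a) l2
  have k0 : ∀ z x b, IsLocallyConstant fun a => F z x b a := fun z x b =>
    hF.comp_continuous (f := fun a => (((z, x), b), a)) (by fun_prop)
  have k1 : ∀ z x, IsLocallyConstant fun b => integralZp p (unitsZp p) fun a => F z x b a :=
    fun z x => l1.comp_continuous (f := fun b => ((z, x), b)) (by fun_prop)
  have k2 : ∀ z, IsLocallyConstant fun x => integralZp p (unitsZp p) fun b =>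
      integralZp p (unitsZp p) fun a => F z x b a :=
    fun z => l2.comp_continuous (f := fun x => (z, x)) (by fun_prop)
  rw [e, map_integralZp φ isClopen_univ l3 (w := fun _ => 1) (g := fun z => mean p fun x => w x *
    mean p fun b => oneU p b * mean p fun a => oneU p a * G z x b a) (by simp) fun z =>
    map_integralZp φ hS (k2 z) (g := fun x => mean p fun b => oneU p b * mean p fun a =>
      oneU p a * G z x b a) hw fun x => map_integralZp φ isClopen_unitsZp (k1 z x)
        (g := fun b => mean p fun a => oneU p a * G z x b a) oneU_eq_indicator fun b =>
          map_integralZp φ isClopen_unitsZp (k0 z x b) oneU_eq_indicator fun a => hFG z x b a]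
  have e2 : (mean p fun z => 1 * mean p fun x => w x * mean p fun b => oneU p b * mean p fun a =>
      oneU p a * G z x b a) = mean4 p fun z x b a => w x * G z x b a := by
    simp only [mean4, one_mul, ← mean_const_mul (oneU p _), ← mean_const_mul (w _), hGU]
  rw [e2]
  have hG' : Continuous fun q : ℚ_[p] × ℚ_[p] × ℚ_[p] × ℚ_[p] => G q.1 q.2.1 q.2.2.1 q.2.2.2 := hG
  -- The order z, x, b, a of the definition becomes x, a, b, z.
  refine (mean4_comm14 ?_).trans ((mean4_comm24 ?_).trans ((mean4_comm34 ?_).trans ?_))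
  · exact (hwc.comp (by fun_prop)).mul hG
  · refine (hwc.comp (by fun_prop)).mul (hG.comp ?_ ?_ ?_ ?_) <;> fun_prop
  · refine (hwc.comp (by fun_prop)).mul (hG.comp ?_ ?_ ?_ ?_) <;> fun_prop
  · simp only [mean4, mean_const_mul]

end LocallyConstantIntegral

/-! ### The twisting map in terms of averages, and the explicit formula -/

section TwistAverage

variable {p : ℕ} [Fact p.Prime] {V : Type*} [AddCommGroup V] [Module ℂ V]
  {π : Representation ℂ (GSp4 p) V} {φ : V →ₗ[ℂ] ℂ} {v : V} {χ : MulChar ℚ_[p] ℂ}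

lemma IsSmooth.isLocallyConstant (hπ : IsSmooth π) (v : V) :
    IsLocallyConstant fun g => π g v := by
  refine (IsLocallyConstant.iff_exists_open _).mpr fun g₀ => ?_
  refine ⟨(fun g => g₀⁻¹ * g) ⁻¹' {g | π g v = v}, (hπ v).preimage (continuous_const_mul _), ?_,
    fun g hg => ?_⟩
  · simp
  · have h : π (g₀⁻¹ * g) v = v := hg
    have e : π g v = π (g₀ * (g₀⁻¹ * g)) v := by rw [mul_inv_cancel_left]
    rw [e, map_mul]
    exact congrArg (π g₀) h

lemma isSpherical_coeff (hπ : IsSmooth π) (φ : V →ₗ[ℂ] ℂ) (hv : ∀ k ∈ GSp4Zp p, π k v = v) :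
    IsSpherical (coeff π φ v) where
  continuous := ((hπ.isLocallyConstant v).comp φ).continuous
  right_inv g k hk := by
    rw [coeff, coeff, map_mul]
    exact congrArg (fun u => φ (π g u)) (hv k hk)

/-- The average of `Φ` that underlies the twisting map. -/
def twistMean (Φ : GSp4 p → ℂ) (χ : MulChar ℚ_[p] ℂ) (m : ℕ) : ℂ :=
  (mean p fun x => mean p fun a => mean p fun b => mean p fun z => chi χ a * chi χ b *
    Φ (lowHeis p x (a / p) (b / p ^ 2) (z / p ^ m))) +
  mean p fun x => oneP p x * mean p fun a => mean p fun b => mean p fun z => chi χ a * chi χ b *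
    Φ (weyl p * lowHeis p x (a / p) (b / p ^ 2) (z / p ^ m))

lemma isLocallyConstant_chi (hc : HasConductorP χ) : IsLocallyConstant (chi χ) := by
  refine (IsLocallyConstant.iff_exists_open _).mpr fun x => ?_
  refine ⟨Metric.ball x 1, Metric.isOpen_ball, Metric.mem_ball_self one_pos, fun y hy => ?_⟩
  exact chi_congr hc (by rwa [Metric.mem_ball, dist_eq_norm] at hy)

/-- One statement for all four integrals: the prefix is 1, s, t₄ or t₄s, and S is the whole ring or
the maximal ideal. -/
lemma map_integralZp_lowHeis (hπ : IsSmooth π) (hc : HasConductorP χ) (φ : V →ₗ[ℂ] ℂ)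
    (hv : ∀ k ∈ GSp4Zp p, π k v = v) {S : Set ℤ_[p]} (hS : IsClopen S) {w : ℚ_[p] → ℂ}
    (hw : ∀ x : ℤ_[p], w x = S.indicator 1 x) (hwc : Continuous w) (h : GSp4 p) (h' : GSp4' p)
    (hh : conjC p h' = h) (m : ℕ) :
    φ (integralZp p Set.univ fun z => integralZp p S fun x =>
      integralZp p (unitsZp p) fun b => integralZp p (unitsZp p) fun a =>
        χ ((a : ℚ_[p]) * b) • π.comp (conjC p).toMonoidHom (h' * lower' p (x : ℚ_[p]) *
          heis' p ((a : ℚ_[p]) / p) ((b : ℚ_[p]) / p ^ 2) ((z : ℚ_[p]) / p ^ m))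
            (π.comp (conjC p).toMonoidHom (tauJ' p) v)) =
    mean p fun x => w x * mean p fun a => mean p fun b => mean p fun z => chi χ a * chi χ b *
      coeff π φ v (h * lowHeis p x (a / p) (b / p ^ 2) (z / p ^ m)) := by
  have hχc := continuous_chi hc
  have hχl := isLocallyConstant_chi hc
  have hΦ := (isSpherical_coeff hπ φ hv).comp_mul_left h
  have hΦc := hΦ.continuous
  refine map_integralZp_four φ hS hw hwc
    (F := fun z x b a => (chi χ a * chi χ b) • π (h * lowHeis p x (a / p) (b / p ^ 2) (z / p ^ m)) v)
    (G := fun z x b a => chi χ a * chi χ b *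
      coeff π φ v (h * lowHeis p x (a / p) (b / p ^ 2) (z / p ^ m))) ?_ ?_ ?_ ?_ ?_
  · intro z x b a hb ha
    have ha' : ‖(a : ℚ_[p])‖ = 1 := ha
    have hb' : ‖(b : ℚ_[p])‖ = 1 := hb
    rw [chi_of ha', chi_of hb', ← map_mul χ]
    congr 1
    change π (conjC p _) (π (conjC p _) v) = _
    rw [map_mul (conjC p), map_mul (conjC p), hh, conjC_lower', conjC_heis', conjC_tauJ', lowHeis,
      ← mul_assoc h, ← mul_assoc h, map_mul π _ (diagp p 0 1)]
    rfl
  · refine IsLocallyConstant.comp₂ (g := fun q : ((ℤ_[p] × ℤ_[p]) × ℤ_[p]) × ℤ_[p] =>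
      π (h * lowHeis p q.1.1.2 (q.2 / p) (q.1.2 / p ^ 2) (q.1.1.1 / p ^ m)) v)
      (f := fun q : ((ℤ_[p] × ℤ_[p]) × ℤ_[p]) × ℤ_[p] => chi χ q.2 * chi χ q.1.2) ?_ ?_ (fun c u => c • u)
    · exact (hχl.comp_continuous (f := fun q : ((ℤ_[p] × ℤ_[p]) × ℤ_[p]) × ℤ_[p] => (q.2 : ℚ_[p]))
        (by fun_prop)).mul (hχl.comp_continuous
          (f := fun q : ((ℤ_[p] × ℤ_[p]) × ℤ_[p]) × ℤ_[p] => (q.1.2 : ℚ_[p])) (by fun_prop))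
    · exact (hπ.isLocallyConstant v).comp_continuous
        (f := fun q : ((ℤ_[p] × ℤ_[p]) × ℤ_[p]) × ℤ_[p] =>
          h * lowHeis p q.1.1.2 (q.2 / p) (q.1.2 / p ^ 2) (q.1.1.1 / p ^ m)) (by
            refine continuous_const.mul ?_
            fun_prop)
  · unfold Continuous4
    exact (by fun_prop : Continuous fun q : ℚ_[p] × ℚ_[p] × ℚ_[p] × ℚ_[p] =>
      chi χ q.2.2.2 * chi χ q.2.2.1).mul (hΦ.continuous_comp (by fun_prop))
  · intro z x b a
    rw [map_smul, smul_eq_mul]; rfl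
  · intro z x b a
    have h1 := oneU_mul_chi (χ := χ) a
    have h2 := oneU_mul_chi (χ := χ) b
    linear_combination (chi χ b * coeff π φ v (h * lowHeis p x (a / p) (b / p ^ 2) (z / p ^ m)) *
      oneU p b) * h1 + (chi χ a * coeff π φ v (h * lowHeis p x (a / p) (b / p ^ 2) (z / p ^ m))) * h2

lemma map_twist (hπ : IsSmooth π) (hc : HasConductorP χ) (φ : V →ₗ[ℂ] ℂ)
    (hv : ∀ k ∈ GSp4Zp p, π k v = v) :
    φ (twist π χ v) = (p : ℂ) ^ 3 * twistMean (coeff π φ v) χ 4 +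
      (p : ℂ) ^ 2 * twistMean (fun g => coeff π φ v (t4 p * g)) χ 3 := by
  have h1 := map_integralZp_lowHeis hπ hc φ hv isClopen_univ (w := fun _ => 1) (by simp)
    continuous_const 1 1 (map_one _) 4
  have h2 := map_integralZp_lowHeis hπ hc φ hv isClopen_maxIdealZp oneP_eq_indicator
    continuous_oneP (weyl p) (weyl' p) conjC_weyl' 4
  have h3 := map_integralZp_lowHeis hπ hc φ hv isClopen_univ (w := fun _ => 1) (by simp)
    continuous_const (t4 p) (t4' p) conjC_t4' 3
  have h4 := map_integralZp_lowHeis hπ hc φ hv isClopen_maxIdealZp oneP_eq_indicator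
    continuous_oneP (t4 p * weyl p) (t4' p * weyl' p)
    (by rw [map_mul, conjC_t4', conjC_weyl']) 3
  simp only [one_mul, mul_assoc (t4 p)] at h1 h2 h3 h4
  rw [twist, twist', map_add, map_add, map_add, map_smul, map_smul, map_smul, map_smul, twistMean,
    twistMean, ← h2, ← h1, ← h3, ← h4]
  simp only [smul_eq_mul]
  ring

lemma twistMean_eq {Φ : GSp4 p → ℂ} (hΦ : IsSpherical Φ) (hc : HasConductorP χ) {m : ℕ}
    (hm : 3 ≤ m) : twistMean Φ χ m =
      mean p (avgTauInvAt Φ χ m) + (p : ℂ)⁻¹ * avgOne Φ χ m + (p : ℂ)⁻¹ ^ 2 * avgTau Φ χ m :=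
  avg_lowHeis_add_avg_weyl χ hΦ hc hm

theorem map_twist_eq_sum (hπ : IsSmooth π) (hq : χ.IsQuadratic) (hc : HasConductorP χ)
    (φ : V →ₗ[ℂ] ℂ) (hv : ∀ k ∈ GSp4Zp p, π k v = v) (r : Representatives p) :
    φ (twist π χ v) = φ (T1 π χ r v + T2 π χ r v + T3 π χ r v + T4 π χ r v + T5 π χ r v +
      T6 π χ r v + T7 π χ r v + T8 π χ r v + T9 π χ r v + T10 π χ r v + T11 π χ r v +
      T12 π χ r v + T13 π χ r v + T14 π χ r v) := by
  have hΦ := isSpherical_coeff hπ φ hv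
  have h1 := mean_t4_avgTauInvAt hΦ hq hc
  have h2 := mean_t4_avgOne_add_avgTau hΦ hq hc
  have hp := natCast_p_ne_zero (p := p)
  rw [map_twist hπ hc φ hv, twistMean_eq hΦ hc (by norm_num),
    twistMean_eq (hΦ.comp_mul_left (t4 p)) hc le_rfl]
  simp only [map_add, coeff_T1 hΦ hc r, coeff_T2 hΦ hc r, coeff_T3 hΦ hc r, coeff_T4 hΦ hc r,
    coeff_T5 hΦ hc r, coeff_T6 hΦ hc r, coeff_T7 hΦ hc r, coeff_T8 hΦ hc r, coeff_T9 hΦ hc r,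
    coeff_T10 hΦ hc r, coeff_T11 hΦ hc r, coeff_T12 hΦ hc r, coeff_T13 hΦ hc r, coeff_T14 hΦ hc r]
  have e : (p : ℂ) ^ 3 * (mean p (avgTauInvAt (coeff π φ v) χ 4) +
      (p : ℂ)⁻¹ * avgOne (coeff π φ v) χ 4 + (p : ℂ)⁻¹ ^ 2 * avgTau (coeff π φ v) χ 4) =
      (p : ℂ) ^ 3 * mean p (avgTauInvAt (coeff π φ v) χ 4) + (p : ℂ) ^ 2 * avgOne (coeff π φ v) χ 4 +
        p * avgTau (coeff π φ v) χ 4 := by field_simp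
  have e' : ∀ A B C : ℂ, (p : ℂ) ^ 2 * (A + (p : ℂ)⁻¹ * B + (p : ℂ)⁻¹ ^ 2 * C) =
      (p : ℂ) ^ 2 * A + (p * B + C) := by
    intro A B C; field_simp; ring
  -- The weights 1, 1/p, 1/p² meet p³ in the part without t₄, giving the scalars of T¹¹, T¹, T⁷;
  -- with p² in the other part they give the two combinations evaluated above.
  rw [e, e', h1, h2]
  ring

end TwistAverage

/-! ### Relations between the generators of the paramodular group -/

section MoreElements

variable {p : ℕ} [Fact p.Prime]

/-- The diagonal matrix `diag(e, f, e⁻¹, f⁻¹)`. -/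
def tor (e f : ℚ_[p]) (he : e ≠ 0) (hf : f ≠ 0) : GSp4 p :=
  ofIsometry (J p) (J_mul_J p)
    !![e, 0, 0, 0;
       0, f, 0, 0;
       0, 0, e⁻¹, 0;
       0, 0, 0, f⁻¹]
    (by
      ext i j; fin_cases i <;> fin_cases j <;>
        simp [J, Matrix.mul_apply, Fin.sum_univ_four, he, hf])

/-- The lower unipotent matrix `1 + p⁴ y E₃₁`. -/
def lowCenter (p : ℕ) [Fact p.Prime] (y : ℚ_[p]) : GSp4 p :=
  ofIsometry (J p) (J_mul_J p)
    !![1, 0, 0, 0;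
       0, 1, 0, 0;
       p ^ 4 * y, 0, 1, 0;
       0, 0, 0, 1]
    (by ext i j; fin_cases i <;> fin_cases j <;> simp [J, Matrix.mul_apply, Fin.sum_univ_four])

/-- The conjugate of `heis s t 0` by `t₄`. -/
def lowHeisT4 (p : ℕ) [Fact p.Prime] (s t : ℚ_[p]) : GSp4 p :=
  ofIsometry (J p) (J_mul_J p)
    !![1, 0, 0, 0;
       p ^ 4 * t, 1, 0, 0;
       0, p ^ 4 * s, 1, -(p ^ 4 * t);
       p ^ 4 * s, 0, 0, 1]
    (by
      ext i j; fin_cases i <;> fin_cases j <;>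
        simp [J, Matrix.mul_apply, Fin.sum_univ_four]
      ring)

lemma mat_tor (e f : ℚ_[p]) (he : e ≠ 0) (hf : f ≠ 0) :
    mat (tor e f he hf) = !![e, 0, 0, 0; 0, f, 0, 0; 0, 0, e⁻¹, 0; 0, 0, 0, f⁻¹] := rfl

lemma mat_lowCenter (y : ℚ_[p]) :
    mat (lowCenter p y) = !![1, 0, 0, 0; 0, 1, 0, 0; p ^ 4 * y, 0, 1, 0; 0, 0, 0, 1] := rfl

lemma mat_lowHeisT4 (s t : ℚ_[p]) :
    mat (lowHeisT4 p s t) = !![1, 0, 0, 0; p ^ 4 * t, 1, 0, 0; 0, p ^ 4 * s, 1, -(p ^ 4 * t);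
      p ^ 4 * s, 0, 0, 1] := rfl

@[simp] lemma multiplier_lowCenter (y : ℚ_[p]) : multiplier (lowCenter p y) = 1 :=
  multiplier_ofIsometry _ _
@[simp] lemma multiplier_lowHeisT4 (s t : ℚ_[p]) : multiplier (lowHeisT4 p s t) = 1 :=
  multiplier_ofIsometry _ _

/-- An identity of SL(2) in coordinates 2, 4: on the overlap of the two big cells the chart changes
by x ↦ -x⁻¹. The right factor, diagonal times upper unipotent, is integral for a unit x and fixes
the inner average. -/
lemma weyl_mul_low {x : ℚ_[p]} (hx : x ≠ 0) :
    weyl p * low p x = low p (-x⁻¹) * (tor 1 x one_ne_zero hx * unip p 0 0 x⁻¹) := by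
  apply mat_injective
  simp only [mat_mul, mat_weyl, mat_low, mat_tor, mat_unip, mul_fin_four]
  apply fin_four_congr <;> simp [hx]

/-- L(y) acts on the chart at infinity by the Moebius transformation x ↦ x/(1 - xy), again up to a
factor that fixes the inner average when x is divisible by p and y is integral. -/
lemma low_mul_weyl_mul_low {x y : ℚ_[p]} (h : 1 - x * y ≠ 0) :
    low p y * (weyl p * low p x) = weyl p * low p (x / (1 - x * y)) *
      (tor 1 (1 - x * y) one_ne_zero h * unip p 0 0 (-y / (1 - x * y))) := by
  have h' : 1 - y * x ≠ 0 := by rwa [mul_comm]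
  apply mat_injective
  simp only [mat_mul, mat_weyl, mat_low, mat_tor, mat_unip, mul_fin_four]
  apply fin_four_congr <;> simp
  all_goals (field_simp; try ring)

lemma weyl_mul_weyl_mul (x : ℚ_[p]) :
    weyl p * (weyl p * low p x) = low p x * tor 1 (-1) one_ne_zero (by simp) := by
  apply mat_injective
  simp only [mat_mul, mat_weyl, mat_low, mat_tor, mul_fin_four]
  apply fin_four_congr <;> simp

lemma low_mul_low (x y : ℚ_[p]) : low p x * low p y = low p (x + y) := by
  apply mat_injective
  simp only [mat_mul, mat_low, mul_fin_four]
  apply fin_four_congr <;> simp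

/-- This and the next identity are the same relations for the SL(2) in coordinates 1, 3. The Weyl
element is now t₄ and the chart is the center scaled by p⁻⁴; the lower central element appears as
the right factor. -/
lemma t4_mul_unip {x : ℚ_[p]} (hx : x ≠ 0) :
    t4 p * unip p (x / p ^ 4) 0 0 = unip p (-x⁻¹ / p ^ 4) 0 0 *
      (tor x⁻¹ 1 (inv_ne_zero hx) one_ne_zero * lowCenter p x⁻¹) := by
  have hp := p_ne_zero p
  apply mat_injective
  simp only [mat_mul, mat_t4, mat_unip, mat_tor, mat_lowCenter, mul_fin_four]
  apply fin_four_congr <;> simp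
  all_goals (field_simp; try ring)

lemma unip_mul_t4_mul_unip {x y : ℚ_[p]} (h : 1 - x * y ≠ 0) :
    unip p (y / p ^ 4) 0 0 * (t4 p * unip p (x / p ^ 4) 0 0) =
      t4 p * unip p (x / (1 - x * y) / p ^ 4) 0 0 *
      (tor (1 - x * y)⁻¹ 1 (inv_ne_zero h) one_ne_zero * lowCenter p (-y / (1 - x * y))) := by
  have hp := p_ne_zero p
  have h' : 1 - y * x ≠ 0 := by rwa [mul_comm]
  apply mat_injective
  simp only [mat_mul, mat_t4, mat_unip, mat_tor, mat_lowCenter, mul_fin_four]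
  apply fin_four_congr <;> simp
  all_goals (field_simp; try ring)

lemma t4_mul_t4_mul (x : ℚ_[p]) :
    t4 p * (t4 p * unip p x 0 0) = unip p x 0 0 * tor (-1) 1 (by simp) one_ne_zero := by
  have hp := p_ne_zero p
  apply mat_injective
  simp only [mat_mul, mat_t4, mat_unip, mat_tor, mul_fin_four]
  apply fin_four_congr <;> simp [hp]

lemma unip_center_mul (x y : ℚ_[p]) : unip p x 0 0 * unip p y 0 0 = unip p (x + y) 0 0 := by
  apply mat_injective
  simp only [mat_mul, mat_unip, mul_fin_four]
  apply fin_four_congr <;> simp [add_comm]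

lemma heis_mul_t4 (s t : ℚ_[p]) : heis p s t 0 * t4 p = t4 p * lowHeisT4 p s t := by
  have hp := p_ne_zero p
  apply mat_injective
  simp only [mat_mul, mat_t4, mat_heis, mat_lowHeisT4, mul_fin_four]
  apply fin_four_congr <;> simp
  all_goals (field_simp)

lemma t4_mul_low (x : ℚ_[p]) : t4 p * low p x = low p x * t4 p := by
  apply mat_injective
  simp only [mat_mul, mat_t4, mat_low, mul_fin_four]
  apply fin_four_congr <;> simp

lemma t4_mul_weyl : t4 p * weyl p = weyl p * t4 p := by
  apply mat_injective
  simp only [mat_mul, mat_t4, mat_weyl, mul_fin_four]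
  apply fin_four_congr <;> simp

lemma unip_mul_low (x y : ℚ_[p]) : unip p y 0 0 * low p x = low p x * unip p y 0 0 := by
  apply mat_injective
  simp only [mat_mul, mat_unip, mat_low, mul_fin_four]
  apply fin_four_congr <;> simp

lemma unip_mul_weyl (y : ℚ_[p]) : unip p y 0 0 * weyl p = weyl p * unip p y 0 0 := by
  apply mat_injective
  simp only [mat_mul, mat_unip, mat_weyl, mul_fin_four]
  apply fin_four_congr <;> simp

lemma lowCenter_mul_low (x y : ℚ_[p]) : lowCenter p y * low p x = low p x * lowCenter p y := by
  apply mat_injective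
  simp only [mat_mul, mat_lowCenter, mat_low, mul_fin_four]
  apply fin_four_congr <;> simp

lemma lowCenter_mul_weyl (y : ℚ_[p]) : lowCenter p y * weyl p = weyl p * lowCenter p y := by
  apply mat_injective
  simp only [mat_mul, mat_lowCenter, mat_weyl, mul_fin_four]
  apply fin_four_congr <;> simp

lemma tor_mul_low (e : ℚ_[p]) (he : e ≠ 0) (x : ℚ_[p]) :
    tor e 1 he one_ne_zero * low p x = low p x * tor e 1 he one_ne_zero := by
  apply mat_injective
  simp only [mat_mul, mat_tor, mat_low, mul_fin_four]
  apply fin_four_congr <;> simp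

lemma tor_mul_weyl (e : ℚ_[p]) (he : e ≠ 0) :
    tor e 1 he one_ne_zero * weyl p = weyl p * tor e 1 he one_ne_zero := by
  apply mat_injective
  simp only [mat_mul, mat_tor, mat_weyl, mul_fin_four]
  apply fin_four_congr <;> simp

/-- `heis` normalizes with respect to the middle `SL(2)`. -/
lemma heis_mul_low (s t x : ℚ_[p]) : heis p s t 0 * low p x = low p x * heis p (s - x * t) t 0 := by
  apply mat_injective
  simp only [mat_mul, mat_heis, mat_low, mul_fin_four]
  apply fin_four_congr <;> simp
  ring

lemma heis_mul_weyl (s t : ℚ_[p]) : heis p s t 0 * weyl p = weyl p * heis p t (-s) 0 := by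
  apply mat_injective
  simp only [mat_mul, mat_heis, mat_weyl, mul_fin_four]
  apply fin_four_congr <;> simp

lemma lowHeis_eq (x a b z : ℚ_[p]) : lowHeis p x a b z = low p x * lowHeis p 0 a b z := by
  apply mat_injective
  simp only [mat_mul, mat_lowHeis, mat_low, mul_fin_four]
  apply fin_four_congr <;> simp
  all_goals ring

lemma lowHeis_center (a b z : ℚ_[p]) :
    lowHeis p 0 a b z = unip p z 0 0 * lowHeis p 0 a b 0 := by
  apply mat_injective
  simp only [mat_mul, mat_lowHeis, mat_unip, mul_fin_four]
  apply fin_four_congr <;> simp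

lemma heis_mul_lowHeis (s t a b z : ℚ_[p]) : heis p s t 0 * lowHeis p 0 a b z =
    lowHeis p 0 (a + s) (b + t) (z - s * b + t * a) := by
  have hp := p_ne_zero p
  apply mat_injective
  simp only [mat_mul, mat_lowHeis, mat_heis, mul_fin_four]
  apply fin_four_congr <;> simp
  all_goals (ring_nf; try field_simp)

end MoreElements

/-! ### Absorbing generators into the Heisenberg average -/

section SphericalCosets

variable {p : ℕ} [Fact p.Prime] {Φ : GSp4 p → ℂ}

/-- Commuting the element with the Heisenberg factor shifts b by pta, and conjugation by the
diagonal factor multiplies t by p², leaving an integral matrix on the right. -/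
lemma IsSpherical.unip_lowHeis (hΦ : IsSpherical Φ) {t : ℚ_[p]} (ht : ‖t‖ ≤ 1) (a b z : ℚ_[p]) :
    Φ (unip p 0 0 t * lowHeis p 0 (a / p) (b / p ^ 2) z) =
      Φ (lowHeis p 0 (a / p) ((b + p * (t * a)) / p ^ 2) z) := by
  have hp := p_ne_zero p
  obtain ⟨t, rfl⟩ := exists_int ht
  refine hΦ.eq_of_mat !![1, 0, 0, 0; 0, 1, 0, p ^ 2 * t; 0, 0, 1, 0; 0, 0, 0, 1]
    (by simp [multiplier_mul]) ?_
  simp only [mat_mul, mat_lowHeis, mat_unip, mul_fin_four]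
  apply eq_mul_map_fin_four <;> simp
  all_goals (field_simp; try ring)

/-- With denominators p and p² in the Heisenberg element, the factor p⁴ makes the conjugated lower
central element integral. The vanishing central coordinate is essential for the displayed matrix,
which is why the central integration is separated off beforehand. -/
lemma IsSpherical.lowCenter_lowHeis (hΦ : IsSpherical Φ) {y a b : ℚ_[p]} (hy : ‖y‖ ≤ 1)
    (ha : ‖a‖ ≤ 1) (hb : ‖b‖ ≤ 1) :
    Φ (lowCenter p y * lowHeis p 0 (a / p) (b / p ^ 2) 0) =
      Φ (lowHeis p 0 (a / p) (b / p ^ 2) 0) := by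
  have hp := p_ne_zero p
  obtain ⟨y, rfl⟩ := exists_int hy
  obtain ⟨a, rfl⟩ := exists_int ha
  obtain ⟨b, rfl⟩ := exists_int hb
  refine hΦ.eq_of_mat !![1, 0, 0, 0;
    -(y * b * p ^ 3), 1 + y * a * b * p, 0, -(y * b ^ 2 * p ^ 2);
    y * p ^ 4, -(y * a * p ^ 2), 1, y * b * p ^ 3;
    -(y * a * p ^ 2), y * a ^ 2, 0, 1 - y * a * b * p] (by simp [multiplier_mul]) ?_
  simp only [mat_mul, mat_lowHeis, mat_lowCenter, mul_fin_four]
  apply eq_mul_map_fin_four <;> simp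
  all_goals (field_simp; try ring)

/-- The conjugate is integral up to a change of the central coordinate, and that change is
multiplication of z by the unit 1 - 2p²sb, harmless in the average. -/
lemma IsSpherical.lowHeisT4_lowHeis (hΦ : IsSpherical Φ) {s t a b z : ℚ_[p]} (hs : ‖s‖ ≤ 1)
    (ht : ‖t‖ ≤ 1) (ha : ‖a‖ ≤ 1) (hb : ‖b‖ ≤ 1) (hz : ‖z‖ ≤ 1) :
    Φ (lowHeisT4 p s t * lowHeis p 0 (a / p) (b / p ^ 2) (z / p ^ 3)) =
      Φ (lowHeis p 0 (a / p) (b / p ^ 2) ((1 - p * (2 * s * b * p)) * z / p ^ 3)) := by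
  have hp := p_ne_zero p
  obtain ⟨s, rfl⟩ := exists_int hs
  obtain ⟨t, rfl⟩ := exists_int ht
  obtain ⟨a, rfl⟩ := exists_int ha
  obtain ⟨b, rfl⟩ := exists_int hb
  obtain ⟨z, rfl⟩ := exists_int hz
  refine hΦ.eq_of_mat !![1 + a * t * p ^ 3 - b * s * p ^ 2,
      -(a ^ 2 * t * p) - (1 - p * (2 * s * b * p)) * z * s + s * a * b,
      t * a * (z + (1 - p * (2 * s * b * p)) * z) + 2 * s ^ 2 * b ^ 2 * z * p,
      a * b * t * p ^ 2 + (1 - p * (2 * s * b * p)) * z * t * p ^ 2 - b ^ 2 * s * p;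
    t * p ^ 5, 1 - a * p ^ 3 * t - s * b * p ^ 2, z * p ^ 2 * t - s * b ^ 2 * p + t * a * b * p ^ 2,
      2 * b * p ^ 4 * t;
    0, s * p ^ 3, 1 + s * b * p ^ 2 - t * a * p ^ 3, -(t * p ^ 5);
    s * p ^ 3, -(2 * a * s * p), z * s - s * a * b + t * a ^ 2 * p, 1 + s * b * p ^ 2 + t * a * p ^ 3]
    (by simp [multiplier_mul]) ?_
  simp only [mat_mul, mat_lowHeis, mat_lowHeisT4, mul_fin_four]
  apply eq_mul_map_fin_four <;> simp
  all_goals (field_simp; try ring)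

lemma IsSpherical.diag_lowHeis (hΦ : IsSpherical Φ) {k : GSp4 p} {α β γ δ : ℚ_[p]}
    (hk : mat k = !![α, 0, 0, 0; 0, β, 0, 0; 0, 0, γ, 0; 0, 0, 0, δ]) (hα : ‖α‖ = 1) (hβ : ‖β‖ = 1)
    (hγ : ‖γ‖ = 1) (hδ : ‖δ‖ = 1) (h : α * γ = β * δ) (a b z : ℚ_[p]) :
    Φ (k * lowHeis p 0 (a / p) (b / p ^ 2) z) =
      Φ (lowHeis p 0 (α / β * a / p) (α / δ * b / p ^ 2) (α / γ * z)) := by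
  have hp := p_ne_zero p
  have hm : multiplier k = α * γ := by
    rw [multiplier, hk]
    simp [Matrix.mul_apply, Fin.sum_univ_four, J]
  have hα0 := ne_zero_of_norm_one hα
  have hβ0 := ne_zero_of_norm_one hβ
  have hγ0 := ne_zero_of_norm_one hγ
  have hδ0 := ne_zero_of_norm_one hδ
  refine hΦ.eq_of_mat !![⟨α, hα.le⟩, 0, 0, 0; 0, ⟨β, hβ.le⟩, 0, 0; 0, 0, ⟨γ, hγ.le⟩, 0;
    0, 0, 0, ⟨δ, hδ.le⟩] (by simp [multiplier_mul, hm, hα, hγ]) ?_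
  simp only [mat_mul, mat_lowHeis, hk, mul_fin_four]
  apply eq_mul_map_fin_four <;> simp
  all_goals field_simp
  · linear_combination (-b) * h
  · linear_combination (-a) * h

end SphericalCosets

attribute [irreducible] tor lowCenter lowHeisT4

/-! ### Integration over a projective line in two charts -/

section TwoLevel

variable {p : ℕ} [Fact p.Prime]

/-- Both sides integrate one function over ℙ¹(ℚ_p), given in two charts as f₁ and f₂ that are glued
on units by x ↦ -x⁻¹. The left side takes all of `ℤ_p` in the second chart and the maximal ideal in
the first; the right side does the opposite. -/
lemma mean_swap {f₁ f₂ : ℚ_[p] → ℂ} (h₁ : Continuous f₁) (h₂ : Continuous f₂)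
    (h : ∀ x, ‖x‖ = 1 → f₂ x = f₁ (-x⁻¹)) :
    mean p f₂ + mean p (fun x => oneP p x * f₁ x) = mean p f₁ + mean p fun x => oneP p x * f₂ x := by
  have e : mean p (fun x => oneU p x * f₂ x) = mean p fun x => oneU p x * f₁ x := by
    rw [← mean_oneU_mul_left (-1) (by simp) f₁, ← mean_inv (fun x => f₁ (-1 * x))]
    refine mean_congr fun x _ => ?_
    by_cases hx : ‖x‖ = 1
    · rw [h x hx, neg_one_mul]
    · rw [oneU_of_ne hx, zero_mul, zero_mul]
  rw [mean_split h₁, mean_split h₂, e, mean_oneP, mean_oneP]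
  ring

lemma mean_add_swap {A B : ℚ_[p] → ℚ_[p] → ℂ} (hA : Continuous fun q : ℚ_[p] × ℚ_[p] => A q.1 q.2)
    (hB : Continuous fun q : ℚ_[p] × ℚ_[p] => B q.1 q.2) :
    (mean p fun x => mean p fun z => A x z) + (mean p fun x => mean p fun z => B x z) =
      mean p fun z => (mean p fun x => A x z) + mean p fun x => B x z := by
  rw [mean_add (continuous_mean (F := fun z x => A x z) (hA.comp continuous_swap))
    (continuous_mean (F := fun z x => B x z) (hB.comp continuous_swap)), mean_comm hA, mean_comm hB]

lemma norm_one_add_p_mul {x : ℚ_[p]} (hx : ‖x‖ ≤ 1) : ‖1 + (p : ℚ_[p]) * x‖ = 1 :=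
  (norm_add_p_mul hx).mpr norm_one

lemma norm_one_sub_p_mul {x : ℚ_[p]} (hx : ‖x‖ ≤ 1) : ‖1 - (p : ℚ_[p]) * x‖ = 1 :=
  (norm_sub_p_mul hx).mpr norm_one

/-- Substitution along a Moebius transformation. -/
lemma mean_oneP_moebius {y : ℚ_[p]} (hy : ‖y‖ ≤ 1) (f : ℚ_[p] → ℂ) :
    mean p (fun x => oneP p x * f (x / (1 - x * y))) = mean p fun x => oneP p x * f x := by
  rw [mean_oneP, mean_oneP]
  congr 1
  refine Eq.trans (mean_congr fun x _ => ?_) (mean_comp (fun x => x / (1 - (p : ℚ_[p]) * (x * y)))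
    (fun x => x / (1 + (p : ℚ_[p]) * (x * y))) ?_ ?_ ?_ ?_ fun x => f ((p : ℚ_[p]) * x))
  · rw [mul_div_assoc, mul_assoc (p : ℚ_[p])]
  · exact fun x hx => norm_div_le_one hx (norm_one_sub_p_mul (norm_mul_le_one hx hy))
  · exact fun x hx => norm_div_le_one hx (norm_one_add_p_mul (norm_mul_le_one hx hy))
  · intro x hx
    have h := ne_zero_of_norm_one (norm_one_add_p_mul (norm_mul_le_one hx hy))
    have e : 1 - (p : ℚ_[p]) * (x / (1 + p * (x * y)) * y) = 1 / (1 + p * (x * y)) := by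
      rw [div_mul_eq_mul_div, ← mul_div_assoc, eq_div_iff h, sub_mul, div_mul_cancel₀ _ h]
      ring
    rw [e, div_div_div_cancel_right₀ h, div_one]
  · intro x z hx hz
    have h1 := norm_one_sub_p_mul (norm_mul_le_one hx hy)
    have h2 := norm_one_sub_p_mul (norm_mul_le_one hz hy)
    have e : x / (1 - (p : ℚ_[p]) * (x * y)) - z / (1 - p * (z * y)) =
        (x - z) / ((1 - p * (x * y)) * (1 - p * (z * y))) := by
      rw [div_sub_div _ _ (ne_zero_of_norm_one h1) (ne_zero_of_norm_one h2)]
      congr 1; ring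
    rw [e, norm_div, norm_mul, h1, h2]; simp

end TwoLevel

/-! ### Behavior of the inner averages under translation -/

section Invariance

variable {p : ℕ} [Fact p.Prime] {Φ : GSp4 p → ℂ} {χ : MulChar ℚ_[p] ℂ}

/-- The average over the Heisenberg group, without its center, that underlies the twisting map. -/
def coreMean (Φ : GSp4 p → ℂ) (χ : MulChar ℚ_[p] ℂ) : ℂ :=
  mean p fun a => mean p fun b => chi χ a * chi χ b * Φ (lowHeis p 0 (a / p) (b / p ^ 2) 0)

/-- The average over the Heisenberg group that underlies the twisting map. -/
def heisMean (Φ : GSp4 p → ℂ) (χ : MulChar ℚ_[p] ℂ) (m : ℕ) : ℂ :=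
  mean p fun a => mean p fun b => mean p fun z => chi χ a * chi χ b *
    Φ (lowHeis p 0 (a / p) (b / p ^ 2) (z / p ^ m))

/-- The average over the middle `SL(2)` of `coreMean`. -/
def outerMean (Φ : GSp4 p → ℂ) (χ : MulChar ℚ_[p] ℂ) : ℂ :=
  mean p (fun x => coreMean (fun g => Φ (low p x * g)) χ) +
    mean p fun x => oneP p x * coreMean (fun g => Φ (weyl p * (low p x * g))) χ

/-- The function whose value at a matrix coefficient is the matrix coefficient of the twist. -/
def twistAvg (Φ : GSp4 p → ℂ) (χ : MulChar ℚ_[p] ℂ) : ℂ :=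
  (p : ℂ) ^ 3 * twistMean Φ χ 4 + (p : ℂ) ^ 2 * twistMean (fun g => Φ (t4 p * g)) χ 3

lemma twistMean_eq_heisMean (Φ : GSp4 p → ℂ) (χ : MulChar ℚ_[p] ℂ) (m : ℕ) : twistMean Φ χ m =
    mean p (fun x => heisMean (fun g => Φ (low p x * g)) χ m) +
      mean p fun x => oneP p x * heisMean (fun g => Φ (weyl p * (low p x * g))) χ m := by
  unfold twistMean heisMean
  congr 1
  · refine mean_congr fun x _ => mean_congr fun a _ => mean_congr fun b _ => mean_congr fun z _ => ?_
    rw [lowHeis_eq]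
  · refine mean_congr fun x _ => congrArg _ (mean_congr fun a _ => mean_congr fun b _ =>
      mean_congr fun z _ => ?_)
    rw [lowHeis_eq]

lemma heisMean_unip (hΦ : IsSpherical Φ) (hc : HasConductorP χ) (m : ℕ) {t : ℚ_[p]} (ht : ‖t‖ ≤ 1) :
    heisMean (fun g => Φ (unip p 0 0 t * g)) χ m = heisMean Φ χ m := by
  refine mean_congr fun a ha => ?_
  have hta := norm_mul_le_one ht ha
  refine Eq.trans (mean_congr fun b hb => ?_)
    (mean_add_right ((p : ℚ_[p]) * (t * a)) (norm_p_mul_lt hta).le _)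
  refine mean_congr fun z _ => ?_
  beta_reduce
  rw [hΦ.unip_lowHeis ht, chi_add_p_mul χ hc hta]

/-- The product of the two scaling factors is α²/(βδ) = α/γ, which is αγ up to a square. This is
where the value of χ at the multiplier arises. -/
lemma chi_mul_chi_diag (hq : χ.IsQuadratic) {α β γ δ : ℚ_[p]} (hα : ‖α‖ = 1) (hβ : ‖β‖ = 1)
    (hγ : ‖γ‖ = 1) (hδ : ‖δ‖ = 1) (h : α * γ = β * δ) (a b : ℚ_[p]) :
    chi χ a * chi χ b = chi χ (α * γ) * (chi χ (α / β * a) * chi χ (α / δ * b)) := by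
  have hαγ : ‖α * γ‖ = 1 := by simp [hα, hγ]
  have h1 := chi_sq hq (α * γ)
  rw [oneU_of hαγ] at h1
  have h2 : chi χ (α / β) * chi χ (α / δ) = chi χ (α * γ) := by
    rw [← chi_unit_mul (by simp [hα, hβ])]
    have := ne_zero_of_norm_one hβ
    have := ne_zero_of_norm_one hδ
    have := ne_zero_of_norm_one hγ
    refine chi_eq_of_sq hq (c := γ⁻¹) (by simp [hγ]) ?_
    field_simp
    linear_combination α * h
  rw [chi_unit_mul (x := α / β) (by simp [hα, hβ]), chi_unit_mul (x := α / δ) (by simp [hα, hδ])]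
  linear_combination (-(chi χ a * chi χ b)) * h1 - (chi χ (α * γ) * chi χ a * chi χ b) * h2

lemma heisMean_diag (hΦ : IsSpherical Φ) (hq : χ.IsQuadratic) (m : ℕ) {k : GSp4 p} {α β γ δ : ℚ_[p]}
    (hk : mat k = !![α, 0, 0, 0; 0, β, 0, 0; 0, 0, γ, 0; 0, 0, 0, δ]) (hα : ‖α‖ = 1) (hβ : ‖β‖ = 1)
    (hγ : ‖γ‖ = 1) (hδ : ‖δ‖ = 1) (h : α * γ = β * δ) :
    heisMean (fun g => Φ (k * g)) χ m = chi χ (α * γ) * heisMean Φ χ m := by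
  refine Eq.trans ?_ (mean_const_mul _ _)
  refine Eq.trans (mean_congr fun a _ => ?_) (mean_mul_left (α / β) (by simp [hα, hβ]) _)
  refine Eq.trans ?_ (mean_const_mul _ _)
  refine Eq.trans (mean_congr fun b _ => ?_) (mean_mul_left (α / δ) (by simp [hα, hδ]) _)
  refine Eq.trans ?_ (mean_const_mul _ _)
  refine Eq.trans (mean_congr fun z _ => ?_) (mean_mul_left (α / γ) (by simp [hα, hγ]) _)
  beta_reduce
  rw [hΦ.diag_lowHeis hk hα hβ hγ hδ h, chi_mul_chi_diag hq hα hβ hγ hδ h a b, ← mul_div_assoc,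
    mul_assoc]

lemma coreMean_diag (hΦ : IsSpherical Φ) (hq : χ.IsQuadratic) {k : GSp4 p} {α β γ δ : ℚ_[p]}
    (hk : mat k = !![α, 0, 0, 0; 0, β, 0, 0; 0, 0, γ, 0; 0, 0, 0, δ]) (hα : ‖α‖ = 1) (hβ : ‖β‖ = 1)
    (hγ : ‖γ‖ = 1) (hδ : ‖δ‖ = 1) (h : α * γ = β * δ) :
    coreMean (fun g => Φ (k * g)) χ = chi χ (α * γ) * coreMean Φ χ := by
  refine Eq.trans ?_ (mean_const_mul _ _)
  refine Eq.trans (mean_congr fun a _ => ?_) (mean_mul_left (α / β) (by simp [hα, hβ]) _)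
  refine Eq.trans ?_ (mean_const_mul _ _)
  refine Eq.trans (mean_congr fun b _ => ?_) (mean_mul_left (α / δ) (by simp [hα, hδ]) _)
  beta_reduce
  rw [hΦ.diag_lowHeis hk hα hβ hγ hδ h, chi_mul_chi_diag hq hα hβ hγ hδ h a b, mul_zero, mul_assoc]

lemma coreMean_lowCenter (hΦ : IsSpherical Φ) (χ : MulChar ℚ_[p] ℂ) {y : ℚ_[p]} (hy : ‖y‖ ≤ 1) :
    coreMean (fun g => Φ (lowCenter p y * g)) χ = coreMean Φ χ :=
  mean_congr fun a ha => mean_congr fun b hb => by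
    beta_reduce
    rw [hΦ.lowCenter_lowHeis hy ha hb]

/-- Multiplication in the Heisenberg group translates a by ps, b by p²t and z by p²(pta - sb). These
are integral, and the first two are divisible by p, so the character does not notice. -/
lemma heisMean_heis (Φ : GSp4 p → ℂ) (hc : HasConductorP χ) {s t : ℚ_[p]} (hs : ‖s‖ ≤ 1)
    (ht : ‖t‖ ≤ 1) : heisMean (fun g => Φ (heis p s t 0 * g)) χ 4 = heisMean Φ χ 4 := by
  have hp := p_ne_zero p
  refine Eq.trans (mean_congr fun a ha => ?_) (mean_add_right ((p : ℚ_[p]) * s) (norm_p_mul_lt hs).le _)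
  refine Eq.trans (mean_congr fun b hb => ?_)
    (mean_add_right ((p : ℚ_[p]) * ((p : ℚ_[p]) * t)) (norm_p_mul_lt (norm_p_mul_lt ht).le).le _)
  have hpt : ‖(p : ℚ_[p]) * t‖ ≤ 1 := (norm_p_mul_lt ht).le
  have hz : ‖(p : ℚ_[p]) * ((p : ℚ_[p]) * ((p : ℚ_[p]) * t * a - s * b))‖ ≤ 1 :=
    (norm_p_mul_lt (norm_p_mul_lt (norm_sub_le_one (norm_mul_le_one hpt ha)
      (norm_mul_le_one hs hb))).le).le
  refine Eq.trans (mean_congr fun z _ => ?_) (mean_add_right _ hz _)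
  beta_reduce
  rw [chi_add_p_mul χ hc hs, chi_add_p_mul χ hc (norm_p_mul_lt ht).le, heis_mul_lowHeis]
  congr 3 <;> field_simp
  ring

lemma heisMean_lowHeisT4 (hΦ : IsSpherical Φ) (χ : MulChar ℚ_[p] ℂ) {s t : ℚ_[p]} (hs : ‖s‖ ≤ 1)
    (ht : ‖t‖ ≤ 1) : heisMean (fun g => Φ (lowHeisT4 p s t * g)) χ 3 = heisMean Φ χ 3 := by
  refine mean_congr fun a ha => mean_congr fun b hb => ?_
  have h2 : ‖(2 : ℚ_[p])‖ ≤ 1 := by exact_mod_cast Padic.norm_int_le_one 2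
  have hu : ‖1 - (p : ℚ_[p]) * (2 * s * b * p)‖ = 1 := norm_one_sub_p_mul (norm_mul_le_one (norm_mul_le_one
    (norm_mul_le_one h2 hs) hb) norm_p_lt_one.le)
  refine Eq.trans (mean_congr fun z hz => ?_) (mean_mul_left _ hu _)
  beta_reduce
  rw [hΦ.lowHeisT4_lowHeis hs ht ha hb hz]

lemma heisMean_eq_coreMean (hΦ : IsSpherical Φ) (hc : HasConductorP χ) (m : ℕ) : heisMean Φ χ m =
    mean p fun z => coreMean (fun g => Φ (unip p (z / p ^ m) 0 0 * g)) χ := by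
  have hΦc := hΦ.continuous
  have hχc := continuous_chi hc
  unfold heisMean coreMean
  refine Eq.trans (mean_congr fun a _ => mean_comm (by fun_prop)) ((mean_comm (F := fun a z =>
    mean p fun b => chi χ a * chi χ b * Φ (lowHeis p 0 (a / p) (b / p ^ 2) (z / p ^ m)))
      (by fun_prop)).trans ?_)
  refine mean_congr fun z _ => mean_congr fun a _ => mean_congr fun b _ => ?_
  rw [lowHeis_center]

/-- The center commutes with the SL(2) in coordinates 2, 4, so its integration can be carried
outside the average over that group. This prepares the second projective line. -/
lemma twistMean_eq_outerMean (hΦ : IsSpherical Φ) (hc : HasConductorP χ) (m : ℕ) : twistMean Φ χ m =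
    mean p fun z => outerMean (fun g => Φ (unip p (z / p ^ m) 0 0 * g)) χ := by
  have hΦc := hΦ.continuous
  have hχc := continuous_chi hc
  have hm1 : Continuous fun q : GSp4 p × GSp4 p => q.1 * q.2 := continuous_mul
  have c1 : Continuous fun q : ℚ_[p] × ℚ_[p] =>
      coreMean (fun g => Φ (unip p (q.2 / p ^ m) 0 0 * (low p q.1 * g))) χ := by
    unfold coreMean; fun_prop
  have c2 : Continuous fun q : ℚ_[p] × ℚ_[p] => oneP p q.1 *
      coreMean (fun g => Φ (unip p (q.2 / p ^ m) 0 0 * (weyl p * (low p q.1 * g)))) χ := by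
    unfold coreMean; fun_prop
  rw [twistMean_eq_heisMean]
  refine Eq.trans ?_ (mean_add_swap (A := fun x z : ℚ_[p] =>
    coreMean (fun g => Φ (unip p (z / p ^ m) 0 0 * (low p x * g))) χ) (B := fun x z : ℚ_[p] => oneP p x *
      coreMean (fun g => Φ (unip p (z / p ^ m) 0 0 * (weyl p * (low p x * g)))) χ) c1 c2)
  congr 1
  · refine mean_congr fun x _ => ?_
    rw [heisMean_eq_coreMean (hΦ.comp_mul_left _) hc]
    refine mean_congr fun z _ => ?_
    simp only [← mul_assoc, unip_mul_low]
  · refine mean_congr fun x _ => ?_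
    rw [mean_const_mul]
    congr 1
    have := heisMean_eq_coreMean ((hΦ.comp_mul_left (weyl p)).comp_mul_left (low p x)) hc m
    rw [this]
    refine mean_congr fun z _ => ?_
    have e : ∀ g, weyl p * (low p x * (unip p (z / p ^ m) 0 0 * g)) =
        unip p (z / p ^ m) 0 0 * (weyl p * (low p x * g)) := by
      intro g
      rw [← mul_assoc (low p x), ← unip_mul_low, mul_assoc, ← mul_assoc (weyl p), ← unip_mul_weyl,
        mul_assoc]
    simp only [e]

end Invariance

attribute [irreducible] coreMean heisMean outerMean

/-! ### Invariance of the twist under generators -/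

section Generators

variable {p : ℕ} [Fact p.Prime] {Φ : GSp4 p → ℂ} {χ : MulChar ℚ_[p] ℂ}

lemma heisMean_tor (hΦ : IsSpherical Φ) (hq : χ.IsQuadratic) (m : ℕ) {e f : ℚ_[p]} (he : ‖e‖ = 1)
    (hf : ‖f‖ = 1) :
    heisMean (fun g => Φ (tor e f (ne_zero_of_norm_one he) (ne_zero_of_norm_one hf) * g)) χ m =
      heisMean Φ χ m := by
  have h1 := mul_inv_cancel₀ (ne_zero_of_norm_one he)
  have h2 := mul_inv_cancel₀ (ne_zero_of_norm_one hf)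
  rw [heisMean_diag hΦ hq m (mat_tor _ _ _ _) he hf (by simp [he]) (by simp [hf]) (by rw [h1, h2]),
    h1, chi_one, one_mul]

lemma coreMean_tor (hΦ : IsSpherical Φ) (hq : χ.IsQuadratic) {e f : ℚ_[p]} (he : ‖e‖ = 1)
    (hf : ‖f‖ = 1) :
    coreMean (fun g => Φ (tor e f (ne_zero_of_norm_one he) (ne_zero_of_norm_one hf) * g)) χ =
      coreMean Φ χ := by
  have h1 := mul_inv_cancel₀ (ne_zero_of_norm_one he)
  have h2 := mul_inv_cancel₀ (ne_zero_of_norm_one hf)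
  rw [coreMean_diag hΦ hq (mat_tor _ _ _ _) he hf (by simp [he]) (by simp [hf]) (by rw [h1, h2]),
    h1, chi_one, one_mul]

/-- Translation by s exchanges the two charts of ℙ¹; the square of s is diagonal with unit entries,
and the inner average is invariant under it. -/
lemma twistMean_weyl (hΦ : IsSpherical Φ) (hq : χ.IsQuadratic) (hc : HasConductorP χ) (m : ℕ) :
    twistMean (fun g => Φ (weyl p * g)) χ m = twistMean Φ χ m := by
  have hΦc := hΦ.continuous
  have hχc := continuous_chi hc
  rw [twistMean_eq_heisMean, twistMean_eq_heisMean]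
  have c1 : Continuous fun x => heisMean (fun g => Φ (low p x * g)) χ m := by
    unfold heisMean; fun_prop
  have c2 : Continuous fun x => heisMean (fun g => Φ (weyl p * (low p x * g))) χ m := by
    unfold heisMean; fun_prop
  have h := mean_swap c1 c2 fun x hx => by
    have hx0 := ne_zero_of_norm_one hx
    have e : ∀ g, weyl p * (low p x * g) =
        low p (-x⁻¹) * (tor 1 x one_ne_zero hx0 * (unip p 0 0 x⁻¹ * g)) := by
      intro g
      rw [← mul_assoc, weyl_mul_low hx0, mul_assoc, mul_assoc]
    simp only [e]
    have hΦ1 := hΦ.comp_mul_left (low p (-x⁻¹))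
    exact (heisMean_unip (hΦ1.comp_mul_left (tor 1 x one_ne_zero hx0)) hc m (by simp [hx])).trans
      (heisMean_tor hΦ1 hq m norm_one hx)
  rw [← h]
  congr 1
  refine mean_congr fun x _ => congrArg _ ?_
  have e : ∀ g, weyl p * (weyl p * (low p x * g)) =
      low p x * (tor 1 (-1) one_ne_zero (by simp) * g) := by
    intro g
    rw [← mul_assoc, ← mul_assoc, mul_assoc (weyl p), weyl_mul_weyl_mul, mul_assoc]
  simp only [e]
  exact heisMean_tor (hΦ.comp_mul_left (low p x)) hq m norm_one (by simp)

lemma twistMean_low (hΦ : IsSpherical Φ) (hq : χ.IsQuadratic) (hc : HasConductorP χ) (m : ℕ)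
    {y : ℚ_[p]} (hy : ‖y‖ ≤ 1) :
    twistMean (fun g => Φ (low p y * g)) χ m = twistMean Φ χ m := by
  have hm := mean_oneP_moebius hy fun x => heisMean (fun g => Φ (weyl p * (low p x * g))) χ m
  beta_reduce at hm
  rw [twistMean_eq_heisMean, twistMean_eq_heisMean, ← hm]
  refine congrArg₂ (· + ·) ?_ ?_
  · refine Eq.trans (mean_congr fun x _ => ?_) (mean_add_right y hy _)
    simp only [← mul_assoc, low_mul_low, add_comm]
  · refine mean_congr fun x _ => ?_
    by_cases hx : ‖x‖ < 1; swap
    · rw [oneP_of_not hx, zero_mul, zero_mul]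
    congr 1
    have h : ‖1 - x * y‖ = 1 := by
      have h1 := norm_one_sub_p_mul (norm_mul_le_one (norm_le_inv_p_of_lt_one hx) hy)
      rwa [← mul_assoc, mul_div_cancel₀ _ (p_ne_zero p)] at h1
    have h0 := ne_zero_of_norm_one h
    have e : ∀ g, low p y * (weyl p * (low p x * g)) = weyl p * low p (x / (1 - x * y)) *
        (tor 1 (1 - x * y) one_ne_zero h0 * (unip p 0 0 (-y / (1 - x * y)) * g)) := by
      intro g
      rw [← mul_assoc, ← mul_assoc, mul_assoc (low p y), low_mul_weyl_mul_low h0]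
      simp only [mul_assoc]
    have hΦ1 := hΦ.comp_mul_left (weyl p * low p (x / (1 - x * y)))
    have h2 := (heisMean_unip (hΦ1.comp_mul_left (tor 1 (1 - x * y) one_ne_zero h0)) hc m
      (t := -y / (1 - x * y)) (norm_div_le_one (by simpa using hy) h)).trans
      (heisMean_tor hΦ1 hq m norm_one h)
    simp only [e]
    rw [h2]
    simp only [mul_assoc]

lemma outerMean_tor (hΦ : IsSpherical Φ) (hq : χ.IsQuadratic) {e : ℚ_[p]} (he : ‖e‖ = 1) :
    outerMean (fun g => Φ (tor e 1 (ne_zero_of_norm_one he) one_ne_zero * g)) χ = outerMean Φ χ := by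
  have he0 := ne_zero_of_norm_one he
  have e1 : ∀ x g, tor e 1 he0 one_ne_zero * (low p x * g) = low p x * (tor e 1 he0 one_ne_zero * g) :=
    fun x g => Commute.left_comm (tor_mul_low e he0 x) g
  have e2 : ∀ g, tor e 1 he0 one_ne_zero * (weyl p * g) = weyl p * (tor e 1 he0 one_ne_zero * g) :=
    fun g => Commute.left_comm (tor_mul_weyl e he0) g
  unfold outerMean
  simp only [e1, e2]
  refine congrArg₂ (· + ·) ?_ ?_
  · exact mean_congr fun x _ => coreMean_tor (hΦ.comp_mul_left (low p x)) hq he norm_one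
  · exact mean_congr fun x _ => congrArg _ (coreMean_tor
      ((hΦ.comp_mul_left (weyl p)).comp_mul_left (low p x)) hq he norm_one)

lemma outerMean_lowCenter (hΦ : IsSpherical Φ) (χ : MulChar ℚ_[p] ℂ) {y : ℚ_[p]} (hy : ‖y‖ ≤ 1) :
    outerMean (fun g => Φ (lowCenter p y * g)) χ = outerMean Φ χ := by
  have e1 : ∀ x g, lowCenter p y * (low p x * g) = low p x * (lowCenter p y * g) :=
    fun x g => Commute.left_comm (lowCenter_mul_low x y) g
  have e2 : ∀ g, lowCenter p y * (weyl p * g) = weyl p * (lowCenter p y * g) :=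
    fun g => Commute.left_comm (lowCenter_mul_weyl y) g
  unfold outerMean
  simp only [e1, e2]
  refine congrArg₂ (· + ·) ?_ ?_
  · exact mean_congr fun x _ => coreMean_lowCenter (hΦ.comp_mul_left (low p x)) χ hy
  · exact mean_congr fun x _ => congrArg _ (coreMean_lowCenter
      ((hΦ.comp_mul_left (weyl p)).comp_mul_left (low p x)) χ hy)

/-- An average over z/p³ is p times the integral of z/p⁴ over the maximal ideal. The normalizations
p³ and p² of the twisting map are thus exactly those that make it one integral over the projective
line of the SL(2) containing t₄. -/
lemma twistAvg_eq_outerMean (hΦ : IsSpherical Φ) (hc : HasConductorP χ) : twistAvg Φ χ =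
    (p : ℂ) ^ 3 * (mean p (fun z => outerMean (fun g => Φ (unip p (z / p ^ 4) 0 0 * g)) χ) +
      mean p fun z => oneP p z *
        outerMean (fun g => Φ (t4 p * (unip p (z / p ^ 4) 0 0 * g))) χ) := by
  have hp := p_ne_zero p
  have hp' := natCast_p_ne_zero (p := p)
  rw [twistAvg, twistMean_eq_outerMean hΦ hc, twistMean_eq_outerMean (hΦ.comp_mul_left (t4 p)) hc,
    mean_oneP]
  have e : ∀ z : ℚ_[p], (p : ℚ_[p]) * z / p ^ 4 = z / p ^ 3 := fun z => by field_simp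
  simp only [e]
  field_simp

lemma continuous_outerMean_unip (hΦ : IsSpherical Φ) (hc : HasConductorP χ) :
    Continuous fun z => outerMean (fun g => Φ (unip p (z / p ^ 4) 0 0 * g)) χ := by
  have hΦc := hΦ.continuous
  have hχc := continuous_chi hc
  unfold outerMean coreMean
  fun_prop

lemma twistAvg_t4 (hΦ : IsSpherical Φ) (hq : χ.IsQuadratic) (hc : HasConductorP χ) :
    twistAvg (fun g => Φ (t4 p * g)) χ = twistAvg Φ χ := by
  have hΦt := hΦ.comp_mul_left (t4 p)
  rw [twistAvg_eq_outerMean hΦt hc, twistAvg_eq_outerMean hΦ hc]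
  congr 1
  have h := mean_swap (continuous_outerMean_unip hΦ hc) (continuous_outerMean_unip hΦt hc)
    fun x hx => by
      have hx0 := ne_zero_of_norm_one hx
      have e : ∀ g, t4 p * (unip p (x / p ^ 4) 0 0 * g) = unip p (-x⁻¹ / p ^ 4) 0 0 *
          (tor x⁻¹ 1 (inv_ne_zero hx0) one_ne_zero * (lowCenter p x⁻¹ * g)) := by
        intro g
        rw [← mul_assoc, t4_mul_unip hx0, mul_assoc, mul_assoc]
      simp only [e]
      have hΦ1 := hΦ.comp_mul_left (unip p (-x⁻¹ / p ^ 4) 0 0)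
      exact (outerMean_lowCenter (hΦ1.comp_mul_left (tor x⁻¹ 1 (inv_ne_zero hx0) one_ne_zero)) χ
        (by simp [hx])).trans (outerMean_tor hΦ1 hq (by simp [hx]))
  rw [← h]
  congr 1
  refine mean_congr fun x _ => congrArg _ ?_
  have e : ∀ g, t4 p * (t4 p * (unip p (x / p ^ 4) 0 0 * g)) =
      unip p (x / p ^ 4) 0 0 * (tor (-1) 1 (by simp) one_ne_zero * g) := by
    intro g
    rw [← mul_assoc, ← mul_assoc, mul_assoc (t4 p), t4_mul_t4_mul, mul_assoc]
  simp only [e]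
  exact outerMean_tor (hΦ.comp_mul_left _) hq (by simp)

/-- In the affine chart the center acts by translation. In the chart of t₄ it acts by a Moebius
transformation of the maximal ideal, which preserves the measure. -/
lemma twistAvg_center (hΦ : IsSpherical Φ) (hq : χ.IsQuadratic) (hc : HasConductorP χ)
    {y : ℚ_[p]} (hy : ‖y‖ ≤ 1) :
    twistAvg (fun g => Φ (unip p (y / p ^ 4) 0 0 * g)) χ = twistAvg Φ χ := by
  have hm := mean_oneP_moebius hy fun x =>
    outerMean (fun g => Φ (t4 p * (unip p (x / p ^ 4) 0 0 * g))) χ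
  beta_reduce at hm
  rw [twistAvg_eq_outerMean (hΦ.comp_mul_left (unip p (y / p ^ 4) 0 0)) hc,
    twistAvg_eq_outerMean hΦ hc, ← hm]
  refine congrArg (_ * ·) (congrArg₂ (· + ·) ?_ ?_)
  · refine Eq.trans (mean_congr fun x _ => ?_) (mean_add_right y hy _)
    simp only [← mul_assoc, unip_center_mul]
    rw [← add_div, add_comm]
  · refine mean_congr fun x _ => ?_
    by_cases hx : ‖x‖ < 1; swap
    · rw [oneP_of_not hx, zero_mul, zero_mul]
    congr 1
    have h : ‖1 - x * y‖ = 1 := by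
      have h1 := norm_one_sub_p_mul (norm_mul_le_one (norm_le_inv_p_of_lt_one hx) hy)
      rwa [← mul_assoc, mul_div_cancel₀ _ (p_ne_zero p)] at h1
    have h0 := ne_zero_of_norm_one h
    have e : ∀ g, unip p (y / p ^ 4) 0 0 * (t4 p * (unip p (x / p ^ 4) 0 0 * g)) =
        t4 p * unip p (x / (1 - x * y) / p ^ 4) 0 0 * (tor (1 - x * y)⁻¹ 1 (inv_ne_zero h0)
          one_ne_zero * (lowCenter p (-y / (1 - x * y)) * g)) := by
      intro g
      rw [← mul_assoc, ← mul_assoc, mul_assoc (unip p (y / p ^ 4) 0 0), unip_mul_t4_mul_unip h0]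
      simp only [mul_assoc]
    have hΦ1 := hΦ.comp_mul_left (t4 p * unip p (x / (1 - x * y) / p ^ 4) 0 0)
    have h2 := (outerMean_lowCenter (hΦ1.comp_mul_left (tor (1 - x * y)⁻¹ 1 (inv_ne_zero h0)
      one_ne_zero)) χ (y := -y / (1 - x * y)) (norm_div_le_one (by simpa using hy) h)).trans
      (outerMean_tor hΦ1 hq (by simp [h]))
    simp only [e]
    rw [h2]
    simp only [mul_assoc]

lemma twistAvg_weyl (hΦ : IsSpherical Φ) (hq : χ.IsQuadratic) (hc : HasConductorP χ) :
    twistAvg (fun g => Φ (weyl p * g)) χ = twistAvg Φ χ := by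
  have e : ∀ g, weyl p * (t4 p * g) = t4 p * (weyl p * g) :=
    fun g => Commute.left_comm t4_mul_weyl.symm g
  unfold twistAvg
  rw [twistMean_weyl hΦ hq hc]
  simp only [e]
  rw [twistMean_weyl (hΦ.comp_mul_left (t4 p)) hq hc]

lemma twistAvg_low (hΦ : IsSpherical Φ) (hq : χ.IsQuadratic) (hc : HasConductorP χ)
    {y : ℚ_[p]} (hy : ‖y‖ ≤ 1) : twistAvg (fun g => Φ (low p y * g)) χ = twistAvg Φ χ := by
  have e : ∀ g, low p y * (t4 p * g) = t4 p * (low p y * g) :=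
    fun g => Commute.left_comm (t4_mul_low y).symm g
  unfold twistAvg
  rw [twistMean_low hΦ hq hc 4 hy]
  simp only [e]
  rw [twistMean_low (hΦ.comp_mul_left (t4 p)) hq hc 3 hy]

lemma twistMean_heis (Φ : GSp4 p → ℂ) (hc : HasConductorP χ) {s t : ℚ_[p]} (hs : ‖s‖ ≤ 1)
    (ht : ‖t‖ ≤ 1) : twistMean (fun g => Φ (heis p s t 0 * g)) χ 4 = twistMean Φ χ 4 := by
  have e1 : ∀ s t x g, heis p s t 0 * (low p x * g) = low p x * (heis p (s - x * t) t 0 * g) := by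
    intro s t x g
    rw [← mul_assoc, heis_mul_low, mul_assoc]
  have e2 : ∀ s t g, heis p s t 0 * (weyl p * g) = weyl p * (heis p t (-s) 0 * g) := by
    intro s t g
    rw [← mul_assoc, heis_mul_weyl, mul_assoc]
  rw [twistMean_eq_heisMean, twistMean_eq_heisMean]
  simp only [e1, e2]
  refine congrArg₂ (· + ·) ?_ ?_
  · exact mean_congr fun x hx => heisMean_heis (fun g => Φ (low p x * g)) hc
      (norm_sub_le_one hs (norm_mul_le_one hx ht)) ht
  · exact mean_congr fun x hx => congrArg _ (heisMean_heis (fun g => Φ (weyl p * (low p x * g))) hc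
      (norm_sub_le_one ht (norm_mul_le_one hx (by rwa [norm_neg]))) (by rwa [norm_neg]))

/-- Past t₄ the Heisenberg element becomes a lower triangular one divisible by p⁴, and the average
absorbs it by a unit scaling of z. Crossing L(x) or s first changes the parameters by an integral
linear map. -/
lemma twistMean_t4_heis (hΦ : IsSpherical Φ) (χ : MulChar ℚ_[p] ℂ) {s t : ℚ_[p]} (hs : ‖s‖ ≤ 1)
    (ht : ‖t‖ ≤ 1) : twistMean (fun g => Φ (heis p s t 0 * (t4 p * g))) χ 3 =
      twistMean (fun g => Φ (t4 p * g)) χ 3 := by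
  have e0 : ∀ x g, t4 p * (low p x * g) = low p x * (t4 p * g) :=
    fun x g => Commute.left_comm (t4_mul_low x) g
  have e0' : ∀ g, t4 p * (weyl p * g) = weyl p * (t4 p * g) :=
    fun g => Commute.left_comm t4_mul_weyl g
  have e1 : ∀ s t x g, heis p s t 0 * (low p x * g) = low p x * (heis p (s - x * t) t 0 * g) := by
    intro s t x g
    rw [← mul_assoc, heis_mul_low, mul_assoc]
  have e2 : ∀ s t g, heis p s t 0 * (weyl p * g) = weyl p * (heis p t (-s) 0 * g) := by
    intro s t g
    rw [← mul_assoc, heis_mul_weyl, mul_assoc]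
  have e3 : ∀ s t g, heis p s t 0 * (t4 p * g) = t4 p * (lowHeisT4 p s t * g) := by
    intro s t g
    rw [← mul_assoc, heis_mul_t4, mul_assoc]
  rw [twistMean_eq_heisMean, twistMean_eq_heisMean]
  simp only [e0, e0', e1, e2, e3]
  refine congrArg₂ (· + ·) ?_ ?_
  · refine mean_congr fun x hx => ?_
    have h1 : IsSpherical fun g => Φ (low p x * (t4 p * g)) :=
      (hΦ.comp_mul_left (low p x)).comp_mul_left (t4 p)
    exact heisMean_lowHeisT4 h1 χ (norm_sub_le_one hs (norm_mul_le_one hx ht)) ht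
  · refine mean_congr fun x hx => ?_
    have h1 : IsSpherical fun g => Φ (weyl p * (low p x * (t4 p * g))) :=
      ((hΦ.comp_mul_left (weyl p)).comp_mul_left (low p x)).comp_mul_left (t4 p)
    rw [heisMean_lowHeisT4 h1 χ (norm_sub_le_one ht (norm_mul_le_one hx (by rwa [norm_neg])))
      (by rwa [norm_neg])]

lemma twistAvg_heis (hΦ : IsSpherical Φ) (hc : HasConductorP χ) {s t : ℚ_[p]} (hs : ‖s‖ ≤ 1)
    (ht : ‖t‖ ≤ 1) : twistAvg (fun g => Φ (heis p s t 0 * g)) χ = twistAvg Φ χ := by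
  unfold twistAvg
  rw [twistMean_heis Φ hc hs ht, twistMean_t4_heis hΦ χ hs ht]

lemma mat_conj {w : GSp4 p} {W : Matrix (Fin 4) (Fin 4) ℚ_[p]} (hW : W * mat w = 1) (k : GSp4 p) :
    mat (w⁻¹ * k * w) = W * mat k * mat w := by
  have h : mat w * mat w⁻¹ = 1 := by rw [← mat_mul, mul_inv_cancel, mat_one]
  have h' : mat w⁻¹ = W := by
    rw [← Matrix.one_mul (mat w⁻¹), ← hW, Matrix.mul_assoc, h, Matrix.mul_one]
  rw [mat_mul, mat_mul, h']

lemma exists_diag_mul_weyl {k : GSp4 p} {α β γ δ : ℚ_[p]}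
    (hk : mat k = !![α, 0, 0, 0; 0, β, 0, 0; 0, 0, γ, 0; 0, 0, 0, δ]) :
    ∃ k' : GSp4 p, k * weyl p = weyl p * k' ∧
      mat k' = !![α, 0, 0, 0; 0, δ, 0, 0; 0, 0, γ, 0; 0, 0, 0, β] := by
  refine ⟨(weyl p)⁻¹ * k * weyl p, by group, ?_⟩
  rw [mat_conj (W := !![1, 0, 0, 0; 0, 0, 0, -1; 0, 0, 1, 0; 0, 1, 0, 0]), hk, mat_weyl]
  · simp only [mul_fin_four]
    apply fin_four_congr <;> simp
  · rw [mat_weyl]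
    ext i j; fin_cases i <;> fin_cases j <;> simp [Matrix.mul_apply, Fin.sum_univ_four]

lemma exists_diag_mul_t4 {k : GSp4 p} {α β γ δ : ℚ_[p]}
    (hk : mat k = !![α, 0, 0, 0; 0, β, 0, 0; 0, 0, γ, 0; 0, 0, 0, δ]) :
    ∃ k' : GSp4 p, k * t4 p = t4 p * k' ∧
      mat k' = !![γ, 0, 0, 0; 0, β, 0, 0; 0, 0, α, 0; 0, 0, 0, δ] := by
  have hp := p_ne_zero p
  refine ⟨(t4 p)⁻¹ * k * t4 p, by group, ?_⟩
  rw [mat_conj (W := !![0, 0, ((p : ℚ_[p]) ^ 4)⁻¹, 0; 0, 1, 0, 0; -(p : ℚ_[p]) ^ 4, 0, 0, 0;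
    0, 0, 0, 1]), hk, mat_t4]
  · simp only [mul_fin_four]
    apply fin_four_congr <;> simp
    all_goals field_simp
  · rw [mat_t4]
    ext i j; fin_cases i <;> fin_cases j <;> simp [Matrix.mul_apply, Fin.sum_univ_four, hp]

lemma diag_mul_low {k : GSp4 p} {α β γ δ : ℚ_[p]}
    (hk : mat k = !![α, 0, 0, 0; 0, β, 0, 0; 0, 0, γ, 0; 0, 0, 0, δ]) (hβ : β ≠ 0) (x : ℚ_[p]) :
    k * low p x = low p (δ / β * x) * k := by
  apply mat_injective
  rw [mat_mul, mat_mul, mat_low, mat_low, hk]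
  simp only [mul_fin_four]
  apply fin_four_congr <;> simp
  field_simp

lemma twistMean_diag (hΦ : IsSpherical Φ) (hq : χ.IsQuadratic) (m : ℕ) {k : GSp4 p} {α β γ δ : ℚ_[p]}
    (hk : mat k = !![α, 0, 0, 0; 0, β, 0, 0; 0, 0, γ, 0; 0, 0, 0, δ]) (hα : ‖α‖ = 1) (hβ : ‖β‖ = 1)
    (hγ : ‖γ‖ = 1) (hδ : ‖δ‖ = 1) (h : α * γ = β * δ) :
    twistMean (fun g => Φ (k * g)) χ m = chi χ (α * γ) * twistMean Φ χ m := by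
  obtain ⟨k', hkk', hk'⟩ := exists_diag_mul_weyl hk
  have e1 : ∀ x g, k * (low p x * g) = low p (δ / β * x) * (k * g) := by
    intro x g
    rw [← mul_assoc, diag_mul_low hk (ne_zero_of_norm_one hβ), mul_assoc]
  have e2 : ∀ x g, k * (weyl p * (low p x * g)) = weyl p * (low p (β / δ * x) * (k' * g)) := by
    intro x g
    rw [← mul_assoc, hkk', mul_assoc, ← mul_assoc k', diag_mul_low hk' (ne_zero_of_norm_one hδ),
      mul_assoc]
  have hu : ‖β / δ‖ = 1 := by simp [hβ, hδ]
  rw [twistMean_eq_heisMean, twistMean_eq_heisMean, mul_add]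
  simp only [e1, e2]
  refine congrArg₂ (· + ·) ?_ ?_
  · refine Eq.trans ?_ (mean_const_mul _ _)
    refine Eq.trans (mean_congr fun x _ => ?_) (mean_mul_left (δ / β) (by simp [hβ, hδ]) _)
    exact heisMean_diag (hΦ.comp_mul_left (low p (δ / β * x))) hq m hk hα hβ hγ hδ h
  · refine Eq.trans ?_ (mean_const_mul _ _)
    refine Eq.trans (mean_congr fun x _ => ?_) (mean_mul_left (β / δ) hu _)
    have e3 : oneP p (β / δ * x) = oneP p x := by simp only [oneP, norm_mul, hu, one_mul]
    rw [heisMean_diag ((hΦ.comp_mul_left (weyl p)).comp_mul_left (low p (β / δ * x))) hq m hk' hα hδ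
      hγ hβ (h.trans (mul_comm _ _)), e3]
    ring

lemma twistAvg_diag (hΦ : IsSpherical Φ) (hq : χ.IsQuadratic) {k : GSp4 p} {α β γ δ : ℚ_[p]}
    (hk : mat k = !![α, 0, 0, 0; 0, β, 0, 0; 0, 0, γ, 0; 0, 0, 0, δ]) (hα : ‖α‖ = 1) (hβ : ‖β‖ = 1)
    (hγ : ‖γ‖ = 1) (hδ : ‖δ‖ = 1) (h : α * γ = β * δ) :
    twistAvg (fun g => Φ (k * g)) χ = chi χ (α * γ) * twistAvg Φ χ := by
  obtain ⟨k', hkk', hk'⟩ := exists_diag_mul_t4 hk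
  have e : ∀ g, k * (t4 p * g) = t4 p * (k' * g) := by
    intro g
    rw [← mul_assoc, hkk', mul_assoc]
  unfold twistAvg
  simp only [e]
  rw [twistMean_diag hΦ hq 4 hk hα hβ hγ hδ h, twistMean_diag (hΦ.comp_mul_left (t4 p)) hq 3 hk' hγ hβ
    hα hδ ((mul_comm _ _).trans h), mul_comm γ]
  ring

end Generators

/-! ### Generation of the paramodular group -/

section Paramodular

variable {p : ℕ} [Fact p.Prime] {χ : MulChar ℚ_[p] ℂ}

/-- The entrywise form of `ᵗg J g = λ(g) J`. -/
lemma column_pairing (g : GSp4 p) (i j : Fin 4) :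
    mat g 0 i * mat g 2 j + mat g 1 i * mat g 3 j - mat g 2 i * mat g 0 j - mat g 3 i * mat g 1 j =
      multiplier g * J p i j := by
  have h := congrFun (congrFun (multiplier_spec g) i) j
  rw [Matrix.smul_apply, smul_eq_mul] at h
  rw [← h]
  simp [J, Matrix.mul_apply, Fin.sum_univ_four]
  ring

/-- Left translation by `k` multiplies `twistAvg` by the value of `χ` at the multiplier. -/
def TwistInvariant (χ : MulChar ℚ_[p] ℂ) (k : GSp4 p) : Prop :=
  ‖multiplier k‖ = 1 ∧ ∀ Φ : GSp4 p → ℂ, IsSpherical Φ →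
    twistAvg (fun g => Φ (k * g)) χ = chi χ (multiplier k) * twistAvg Φ χ

lemma TwistInvariant.mul {k l : GSp4 p} (hk : TwistInvariant χ k) (hl : TwistInvariant χ l) :
    TwistInvariant χ (k * l) := by
  refine ⟨by rw [multiplier_mul, norm_mul, hk.1, hl.1, one_mul], fun Φ hΦ => ?_⟩
  have h := hl.2 _ (hΦ.comp_mul_left k)
  rw [hk.2 Φ hΦ] at h
  simp only [mul_assoc]
  rw [h, multiplier_mul, chi_unit_mul hk.1]
  ring

lemma TwistInvariant.inv {k : GSp4 p} (hk : TwistInvariant χ k) :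
    TwistInvariant χ k⁻¹ := by
  refine ⟨by rw [multiplier_inv, norm_inv, hk.1, inv_one], fun Φ hΦ => ?_⟩
  have h := hk.2 _ (hΦ.comp_mul_left k⁻¹)
  simp only [inv_mul_cancel_left] at h
  have h1 : chi χ (multiplier k) * chi χ (multiplier k⁻¹) = 1 := by
    rw [← chi_unit_mul hk.1, multiplier_inv, mul_inv_cancel₀ (multiplier_ne_zero k), chi_one]
  rw [h, ← mul_assoc, mul_comm (chi χ (multiplier k⁻¹)), h1, one_mul]

lemma TwistInvariant.of_mul_left {k l : GSp4 p} (hl : TwistInvariant χ l)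
    (h : TwistInvariant χ (l * k)) : TwistInvariant χ k := by
  simpa using hl.inv.mul h

lemma TwistInvariant.of_mul_right {k l : GSp4 p} (hl : TwistInvariant χ l)
    (h : TwistInvariant χ (k * l)) : TwistInvariant χ k := by
  simpa using h.mul hl.inv

lemma TwistInvariant.of_multiplier_one {k : GSp4 p} (hk : multiplier k = 1)
    (h : ∀ Φ : GSp4 p → ℂ, IsSpherical Φ → twistAvg (fun g => Φ (k * g)) χ = twistAvg Φ χ) :
    TwistInvariant χ k :=
  ⟨by rw [hk, norm_one], fun Φ hΦ => by rw [h Φ hΦ, hk, chi_one, one_mul]⟩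

lemma twistInvariant_t4 (hq : χ.IsQuadratic) (hc : HasConductorP χ) : TwistInvariant χ (t4 p) :=
  .of_multiplier_one multiplier_t4 fun _ hΦ => twistAvg_t4 hΦ hq hc

lemma twistInvariant_weyl (hq : χ.IsQuadratic) (hc : HasConductorP χ) : TwistInvariant χ (weyl p) :=
  .of_multiplier_one multiplier_weyl fun _ hΦ => twistAvg_weyl hΦ hq hc

lemma twistInvariant_low (hq : χ.IsQuadratic) (hc : HasConductorP χ) {y : ℚ_[p]} (hy : ‖y‖ ≤ 1) :
    TwistInvariant χ (low p y) :=
  .of_multiplier_one (multiplier_low y) fun _ hΦ => twistAvg_low hΦ hq hc hy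

lemma twistInvariant_heis (hq : χ.IsQuadratic) (hc : HasConductorP χ) {s t z : ℚ_[p]} (hs : ‖s‖ ≤ 1)
    (ht : ‖t‖ ≤ 1) (hz : ‖z‖ ≤ 1) : TwistInvariant χ (heis p s t (z / p ^ 4)) := by
  have e : heis p s t (z / p ^ 4) = unip p (z / p ^ 4) 0 0 * heis p s t 0 := by
    apply mat_injective
    rw [mat_mul, mat_unip, mat_heis, mat_heis]
    simp only [mul_fin_four]
    apply fin_four_congr <;> simp
  rw [e]
  exact (TwistInvariant.of_multiplier_one (multiplier_unip _ _ _)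
    fun _ hΦ => twistAvg_center hΦ hq hc hz).mul
    (.of_multiplier_one (multiplier_heis _ _ _) fun _ hΦ => twistAvg_heis hΦ hc hs ht)

/-- Conjugation by s turns this element into L(-y). -/
lemma twistInvariant_unip (hq : χ.IsQuadratic) (hc : HasConductorP χ) {y : ℚ_[p]} (hy : ‖y‖ ≤ 1) :
    TwistInvariant χ (unip p 0 0 y) := by
  have e : weyl p * unip p 0 0 y = low p (-y) * weyl p := by
    apply mat_injective
    rw [mat_mul, mat_mul, mat_unip, mat_low, mat_weyl]
    simp only [mul_fin_four]
    apply fin_four_congr <;> simp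
  refine (twistInvariant_weyl hq hc).of_mul_left ?_
  rw [e]
  exact (twistInvariant_low hq hc (by rwa [norm_neg])).mul (twistInvariant_weyl hq hc)

lemma twistInvariant_diag (hq : χ.IsQuadratic) {k : GSp4 p} {α β γ δ : ℚ_[p]}
    (hk : mat k = !![α, 0, 0, 0; 0, β, 0, 0; 0, 0, γ, 0; 0, 0, 0, δ]) (hα : ‖α‖ = 1) (hβ : ‖β‖ = 1)
    (hγ : ‖γ‖ = 1) (hδ : ‖δ‖ = 1) : TwistInvariant χ k := by
  have h1 := column_pairing k 0 2
  have h2 := column_pairing k 1 3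
  simp [hk, J] at h1 h2
  refine ⟨by rw [← h1, norm_mul, hα, hγ, one_mul], fun Φ hΦ => ?_⟩
  rw [← h1, twistAvg_diag hΦ hq hk hα hβ hγ hδ (h1.trans h2.symm)]

/-- The case of a block matrix whose middle block has a unit in its last entry. -/
lemma twistInvariant_middle_of_unit (hq : χ.IsQuadratic) (hc : HasConductorP χ) {k : GSp4 p}
    (hm : ‖multiplier k‖ = 1) {α γ A B C D : ℚ_[p]}
    (hk : mat k = !![α, 0, 0, 0; 0, A, 0, B; 0, 0, γ, 0; 0, C, 0, D]) (hα : ‖α‖ = 1) (hγ : ‖γ‖ = 1)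
    (hB : ‖B‖ ≤ 1) (hC : ‖C‖ ≤ 1) (hD : ‖D‖ = 1) : TwistInvariant χ k := by
  have hD0 := ne_zero_of_norm_one hD
  have h2 := column_pairing k 1 3
  simp [hk, J] at h2
  refine (twistInvariant_unip hq hc (y := -(B / D))
    (by rw [norm_neg]; exact norm_div_le_one hB hD)).of_mul_left ?_
  refine (twistInvariant_low hq hc (y := -(C / D))
    (by rw [norm_neg]; exact norm_div_le_one hC hD)).of_mul_right ?_
  refine twistInvariant_diag hq (α := α) (β := multiplier k / D) (γ := γ) (δ := D) ?_ hα
    (by rw [norm_div, hm, hD, div_one]) hγ hD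
  rw [mat_mul, mat_mul, mat_unip, mat_low, hk, ← h2]
  simp only [mul_fin_four]
  apply fin_four_congr <;> simp <;> field_simp
  all_goals ring

lemma norm_eq_one_or_of_norm_sub {a b : ℚ_[p]} (ha : ‖a‖ ≤ 1) (hb : ‖b‖ ≤ 1) (h : ‖a - b‖ = 1) :
    ‖a‖ = 1 ∨ ‖b‖ = 1 := by
  by_contra! hn
  exact norm_sub_ne_one (norm_lt_one_of_ne ha hn.1) (norm_lt_one_of_ne hb hn.2) h

lemma norm_eq_one_of_mul {a b : ℚ_[p]} (ha : ‖a‖ ≤ 1) (hb : ‖b‖ ≤ 1) (h : ‖a * b‖ = 1) :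
    ‖a‖ = 1 ∧ ‖b‖ = 1 := by
  rw [norm_mul] at h
  constructor <;> nlinarith [norm_nonneg a, norm_nonneg b]

/-- The multiplier AD - CB is a unit, so AD or CB is one. In the first case D can serve as a pivot;
in the second, s exchanges the rows and moves B to the pivot position. -/
lemma twistInvariant_middle (hq : χ.IsQuadratic) (hc : HasConductorP χ) {k : GSp4 p}
    (hm : ‖multiplier k‖ = 1) {α γ A B C D : ℚ_[p]}
    (hk : mat k = !![α, 0, 0, 0; 0, A, 0, B; 0, 0, γ, 0; 0, C, 0, D]) (hα : ‖α‖ = 1) (hγ : ‖γ‖ = 1)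
    (hA : ‖A‖ ≤ 1) (hB : ‖B‖ ≤ 1) (hC : ‖C‖ ≤ 1) (hD : ‖D‖ ≤ 1) : TwistInvariant χ k := by
  have h2 := column_pairing k 1 3
  simp [hk, J] at h2
  rcases norm_eq_one_or_of_norm_sub (norm_mul_le_one hA hD) (norm_mul_le_one hC hB)
    (by rw [h2, hm]) with h | h
  · exact twistInvariant_middle_of_unit hq hc hm hk hα hγ hB hC (norm_eq_one_of_mul hA hD h).2
  · have hB1 := (norm_eq_one_of_mul hC hB h).2
    refine (twistInvariant_weyl hq hc).of_mul_left ?_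
    refine twistInvariant_middle_of_unit hq hc (α := α) (γ := γ) (A := C) (B := D) (C := -A) (D := -B)
      (by simpa [multiplier_mul] using hm) ?_ hα hγ hD (by rwa [norm_neg]) (by rwa [norm_neg])
    rw [mat_mul, mat_weyl, hk]
    simp only [mul_fin_four]
    apply fin_four_congr <;> simp

/-- The case of an element of the Klingen parabolic subgroup. -/
lemma twistInvariant_klingen (hq : χ.IsQuadratic) (hc : HasConductorP χ) {k : GSp4 p}
    (hm : ‖multiplier k‖ = 1) {γ δ u₁ u₂ u₃ v₁ v₃ s t A B C D : ℚ_[p]}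
    (hk : mat k = !![γ, u₁, u₂ / p ^ 4, u₃; 0, A, s, B; 0, v₁, δ, v₃; 0, C, t, D]) (hγ : ‖γ‖ = 1)
    (hu : ‖u₂‖ ≤ 1) (hs : ‖s‖ ≤ 1) (ht : ‖t‖ ≤ 1)
    (hA : ‖A‖ ≤ 1) (hB : ‖B‖ ≤ 1) (hC : ‖C‖ ≤ 1) (hD : ‖D‖ ≤ 1) : TwistInvariant χ k := by
  have hp := p_ne_zero p
  have hγ0 := ne_zero_of_norm_one hγ
  -- The first column is a multiple of the first basis vector. Pairing it with the others forces the
  -- off-diagonal entries of the third row to vanish and the product of the two outer diagonal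
  -- entries to be the multiplier.
  have h1 := column_pairing k 0 1
  have h2 := column_pairing k 0 2
  have h3 := column_pairing k 0 3
  simp [hk, J, hγ0] at h1 h2 h3
  subst h1 h3
  have hδ : ‖δ‖ = 1 := by
    rw [← h2, norm_mul, hγ, one_mul] at hm
    exact hm
  have hδ0 := ne_zero_of_norm_one hδ
  have h4 := column_pairing k 1 2
  have h5 := column_pairing k 3 2
  simp [hk, J] at h4 h5
  refine (twistInvariant_heis hq hc (s := -(t / δ)) (t := -(s / δ)) (z := -(u₂ / δ))
    (by rw [norm_neg]; exact norm_div_le_one ht hδ) (by rw [norm_neg]; exact norm_div_le_one hs hδ)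
    (by rw [norm_neg]; exact norm_div_le_one hu hδ)).of_mul_left ?_
  refine twistInvariant_middle hq hc (α := γ) (γ := δ) (A := A) (B := B) (C := C) (D := D)
    (by simpa [multiplier_mul] using hm) ?_ hγ hδ hA hB hC hD
  rw [mat_mul, mat_heis, hk]
  simp only [mul_fin_four]
  apply fin_four_congr <;> simp <;> field_simp
  · linear_combination h4
  · ring
  · linear_combination h5
  · ring
  · ring

/-- Integrality of the entries of `k`, up to the powers of `p` prescribed for `Kpara p 4`. -/
lemma exists_integral_of_mem_Kpara {k : GSp4 p} (hk : k ∈ Kpara p 4) :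
    ∃ X : Fin 4 → Fin 4 → ℚ_[p], (∀ i j, ‖X i j‖ ≤ 1) ∧
      mat k = !![X 0 0, X 0 1, X 0 2 / p ^ 4, X 0 3;
        p ^ 4 * X 1 0, X 1 1, X 1 2, X 1 3;
        p ^ 4 * X 2 0, p ^ 4 * X 2 1, X 2 2, p ^ 4 * X 2 3;
        p ^ 4 * X 3 0, X 3 1, X 3 2, X 3 3] := by
  have hp := p_ne_zero p
  have hp' : (p : ℝ) ≠ 0 := Nat.cast_ne_zero.mpr (Fact.out : p.Prime).ne_zero
  set e : Matrix (Fin 4) (Fin 4) ℤ := !![0, 0, -(4 : ℕ), 0; (4 : ℕ), 0, 0, 0;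
    (4 : ℕ), (4 : ℕ), 0, (4 : ℕ); (4 : ℕ), 0, 0, 0] with he
  have hb : ∀ i j, ‖mat k i j‖ ≤ (p : ℝ) ^ (-(e i j)) := hk.2
  refine ⟨fun i j => (p : ℚ_[p]) ^ (-(e i j)) * mat k i j, fun i j => ?_, ?_⟩
  · rw [norm_mul, Padic.norm_p_zpow, neg_neg]
    calc _ ≤ (p : ℝ) ^ (e i j) * (p : ℝ) ^ (-(e i j)) := by gcongr; exact hb i j
      _ = 1 := by rw [← zpow_add₀ hp', add_neg_cancel, zpow_zero]
  · have z4 : (p : ℚ_[p]) ^ (4 : ℤ) = (p : ℚ_[p]) ^ 4 := by norm_cast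
    have z4' : (p : ℚ_[p]) ^ (-4 : ℤ) = ((p : ℚ_[p]) ^ 4)⁻¹ := by rw [_root_.zpow_neg, z4]
    ext i j; fin_cases i <;> fin_cases j <;> simp [he, z4, z4', hp]

/-- The case of an element of `Kpara p 4` with a unit in the third diagonal entry. -/
lemma twistInvariant_of_unit (hq : χ.IsQuadratic) (hc : HasConductorP χ) {k : GSp4 p}
    (hm : ‖multiplier k‖ = 1) {X : Fin 4 → Fin 4 → ℚ_[p]} (hX : ∀ i j, ‖X i j‖ ≤ 1)
    (hk : mat k = !![X 0 0, X 0 1, X 0 2 / p ^ 4, X 0 3;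
        p ^ 4 * X 1 0, X 1 1, X 1 2, X 1 3;
        p ^ 4 * X 2 0, p ^ 4 * X 2 1, X 2 2, p ^ 4 * X 2 3;
        p ^ 4 * X 3 0, X 3 1, X 3 2, X 3 3]) (h22 : ‖X 2 2‖ = 1) : TwistInvariant χ k := by
  have hp := p_ne_zero p
  have hp4 : ‖(p : ℚ_[p]) ^ 4‖ ≤ 1 := by
    rw [norm_pow]; exact pow_le_one₀ (norm_nonneg _) norm_p_lt_one.le
  have h0 := ne_zero_of_norm_one h22
  have hb : ‖X 1 2 / X 2 2‖ ≤ 1 := norm_div_le_one (hX 1 2) h22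
  have ha : ‖X 3 2 / X 2 2‖ ≤ 1 := norm_div_le_one (hX 3 2) h22
  refine (twistInvariant_heis hq hc (s := -(X 3 2 / X 2 2)) (t := -(X 1 2 / X 2 2))
    (z := -(X 0 2 / X 2 2)) (by rwa [norm_neg]) (by rwa [norm_neg])
    (by rw [norm_neg]; exact norm_div_le_one (hX 0 2) h22)).of_mul_left ?_
  -- The Heisenberg factor has cleared the third column outside its pivot. Multiplying by t₄ on both
  -- sides moves that column to the first place, which is the Klingen shape.
  refine (twistInvariant_t4 hq hc).of_mul_left ((twistInvariant_t4 hq hc).of_mul_right ?_)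
  set k' := t4 p * (heis p (-(X 3 2 / X 2 2)) (-(X 1 2 / X 2 2)) (-(X 0 2 / X 2 2) / p ^ 4) * k) *
    t4 p with hk'
  have e (i j) : ‖X i j - X i 2 / X 2 2 * (p ^ 4 * X 2 j)‖ ≤ 1 := norm_sub_le_one (hX i j)
    (norm_mul_le_one (norm_div_le_one (hX i 2) h22) (norm_mul_le_one hp4 (hX 2 j)))
  have e' (i) : ‖X i 0 - X i 2 / X 2 2 * X 2 0‖ ≤ 1 := norm_sub_le_one (hX i 0)
    (norm_mul_le_one (norm_div_le_one (hX i 2) h22) (hX 2 0))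
  have h0' : mat k' = !![-X 2 2, -X 2 1, X 2 0 / p ^ 4, -X 2 3;
      0, X 1 1 - X 1 2 / X 2 2 * (p ^ 4 * X 2 1), -(X 1 0 - X 1 2 / X 2 2 * X 2 0),
        X 1 3 - X 1 2 / X 2 2 * (p ^ 4 * X 2 3);
      0, mat k' 2 1, mat k' 2 2, mat k' 2 3;
      0, X 3 1 - X 3 2 / X 2 2 * (p ^ 4 * X 2 1), -(X 3 0 - X 3 2 / X 2 2 * X 2 0),
        X 3 3 - X 3 2 / X 2 2 * (p ^ 4 * X 2 3)] := by
    rw [hk', mat_mul, mat_mul, mat_mul, mat_t4, mat_heis, hk]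
    simp only [mul_fin_four]
    apply fin_four_congr <;> simp
    all_goals first | (field_simp; ring1) | (field_simp; simp) | field_simp
  exact twistInvariant_klingen hq hc (by simpa [hk', multiplier_mul] using hm) h0'
    (by rwa [norm_neg]) (hX 2 0) (by rw [norm_neg]; exact e' 1) (by rw [norm_neg]; exact e' 3)
    (e 1 1) (e 1 3) (e 3 1) (e 3 3)

/-- In the multiplier the powers p⁴ and p⁻⁴ at the corners cancel, and it is congruent modulo p to
the determinant of the rescaled outer 2×2 block. Hence either the third diagonal entry is a unit, or
the rescaled upper right corner is, and t₄ moves the latter into the pivot position. -/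
lemma twistInvariant_of_mem_Kpara (hq : χ.IsQuadratic) (hc : HasConductorP χ) {k : GSp4 p}
    (hk : k ∈ Kpara p 4) : TwistInvariant χ k := by
  have hp := p_ne_zero p
  obtain ⟨X, hX, hX'⟩ := exists_integral_of_mem_Kpara hk
  have hm : ‖multiplier k‖ = 1 := hk.1
  have h := column_pairing k 0 2
  simp [hX', J] at h
  have h' : X 0 0 * X 2 2 - X 2 0 * X 0 2 +
      p * (p ^ 3 * (X 1 0 * X 3 2 - X 3 0 * X 1 2)) = multiplier k := by
    rw [← h]; field_simp; ring
  have hp3 : ‖(p : ℚ_[p]) ^ 3‖ ≤ 1 := by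
    rw [norm_pow]; exact pow_le_one₀ (norm_nonneg _) norm_p_lt_one.le
  rw [← h', norm_add_p_mul (norm_mul_le_one hp3 (norm_sub_le_one (norm_mul_le_one (hX 1 0) (hX 3 2))
    (norm_mul_le_one (hX 3 0) (hX 1 2))))] at hm
  rcases norm_eq_one_or_of_norm_sub (norm_mul_le_one (hX 0 0) (hX 2 2))
    (norm_mul_le_one (hX 2 0) (hX 0 2)) hm with h1 | h1
  · exact twistInvariant_of_unit hq hc hk.1 hX hX' (norm_eq_one_of_mul (hX 0 0) (hX 2 2) h1).2
  · have h02 := (norm_eq_one_of_mul (hX 2 0) (hX 0 2) h1).2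
    refine (twistInvariant_t4 hq hc).of_mul_left ?_
    refine twistInvariant_of_unit hq hc (X := ![-X 2, X 1, X 0, X 3])
      (by simpa [multiplier_mul] using hk.1) ?_ ?_ (by simpa using h02)
    · intro i j; fin_cases i <;> simp [hX]
    · rw [mat_mul, mat_t4, hX']
      simp only [mul_fin_four]
      apply fin_four_congr <;> simp [hp]
      all_goals field_simp

end Paramodular

/-! ### Membership of the twist in V(4, χ) -/

section Membership

variable {p : ℕ} [Fact p.Prime] {V : Type*} [AddCommGroup V] [Module ℂ V]
  {π : Representation ℂ (GSp4 p) V} {χ : MulChar ℚ_[p] ℂ} {v : V}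

lemma eq_of_forall_dual {v w : V} (h : ∀ φ : V →ₗ[ℂ] ℂ, φ v = φ w) : v = w :=
  sub_eq_zero.mp ((Module.forall_dual_apply_eq_zero_iff ℂ (v - w)).mp fun φ => by
    rw [map_sub, h φ, sub_self])

/-- Testing π(k) of the twist with φ means testing the twist with φ ∘ π(k), whose coefficient is the
left translate of the coefficient of φ by k. -/
lemma twist_mem_paramodularVectors (hπ : IsSmooth π) (hq : χ.IsQuadratic) (hc : HasConductorP χ)
    (hv : ∀ k ∈ GSp4Zp p, π k v = v) : twist π χ v ∈ paramodularVectors π 4 χ := by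
  intro k hk
  refine eq_of_forall_dual fun φ => ?_
  have hinv := twistInvariant_of_mem_Kpara hq hc hk
  have h1 : (φ ∘ₗ π k) (twist π χ v) = twistAvg (coeff π (φ ∘ₗ π k) v) χ := map_twist hπ hc _ hv
  have h2 : φ (twist π χ v) = twistAvg (coeff π φ v) χ := map_twist hπ hc _ hv
  have h3 : coeff π (φ ∘ₗ π k) v = fun g => coeff π φ v (k * g) := by
    funext g
    simp [coeff]
  rw [map_smul, smul_eq_mul, h2, ← chi_of hinv.1, ← hinv.2 _ (isSpherical_coeff hπ φ hv), ← h3, ← h1]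
  rfl

end Membership

end TwistGSp4

end

theorem corollary5p1 (p : ℕ) [Fact p.Prime] {V : Type*} [AddCommGroup V] [Module ℂ V]
    (π : Representation ℂ (TwistGSp4.GSp4 p) V) (hπ : TwistGSp4.IsSmooth π)
    (hcenter : ∀ z ∈ Subgroup.center (TwistGSp4.GSp4 p), π z = 1)
    (χ : MulChar ℚ_[p] ℂ) (hquad : χ.IsQuadratic) (hcond : TwistGSp4.HasConductorP χ)
    (v : V) (hv : ∀ k ∈ TwistGSp4.GSp4Zp p, π k v = v)
    (r : TwistGSp4.Representatives p) :
    TwistGSp4.twist π χ v ∈ TwistGSp4.paramodularVectors π 4 χ ∧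
    TwistGSp4.twist π χ v =
      TwistGSp4.T1 π χ r v + TwistGSp4.T2 π χ r v + TwistGSp4.T3 π χ r v +
      TwistGSp4.T4 π χ r v + TwistGSp4.T5 π χ r v + TwistGSp4.T6 π χ r v +
      TwistGSp4.T7 π χ r v + TwistGSp4.T8 π χ r v + TwistGSp4.T9 π χ r v +
      TwistGSp4.T10 π χ r v + TwistGSp4.T11 π χ r v + TwistGSp4.T12 π χ r v +
      TwistGSp4.T13 π χ r v + TwistGSp4.T14 π χ r v := by
  exact ⟨TwistGSp4.twist_mem_paramodularVectors hπ hquad hcond hv, TwistGSp4.eq_of_forall_dual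
    fun φ => TwistGSp4.map_twist_eq_sum hπ hquad hcond φ hv r⟩
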